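/- Let $p$ be a probability density on $\mathbb R$ that is symmetric around $0$ ($p(-x)=p(x)$), continuous at $0$ with $p_0:=p(0)>0$, and has three continuous bounded derivatives on some interval $(0,x_0)$, $x_0>0$; put $p_1:=p'(0+)$ and $p_2:=p''(0+)$. For $\theta\in\mathbb R$ let $X_1,X_2,\dots$ be independent random variables with common density $p(\cdot-\theta)$, and let $M_m$ be the sample median of $X_1,\dots,X_m$ with order statistics $X_{(1)}\le\dots\le X_{(m)}$: $M_m=X_{(j)}$ if $m=2j-1$, and $M_m=(X_{(j)}+X_{(j+1)})/2$ if $m=2j$. Let $r>0$ and, for $n\in\mathbb N=\{1,2,\dots\}$, let $N_n=N_n(r)$ be independent of $(X_i)_{i\ge1}$ with $$\mathbb P(N_n=j)=\frac{\Gamma(j+r-1)}{\Gamma(j)\,\Gamma(r)}\Big(\frac1n\Big)^r\Big(1-\frac1n\Big)^{j-1},\qquad j=1,2,\dots$$ Put $g_n=r(n-1)+1$ and $N_n^*=2\lfloor N_n/2\rfloor$. For $\nu>0$ let $$s_\nu(x)=\frac{\Gamma((\nu+1)/2)}{\sqrt{\nu\pi}\,\Gamma(\nu/2)}\Big(1+\frac{x^2}{\nu}\Big)^{-(\nu+1)/2},\qquad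 S_\nu(x)=\int_{-\infty}^x s_\nu(t)\,dt$$ be the density and the distribution function of Student's $t$-distribution with $\nu$ degrees of freedom. Theorem 4.3. There is a constant $C_r>0$, depending only on $r$ and $p$, such that for all $n\ge1$ if $r\ne 3/2$, respectively for all $n\ge2$ if $r=3/2$, and for all $x\in\mathbb R$, $$\Big|\mathbb P\Big(2p_0\sqrt{\tfrac{g_nN_n^*}{N_n}}\,(M_{N_n}-\theta)\le x\Big)-S_{2r}(x)-s_{2r}(x)\big(A_{1;r}(x)g_n^{-1/2}+A_{2;r}(x)g_n^{-1}\big)\Big|\le\begin{cases}C_r\,n^{-\min\{r,3/2\}},&r\neq3/2,\\ C_r\,n^{-3/2}\ln n,&r=3/2,\end{cases}$$ where $$A_{1;r}(x)=\frac{p_1\,x|x|}{4p_0^2}\,\mathbf 1_{(1/2,\infty)}(r),$$ $$A_{2;r}(x)=\frac x4\Big(\frac{(5-r)x^2+5r+2}{2r-1}+x^2\Big(1+\frac{p_2}{6p_0^3}\Big)-\frac{x^4p_1^2(2r+1)}{8p_0^4(2r+x^2)}\Big)\mathbf 1_{(1,\infty)}(r).$$ -/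

import Mathlib

open MeasureTheory ProbabilityTheory Filter Topology

/-- Regularity assumption on a probability density `p` on the real line: `p` is symmetric about `0`
and continuous at `0` with `p 0 > 0`, and it has three continuous bounded derivatives on some
interval `(0, x₀)`. -/
structure RegularSymmetricDensity (p : ℝ → ℝ) : Prop where
  measurable : Measurable p
  nonneg : ∀ x, 0 ≤ p x
  lintegral_eq_one : ∫⁻ x, ENNReal.ofReal (p x) = 1
  symm : ∀ x, p (-x) = p x
  pos : 0 < p 0
  continuousAt_zero : ContinuousAt p 0
  smooth : ∃ x₀ : ℝ, 0 < x₀ ∧ ContDiffOn ℝ 3 p (Set.Ioo 0 x₀) ∧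
    ∃ K : ℝ, ∀ k : ℕ, 1 ≤ k → k ≤ 3 → ∀ x ∈ Set.Ioo 0 x₀, |iteratedDeriv k p x| ≤ K

/-- The `k`-th order statistic `v_(k)` (counted from `k = 1`) of `v₀, …, v_{m-1}`, for
`1 ≤ k ≤ m`. -/
noncomputable def orderStat {m : ℕ} (v : Fin m → ℝ) (k : ℕ) : ℝ :=
  if h : k - 1 < m then v (Tuple.sort v ⟨k - 1, h⟩) else 0

/-- The sample median of `v₀, …, v_{m-1}`: it is `v_(j)` if `m = 2 j - 1`, and
`(v_(j) + v_(j+1)) / 2` if `m = 2 j`. -/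
noncomputable def sampleMedian {m : ℕ} (v : Fin m → ℝ) : ℝ :=
  if Odd m then orderStat v ((m + 1) / 2)
  else (orderStat v (m / 2) + orderStat v (m / 2 + 1)) / 2

/-- `m* = 2 ⌊m / 2⌋`. -/
def evenPart (m : ℕ) : ℕ := 2 * (m / 2)

/-- Probability mass at `j ≥ 1` of the negative binomial distribution (shifted by one) with
parameters `1 / n` and `r`. -/
noncomputable def shiftedNegBinomialMass (r : ℝ) (n j : ℕ) : ℝ :=
  Real.Gamma ((j : ℝ) + r - 1) / (Real.Gamma (j : ℝ) * Real.Gamma r)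
    * (1 / (n : ℝ)) ^ r * (1 - 1 / (n : ℝ)) ^ (j - 1)

/-- `g_n = r (n - 1) + 1`, the mean of the shifted negative binomial distribution. -/
noncomputable def negBinomialScale (r : ℝ) (n : ℕ) : ℝ := r * ((n : ℝ) - 1) + 1

/-- The density `s_ν` of Student's t-distribution with `ν` degrees of freedom. -/
noncomputable def studentDensity (ν x : ℝ) : ℝ :=
  Real.Gamma ((ν + 1) / 2) / (Real.sqrt (ν * Real.pi) * Real.Gamma (ν / 2))
    * (1 + x ^ 2 / ν) ^ (-(ν + 1) / 2)

/-- The distribution function `S_ν` of Student's t-distribution with `ν` degrees of freedom. -/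
noncomputable def studentCDF (ν x : ℝ) : ℝ := ∫ t in Set.Iic x, studentDensity ν t

/-- The coefficient `A_{1;r}(x)` of `g_n ^ (-1/2)`. -/
noncomputable def coeffA1 (p₀ p₁ r x : ℝ) : ℝ :=
  if 1 / 2 < r then p₁ * x * |x| / (4 * p₀ ^ 2) else 0

/-- The coefficient `A_{2;r}(x)` of `g_n ^ (-1)`. -/
noncomputable def coeffA2 (p₀ p₁ p₂ r x : ℝ) : ℝ :=
  if 1 < r then
    x / 4 * (((5 - r) * x ^ 2 + 5 * r + 2) / (2 * r - 1)
      + x ^ 2 * (1 + p₂ / (6 * p₀ ^ 3))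
      - x ^ 4 * p₁ ^ 2 * (2 * r + 1) / (8 * p₀ ^ 4 * (2 * r + x ^ 2)))
  else 0

/-- The second order expansion `S_{2r;2}(x; n)` around `S_{2r}(x)`. -/
noncomputable def studentExpansion (p₀ p₁ p₂ r : ℝ) (n : ℕ) (x : ℝ) : ℝ :=
  studentCDF (2 * r) x + studentDensity (2 * r) x *
    (coeffA1 p₀ p₁ r x * (negBinomialScale r n) ^ (-(1 / 2) : ℝ)
      + coeffA2 p₀ p₁ p₂ r x * (negBinomialScale r n)⁻¹)

/-- The rate of approximation: `n ^ (-min {r, 3/2})`, with an extra factor `ln n` if `r = 3/2`. -/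
noncomputable def approximationRate (r : ℝ) (n : ℕ) : ℝ :=
  if r = 3 / 2 then Real.log n * (n : ℝ) ^ (-(3 / 2) : ℝ)
  else (n : ℝ) ^ (-min r (3 / 2))

/-- The normalized median `2 p₀ √(g m* / m) (M_m - θ)` of the first `m` terms `x₀, …, x_{m-1}` of
the sequence `x`. -/
noncomputable def normalizedMedian (p₀ g θ : ℝ) (x : ℕ → ℝ) (m : ℕ) : ℝ :=
  2 * p₀ * Real.sqrt (g * (evenPart m : ℝ) / (m : ℝ))
    * (sampleMedian (fun i : Fin m => x i) - θ)

/-! Condition on the sample size. With the factor `√(g m*/m)`, the event given `N = m` says that `2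
p₀ √m* (M_m - θ) ≤ √(m/g) x`. So the probability is `∑ P(N = m) F_m(√(m/g) x)`, where `F_m` is the
distribution function of `2 p₀ √m* (M_m - θ)`. Two things are needed: an expansion of `F_m` with
error `O(m^(-3/2))` uniform in the argument, and the negative binomial mixture of that expansion.

Expansion for fixed size (`exists_abs_median_sub_medianExpansion_le`). Let `F` be the distribution
function of `p`. For `m = 2k+1` the median lies below `s` with probability `medianPoly k (F s)`,
whose derivative in `u = F s` is proportional to `(u(1-u))^k`. After rescaling this is an integral
of `(1 - t²/(2k))^k`, which gives `Φ(z) + φ(z)(z³+3z)/(8k)` at `z = 2√(2k)(F(s) - 1/2)`. The cubic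
Taylor expansion of `F` at `0` then yields the terms in `p₁` and `p₂`. For `m = 2k` the median is
below `y` only if more than half of the sample is, or if the two middle observations straddle `y`
with the lower one farther away. The second probability is an integral (`exists_gap_integral_le`)
that exceeds the term which turns the binomial tail of size `2k` into that of size `2k+1` by at most
`O(k^(-3/2))`. Reflection in `0` supplies the opposite inequality, so even and odd sizes share one
expansion, governed by `m* = 2⌊m/2⌋`.

Mixture (`exists_abs_tsum_mass_sub_studentExpansion_le`). The mass at `j` is `D Γ(j+r-1)/Γ(j)
e^(-βj)` with `β = -log(1 - 1/n)`, and the Gamma ratio is `j^(r-1)(1 + c/j + O(j⁻²))`. Multiplied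
with the expansion of `F_j`, everything of relative order `j^(-3/2)` contributes `n^(-r) ∑ j^(r-5/2)
e^(-βj)`. This sum is bounded, logarithmic or a power of `n` according as `r` is below, at or above
`3/2`, which is the stated rate. The remaining sums are replaced by gamma integrals. A gamma scale
mixture of normal laws is a Student law (`integral_gamma_gaussCDF`), and the corrections become
gamma integrals equal to powers of `x` times the Student density (`leadingMoment_values`). A
correction whose integral has a nonintegrable weight `t^a`, `a ≤ -1`, is itself of the order of the
error; hence the indicators of `r > 1/2` and `r > 1`.

Finally `β`, `D` and the scale `√(r/(βg))` are expanded in `1/n`. For `r > 1` the change of scale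
and an integration by parts of the term in `c` produce the remaining part of `A₂`. The finitely many
small `n` are absorbed into the constant. -/

/-! ### Gamma ratios and the negative binomial series -/

/-- A null sequence whose increments are `O(j⁻³)` is `O(j⁻²)`. -/
theorem abs_le_of_tendsto_zero_of_increments {e : ℕ → ℝ} {C : ℝ} {J : ℕ} (hJ : 1 ≤ J)
    (he : Tendsto e atTop (𝓝 0))
    (hd : ∀ j, J ≤ j → |e (j + 1) - e j| ≤ C * (1 / (j : ℝ)) ^ 3) :
    ∀ j, J ≤ j → |e j| ≤ 2 * C * (1 / (j : ℝ)) ^ 2 := by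
  have hC : 0 ≤ C := by
    have := (abs_nonneg _).trans (hd J le_rfl)
    have hJ' : (0 : ℝ) < J := by exact_mod_cast hJ
    by_contra h
    push Not at h
    have : C * (1 / (J : ℝ)) ^ 3 < 0 := mul_neg_of_neg_of_pos h (by positivity)
    linarith
  have key : ∀ σ : ℝ, |σ| = 1 → ∀ j, J ≤ j → σ * e j ≤ 2 * C * (1 / (j : ℝ)) ^ 2 := by
    intro σ hσ j hj
    -- Since `1/i³ ≤ 2(1/i² - 1/(i+1)²)`, subtracting `2C/i²` makes `±e` nondecreasing; the
    -- difference tends to `0`, so it is never positive.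
    have hmono : ∀ i, J ≤ i → σ * e i - 2 * C * (1 / (i : ℝ)) ^ 2
        ≤ σ * e (i + 1) - 2 * C * (1 / ((i + 1 : ℕ) : ℝ)) ^ 2 := by
      intro i hi
      have hi0 : (1 : ℝ) ≤ i := by exact_mod_cast hJ.trans hi
      have h1 : -(σ * (e (i + 1) - e i)) ≤ C * (1 / (i : ℝ)) ^ 3 := by
        refine (neg_le_abs _).trans ?_
        rw [abs_mul, hσ, one_mul]
        exact hd i hi
      have h2 : (1 / (i : ℝ)) ^ 3 ≤ 2 * ((1 / (i : ℝ)) ^ 2 - (1 / ((i : ℝ) + 1)) ^ 2) := by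
        have : 2 * ((1 / (i : ℝ)) ^ 2 - (1 / ((i : ℝ) + 1)) ^ 2) - (1 / (i : ℝ)) ^ 3
            = (3 * i ^ 2 - 1) / (i ^ 3 * (i + 1) ^ 2) := by
          field_simp
          ring
        have h3 : 0 ≤ (3 * (i : ℝ) ^ 2 - 1) / (i ^ 3 * (i + 1) ^ 2) := by
          apply div_nonneg
          · nlinarith
          · positivity
        linarith
      have h4 := mul_le_mul_of_nonneg_left h2 hC
      push_cast
      nlinarith
    have hmono' : ∀ i, σ * e j - 2 * C * (1 / (j : ℝ)) ^ 2
        ≤ σ * e (j + i) - 2 * C * (1 / ((j + i : ℕ) : ℝ)) ^ 2 := by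
      intro i
      induction i with
      | zero => simp
      | succ i ih => exact ih.trans (hmono (j + i) (by omega))
    have hlim : Tendsto (fun i : ℕ => σ * e i - 2 * C * (1 / (i : ℝ)) ^ 2) atTop (𝓝 0) := by
      have h1 := (he.const_mul σ).sub
        (((tendsto_one_div_atTop_nhds_zero_nat (𝕜 := ℝ)).pow 2).const_mul (2 * C))
      simpa using h1
    have hlim' := hlim.comp (tendsto_add_atTop_nat j)
    have := ge_of_tendsto' hlim' (b := σ * e j - 2 * C * (1 / (j : ℝ)) ^ 2) (fun i => by
      have := hmono' i
      rwa [add_comm j i] at this)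
    linarith
  intro j hj
  refine abs_le.mpr ⟨?_, ?_⟩
  · have := key (-1) (by simp) j hj
    linarith
  · have := key 1 (by simp) j hj
    linarith

theorem Gamma_add_nat_eq_mul_prod {s : ℝ} (hs : 0 < s) (n : ℕ) :
    Real.Gamma (s + n) = Real.Gamma s * ∏ j ∈ Finset.range n, (s + j) := by
  induction n with
  | zero => simp
  | succ n ih =>
    rw [Finset.prod_range_succ, ← mul_assoc, ← ih]
    push_cast
    rw [← add_assoc, Real.Gamma_add_one (by positivity)]
    ring

/-- This is Euler's limit formula for `Γ(s+1)`, read at the index `n + 2`. -/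
theorem tendsto_Gamma_ratio {s : ℝ} (hs : -1 < s) :
    Tendsto (fun j : ℕ => Real.Gamma (j + s) / (Real.Gamma j * (j : ℝ) ^ s)) atTop (𝓝 1) := by
  have hs' : 0 < s + 1 := by linarith
  have hG := Real.GammaSeq_tendsto_Gamma (s + 1)
  have hG0 : Real.Gamma (s + 1) ≠ 0 := (Real.Gamma_pos_of_pos hs').ne'
  have h1 := (tendsto_const_nhds (x := Real.Gamma (s + 1))).div hG hG0
  rw [div_self hG0] at h1
  -- The quotient of the two normalizations: Euler's sequence carries `n^(s+1) n!`, the ratio at `n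
  -- + 2` carries `(n+1)! (n+2)^s`.
  have h2 : Tendsto (fun n : ℕ => ((n : ℝ) / (n + 1)) * ((n : ℝ) / (n + 2)) ^ s) atTop (𝓝 1) := by
    have ha : Tendsto (fun n : ℕ => (n : ℝ) / (n + 1)) atTop (𝓝 1) :=
      tendsto_natCast_div_add_atTop 1
    have hb : Tendsto (fun n : ℕ => (n : ℝ) / (n + 2)) atTop (𝓝 1) :=
      tendsto_natCast_div_add_atTop 2
    have := ha.mul (hb.rpow_const (p := s) (Or.inl one_ne_zero))
    simpa using this
  have h3 := h1.mul h2
  rw [one_mul] at h3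
  rw [← tendsto_add_atTop_iff_nat 2]
  refine h3.congr' ?_
  filter_upwards [eventually_ge_atTop 1] with n hn
  have hn0 : (0 : ℝ) < n := by exact_mod_cast hn
  have e1 : Real.Gamma (((n + 2 : ℕ) : ℝ) + s)
      = Real.Gamma (s + 1) * ∏ j ∈ Finset.range (n + 1), (s + 1 + j) := by
    rw [← Gamma_add_nat_eq_mul_prod hs']
    congr 1
    push_cast
    ring
  have e2 : Real.Gamma ((n + 2 : ℕ) : ℝ) = (n + 1) * (n.factorial : ℝ) := by
    have : ((n + 2 : ℕ) : ℝ) = ((n + 1 : ℕ) : ℝ) + 1 := by push_cast; ring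
    rw [this, Real.Gamma_nat_eq_factorial, Nat.factorial_succ]
    push_cast
    ring
  have hP : ∏ j ∈ Finset.range (n + 1), (s + 1 + (j : ℝ)) ≠ 0 :=
    Finset.prod_ne_zero_iff.mpr fun j _ => by positivity
  rw [e1, e2]
  simp only [Pi.div_apply]
  rw [Real.GammaSeq, Real.div_rpow hn0.le (by positivity), Real.rpow_add hn0, Real.rpow_one]
  have hf : (n.factorial : ℝ) ≠ 0 := by positivity
  have h5 : (n : ℝ) ^ s ≠ 0 := (Real.rpow_pos_of_pos hn0 _).ne'
  have h6 : ((n : ℝ) + 2) ^ s ≠ 0 := (Real.rpow_pos_of_pos (by positivity) _).ne'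
  push_cast
  field_simp

theorem abs_log_one_add_sub_le {x : ℝ} (hx : |x| ≤ 1 / 2) :
    |Real.log (1 + x) - (x - x ^ 2 / 2)| ≤ 2 * |x| ^ 3 := by
  have h := Real.abs_log_sub_add_sum_range_le (x := -x) (by rw [abs_neg]; linarith) 2
  simp only [Finset.sum_range_succ, Finset.sum_range_zero, abs_neg, sub_neg_eq_add] at h
  have e : 0 + (-x) ^ (0 + 1) / ((0 : ℕ) + 1 : ℝ) + (-x) ^ (1 + 1) / ((1 : ℕ) + 1 : ℝ)
      + Real.log (1 + x) = Real.log (1 + x) - (x - x ^ 2 / 2) := by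
    push_cast
    ring
  rw [e] at h
  refine h.trans ?_
  rw [div_le_iff₀ (by linarith)]
  have : 0 ≤ |x| ^ 3 := by positivity
  norm_num
  nlinarith

/-- Two-term asymptotics of a ratio of Gamma functions. -/
theorem exists_abs_Gamma_ratio_sub_le {s : ℝ} (hs : -1 < s) :
    ∃ C : ℝ, 0 < C ∧ ∀ j : ℕ, 1 ≤ j →
      |Real.Gamma (j + s) / (Real.Gamma j * (j : ℝ) ^ s) - (1 + s * (s - 1) / 2 / j)|
        ≤ C * (1 / (j : ℝ)) ^ 2 := by
  set a : ℕ → ℝ := fun j => Real.Gamma (j + s) / (Real.Gamma j * (j : ℝ) ^ s) with ha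
  set c : ℝ := s * (s - 1) / 2 with hc
  set e : ℕ → ℝ := fun j => Real.log (a j) - c / j with he
  have hapos : ∀ j : ℕ, 1 ≤ j → 0 < a j := by
    intro j hj
    have hj' : (1 : ℝ) ≤ j := by exact_mod_cast hj
    exact div_pos (Real.Gamma_pos_of_pos (by linarith))
      (mul_pos (Real.Gamma_pos_of_pos (by linarith)) (Real.rpow_pos_of_pos (by linarith) _))
  have hlim : Tendsto e atTop (𝓝 0) := by
    have h1 := (tendsto_Gamma_ratio hs).log one_ne_zero
    have h2 := tendsto_const_div_atTop_nhds_zero_nat (𝕜 := ℝ) c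
    simpa using h1.sub h2
  -- From `J` on both `1/j` and `|s|/j` are at most `1/2`, the range of the logarithm estimate.
  obtain ⟨J, hJ⟩ := exists_nat_ge (2 * |s| + 2)
  have hJ1 : 1 ≤ J := by
    have : (1 : ℝ) ≤ J := by linarith [abs_nonneg s]
    exact_mod_cast this
  set D : ℝ := 2 * |s| ^ 3 + 2 * |s| + |c| with hD
  -- The choice of `c` cancels the second order: with `u = 1/j`, `log(1+su) - s log(1+u) = -c u² +
  -- O(u³)`, while `c/j - c/(j+1) = c u² + O(u³)`.
  have hstep : ∀ j, J ≤ j → |e (j + 1) - e j| ≤ D * (1 / (j : ℝ)) ^ 3 := by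
    intro j hj
    have hjJ : (J : ℝ) ≤ j := by exact_mod_cast hj
    have hj2 : 2 * |s| + 2 ≤ (j : ℝ) := hJ.trans hjJ
    have hj1 : 1 ≤ j := hJ1.trans hj
    have hj0 : (0 : ℝ) < j := by exact_mod_cast hj1
    set u : ℝ := 1 / (j : ℝ) with hu
    have hu0 : 0 < u := by positivity
    have huh : u ≤ 1 / 2 := by
      rw [hu]
      exact one_div_le_one_div_of_le (by norm_num) (by linarith [abs_nonneg s])
    have hsu : |s * u| ≤ 1 / 2 := by
      rw [abs_mul, abs_of_pos hu0, hu, mul_one_div, div_le_iff₀ hj0]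
      linarith
    have hrat : a (j + 1) = a j * ((1 + s * u) * (1 + u) ^ (-s)) := by
      simp only [ha]
      have g1 : Real.Gamma (((j + 1 : ℕ) : ℝ) + s) = (j + s) * Real.Gamma (j + s) := by
        rw [← Real.Gamma_add_one (by linarith [neg_abs_le s, abs_nonneg s])]
        congr 1
        push_cast
        ring
      have g2 : Real.Gamma ((j + 1 : ℕ) : ℝ) = j * Real.Gamma j := by
        push_cast
        exact Real.Gamma_add_one hj0.ne'
      have g3 : (((j + 1 : ℕ) : ℝ)) ^ s = (j : ℝ) ^ s * (1 + u) ^ s := by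
        rw [← Real.mul_rpow hj0.le (by positivity)]
        congr 1
        rw [hu]
        push_cast
        field_simp
      rw [g1, g2, g3, Real.rpow_neg (by positivity)]
      have h1 : Real.Gamma (j : ℝ) ≠ 0 := (Real.Gamma_pos_of_pos hj0).ne'
      have h2 : (j : ℝ) ^ s ≠ 0 := (Real.rpow_pos_of_pos hj0 _).ne'
      have h3 : (1 + u) ^ s ≠ 0 := (Real.rpow_pos_of_pos (by positivity) _).ne'
      have h4 : 1 + s * u = (j + s) / j := by
        rw [hu]
        field_simp
      rw [h4]
      field_simp
    have hpos1 : 0 < 1 + s * u := by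
      have := (abs_le.mp hsu).1
      linarith
    have hediff : e (j + 1) - e j
        = (Real.log (1 + s * u) - (s * u - (s * u) ^ 2 / 2))
          - s * (Real.log (1 + u) - (u - u ^ 2 / 2)) - c * (u ^ 3 / (1 + u)) := by
      simp only [he]
      rw [hrat, Real.log_mul (hapos j hj1).ne'
        (mul_ne_zero hpos1.ne' (Real.rpow_pos_of_pos (by positivity) _).ne'),
        Real.log_mul hpos1.ne' (Real.rpow_pos_of_pos (by positivity) _).ne',
        Real.log_rpow (by positivity)]
      have h5 : c / (j : ℝ) - c / ((j + 1 : ℕ) : ℝ) = c * (u ^ 2 - u ^ 3 / (1 + u)) := by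
        rw [hu]
        push_cast
        field_simp
        ring
      have h6 : c * u ^ 2 = s * (s - 1) / 2 * u ^ 2 := by rw [hc]
      linear_combination h5 + h6
    rw [hediff]
    have t1 := abs_log_one_add_sub_le hsu
    have t2 := abs_log_one_add_sub_le (x := u) (by rw [abs_of_pos hu0]; exact huh)
    rw [abs_of_pos hu0] at t2
    rw [abs_mul, abs_of_pos hu0, mul_pow |s| u 3] at t1
    have t3 : |c * (u ^ 3 / (1 + u))| ≤ |c| * u ^ 3 := by
      rw [abs_mul, abs_of_pos (by positivity : 0 < u ^ 3 / (1 + u))]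
      refine mul_le_mul_of_nonneg_left ?_ (abs_nonneg _)
      exact div_le_self (by positivity) (by linarith)
    have t4 : |s * (Real.log (1 + u) - (u - u ^ 2 / 2))| ≤ |s| * (2 * u ^ 3) := by
      rw [abs_mul]
      exact mul_le_mul_of_nonneg_left t2 (abs_nonneg _)
    refine (abs_sub _ _).trans ?_
    refine (add_le_add (abs_sub _ _) le_rfl).trans ?_
    rw [hD]
    linarith
  have hebound := abs_le_of_tendsto_zero_of_increments hJ1 hlim hstep
  have hD0 : 0 ≤ D := by positivity
  -- Exponentiate: `log (a j) = c/j + O(j⁻²)` is small, so its exponential differs from `1 + c/j` by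
  -- `O(j⁻²)`.
  have hO : (fun j : ℕ => a j - (1 + c / j)) =O[atTop] fun j : ℕ => (1 / (j : ℝ)) ^ 2 := by
    obtain ⟨J', hJ'⟩ := exists_nat_ge (|c| + 2 * D)
    refine Asymptotics.IsBigO.of_bound ((|c| + 2 * D) ^ 2 + 2 * D) ?_
    filter_upwards [eventually_ge_atTop J, eventually_ge_atTop J'] with j hj hj'
    have hj1 : 1 ≤ j := hJ1.trans hj
    have hj1' : (1 : ℝ) ≤ j := by exact_mod_cast hj1
    have hj0 : (0 : ℝ) < j := by linarith
    have hjJ' : (J' : ℝ) ≤ j := by exact_mod_cast hj'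
    have hE := hebound j hj
    set u : ℝ := 1 / (j : ℝ) with hu
    have hu0 : 0 < u := by positivity
    have hu1 : u ≤ 1 := by
      rw [hu, div_le_one hj0]; exact hj1'
    have hlog : Real.log (a j) = c * u + e j := by
      simp only [he, hu]
      ring
    have hx : |c * u + e j| ≤ (|c| + 2 * D) * u := by
      refine (abs_add_le _ _).trans ?_
      rw [abs_mul, abs_of_pos hu0]
      have : 2 * D * u ^ 2 ≤ 2 * D * u := by
        have : u ^ 2 ≤ u := by nlinarith
        exact mul_le_mul_of_nonneg_left this (by positivity)
      linarith
    have hx1 : |c * u + e j| ≤ 1 := by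
      refine hx.trans ?_
      rw [hu, mul_one_div, div_le_one hj0]
      linarith
    have hexp := Real.abs_exp_sub_one_sub_id_le hx1
    rw [← hlog, Real.exp_log (hapos j hj1), hlog] at hexp
    have : a j - (1 + c / j) = (a j - 1 - (c * u + e j)) + e j := by
      rw [hu]
      ring
    rw [Real.norm_eq_abs, Real.norm_eq_abs, this, abs_of_pos (by positivity : 0 < u ^ 2)]
    refine (abs_add_le _ _).trans ?_
    have h7 : (c * u + e j) ^ 2 ≤ ((|c| + 2 * D) * u) ^ 2 := by
      rw [← sq_abs]
      exact pow_le_pow_left₀ (abs_nonneg _) hx 2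
    rw [mul_pow] at h7
    linarith
  obtain ⟨C, hC, hb⟩ := Asymptotics.bound_of_isBigO_nat_atTop hO
  refine ⟨C, hC, fun j hj => ?_⟩
  have hj0 : (0 : ℝ) < j := by exact_mod_cast hj
  have := hb (x := j) (by positivity)
  rwa [Real.norm_eq_abs, Real.norm_eq_abs, abs_of_pos (by positivity : 0 < (1 / (j : ℝ)) ^ 2)] at this

/-- The negative binomial series. -/
theorem hasSum_Gamma_ratio_mul_pow {s q : ℝ} (hs : -1 < s) (hq0 : 0 < q) (hq1 : q < 1) :
    HasSum (fun k : ℕ => Real.Gamma ((k : ℝ) + 1 + s) / Real.Gamma ((k : ℝ) + 1) * q ^ k)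
      (Real.Gamma (s + 1) * (1 - q) ^ (-(s + 1))) := by
  have hs' : 0 < s + 1 := by linarith
  -- Each coefficient is written as a gamma integral. Summing under the integral turns `∑ (qt)^k/k!`
  -- into `e^(qt)`, and one gamma integral of rate `1 - q` remains.
  set F : ℕ → ℝ → ℝ := fun k t =>
    q ^ k / (k.factorial : ℝ) * (t ^ ((k : ℝ) + 1 + s - 1) * Real.exp (-(1 * t))) with hF
  have hposk : ∀ k : ℕ, 0 < (k : ℝ) + 1 + s := fun k => by
    have : (0 : ℝ) ≤ k := k.cast_nonneg
    linarith
  have hI : ∀ k, ∫ t in Set.Ioi 0, F k t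
      = Real.Gamma ((k : ℝ) + 1 + s) / Real.Gamma ((k : ℝ) + 1) * q ^ k := by
    intro k
    simp only [hF]
    rw [integral_const_mul, Real.integral_rpow_mul_exp_neg_mul_Ioi (hposk k) one_pos,
      Real.Gamma_nat_eq_factorial]
    simp
    ring
  have hint : ∀ k, Integrable (F k) (volume.restrict (Set.Ioi 0)) := by
    intro k
    refine Integrable.const_mul ?_ _
    refine Integrable.of_integral_ne_zero ?_
    rw [Real.integral_rpow_mul_exp_neg_mul_Ioi (hposk k) one_pos]
    have := Real.Gamma_pos_of_pos (hposk k)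
    positivity
  have hnonneg : ∀ k, ∀ t ∈ Set.Ioi (0 : ℝ), 0 ≤ F k t := by
    intro k t ht
    have ht' : (0 : ℝ) < t := ht
    simp only [hF]
    positivity
  have hnorm : ∀ k, ∫ t in Set.Ioi 0, ‖F k t‖
      = Real.Gamma ((k : ℝ) + 1 + s) / Real.Gamma ((k : ℝ) + 1) * q ^ k := by
    intro k
    rw [← hI k]
    refine setIntegral_congr_fun measurableSet_Ioi fun t ht => ?_
    exact Real.norm_of_nonneg (hnonneg k t ht)
  have hsum : Summable fun k : ℕ =>
      Real.Gamma ((k : ℝ) + 1 + s) / Real.Gamma ((k : ℝ) + 1) * q ^ k := by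
    refine summable_of_ratio_test_tendsto_lt_one hq1 (Eventually.of_forall fun k => ?_) ?_
    · have := Real.Gamma_pos_of_pos (hposk k)
      have : 0 < Real.Gamma ((k : ℝ) + 1) := Real.Gamma_pos_of_pos (by positivity)
      positivity
    · have h1 : Tendsto (fun k : ℕ => ((k : ℝ) + (1 + s)) / ((k : ℝ) + 1) * q) atTop (𝓝 (1 * q)) :=
        (by
          have := tendsto_add_mul_div_add_mul_atTop_nhds (𝕜 := ℝ) (1 + s) 1 1 one_ne_zero
          refine (this.congr fun k => ?_).mul_const q |>.trans (by simp)
          ring)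
      rw [one_mul] at h1
      refine h1.congr fun k => ?_
      have g0 := Real.Gamma_pos_of_pos (hposk k)
      have g0' : 0 < Real.Gamma ((k : ℝ) + 1) := Real.Gamma_pos_of_pos (by positivity)
      have g1 : Real.Gamma (((k + 1 : ℕ) : ℝ) + 1 + s)
          = (k + 1 + s) * Real.Gamma ((k : ℝ) + 1 + s) := by
        rw [← Real.Gamma_add_one (hposk k).ne']
        congr 1
        push_cast
        ring
      have g2 : Real.Gamma (((k + 1 : ℕ) : ℝ) + 1) = (k + 1) * Real.Gamma ((k : ℝ) + 1) := by
        push_cast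
        exact Real.Gamma_add_one (by positivity)
      have hk := hposk k
      have p1 : 0 < Real.Gamma ((k : ℝ) + 1 + s) / Real.Gamma ((k : ℝ) + 1) * q ^ k := by positivity
      have p2 : 0 < (k + 1 + s) * Real.Gamma ((k : ℝ) + 1 + s)
          / ((k + 1) * Real.Gamma ((k : ℝ) + 1)) * q ^ (k + 1) := by positivity
      rw [g1, g2, Real.norm_of_nonneg p1.le, Real.norm_of_nonneg p2.le, pow_succ]
      field_simp
      ring
  have key := hasSum_integral_of_summable_integral_norm hint (by simpa only [hnorm] using hsum)
  simp only [hI] at key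
  have : ∀ t ∈ Set.Ioi (0 : ℝ), (∑' k, F k t) = t ^ ((s + 1) - 1) * Real.exp (-((1 - q) * t)) := by
    intro t ht
    have ht' : (0 : ℝ) < t := ht
    have h1 : HasSum (fun k : ℕ => (q * t) ^ k / (k.factorial : ℝ)) (Real.exp (q * t)) := by
      rw [Real.exp_eq_exp_ℝ]
      exact NormedSpace.expSeries_div_hasSum_exp (q * t)
    have h2 := (h1.mul_right (t ^ s * Real.exp (-t))).tsum_eq
    rw [add_sub_cancel_right]
    have h3 : Real.exp (-((1 - q) * t)) = Real.exp (q * t) * Real.exp (-t) := by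
      rw [← Real.exp_add]; congr 1; ring
    rw [h3, show t ^ s * (Real.exp (q * t) * Real.exp (-t))
      = Real.exp (q * t) * (t ^ s * Real.exp (-t)) by ring, ← h2]
    refine tsum_congr fun k => ?_
    simp only [hF]
    rw [show (k : ℝ) + 1 + s - 1 = (k : ℝ) + s by ring, Real.rpow_add ht', Real.rpow_natCast,
      mul_pow, one_mul]
    ring
  rw [setIntegral_congr_fun measurableSet_Ioi this,
    Real.integral_rpow_mul_exp_neg_mul_Ioi hs' (by linarith), one_div,
    Real.inv_rpow (by linarith), ← Real.rpow_neg (by linarith), mul_comm] at key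
  exact key

/-! ### Exponential power sums and the rate of approximation -/

/-- The sum `∑_{j ≥ 1} j ^ a * exp (-b * j)`. -/
noncomputable def expPowerSum (a b : ℝ) : ℝ :=
  ∑' k : ℕ, ((k : ℝ) + 1) ^ a * Real.exp (-(b * ((k : ℝ) + 1)))

/-- Powers are traded for Gamma ratios because the series of the latter has a closed form. -/
theorem exists_rpow_le_mul_Gamma_ratio {s : ℝ} (hs : -1 < s) :
    ∃ C : ℝ, 0 < C ∧ ∀ k : ℕ,
      ((k : ℝ) + 1) ^ s ≤ C * (Real.Gamma ((k : ℝ) + 1 + s) / Real.Gamma ((k : ℝ) + 1)) := by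
  have h := ((tendsto_Gamma_ratio hs).inv₀ one_ne_zero).isBigO_one ℝ
  obtain ⟨C, hC, hb⟩ := Asymptotics.bound_of_isBigO_nat_atTop h
  refine ⟨C, hC, fun k => ?_⟩
  have := hb (x := k + 1) (by simp)
  have h1 : 0 < Real.Gamma ((k : ℝ) + 1) := Real.Gamma_pos_of_pos (by positivity)
  have h2 : 0 < Real.Gamma ((k : ℝ) + 1 + s) :=
    Real.Gamma_pos_of_pos (by have : (0 : ℝ) ≤ k := k.cast_nonneg
                              linarith)
  have h3 : 0 < ((k : ℝ) + 1) ^ s := by positivity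
  push_cast at this
  rw [norm_one, mul_one, Real.norm_of_nonneg (by positivity), inv_div, div_le_iff₀ h2] at this
  rw [← mul_div_assoc, le_div_iff₀ h1]
  linarith

theorem half_le_one_sub_exp_neg {b : ℝ} (hb0 : 0 ≤ b) (hb1 : b ≤ 1) :
    b / 2 ≤ 1 - Real.exp (-b) := by
  have h := Real.abs_exp_sub_one_sub_id_le (x := -b) (by rw [abs_neg, abs_of_nonneg hb0]; exact hb1)
  have h1 := (abs_le.mp h).2
  have h2 : Real.exp (-b) * (1 + b) ≤ 1 := by
    have h3 : Real.exp (-b) * Real.exp b = 1 := by rw [← Real.exp_add]; simp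
    have h4 := mul_le_mul_of_nonneg_left (Real.add_one_le_exp b) (Real.exp_pos (-b)).le
    linarith
  nlinarith [Real.exp_pos (-b)]

theorem summable_expPowerSum (a : ℝ) {b : ℝ} (hb : 0 < b) :
    Summable fun k : ℕ => ((k : ℝ) + 1) ^ a * Real.exp (-(b * ((k : ℝ) + 1))) := by
  set s := max a 0
  have hs : -1 < s := by
    have : 0 ≤ s := le_max_right _ _
    linarith
  obtain ⟨C, hC, h⟩ := exists_rpow_le_mul_Gamma_ratio hs
  have hsum := ((hasSum_Gamma_ratio_mul_pow hs (Real.exp_pos (-b))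
    (by rw [Real.exp_lt_one_iff]; linarith)).summable.mul_left (C * Real.exp (-b)))
  refine Summable.of_nonneg_of_le (fun k => by positivity) (fun k => ?_) hsum
  have h1 : ((k : ℝ) + 1) ^ a ≤ ((k : ℝ) + 1) ^ s :=
    Real.rpow_le_rpow_of_exponent_le (by have : (0 : ℝ) ≤ k := k.cast_nonneg
                                         linarith) (le_max_left _ _)
  have h2 : Real.exp (-(b * ((k : ℝ) + 1))) = Real.exp (-b) * Real.exp (-b) ^ k := by
    rw [← Real.exp_nat_mul, ← Real.exp_add]
    congr 1
    ring
  calc ((k : ℝ) + 1) ^ a * Real.exp (-(b * ((k : ℝ) + 1)))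
      ≤ (C * (Real.Gamma ((k : ℝ) + 1 + s) / Real.Gamma ((k : ℝ) + 1)))
        * Real.exp (-(b * ((k : ℝ) + 1))) :=
        mul_le_mul_of_nonneg_right (h1.trans (h k)) (Real.exp_pos _).le
    _ = _ := by rw [h2]; ring

theorem exists_expPowerSum_le_rpow {a : ℝ} (ha : -1 < a) :
    ∃ C : ℝ, 0 < C ∧ ∀ b : ℝ, 0 < b → b ≤ 1 → expPowerSum a b ≤ C * b ^ (-(a + 1)) := by
  obtain ⟨C, hC, h⟩ := exists_rpow_le_mul_Gamma_ratio ha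
  have hG := Real.Gamma_pos_of_pos (show 0 < a + 1 by linarith)
  refine ⟨C * Real.Gamma (a + 1) * 2 ^ (a + 1), by positivity, fun b hb0 hb1 => ?_⟩
  have hs := hasSum_Gamma_ratio_mul_pow ha (Real.exp_pos (-b))
    (by rw [Real.exp_lt_one_iff]; linarith)
  have hsum := hs.mul_left C
  have hle : expPowerSum a b ≤ C * (Real.Gamma (a + 1) * (1 - Real.exp (-b)) ^ (-(a + 1))) := by
    rw [← hsum.tsum_eq]
    refine Summable.tsum_le_tsum (fun k => ?_) (summable_expPowerSum a hb0) hsum.summable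
    have h2 : Real.exp (-(b * ((k : ℝ) + 1))) ≤ Real.exp (-b) ^ k := by
      rw [← Real.exp_nat_mul]
      apply Real.exp_le_exp.mpr
      nlinarith
    calc _ ≤ (C * (Real.Gamma ((k : ℝ) + 1 + a) / Real.Gamma ((k : ℝ) + 1)))
        * Real.exp (-b) ^ k :=
          mul_le_mul (h k) h2 (Real.exp_pos _).le (le_trans (by positivity) (h k))
      _ = _ := by ring
  refine hle.trans ?_
  have h3 : (1 - Real.exp (-b)) ^ (-(a + 1)) ≤ (b / 2) ^ (-(a + 1)) :=
    Real.rpow_le_rpow_of_nonpos (by positivity) (half_le_one_sub_exp_neg hb0.le hb1) (by linarith)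
  have h4 : (b / 2) ^ (-(a + 1)) = 2 ^ (a + 1) * b ^ (-(a + 1)) := by
    rw [Real.div_rpow hb0.le (by norm_num), Real.rpow_neg (by norm_num : (0 : ℝ) ≤ 2)]
    field_simp
  rw [h4] at h3
  calc _ ≤ C * (Real.Gamma (a + 1) * (2 ^ (a + 1) * b ^ (-(a + 1)))) := by gcongr
    _ = _ := by ring

theorem exists_expPowerSum_le_const {a : ℝ} (ha : a < -1) :
    ∃ C : ℝ, 0 < C ∧ ∀ b : ℝ, 0 < b → expPowerSum a b ≤ C := by
  have hs : Summable fun k : ℕ => ((k : ℝ) + 1) ^ a := by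
    have := (summable_nat_add_iff 1).mpr (Real.summable_nat_rpow.mpr ha)
    simpa using this
  have h0 : 0 ≤ ∑' k : ℕ, ((k : ℝ) + 1) ^ a := tsum_nonneg fun k => by positivity
  refine ⟨(∑' k : ℕ, ((k : ℝ) + 1) ^ a) + 1, by linarith, fun b hb => ?_⟩
  have : expPowerSum a b ≤ ∑' k : ℕ, ((k : ℝ) + 1) ^ a := by
    refine Summable.tsum_le_tsum (fun k => ?_) (summable_expPowerSum a hb) hs
    refine mul_le_of_le_one_right (by positivity) ?_
    rw [Real.exp_le_one_iff]
    have : 0 ≤ b * ((k : ℝ) + 1) := by positivity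
    linarith
  linarith

theorem expPowerSum_neg_one_le {b : ℝ} (hb0 : 0 < b) (hb1 : b ≤ 1) :
    expPowerSum (-1) b ≤ Real.log (2 / b) := by
  have hx : Real.exp (-b) < 1 := by rw [Real.exp_lt_one_iff]; linarith
  have h := Real.hasSum_pow_div_log_of_abs_lt_one (x := Real.exp (-b))
    (by rwa [abs_of_pos (Real.exp_pos _)])
  have e : expPowerSum (-1) b = -Real.log (1 - Real.exp (-b)) := by
    rw [← h.tsum_eq, expPowerSum]
    refine tsum_congr fun k => ?_
    rw [Real.rpow_neg_one, ← Real.exp_nat_mul, div_eq_inv_mul]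
    congr 2
    push_cast
    ring
  rw [e, ← Real.log_inv]
  have h2 := half_le_one_sub_exp_neg hb0.le hb1
  refine Real.log_le_log (by rw [inv_pos]; linarith) ?_
  rw [← inv_div]
  exact inv_anti₀ (by positivity) h2

/-- The origin of the three regimes: the exponent `r - 5/2` lies below, at or above `-1`, so the sum
is bounded, of order `log n`, or of order `n^(r-3/2)`. For `r = 3/2` the condition `n ≥ 2` lets `log
n` absorb the constant `log(2/κ)`. -/
theorem exists_expPowerSum_le_rate {r κ : ℝ} (hκ0 : 0 < κ) (hκ1 : κ ≤ 1) :
    ∃ C : ℝ, 0 < C ∧ ∀ n : ℕ, 1 ≤ n → (r = 3 / 2 → 2 ≤ n) →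
      (n : ℝ) ^ (-r) * expPowerSum (r - 5 / 2) (κ / n) ≤ C * approximationRate r n := by
  rcases lt_trichotomy r (3 / 2) with h | h | h
  · obtain ⟨C, hC, hb⟩ := exists_expPowerSum_le_const (a := r - 5 / 2) (by linarith)
    refine ⟨C, hC, fun n hn _ => ?_⟩
    have hn0 : (0 : ℝ) < n := by exact_mod_cast hn
    rw [approximationRate, if_neg h.ne, min_eq_left h.le, mul_comm C]
    exact mul_le_mul_of_nonneg_left (hb _ (by positivity)) (by positivity)
  · have hl2 : 0 < Real.log 2 := Real.log_pos (by norm_num)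
    have hlκ : 0 ≤ Real.log (2 / κ) := Real.log_nonneg (by rw [le_div_iff₀ hκ0]; linarith)
    refine ⟨Real.log (2 / κ) / Real.log 2 + 1, by positivity, fun n hn hn2 => ?_⟩
    have hn2' : (2 : ℝ) ≤ n := by exact_mod_cast hn2 h
    have hn0 : (0 : ℝ) < n := by linarith
    have hle := expPowerSum_neg_one_le (b := κ / n) (by positivity)
      (by rw [div_le_one hn0]; linarith)
    rw [approximationRate, if_pos h, h, show (3 / 2 - 5 / 2 : ℝ) = -1 by norm_num]
    have e : Real.log (2 / (κ / n)) = Real.log (2 / κ) + Real.log n := by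
      rw [← Real.log_mul (by positivity) hn0.ne']
      congr 1
      field_simp
    rw [e] at hle
    have hln : Real.log 2 ≤ Real.log n := Real.log_le_log (by norm_num) hn2'
    have h5 : Real.log (2 / κ) ≤ Real.log (2 / κ) / Real.log 2 * Real.log n := by
      rw [div_mul_eq_mul_div, le_div_iff₀ hl2]
      exact mul_le_mul_of_nonneg_left hln hlκ
    calc _ ≤ (n : ℝ) ^ (-(3 / 2) : ℝ) * ((Real.log (2 / κ) / Real.log 2 + 1) * Real.log n) := by
          refine mul_le_mul_of_nonneg_left ?_ (by positivity)
          linarith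
      _ = _ := by ring
  · obtain ⟨C, hC, hb⟩ := exists_expPowerSum_le_rpow (a := r - 5 / 2) (by linarith)
    refine ⟨C * κ ^ (-(r - 5 / 2 + 1)), by positivity, fun n hn _ => ?_⟩
    have hn1 : (1 : ℝ) ≤ n := by exact_mod_cast hn
    have hn0 : (0 : ℝ) < n := by linarith
    have := hb (κ / n) (by positivity) (by rw [div_le_one hn0]; linarith)
    rw [approximationRate, if_neg h.ne', min_eq_right h.le]
    rw [Real.div_rpow hκ0.le hn0.le] at this
    have e : (n : ℝ) ^ (-(3 / 2) : ℝ) = (n : ℝ) ^ (-r) / (n : ℝ) ^ (-(r - 5 / 2 + 1)) := by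
      rw [← Real.rpow_sub hn0]
      congr 1
      ring
    rw [e]
    calc _ ≤ (n : ℝ) ^ (-r) * (C * (κ ^ (-(r - 5 / 2 + 1)) / (n : ℝ) ^ (-(r - 5 / 2 + 1)))) :=
          mul_le_mul_of_nonneg_left this (by positivity)
      _ = _ := by ring

/-! ### Normal and Student distributions; gamma mixtures -/

theorem hasDerivAt_integral_Iic {f : ℝ → ℝ} (hf : Continuous f) (hi : Integrable f) (z : ℝ) :
    HasDerivAt (fun z => ∫ t in Set.Iic z, f t) (f z) z := by
  have h : (fun z => ∫ t in Set.Iic z, f t)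
      = fun z => (∫ t in Set.Iic (0 : ℝ), f t) + ∫ t in (0 : ℝ)..z, f t := by
    funext z
    rw [← intervalIntegral.integral_Iic_sub_Iic hi.integrableOn hi.integrableOn]
    ring
  rw [h]
  exact (intervalIntegral.integral_hasDerivAt_right (hf.intervalIntegrable _ _)
    (hf.stronglyMeasurableAtFilter _ _) hf.continuousAt).const_add _

theorem integral_Iic_comp_mul_left (f : ℝ → ℝ) {c : ℝ} (hc : 0 < c) (x : ℝ) :
    ∫ u in Set.Iic x, c * f (c * u) = ∫ u in Set.Iic (c * x), f u := by
  rw [← integral_indicator measurableSet_Iic, ← integral_indicator measurableSet_Iic]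
  have h := Measure.integral_comp_mul_left ((Set.Iic (c * x)).indicator f) c
  rw [abs_of_pos (inv_pos.mpr hc), smul_eq_mul] at h
  rw [← mul_right_inj' (inv_pos.mpr hc).ne', ← h, ← integral_const_mul]
  refine integral_congr_ae (Eventually.of_forall fun u => ?_)
  simp only [Set.indicator, Set.mem_Iic, mul_le_mul_iff_right₀ hc]
  split_ifs
  · field_simp
  · simp

/-- The standard normal density. -/
noncomputable def gaussDensity (t : ℝ) : ℝ := (Real.sqrt (2 * Real.pi))⁻¹ * Real.exp (-t ^ 2 / 2)

/-- The standard normal distribution function. -/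
noncomputable def gaussCDF (z : ℝ) : ℝ := ∫ t in Set.Iic z, gaussDensity t

theorem gaussDensity_pos (t : ℝ) : 0 < gaussDensity t := by
  unfold gaussDensity
  positivity

theorem continuous_gaussDensity : Continuous gaussDensity := by
  unfold gaussDensity
  fun_prop

theorem gaussDensity_eq (t : ℝ) :
    gaussDensity t = (Real.sqrt (2 * Real.pi))⁻¹ * Real.exp (-(1 / 2) * t ^ 2) := by
  rw [gaussDensity]
  congr 2
  ring

theorem gaussDensity_neg (t : ℝ) : gaussDensity (-t) = gaussDensity t := by
  simp [gaussDensity]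

theorem integrable_gaussDensity : Integrable gaussDensity := by
  simp only [funext gaussDensity_eq]
  exact (integrable_exp_neg_mul_sq (by norm_num)).const_mul _

theorem integral_gaussDensity : ∫ t, gaussDensity t = 1 := by
  simp only [gaussDensity_eq]
  rw [integral_const_mul, integral_gaussian]
  rw [show Real.pi / (1 / 2) = 2 * Real.pi by ring]
  exact inv_mul_cancel₀ (by positivity)

theorem gaussDensity_le_one (t : ℝ) : gaussDensity t ≤ 1 := by
  unfold gaussDensity
  have h1 : (1 : ℝ) ≤ Real.sqrt (2 * Real.pi) := by
    rw [Real.one_le_sqrt]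
    linarith [Real.pi_gt_three]
  refine mul_le_one₀ (inv_le_one_of_one_le₀ h1) (Real.exp_pos _).le ?_
  rw [Real.exp_le_one_iff]
  nlinarith [sq_nonneg t]

theorem hasDerivAt_gaussDensity (t : ℝ) : HasDerivAt gaussDensity (-t * gaussDensity t) t := by
  unfold gaussDensity
  have h : HasDerivAt (fun t : ℝ => -t ^ 2 / 2) (-t) t := by
    have := ((hasDerivAt_pow 2 t).neg).div_const 2
    exact this.congr_deriv (by push_cast; ring)
  exact (h.exp.const_mul (Real.sqrt (2 * Real.pi))⁻¹).congr_deriv (by ring)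

theorem hasDerivAt_gaussCDF (z : ℝ) : HasDerivAt gaussCDF (gaussDensity z) z :=
  hasDerivAt_integral_Iic continuous_gaussDensity integrable_gaussDensity z

theorem continuous_gaussCDF : Continuous gaussCDF :=
  continuous_iff_continuousAt.mpr fun z => (hasDerivAt_gaussCDF z).continuousAt

theorem gaussCDF_nonneg (z : ℝ) : 0 ≤ gaussCDF z :=
  integral_nonneg fun t => (gaussDensity_pos t).le

theorem gaussCDF_le_one (z : ℝ) : gaussCDF z ≤ 1 := by
  rw [← integral_gaussDensity]
  exact setIntegral_le_integral integrable_gaussDensity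
    (Eventually.of_forall fun t => (gaussDensity_pos t).le)

theorem gaussCDF_neg (z : ℝ) : gaussCDF (-z) = 1 - gaussCDF z := by
  have h1 : gaussCDF (-z) = ∫ t in Set.Ioi z, gaussDensity t := by
    rw [gaussCDF, ← integral_comp_neg_Ioi]
    simp only [gaussDensity_neg]
  rw [h1, eq_sub_iff_add_eq, add_comm, gaussCDF, ← integral_gaussDensity, ← Set.compl_Iic]
  exact integral_add_compl measurableSet_Iic integrable_gaussDensity

theorem gaussCDF_zero : gaussCDF 0 = 1 / 2 := by
  have := gaussCDF_neg 0
  rw [neg_zero] at this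
  linarith

theorem gaussDensity_mul_sqrt (u : ℝ) {t g : ℝ} (ht : 0 ≤ t) (hg : 0 < g) :
    gaussDensity (Real.sqrt (t / g) * u)
      = (Real.sqrt (2 * Real.pi))⁻¹ * Real.exp (-(u ^ 2 / (2 * g) * t)) := by
  rw [gaussDensity, mul_pow, Real.sq_sqrt (by positivity)]
  congr 2
  field_simp

theorem continuous_studentDensity {ν : ℝ} (hν : 0 < ν) : Continuous (studentDensity ν) := by
  unfold studentDensity
  refine continuous_const.mul (Continuous.rpow_const (by fun_prop) fun x => Or.inl ?_)
  positivity

theorem studentDensity_nonneg {ν : ℝ} (hν : 0 < ν) (x : ℝ) : 0 ≤ studentDensity ν x := by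
  unfold studentDensity
  have := Real.Gamma_pos_of_pos (show 0 < (ν + 1) / 2 by linarith)
  have := Real.Gamma_pos_of_pos (show 0 < ν / 2 by linarith)
  positivity

theorem integrableOn_rpow_mul_exp {a b : ℝ} (ha : 0 < a) (hb : 0 < b) :
    IntegrableOn (fun t : ℝ => t ^ (a - 1) * Real.exp (-(b * t))) (Set.Ioi 0) := by
  refine Integrable.of_integral_ne_zero ?_
  rw [Real.integral_rpow_mul_exp_neg_mul_Ioi ha hb]
  have := Real.Gamma_pos_of_pos ha
  positivity

/-- The Gaussian exponent is linear in `t`, so the integrand is again a gamma density up to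
constants, with shape `r + 1/2` and rate `b + u²/(2g) = b (1 + (r/(bg)) u²/(2r))`; the power of that
rate is the Student profile. -/
theorem integral_gamma_gaussDensity {r b g : ℝ} (hr : 0 < r) (hb : 0 < b) (hg : 0 < g) (u : ℝ) :
    ∫ t in Set.Ioi 0, t ^ (r - 1) * Real.exp (-(b * t))
        * (Real.sqrt (t / g) * gaussDensity (Real.sqrt (t / g) * u))
      = Real.Gamma r * b ^ (-r) * (Real.sqrt (r / (b * g))
          * studentDensity (2 * r) (Real.sqrt (r / (b * g)) * u)) := by
  have hγ : 0 < b + u ^ 2 / (2 * g) := by positivity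
  have h1 : ∀ t ∈ Set.Ioi (0 : ℝ), t ^ (r - 1) * Real.exp (-(b * t))
        * (Real.sqrt (t / g) * gaussDensity (Real.sqrt (t / g) * u))
      = (Real.sqrt (2 * Real.pi))⁻¹ * (Real.sqrt g)⁻¹
        * (t ^ ((r + 1 / 2) - 1) * Real.exp (-((b + u ^ 2 / (2 * g)) * t))) := by
    intro t ht
    have ht' : (0 : ℝ) < t := ht
    rw [gaussDensity_mul_sqrt u ht'.le hg, Real.sqrt_div ht'.le,
      show (r + 1 / 2) - 1 = (r - 1) + 1 / 2 by ring, Real.rpow_add ht', ← Real.sqrt_eq_rpow,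
      show -((b + u ^ 2 / (2 * g)) * t) = -(b * t) + -(u ^ 2 / (2 * g) * t) by ring, Real.exp_add]
    field_simp
  rw [setIntegral_congr_fun measurableSet_Ioi h1, integral_const_mul,
    Real.integral_rpow_mul_exp_neg_mul_Ioi (by linarith) hγ]
  unfold studentDensity
  have hG := Real.Gamma_pos_of_pos hr
  rw [mul_pow, Real.sq_sqrt (by positivity),
    show 2 * r / 2 = r by ring, show (2 * r + 1) / 2 = r + 1 / 2 by ring,
    show -(2 * r + 1) / 2 = -(r + 1 / 2) by ring,
    show b + u ^ 2 / (2 * g) = b * (1 + r / (b * g) * u ^ 2 / (2 * r)) by field_simp,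
    one_div, Real.inv_rpow (by positivity), ← Real.rpow_neg (by positivity),
    Real.mul_rpow hb.le (by positivity),
    show 2 * r * Real.pi = r * (2 * Real.pi) by ring, Real.sqrt_mul hr.le,
    Real.sqrt_div hr.le, Real.sqrt_mul hb.le,
    show -(r + 1 / 2) = -r + -(1 / 2) by ring, Real.rpow_add hb, Real.rpow_neg hb.le (1 / 2),
    ← Real.sqrt_eq_rpow]
  have h2 : Real.sqrt r ≠ 0 := by positivity
  field_simp

/-- The hypothesis of Fubini's theorem for the mixture: the integrand is nonnegative and its
integral over `u` is at most the gamma weight in `t`. -/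
theorem integrable_gamma_gauss_prod {r b g : ℝ} (hr : 0 < r) (hb : 0 < b) (hg : 0 < g)
    (s : Set ℝ) :
    Integrable (Function.uncurry fun t u : ℝ => t ^ (r - 1) * Real.exp (-(b * t))
        * (Real.sqrt (t / g) * gaussDensity (Real.sqrt (t / g) * u)))
      ((volume.restrict (Set.Ioi 0)).prod (volume.restrict s)) := by
  have hmeas : Measurable (Function.uncurry fun t u : ℝ => t ^ (r - 1) * Real.exp (-(b * t))
        * (Real.sqrt (t / g) * gaussDensity (Real.sqrt (t / g) * u))) := by
    unfold gaussDensity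
    fun_prop
  have hscale : ∀ t ∈ Set.Ioi (0 : ℝ), Integrable fun u : ℝ =>
      gaussDensity (Real.sqrt (t / g) * u) := by
    intro t ht
    have ht' : (0 : ℝ) < t := ht
    exact integrable_gaussDensity.comp_mul_left' (by positivity)
  have hscale' : ∀ t ∈ Set.Ioi (0 : ℝ), ∫ u : ℝ,
      Real.sqrt (t / g) * gaussDensity (Real.sqrt (t / g) * u) = 1 := by
    intro t ht
    have ht' : (0 : ℝ) < t := ht
    have hc : 0 < Real.sqrt (t / g) := by positivity
    rw [integral_const_mul, Measure.integral_comp_mul_left, integral_gaussDensity,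
      abs_of_pos (inv_pos.mpr hc)]
    simp [hc.ne']
  rw [integrable_prod_iff hmeas.aestronglyMeasurable]
  constructor
  · filter_upwards [ae_restrict_mem measurableSet_Ioi] with t ht
    exact (((hscale t ht).const_mul (Real.sqrt (t / g))).const_mul
      (t ^ (r - 1) * Real.exp (-(b * t)))).restrict
  · refine Integrable.mono' (integrableOn_rpow_mul_exp hr hb)
      hmeas.norm.stronglyMeasurable.integral_prod_right'.aestronglyMeasurable ?_
    filter_upwards [ae_restrict_mem measurableSet_Ioi] with t ht
    have ht' : (0 : ℝ) < t := ht
    rw [Real.norm_of_nonneg (integral_nonneg fun u => norm_nonneg _)]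
    have hn : ∀ u : ℝ, ‖Function.uncurry (fun t u : ℝ => t ^ (r - 1) * Real.exp (-(b * t))
        * (Real.sqrt (t / g) * gaussDensity (Real.sqrt (t / g) * u))) (t, u)‖
        = t ^ (r - 1) * Real.exp (-(b * t))
        * (Real.sqrt (t / g) * gaussDensity (Real.sqrt (t / g) * u)) := by
      intro u
      rw [Function.uncurry_apply_pair, Real.norm_of_nonneg]
      have := gaussDensity_pos (Real.sqrt (t / g) * u)
      positivity
    simp only [hn]
    have h0 : 0 ≤ t ^ (r - 1) * Real.exp (-(b * t)) := by positivity
    rw [integral_const_mul]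
    refine mul_le_of_le_one_right h0 ?_
    rw [← hscale' t ht]
    exact setIntegral_le_integral ((hscale t ht).const_mul _)
      (Eventually.of_forall fun u => by
        have := gaussDensity_pos (Real.sqrt (t / g) * u)
        positivity)

/-- The choice `b = r`, `g = 1` makes the scale equal to `1`, so the density is a multiple of a
marginal of an integrable function. -/
theorem integrable_studentDensity {r : ℝ} (hr : 0 < r) : Integrable (studentDensity (2 * r)) := by
  have h := (integrable_gamma_gauss_prod hr hr one_pos Set.univ).integral_prod_right
  simp only [Function.uncurry_apply_pair, Measure.restrict_univ,
    integral_gamma_gaussDensity hr hr one_pos] at h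
  have hG := Real.Gamma_pos_of_pos hr
  have h2 := h.const_mul (Real.Gamma r * r ^ (-r))⁻¹
  have h3 : Real.sqrt (r / (r * 1)) = 1 := by rw [mul_one, div_self hr.ne', Real.sqrt_one]
  refine h2.congr (Eventually.of_forall fun u => ?_)
  have : Real.Gamma r * r ^ (-r) ≠ 0 := by positivity
  simp only [h3, one_mul]
  field_simp

/-- Student's distribution function is a scale mixture of normal distribution functions with
respect to a gamma distribution. -/
theorem integral_gamma_gaussCDF {r b g : ℝ} (hr : 0 < r) (hb : 0 < b) (hg : 0 < g) (x : ℝ) :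
    ∫ t in Set.Ioi 0, t ^ (r - 1) * Real.exp (-(b * t)) * gaussCDF (Real.sqrt (t / g) * x)
      = Real.Gamma r * b ^ (-r) * studentCDF (2 * r) (Real.sqrt (r / (b * g)) * x) := by
  have hswap := integral_integral_swap (integrable_gamma_gauss_prod hr hb hg (Set.Iic x))
  have hc : 0 < Real.sqrt (r / (b * g)) := by positivity
  have hR : ∫ u in Set.Iic x, ∫ t in Set.Ioi 0, t ^ (r - 1) * Real.exp (-(b * t))
        * (Real.sqrt (t / g) * gaussDensity (Real.sqrt (t / g) * u))
      = Real.Gamma r * b ^ (-r) * studentCDF (2 * r) (Real.sqrt (r / (b * g)) * x) := by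
    simp only [integral_gamma_gaussDensity hr hb hg]
    rw [integral_const_mul, integral_Iic_comp_mul_left _ hc, studentCDF]
  rw [← hR, ← hswap]
  refine setIntegral_congr_fun measurableSet_Ioi fun t ht => ?_
  have ht' : (0 : ℝ) < t := ht
  rw [integral_const_mul, integral_Iic_comp_mul_left _ (by positivity), gaussCDF]

theorem hasDerivAt_studentCDF {r : ℝ} (hr : 0 < r) (z : ℝ) :
    HasDerivAt (studentCDF (2 * r)) (studentDensity (2 * r) z) z :=
  hasDerivAt_integral_Iic (continuous_studentDensity (by linarith)) (integrable_studentDensity hr) z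

theorem studentCDF_nonneg {r : ℝ} (hr : 0 < r) (z : ℝ) : 0 ≤ studentCDF (2 * r) z :=
  integral_nonneg fun t => studentDensity_nonneg (by linarith) t

/-- The mixture identity at scale `1` compares a gamma average of `Φ ≤ 1` with the total gamma mass;
the total integral of the Student density need not be computed. -/
theorem studentCDF_le_one {r : ℝ} (hr : 0 < r) (z : ℝ) : studentCDF (2 * r) z ≤ 1 := by
  have h := integral_gamma_gaussCDF hr hr one_pos z
  have h3 : Real.sqrt (r / (r * 1)) = 1 := by rw [mul_one, div_self hr.ne', Real.sqrt_one]
  rw [h3, one_mul] at h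
  have hG := Real.Gamma_pos_of_pos hr
  have hK : 0 < Real.Gamma r * r ^ (-r) := by positivity
  have h0 : ∫ t in Set.Ioi 0, t ^ (r - 1) * Real.exp (-(r * t)) = Real.Gamma r * r ^ (-r) := by
    rw [Real.integral_rpow_mul_exp_neg_mul_Ioi hr hr, one_div, Real.inv_rpow hr.le,
      Real.rpow_neg hr.le, mul_comm]
  have hle : Real.Gamma r * r ^ (-r) * studentCDF (2 * r) z ≤ Real.Gamma r * r ^ (-r) := by
    rw [← h]
    rw [← h0]
    refine setIntegral_mono_on ?_ (integrableOn_rpow_mul_exp hr hr) measurableSet_Ioi ?_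
    · refine Integrable.mono' (integrableOn_rpow_mul_exp hr hr) ?_ ?_
      · refine Measurable.aestronglyMeasurable ?_
        have := continuous_gaussCDF.measurable
        fun_prop
      · filter_upwards [ae_restrict_mem measurableSet_Ioi] with t ht
        have ht' : (0 : ℝ) < t := ht
        have h1 := gaussCDF_nonneg (Real.sqrt (t / 1) * z)
        rw [Real.norm_of_nonneg (by positivity)]
        exact mul_le_of_le_one_right (by positivity) (gaussCDF_le_one _)
    · intro t ht
      have ht' : (0 : ℝ) < t := ht
      exact mul_le_of_le_one_right (by positivity) (gaussCDF_le_one _)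
  exact le_of_mul_le_mul_left (by rwa [mul_one]) hK

/-! ### Comparison of sums with integrals -/

/-- The half-line is cut into unit cells centred at the integers, so that a linear term cancels
within each cell. -/
theorem abs_tsum_sub_integral_Ioi_le {f : ℝ → ℝ} {e : ℕ → ℝ}
    (hf : IntegrableOn f (Set.Ioi (1 / 2))) (hs : Summable fun k : ℕ => f ((k : ℝ) + 1))
    (he : Summable e)
    (h : ∀ k : ℕ, |f ((k : ℝ) + 1) - ∫ t in ((k : ℝ) + 1 / 2)..((k : ℝ) + 3 / 2), f t| ≤ e k) :
    |∑' k : ℕ, f ((k : ℝ) + 1) - ∫ t in Set.Ioi (1 / 2), f t| ≤ ∑' k, e k := by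
  have he0 : ∀ k, 0 ≤ e k := fun k => (abs_nonneg _).trans (h k)
  have hu : Tendsto (fun N : ℕ => (N : ℝ) + 1 / 2) atTop atTop :=
    tendsto_atTop_add_const_right _ _ tendsto_natCast_atTop_atTop
  have h1 := intervalIntegral_tendsto_integral_Ioi (1 / 2) hf hu
  have h2 := hs.hasSum.tendsto_sum_nat
  refine le_of_tendsto' (h2.sub h1).abs fun N => ?_
  have h3 : ∫ t in (1 / 2 : ℝ)..((N : ℝ) + 1 / 2), f t
      = ∑ k ∈ Finset.range N, ∫ t in ((k : ℝ) + 1 / 2)..((k : ℝ) + 3 / 2), f t := by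
    have := intervalIntegral.sum_integral_adjacent_intervals (f := f) (μ := volume)
      (a := fun k : ℕ => (k : ℝ) + 1 / 2) (n := N) (fun k _ => by
        refine (intervalIntegrable_iff_integrableOn_Ioc_of_le (by push_cast; linarith)).mpr ?_
        refine hf.mono_set fun t ht => ?_
        have hk : (0 : ℝ) ≤ k := k.cast_nonneg
        have := ht.1
        simp only [Set.mem_Ioi]
        linarith)
    rw [Nat.cast_zero, zero_add] at this
    rw [← this]
    refine Finset.sum_congr rfl fun k _ => ?_
    push_cast
    congr 1
    ring
  rw [h3, ← Finset.sum_sub_distrib]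
  refine (Finset.abs_sum_le_sum_abs _ _).trans ?_
  exact (Finset.sum_le_sum fun k _ => h k).trans (he.sum_le_tsum _ fun k _ => he0 k)

/-- Within distance `1/2` of `j ≥ 1` one has `j/2 ≤ t ≤ 2j`. Moving the bound to the centre of the
cell costs `2^|a|` and half of the exponential rate. -/
theorem rpow_mul_exp_le_of_abs_sub_le (a : ℝ) {b t j : ℝ} (hb : 0 ≤ b) (hj : 1 ≤ j)
    (ht : |t - j| ≤ 1 / 2) :
    t ^ a * Real.exp (-(b * t)) ≤ 2 ^ |a| * (j ^ a * Real.exp (-(b / 2 * j))) := by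
  obtain ⟨h1, h2⟩ := abs_le.mp ht
  have ht0 : 0 < t := by linarith
  have hj0 : 0 < j := by linarith
  have e1 : t ^ a ≤ 2 ^ |a| * j ^ a := by
    have : t ^ a = (t / j) ^ a * j ^ a := by
      rw [Real.div_rpow ht0.le hj0.le]
      have : j ^ a ≠ 0 := (Real.rpow_pos_of_pos hj0 _).ne'
      field_simp
    rw [this]
    refine mul_le_mul_of_nonneg_right ?_ (by positivity)
    rcases le_total 0 a with ha | ha
    · rw [abs_of_nonneg ha]
      refine Real.rpow_le_rpow (by positivity) ?_ ha
      rw [div_le_iff₀ hj0]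
      linarith
    · rw [abs_of_nonpos ha]
      have : (1 / 2 : ℝ) ^ a = 2 ^ (-a) := by
        rw [one_div, Real.inv_rpow (by norm_num), Real.rpow_neg (by norm_num)]
      rw [← this]
      refine Real.rpow_le_rpow_of_nonpos (by norm_num) ?_ ha
      rw [le_div_iff₀ hj0]
      linarith
  have e2 : Real.exp (-(b * t)) ≤ Real.exp (-(b / 2 * j)) := by
    apply Real.exp_le_exp.mpr
    nlinarith
  calc _ ≤ (2 ^ |a| * j ^ a) * Real.exp (-(b / 2 * j)) :=
        mul_le_mul e1 e2 (Real.exp_pos _).le (by positivity)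
    _ = _ := by ring

theorem uIcc_subset_of_mem_unitInterval {j t s : ℝ} (ht : t ∈ Set.Icc (j - 1 / 2) (j + 1 / 2))
    (hs : s ∈ Set.uIcc j t) : |s - j| ≤ 1 / 2 := by
  have h1 : j ∈ Set.Icc (j - 1 / 2) (j + 1 / 2) := ⟨by linarith, by linarith⟩
  have h2 := Set.uIcc_subset_Icc h1 ht hs
  rw [abs_le]
  exact ⟨by linarith [h2.1], by linarith [h2.2]⟩

theorem abs_sub_integral_le_of_deriv {f f' : ℝ → ℝ} {A a b : ℝ} (hA : 0 ≤ A) (hb : 0 ≤ b)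
    (hf : ∀ t, 0 < t → HasDerivAt f (f' t) t)
    (hf' : ∀ t, 1 / 2 ≤ t → |f' t| ≤ A * (t ^ a * Real.exp (-(b * t)))) {j : ℝ} (hj : 1 ≤ j) :
    |f j - ∫ t in (j - 1 / 2)..(j + 1 / 2), f t|
      ≤ A * 2 ^ |a| * (j ^ a * Real.exp (-(b / 2 * j))) := by
  set B := A * 2 ^ |a| * (j ^ a * Real.exp (-(b / 2 * j))) with hB
  have hB0 : 0 ≤ B := by
    have : 0 < j := by linarith
    positivity
  have hbound : ∀ t ∈ Set.Icc (j - 1 / 2) (j + 1 / 2), |f j - f t| ≤ B := by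
    intro t ht
    have hconv := Convex.norm_image_sub_le_of_norm_hasDerivWithin_le (f := f) (f' := f') (C := B)
      (s := Set.uIcc j t) (x := t) (y := j) (fun s hs => (hf s (by
        have := (abs_le.mp (uIcc_subset_of_mem_unitInterval ht hs)).1
        linarith)).hasDerivWithinAt) (fun s hs => by
        have h1 := uIcc_subset_of_mem_unitInterval ht hs
        rw [Real.norm_eq_abs]
        refine (hf' s (by linarith [(abs_le.mp h1).1])).trans ?_
        rw [hB, mul_assoc]
        exact mul_le_mul_of_nonneg_left (rpow_mul_exp_le_of_abs_sub_le a hb hj h1) hA)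
      (convex_uIcc j t) Set.right_mem_uIcc Set.left_mem_uIcc
    rw [Real.norm_eq_abs, Real.norm_eq_abs] at hconv
    refine hconv.trans (mul_le_of_le_one_right hB0 ?_)
    rw [abs_le]
    constructor <;> linarith [ht.1, ht.2]
  have hcont : IntervalIntegrable f volume (j - 1 / 2) (j + 1 / 2) := by
    refine ContinuousOn.intervalIntegrable_of_Icc (by linarith) fun t ht => ?_
    exact (hf t (by linarith [ht.1])).continuousAt.continuousWithinAt
  have e : f j - ∫ t in (j - 1 / 2)..(j + 1 / 2), f t
      = ∫ t in (j - 1 / 2)..(j + 1 / 2), (f j - f t) := by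
    rw [intervalIntegral.integral_sub intervalIntegrable_const hcont,
      intervalIntegral.integral_const]
    norm_num
  rw [e]
  have := intervalIntegral.norm_integral_le_of_norm_le_const (a := j - 1 / 2) (b := j + 1 / 2)
    (f := fun t => f j - f t) (C := B) (fun t ht => by
      rw [Set.uIoc_of_le (by linarith)] at ht
      exact hbound t ⟨ht.1.le, ht.2⟩)
  rw [Real.norm_eq_abs] at this
  refine this.trans (le_of_eq ?_)
  norm_num

/-- The midpoint rule: the tangent at `j` integrates to zero about `j`, so the error is governed by
the second derivative. Compared with `abs_sub_integral_le_of_deriv` this gains a factor `1/j` when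
each derivative costs one power of `t`. -/
theorem abs_sub_integral_le_of_deriv2 {f f' f'' : ℝ → ℝ} {A a b : ℝ} (hA : 0 ≤ A) (hb : 0 ≤ b)
    (hf : ∀ t, 0 < t → HasDerivAt f (f' t) t) (hf' : ∀ t, 0 < t → HasDerivAt f' (f'' t) t)
    (hf'' : ∀ t, 1 / 2 ≤ t → |f'' t| ≤ A * (t ^ a * Real.exp (-(b * t)))) {j : ℝ} (hj : 1 ≤ j) :
    |f j - ∫ t in (j - 1 / 2)..(j + 1 / 2), f t|
      ≤ A * 2 ^ |a| * (j ^ a * Real.exp (-(b / 2 * j))) := by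
  set B := A * 2 ^ |a| * (j ^ a * Real.exp (-(b / 2 * j))) with hB
  have hB0 : 0 ≤ B := by
    have : 0 < j := by linarith
    positivity
  have hbd : ∀ t ∈ Set.Icc (j - 1 / 2) (j + 1 / 2), |f' t - f' j| ≤ B := by
    intro t ht
    have hconv := Convex.norm_image_sub_le_of_norm_hasDerivWithin_le (f := f') (f' := f'') (C := B)
      (s := Set.uIcc j t) (x := j) (y := t) (fun s hs => (hf' s (by
        have := (abs_le.mp (uIcc_subset_of_mem_unitInterval ht hs)).1
        linarith)).hasDerivWithinAt) (fun s hs => by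
        have h1 := uIcc_subset_of_mem_unitInterval ht hs
        rw [Real.norm_eq_abs]
        refine (hf'' s (by linarith [(abs_le.mp h1).1])).trans ?_
        rw [hB, mul_assoc]
        exact mul_le_mul_of_nonneg_left (rpow_mul_exp_le_of_abs_sub_le a hb hj h1) hA)
      (convex_uIcc j t) Set.left_mem_uIcc Set.right_mem_uIcc
    rw [Real.norm_eq_abs, Real.norm_eq_abs] at hconv
    refine hconv.trans (mul_le_of_le_one_right hB0 ?_)
    rw [abs_le]
    constructor <;> linarith [ht.1, ht.2]
  set h : ℝ → ℝ := fun t => f t - f' j * (t - j) with hh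
  have hderiv : ∀ t, 0 < t → HasDerivAt h (f' t - f' j) t := by
    intro t ht
    have h1 := ((hasDerivAt_id t).sub_const j).const_mul (f' j)
    exact ((hf t ht).sub h1).congr_deriv (by ring)
  have hbound : ∀ t ∈ Set.Icc (j - 1 / 2) (j + 1 / 2), |h j - h t| ≤ B := by
    intro t ht
    have hconv := Convex.norm_image_sub_le_of_norm_hasDerivWithin_le (f := h)
      (f' := fun t => f' t - f' j) (C := B)
      (s := Set.uIcc j t) (x := t) (y := j) (fun s hs => (hderiv s (by
        have := (abs_le.mp (uIcc_subset_of_mem_unitInterval ht hs)).1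
        linarith)).hasDerivWithinAt) (fun s hs => by
        have h1 := abs_le.mp (uIcc_subset_of_mem_unitInterval ht hs)
        exact hbd s ⟨by linarith [h1.1], by linarith [h1.2]⟩)
      (convex_uIcc j t) Set.right_mem_uIcc Set.left_mem_uIcc
    rw [Real.norm_eq_abs, Real.norm_eq_abs] at hconv
    refine hconv.trans (mul_le_of_le_one_right hB0 ?_)
    rw [abs_le]
    constructor <;> linarith [ht.1, ht.2]
  have hcont : IntervalIntegrable f volume (j - 1 / 2) (j + 1 / 2) := by
    refine ContinuousOn.intervalIntegrable_of_Icc (by linarith) fun t ht => ?_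
    exact (hf t (by linarith [ht.1])).continuousAt.continuousWithinAt
  have hlin : ∫ t in (j - 1 / 2)..(j + 1 / 2), f' j * (t - j) = 0 := by
    rw [intervalIntegral.integral_const_mul,
      intervalIntegral.integral_sub (Continuous.intervalIntegrable (by fun_prop) _ _)
        intervalIntegrable_const, integral_id, intervalIntegral.integral_const]
    norm_num
    right
    ring
  have hhint : IntervalIntegrable h volume (j - 1 / 2) (j + 1 / 2) :=
    hcont.sub (Continuous.intervalIntegrable (by fun_prop) _ _)
  have e : f j - ∫ t in (j - 1 / 2)..(j + 1 / 2), f t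
      = ∫ t in (j - 1 / 2)..(j + 1 / 2), (h j - h t) := by
    rw [intervalIntegral.integral_sub intervalIntegrable_const hhint,
      intervalIntegral.integral_const]
    simp only [hh]
    rw [intervalIntegral.integral_sub hcont (Continuous.intervalIntegrable (by fun_prop) _ _), hlin]
    norm_num
  rw [e]
  have := intervalIntegral.norm_integral_le_of_norm_le_const (a := j - 1 / 2) (b := j + 1 / 2)
    (f := fun t => h j - h t) (C := B) (fun t ht => by
      rw [Set.uIoc_of_le (by linarith)] at ht
      exact hbound t ⟨ht.1.le, ht.2⟩)
  rw [Real.norm_eq_abs] at this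
  refine this.trans (le_of_eq ?_)
  norm_num

/-- Passing from a sum to the integral over the half-line, given local error bounds and a bound
on the integrand. -/
theorem abs_tsum_sub_integral_Ioi_zero_le {f : ℝ → ℝ} {A B a d b : ℝ} (hb : 0 < b)
    (hd : -1 < d) (hB : 0 ≤ B) (hf : ContinuousOn f (Set.Ioi 0))
    (hfB : ∀ t, 0 < t → |f t| ≤ B * (t ^ d * Real.exp (-(b * t))))
    (h : ∀ j : ℝ, 1 ≤ j → |f j - ∫ t in (j - 1 / 2)..(j + 1 / 2), f t|
      ≤ A * (j ^ a * Real.exp (-(b / 4 * j)))) :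
    IntegrableOn f (Set.Ioi 0) ∧ (Summable fun k : ℕ => f ((k : ℝ) + 1)) ∧
    |∑' k : ℕ, f ((k : ℝ) + 1) - ∫ t in Set.Ioi 0, f t|
      ≤ A * expPowerSum a (b / 4) + B / (d + 1) := by
  have hdom : IntegrableOn (fun t : ℝ => B * (t ^ d * Real.exp (-(b * t)))) (Set.Ioi 0) := by
    have := integrableOn_rpow_mul_exp (a := d + 1) (by linarith) hb
    rw [add_sub_cancel_right] at this
    exact this.const_mul B
  have hint : IntegrableOn f (Set.Ioi 0) := by
    refine Integrable.mono' hdom (hf.aestronglyMeasurable measurableSet_Ioi) ?_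
    filter_upwards [ae_restrict_mem measurableSet_Ioi] with t ht using hfB t ht
  have hsum : Summable fun k : ℕ => f ((k : ℝ) + 1) := by
    refine Summable.of_norm_bounded ((summable_expPowerSum d hb).mul_left B) fun k => ?_
    exact hfB _ (by positivity)
  refine ⟨hint, hsum, ?_⟩
  have h1 := abs_tsum_sub_integral_Ioi_le
    (e := fun k : ℕ => A * (((k : ℝ) + 1) ^ a * Real.exp (-(b / 4 * ((k : ℝ) + 1)))))
    (hint.mono_set (Set.Ioi_subset_Ioi (by norm_num))) hsum
    ((summable_expPowerSum a (by positivity)).mul_left A) (fun k => by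
      have := h ((k : ℝ) + 1) (by have : (0 : ℝ) ≤ k := k.cast_nonneg
                                  linarith)
      rwa [show (k : ℝ) + 1 - 1 / 2 = k + 1 / 2 by ring,
        show (k : ℝ) + 1 + 1 / 2 = k + 3 / 2 by ring] at this)
  rw [tsum_mul_left] at h1
  have h2 : ∫ t in Set.Ioi 0, f t = (∫ t in Set.Ioc 0 (1 / 2), f t) + ∫ t in Set.Ioi (1 / 2), f t := by
    rw [← setIntegral_union (Set.Ioc_disjoint_Ioi le_rfl) measurableSet_Ioi
      (hint.mono_set Set.Ioc_subset_Ioi_self)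
      (hint.mono_set (Set.Ioi_subset_Ioi (by norm_num))), Set.Ioc_union_Ioi_eq_Ioi (by norm_num)]
  -- The piece left of the first cell is merely bounded; its bound is the integral of `B t^d` over
  -- `(0, 1]`, finite because `d > -1`.
  have h3 : |∫ t in Set.Ioc 0 (1 / 2), f t| ≤ B / (d + 1) := by
    have hii : IntervalIntegrable (fun t : ℝ => B * t ^ d) volume 0 1 :=
      (intervalIntegral.intervalIntegrable_rpow' hd).const_mul B
    rw [intervalIntegrable_iff_integrableOn_Ioc_of_le zero_le_one] at hii
    have hval : ∫ t in Set.Ioc (0 : ℝ) 1, B * t ^ d = B / (d + 1) := by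
      rw [← intervalIntegral.integral_of_le zero_le_one, intervalIntegral.integral_const_mul,
        integral_rpow (Or.inl hd)]
      rw [Real.one_rpow, Real.zero_rpow (by linarith)]
      ring
    have hsub : Set.Ioc (0 : ℝ) (1 / 2) ⊆ Set.Ioc 0 1 := Set.Ioc_subset_Ioc_right (by norm_num)
    rw [← hval]
    refine (abs_integral_le_integral_abs).trans ?_
    have hint' : IntegrableOn f (Set.Ioc 0 (1 / 2)) := hint.mono_set Set.Ioc_subset_Ioi_self
    refine le_trans (setIntegral_mono_on hint'.abs (hii.mono_set hsub) measurableSet_Ioc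
      fun t ht => ?_) (setIntegral_mono_set hii ?_ hsub.eventuallyLE)
    · refine (hfB t ht.1).trans ?_
      refine mul_le_mul_of_nonneg_left ?_ hB
      refine mul_le_of_le_one_right (Real.rpow_nonneg ht.1.le _) ?_
      rw [Real.exp_le_one_iff]
      have := mul_pos hb ht.1
      linarith
    · filter_upwards [ae_restrict_mem measurableSet_Ioc] with t ht
      have := Real.rpow_nonneg ht.1.le d
      exact mul_nonneg hB this
  have h4 : ∑' k : ℕ, f ((k : ℝ) + 1) - ∫ t in Set.Ioi 0, f t
      = (∑' k : ℕ, f ((k : ℝ) + 1) - ∫ t in Set.Ioi (1 / 2), f t)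
        - ∫ t in Set.Ioc 0 (1 / 2), f t := by
    rw [h2]
    ring
  rw [h4]
  exact (abs_sub _ _).trans (add_le_add h1 h3)

theorem exists_rpow_mul_exp_neg_le {κ : ℝ} (hκ : 0 ≤ κ) :
    ∃ C : ℝ, 0 < C ∧ ∀ u : ℝ, 0 ≤ u → u ^ κ * Real.exp (-(u / 4)) ≤ C := by
  obtain ⟨N, hN⟩ := exists_nat_ge κ
  refine ⟨1 + 4 ^ N * N.factorial, by positivity, fun u hu => ?_⟩
  have h1 : u ^ κ ≤ 1 + u ^ N := by
    rcases le_total u 1 with h | h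
    · have := Real.rpow_le_one hu h hκ
      have : 0 ≤ u ^ N := by positivity
      linarith
    · have := Real.rpow_le_rpow_of_exponent_le h hN
      rw [Real.rpow_natCast] at this
      linarith
  have h2 : u ^ N ≤ 4 ^ N * N.factorial * Real.exp (u / 4) := by
    have := Real.pow_div_factorial_le_exp (u / 4) (by positivity) N
    rw [div_pow, div_div, div_le_iff₀ (by positivity)] at this
    linarith
  have h3 : Real.exp (-(u / 4)) * Real.exp (u / 4) = 1 := by rw [← Real.exp_add]; simp
  have h4 : Real.exp (-(u / 4)) ≤ 1 := by rw [Real.exp_le_one_iff]; linarith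
  calc u ^ κ * Real.exp (-(u / 4))
      ≤ (1 + 4 ^ N * N.factorial * Real.exp (u / 4)) * Real.exp (-(u / 4)) :=
        mul_le_mul_of_nonneg_right (by linarith) (Real.exp_pos _).le
    _ = Real.exp (-(u / 4))
        + 4 ^ N * N.factorial * (Real.exp (-(u / 4)) * Real.exp (u / 4)) := by ring
    _ ≤ _ := by rw [h3]; linarith

theorem mul_exp_neg_half_le {u : ℝ} : u * Real.exp (-(u / 2)) ≤ 2 := by
  have h1 := Real.add_one_le_exp (u / 2)
  have h3 : Real.exp (-(u / 2)) * Real.exp (u / 2) = 1 := by rw [← Real.exp_add]; simp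
  nlinarith [Real.exp_pos (-(u / 2))]

theorem sq_mul_exp_neg_half_le {u : ℝ} (hu : 0 ≤ u) : u ^ 2 * Real.exp (-(u / 2)) ≤ 16 := by
  have h1 := Real.add_one_le_exp (u / 4)
  have h3 : Real.exp (-(u / 2)) * Real.exp (u / 4) ^ 2 = 1 := by
    rw [← Real.exp_nat_mul, ← Real.exp_add]
    rw [Real.exp_eq_one_iff]
    push_cast
    ring
  have h4 : (u / 4) ^ 2 ≤ Real.exp (u / 4) ^ 2 := pow_le_pow_left₀ (by positivity) (by linarith) 2
  nlinarith [Real.exp_pos (-(u / 2))]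

theorem hasDerivAt_rpow_mul_exp (α b : ℝ) {t : ℝ} (ht : 0 < t) :
    HasDerivAt (fun t : ℝ => t ^ α * Real.exp (-(b * t)))
      ((α / t - b) * (t ^ α * Real.exp (-(b * t)))) t := by
  have h1 := Real.hasDerivAt_rpow_const (x := t) (p := α) (Or.inl ht.ne')
  have h2 : HasDerivAt (fun t : ℝ => Real.exp (-(b * t))) (Real.exp (-(b * t)) * (-b)) t := by
    have := (((hasDerivAt_id t).const_mul b).neg).exp
    exact this.congr_deriv (by simp)
  refine (h1.mul h2).congr_deriv ?_
  rw [Real.rpow_sub_one ht.ne']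
  ring

/-- Sums of `v ^ κ * j ^ α * exp (-(b + v / 2) * j)` are close to gamma integrals, uniformly
in `v`. -/
theorem exists_abs_tsum_rpow_mul_exp_sub_le {κ α : ℝ} (hκ : 0 ≤ κ) (hd : -1 < α - κ) :
    ∃ C : ℝ, 0 < C ∧ ∀ b v : ℝ, 0 < b → 0 ≤ v →
      (Summable fun k : ℕ =>
        v ^ κ * (((k : ℝ) + 1) ^ α * Real.exp (-((b + v / 2) * ((k : ℝ) + 1))))) ∧
      |∑' k : ℕ, v ^ κ * (((k : ℝ) + 1) ^ α * Real.exp (-((b + v / 2) * ((k : ℝ) + 1))))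
        - v ^ κ * (Real.Gamma (α + 1) * (b + v / 2) ^ (-(α + 1)))|
        ≤ C * (expPowerSum (α - 1 - κ) (b / 4) + 1) := by
  obtain ⟨K, hK, hKb⟩ := exists_rpow_mul_exp_neg_le hκ
  set A := (|α| + 2) * K * 2 ^ |α - 1 - κ| with hA
  have hA0 : 0 < A := by positivity
  have hd' : 0 < α - κ + 1 := by linarith
  refine ⟨A + K / (α - κ + 1), by positivity, fun b v hb hv => ?_⟩
  set γ := b + v / 2 with hγ
  have hγ0 : 0 < γ := by positivity
  -- Uniformity in `v`: half of the factor `e^(-vt/2)` turns the unbounded `v^κ` into `t^(-κ)`. The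
  -- other half stays available for the derivative bound.
  have hvt : ∀ t : ℝ, 0 < t → v ^ κ * Real.exp (-(v / 4 * t)) ≤ K * t ^ (-κ) := by
    intro t ht
    have := hKb (v * t) (by positivity)
    rw [Real.mul_rpow hv ht.le, show v * t / 4 = v / 4 * t by ring] at this
    rw [Real.rpow_neg ht.le, ← div_eq_mul_inv, le_div_iff₀ (by positivity)]
    linarith
  set f : ℝ → ℝ := fun t => v ^ κ * (t ^ α * Real.exp (-(γ * t))) with hf
  set f' : ℝ → ℝ := fun t => v ^ κ * ((α / t - γ) * (t ^ α * Real.exp (-(γ * t)))) with hf'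
  have hder : ∀ t, 0 < t → HasDerivAt f (f' t) t := fun t ht =>
    (hasDerivAt_rpow_mul_exp α γ ht).const_mul _
  have hfb : ∀ t, 0 < t → |f t| ≤ K * (t ^ (α - κ) * Real.exp (-(b * t))) := by
    intro t ht
    have h0 : 0 ≤ f t := by simp only [hf]; positivity
    rw [abs_of_nonneg h0]
    have h1 : Real.exp (-(γ * t)) ≤ Real.exp (-(b * t)) * Real.exp (-(v / 4 * t)) := by
      rw [← Real.exp_add]
      apply Real.exp_le_exp.mpr
      rw [hγ]
      have : 0 ≤ v * t := by positivity
      nlinarith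
    calc f t ≤ v ^ κ * (t ^ α * (Real.exp (-(b * t)) * Real.exp (-(v / 4 * t)))) := by
          simp only [hf]; gcongr
      _ = (v ^ κ * Real.exp (-(v / 4 * t))) * (t ^ α * Real.exp (-(b * t))) := by ring
      _ ≤ (K * t ^ (-κ)) * (t ^ α * Real.exp (-(b * t))) :=
          mul_le_mul_of_nonneg_right (hvt t ht) (by positivity)
      _ = _ := by
          rw [sub_eq_add_neg, Real.rpow_add ht]; ring
  have hfb' : ∀ t, 1 / 2 ≤ t → |f' t|
      ≤ ((|α| + 2) * K) * (t ^ (α - 1 - κ) * Real.exp (-(b / 2 * t))) := by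
    intro t ht2
    have ht : 0 < t := by linarith
    have h1 : |α / t - γ| ≤ (|α| + γ * t) / t := by
      refine (abs_sub _ _).trans ?_
      rw [abs_div, abs_of_pos ht, abs_of_pos hγ0]
      apply le_of_eq
      field_simp
    have h2 : (|α| + γ * t) * Real.exp (-(γ * t / 2)) ≤ |α| + 2 := by
      rw [add_mul]
      refine add_le_add (mul_le_of_le_one_right (abs_nonneg _) ?_) mul_exp_neg_half_le
      rw [Real.exp_le_one_iff]
      have : 0 < γ * t := by positivity
      linarith
    have h3 : Real.exp (-(γ * t)) = Real.exp (-(γ * t / 2)) * (Real.exp (-(b / 2 * t))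
        * Real.exp (-(v / 4 * t))) := by
      rw [← Real.exp_add, ← Real.exp_add]
      congr 1
      rw [hγ]
      ring
    calc |f' t| = v ^ κ * (|α / t - γ| * (t ^ α * Real.exp (-(γ * t)))) := by
          simp only [hf']
          rw [abs_mul, abs_mul, abs_of_nonneg (by positivity : 0 ≤ v ^ κ),
            abs_of_nonneg (by positivity : 0 ≤ t ^ α * Real.exp (-(γ * t)))]
      _ ≤ v ^ κ * ((|α| + γ * t) / t * (t ^ α * Real.exp (-(γ * t)))) := by gcongr
      _ = ((|α| + γ * t) * Real.exp (-(γ * t / 2))) * (v ^ κ * Real.exp (-(v / 4 * t)))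
          * (t ^ (α - 1) * Real.exp (-(b / 2 * t))) := by
          rw [h3, Real.rpow_sub_one ht.ne']
          field_simp
      _ ≤ (|α| + 2) * (K * t ^ (-κ)) * (t ^ (α - 1) * Real.exp (-(b / 2 * t))) := by
          refine mul_le_mul_of_nonneg_right ?_ (by positivity)
          exact mul_le_mul h2 (hvt t ht) (by positivity) (by positivity)
      _ = _ := by
          rw [show α - 1 - κ = α - 1 + -κ by ring, Real.rpow_add ht]; ring
  have hmain := abs_tsum_sub_integral_Ioi_zero_le (f := f) (A := A) (B := K) (a := α - 1 - κ)
    (d := α - κ) hb hd hK.le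
    (fun t ht => (hder t ht).continuousAt.continuousWithinAt) hfb (fun j hj => by
      have := abs_sub_integral_le_of_deriv (by positivity) (by positivity) hder hfb' hj
      rwa [show b / 2 / 2 = b / 4 by ring] at this)
  obtain ⟨-, h2, h3⟩ := hmain
  refine ⟨h2, ?_⟩
  have hI : ∫ t in Set.Ioi 0, f t = v ^ κ * (Real.Gamma (α + 1) * γ ^ (-(α + 1))) := by
    simp only [hf]
    have := Real.integral_rpow_mul_exp_neg_mul_Ioi (a := α + 1) (by linarith) hγ0
    rw [add_sub_cancel_right] at this
    rw [integral_const_mul, this, one_div, Real.inv_rpow hγ0.le, Real.rpow_neg hγ0.le]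
    ring
  rw [hI] at h3
  refine h3.trans ?_
  have hE : 0 ≤ expPowerSum (α - 1 - κ) (b / 4) := tsum_nonneg fun k => by positivity
  have hKd : 0 ≤ K / (α - κ + 1) := by positivity
  nlinarith [mul_nonneg hKd hE]

theorem abs_mul_gaussDensity_le (y : ℝ) : |y| * gaussDensity y ≤ 1 := by
  have h1 : gaussDensity y ≤ Real.exp (-(y ^ 2 / 2)) := by
    have := gaussDensity_le_one 0
    unfold gaussDensity at this ⊢
    norm_num at this
    rw [show -y ^ 2 / 2 = -(y ^ 2 / 2) by ring]
    refine mul_le_of_le_one_left (Real.exp_pos _).le ?_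
    simpa using this
  have h2 : |y| ≤ Real.exp (y ^ 2 / 2) := by
    have := Real.add_one_le_exp (y ^ 2 / 2)
    nlinarith [sq_nonneg (|y| - 1), sq_abs y]
  calc |y| * gaussDensity y ≤ Real.exp (y ^ 2 / 2) * Real.exp (-(y ^ 2 / 2)) :=
        mul_le_mul h2 h1 (gaussDensity_pos y).le (Real.exp_pos _).le
    _ = 1 := by rw [← Real.exp_add]; simp

theorem abs_cube_mul_gaussDensity_le (y : ℝ) : |y| ^ 3 * gaussDensity y ≤ 4 := by
  have h1 : gaussDensity y ≤ Real.exp (-(y ^ 2 / 2)) := by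
    have := gaussDensity_le_one 0
    unfold gaussDensity at this ⊢
    norm_num at this
    rw [show -y ^ 2 / 2 = -(y ^ 2 / 2) by ring]
    refine mul_le_of_le_one_left (Real.exp_pos _).le ?_
    simpa using this
  have h2 : |y| ^ 3 ≤ 4 * Real.exp (y ^ 2 / 2) := by
    have := Real.quadratic_le_exp_of_nonneg (x := y ^ 2 / 2) (by positivity)
    rw [← sq_abs] at this
    have h0 := abs_nonneg y
    rw [← sq_abs y]
    nlinarith [mul_nonneg (sq_nonneg |y|) (sq_nonneg (|y| - 1))]
  calc |y| ^ 3 * gaussDensity y ≤ 4 * Real.exp (y ^ 2 / 2) * Real.exp (-(y ^ 2 / 2)) :=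
        mul_le_mul h2 h1 (gaussDensity_pos y).le (by positivity)
    _ = 4 := by rw [mul_assoc, ← Real.exp_add]; simp

theorem hasDerivAt_sqrt_div_mul {g t : ℝ} (hg : 0 < g) (ht : 0 < t) (x : ℝ) :
    HasDerivAt (fun t => Real.sqrt (t / g) * x) (Real.sqrt (t / g) * x / (2 * t)) t := by
  have h1 := (((hasDerivAt_id t).div_const g).sqrt (by simp only [id]; positivity)).mul_const x
  refine h1.congr_deriv ?_
  simp only [id]
  have h2 : Real.sqrt (t / g) ≠ 0 := by positivity
  have h3 : Real.sqrt (t / g) * Real.sqrt (t / g) = t / g := Real.mul_self_sqrt (by positivity)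
  rw [eq_div_iff (by positivity)]
  field_simp
  rw [pow_two, h3]
  field_simp

theorem hasDerivAt_gaussCDF_sqrt {g t : ℝ} (hg : 0 < g) (ht : 0 < t) (x : ℝ) :
    HasDerivAt (fun t => gaussCDF (Real.sqrt (t / g) * x))
      (gaussDensity (Real.sqrt (t / g) * x) * (Real.sqrt (t / g) * x / (2 * t))) t :=
  (hasDerivAt_gaussCDF _).comp t (hasDerivAt_sqrt_div_mul hg ht x)

theorem hasDerivAt_gaussDensity_sqrt {g t : ℝ} (hg : 0 < g) (ht : 0 < t) (x : ℝ) :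
    HasDerivAt (fun t => gaussDensity (Real.sqrt (t / g) * x) * (Real.sqrt (t / g) * x / (2 * t)))
      (-(gaussDensity (Real.sqrt (t / g) * x) * (Real.sqrt (t / g) * x
        + (Real.sqrt (t / g) * x) ^ 3) / (4 * t ^ 2))) t := by
  have hy := hasDerivAt_sqrt_div_mul hg ht x
  have h1 := (hasDerivAt_gaussDensity (Real.sqrt (t / g) * x)).comp t hy
  have h2 := hy.div ((hasDerivAt_id t).const_mul 2) (by simp only [id]; positivity)
  refine (h1.mul h2).congr_deriv ?_
  simp only [id, Function.comp, Pi.div_apply]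
  field_simp
  ring

/-- Since `y φ(y)` and `y³ φ(y)` are bounded, each derivative of `Φ(√(t/g) x)` in `t` costs a factor
`1/t`, uniformly in `x` and `g`. The first bound uses one derivative and the second uses two; they
serve the exponents `α = r - 2` and `α = r - 1`, both with final error exponent `r - 3`. -/
theorem exists_abs_tsum_gaussCDF_sub_le {α : ℝ} (hα : -1 < α) :
    ∃ C : ℝ, 0 < C ∧ ∀ b g x : ℝ, 0 < b → 0 < g →
      let f : ℝ → ℝ := fun t => t ^ α * Real.exp (-(b * t)) * gaussCDF (Real.sqrt (t / g) * x)
      IntegrableOn f (Set.Ioi 0) ∧ (Summable fun k : ℕ => f ((k : ℝ) + 1)) ∧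
      |∑' k : ℕ, f ((k : ℝ) + 1) - ∫ t in Set.Ioi 0, f t|
        ≤ C * (expPowerSum (α - 1) (b / 4) + 1) ∧
      |∑' k : ℕ, f ((k : ℝ) + 1) - ∫ t in Set.Ioi 0, f t|
        ≤ C * (expPowerSum (α - 2) (b / 4) + 1) := by
  set A₁ := (|α| + 3) * 2 ^ |α - 1| with hA₁
  set A₂ := ((|α| ^ 2 + 2 * |α| + 2) + (2 * |α| + 2) * 2 + 16 + |α|) * 2 ^ |α - 2| with hA₂
  have hα1 : 0 < α + 1 := by linarith
  refine ⟨A₁ + A₂ + 1 / (α + 1), by positivity, fun b g x hb hg => ?_⟩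
  intro f
  set w : ℝ → ℝ := fun t => gaussCDF (Real.sqrt (t / g) * x) with hw
  set w' : ℝ → ℝ := fun t =>
    gaussDensity (Real.sqrt (t / g) * x) * (Real.sqrt (t / g) * x / (2 * t)) with hw'
  set w'' : ℝ → ℝ := fun t => -(gaussDensity (Real.sqrt (t / g) * x) * (Real.sqrt (t / g) * x
        + (Real.sqrt (t / g) * x) ^ 3) / (4 * t ^ 2)) with hw''
  set p : ℝ → ℝ := fun t => t ^ α * Real.exp (-(b * t)) with hp
  have hfp : f = fun t => p t * w t := rfl
  have hwb : ∀ t, |w t| ≤ 1 := fun t => by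
    rw [abs_of_nonneg (gaussCDF_nonneg _)]
    exact gaussCDF_le_one _
  have hwb' : ∀ t, 0 < t → |w' t| ≤ 1 / t := by
    intro t ht
    simp only [hw']
    rw [abs_mul, abs_div, abs_of_pos (gaussDensity_pos _), abs_of_pos (by positivity : 0 < 2 * t),
      mul_div_assoc', div_le_div_iff₀ (by positivity) ht]
    have := abs_mul_gaussDensity_le (Real.sqrt (t / g) * x)
    nlinarith
  have hwb'' : ∀ t, 0 < t → |w'' t| ≤ 2 / t ^ 2 := by
    intro t ht
    simp only [hw'']
    set y := Real.sqrt (t / g) * x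
    rw [abs_neg, abs_div, abs_mul, abs_of_pos (gaussDensity_pos _),
      abs_of_pos (by positivity : 0 < 4 * t ^ 2), div_le_div_iff₀ (by positivity) (by positivity)]
    have h1 := abs_mul_gaussDensity_le y
    have h2 := abs_cube_mul_gaussDensity_le y
    have h3 : |y + y ^ 3| ≤ |y| + |y| ^ 3 := by
      rw [← abs_pow]
      exact abs_add_le _ _
    have h4 : gaussDensity y * |y + y ^ 3| ≤ 5 := by
      have := mul_le_mul_of_nonneg_left h3 (gaussDensity_pos y).le
      linarith
    have : 0 < t ^ 2 := by positivity
    nlinarith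
  have hpder : ∀ t, 0 < t → HasDerivAt p ((α / t - b) * p t) t := fun t ht =>
    hasDerivAt_rpow_mul_exp α b ht
  have hwder : ∀ t, 0 < t → HasDerivAt w (w' t) t := fun t ht => hasDerivAt_gaussCDF_sqrt hg ht x
  have hwder' : ∀ t, 0 < t → HasDerivAt w' (w'' t) t := fun t ht =>
    hasDerivAt_gaussDensity_sqrt hg ht x
  have hfder : ∀ t, 0 < t → HasDerivAt f (p t * ((α / t - b) * w t + w' t)) t := by
    intro t ht
    rw [hfp]
    exact ((hpder t ht).mul (hwder t ht)).congr_deriv (by ring)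
  have hfder' : ∀ t, 0 < t → HasDerivAt (fun t => p t * ((α / t - b) * w t + w' t))
      (p t * (((α / t - b) ^ 2 - α / t ^ 2) * w t + 2 * (α / t - b) * w' t + w'' t)) t := by
    intro t ht
    have h1 : HasDerivAt (fun t : ℝ => α / t - b) (-α / t ^ 2) t := by
      have := ((hasDerivAt_inv ht.ne').const_mul α).sub_const b
      refine (this.congr_deriv ?_)
      field_simp
    refine ((hpder t ht).mul ((h1.mul (hwder t ht)).add (hwder' t ht))).congr_deriv ?_
    simp only [Pi.add_apply, Pi.mul_apply]
    ring
  have hp0 : ∀ t, 0 < t → 0 < p t := fun t ht => by simp only [hp]; positivity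
  have hc : ∀ t, 0 < t → |α / t - b| ≤ (|α| + b * t) / t := by
    intro t ht
    refine (abs_sub _ _).trans ?_
    rw [abs_div, abs_of_pos ht, abs_of_pos hb]
    apply le_of_eq
    field_simp
  have hexp : ∀ t, p t = t ^ α * (Real.exp (-(b * t / 2)) * Real.exp (-(b / 2 * t))) := by
    intro t
    rw [← Real.exp_add]
    simp only [hp]
    congr 2
    ring
  have he1 : ∀ t, 0 < t → Real.exp (-(b * t / 2)) ≤ 1 := by
    intro t ht
    rw [Real.exp_le_one_iff]
    have : 0 < b * t := by positivity
    linarith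
  have hb1 : ∀ t, 1 / 2 ≤ t → |p t * ((α / t - b) * w t + w' t)|
      ≤ (|α| + 3) * (t ^ (α - 1) * Real.exp (-(b / 2 * t))) := by
    intro t ht2
    have ht : 0 < t := by linarith
    have h1 : |(α / t - b) * w t + w' t| ≤ (|α| + b * t + 1) / t := by
      refine (abs_add_le _ _).trans ?_
      rw [abs_mul]
      have := mul_le_mul (hc t ht) (hwb t) (abs_nonneg _) (by positivity)
      have h2 := hwb' t ht
      rw [add_div]
      linarith
    have h2 : (|α| + b * t + 1) * Real.exp (-(b * t / 2)) ≤ |α| + 3 := by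
      have h3 := mul_exp_neg_half_le (u := b * t)
      have h4 := mul_le_mul_of_nonneg_left (he1 t ht) (abs_nonneg α)
      linarith [he1 t ht]
    rw [abs_mul, abs_of_pos (hp0 t ht)]
    calc p t * |(α / t - b) * w t + w' t| ≤ p t * ((|α| + b * t + 1) / t) :=
          mul_le_mul_of_nonneg_left h1 (hp0 t ht).le
      _ = ((|α| + b * t + 1) * Real.exp (-(b * t / 2)))
          * (t ^ (α - 1) * Real.exp (-(b / 2 * t))) := by
          rw [hexp, Real.rpow_sub_one ht.ne']
          field_simp
      _ ≤ _ := mul_le_mul_of_nonneg_right h2 (by positivity)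
  have hb2 : ∀ t, 1 / 2 ≤ t →
      |p t * (((α / t - b) ^ 2 - α / t ^ 2) * w t + 2 * (α / t - b) * w' t + w'' t)|
      ≤ ((|α| ^ 2 + 2 * |α| + 2) + (2 * |α| + 2) * 2 + 16 + |α|)
        * (t ^ (α - 2) * Real.exp (-(b / 2 * t))) := by
    intro t ht2
    have ht : 0 < t := by linarith
    have h1 : |((α / t - b) ^ 2 - α / t ^ 2) * w t + 2 * (α / t - b) * w' t + w'' t|
        ≤ ((|α| + b * t) ^ 2 + |α| + 2 * (|α| + b * t) + 2) / t ^ 2 := by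
      have a1 : |((α / t - b) ^ 2 - α / t ^ 2) * w t| ≤ ((|α| + b * t) ^ 2 + |α|) / t ^ 2 := by
        rw [abs_mul]
        refine (mul_le_of_le_one_right (abs_nonneg _) (hwb t)).trans ?_
        refine (abs_sub _ _).trans ?_
        rw [abs_pow, abs_div, abs_of_pos (by positivity : 0 < t ^ 2), add_div, ← div_pow]
        exact add_le_add (pow_le_pow_left₀ (abs_nonneg _) (hc t ht) 2) le_rfl
      have a2 : |2 * (α / t - b) * w' t| ≤ 2 * (|α| + b * t) / t ^ 2 := by
        rw [abs_mul, abs_mul, abs_two]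
        calc 2 * |α / t - b| * |w' t| ≤ 2 * ((|α| + b * t) / t) * (1 / t) :=
              mul_le_mul (mul_le_mul_of_nonneg_left (hc t ht) (by norm_num)) (hwb' t ht)
                (abs_nonneg _) (by positivity)
          _ = _ := by field_simp
      have a3 := hwb'' t ht
      refine (abs_add_le _ _).trans ?_
      refine (add_le_add (abs_add_le _ _) le_rfl).trans ?_
      rw [add_div, add_div]
      linarith
    have h2 : ((|α| + b * t) ^ 2 + |α| + 2 * (|α| + b * t) + 2) * Real.exp (-(b * t / 2))
        ≤ (|α| ^ 2 + 2 * |α| + 2) + (2 * |α| + 2) * 2 + 16 + |α| := by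
      have h3 := mul_exp_neg_half_le (u := b * t)
      have h4 := sq_mul_exp_neg_half_le (u := b * t) (by positivity)
      have h5 := he1 t ht
      have h6 := mul_le_mul_of_nonneg_left h5
        (by positivity : 0 ≤ |α| ^ 2 + 2 * |α| + 2 + |α|)
      have h7 := mul_le_mul_of_nonneg_left h3 (by positivity : 0 ≤ 2 * |α| + 2)
      linarith
    rw [abs_mul, abs_of_pos (hp0 t ht)]
    calc p t * |((α / t - b) ^ 2 - α / t ^ 2) * w t + 2 * (α / t - b) * w' t + w'' t|
        ≤ p t * (((|α| + b * t) ^ 2 + |α| + 2 * (|α| + b * t) + 2) / t ^ 2) :=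
          mul_le_mul_of_nonneg_left h1 (hp0 t ht).le
      _ = (((|α| + b * t) ^ 2 + |α| + 2 * (|α| + b * t) + 2) * Real.exp (-(b * t / 2)))
          * (t ^ (α - 2) * Real.exp (-(b / 2 * t))) := by
          rw [hexp, Real.rpow_sub ht, Real.rpow_two]
          field_simp
      _ ≤ _ := mul_le_mul_of_nonneg_right h2 (by positivity)
  have hfB : ∀ t, 0 < t → |f t| ≤ 1 * (t ^ α * Real.exp (-(b * t))) := by
    intro t ht
    rw [hfp, one_mul, abs_mul, abs_of_pos (hp0 t ht)]
    exact mul_le_of_le_one_right (hp0 t ht).le (hwb t)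
  have hcont : ContinuousOn f (Set.Ioi 0) := fun t ht =>
    (hfder t ht).continuousAt.continuousWithinAt
  obtain ⟨i1, s1, m1⟩ := abs_tsum_sub_integral_Ioi_zero_le (A := A₁) (a := α - 1) hb hα zero_le_one
    hcont hfB (fun j hj => by
      have := abs_sub_integral_le_of_deriv (by positivity) (by positivity) hfder hb1 hj
      rwa [show b / 2 / 2 = b / 4 by ring] at this)
  obtain ⟨-, -, m2⟩ := abs_tsum_sub_integral_Ioi_zero_le
    (A := A₂) (a := α - 2)
    hb hα zero_le_one hcont hfB (fun j hj => by
      have := abs_sub_integral_le_of_deriv2 (by positivity) (by positivity) hfder hfder' hb2 hj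
      rwa [show b / 2 / 2 = b / 4 by ring] at this)
  have hE1 : 0 ≤ expPowerSum (α - 1) (b / 4) := tsum_nonneg fun k => by positivity
  have hE2 : 0 ≤ expPowerSum (α - 2) (b / 4) := tsum_nonneg fun k => by positivity
  have hA₁0 : 0 ≤ A₁ := by positivity
  have hA₂0 : 0 ≤ A₂ := by positivity
  have hα0 : 0 ≤ 1 / (α + 1) := by positivity
  refine ⟨i1, s1, m1.trans ?_, m2.trans ?_⟩
  · nlinarith [mul_nonneg hA₂0 hE1, mul_nonneg hα0 hE1]
  · nlinarith [mul_nonneg hA₁0 hE2, mul_nonneg hα0 hE2]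

/-! ### Asymptotics of the negative binomial parameters -/

theorem rpow_le_two_rpow_abs (a : ℝ) {y : ℝ} (h1 : 1 / 2 ≤ y) (h2 : y ≤ 2) : y ^ a ≤ 2 ^ |a| := by
  rcases le_total 0 a with ha | ha
  · rw [abs_of_nonneg ha]
    exact Real.rpow_le_rpow (by linarith) h2 ha
  · rw [abs_of_nonpos ha]
    have : (1 / 2 : ℝ) ^ a = 2 ^ (-a) := by
      rw [one_div, Real.inv_rpow (by norm_num), Real.rpow_neg (by norm_num)]
    rw [← this]
    exact Real.rpow_le_rpow_of_nonpos (by norm_num) h1 ha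

theorem abs_le_of_mem_uIcc_zero {h y : ℝ} (hy : y ∈ Set.uIcc 0 h) : |y| ≤ |h| := by
  rcases le_total 0 h with hh | hh
  · rw [Set.uIcc_of_le hh] at hy
    rw [abs_of_nonneg hy.1, abs_of_nonneg hh]
    exact hy.2
  · rw [Set.uIcc_of_ge hh] at hy
    rw [abs_of_nonpos hy.2, abs_of_nonpos hh]
    linarith [hy.1]

theorem hasDerivAt_one_add_rpow (s : ℝ) {y : ℝ} (hy : |y| ≤ 1 / 2) :
    HasDerivAt (fun y : ℝ => (1 + y) ^ s) (s * (1 + y) ^ (s - 1)) y := by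
  have := (abs_le.mp hy).1
  have := ((hasDerivAt_id y).const_add 1).rpow_const (p := s) (Or.inl (by simp only [id]; linarith))
  exact this.congr_deriv (by simp)

theorem abs_one_add_rpow_sub_one_le (s : ℝ) {h : ℝ} (hh : |h| ≤ 1 / 2) :
    |(1 + h) ^ s - 1| ≤ |s| * 2 ^ |s - 1| * |h| := by
  have := Convex.norm_image_sub_le_of_norm_hasDerivWithin_le (f := fun y : ℝ => (1 + y) ^ s)
    (f' := fun y => s * (1 + y) ^ (s - 1)) (C := |s| * 2 ^ |s - 1|) (s := Set.uIcc 0 h)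
    (x := 0) (y := h) (fun y hy => (hasDerivAt_one_add_rpow s
      ((abs_le_of_mem_uIcc_zero hy).trans hh)).hasDerivWithinAt) (fun y hy => by
      have h1 := abs_le.mp ((abs_le_of_mem_uIcc_zero hy).trans hh)
      rw [norm_mul, Real.norm_eq_abs, Real.norm_of_nonneg (Real.rpow_nonneg (by linarith) _)]
      exact mul_le_mul_of_nonneg_left
        (rpow_le_two_rpow_abs _ (by linarith) (by linarith)) (abs_nonneg _))
    (convex_uIcc 0 h) Set.left_mem_uIcc Set.right_mem_uIcc
  simpa using this

theorem abs_one_add_rpow_sub_le (s : ℝ) {h : ℝ} (hh : |h| ≤ 1 / 2) :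
    |(1 + h) ^ s - 1 - s * h| ≤ |s| * (|s - 1| * 2 ^ |s - 1 - 1|) * h ^ 2 := by
  have := Convex.norm_image_sub_le_of_norm_hasDerivWithin_le
    (f := fun y : ℝ => (1 + y) ^ s - s * y)
    (f' := fun y => s * (1 + y) ^ (s - 1) - s) (C := |s| * (|s - 1| * 2 ^ |s - 1 - 1|) * |h|)
    (s := Set.uIcc 0 h)
    (x := 0) (y := h) (fun y hy => (((hasDerivAt_one_add_rpow s
      ((abs_le_of_mem_uIcc_zero hy).trans hh)).sub
        ((hasDerivAt_id y).const_mul s)).congr_deriv (by ring)).hasDerivWithinAt) (fun y hy => by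
      have h0 := abs_le_of_mem_uIcc_zero hy
      have h1 := abs_one_add_rpow_sub_one_le (s - 1) (h0.trans hh)
      rw [show s * (1 + y) ^ (s - 1) - s = s * ((1 + y) ^ (s - 1) - 1) by ring, norm_mul,
        Real.norm_eq_abs, Real.norm_eq_abs, mul_assoc |s|]
      refine mul_le_mul_of_nonneg_left (h1.trans ?_) (abs_nonneg _)
      exact mul_le_mul_of_nonneg_left h0 (by positivity))
    (convex_uIcc 0 h) Set.left_mem_uIcc Set.right_mem_uIcc
  simp only [Real.norm_eq_abs, mul_zero, sub_zero, add_zero, Real.one_rpow] at this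
  calc |(1 + h) ^ s - 1 - s * h| = |(1 + h) ^ s - s * h - 1| := by congr 1; ring
    _ ≤ _ := this
    _ = _ := by rw [mul_assoc _ |h| |h|, abs_mul_abs_self, pow_two]

/-- `f n = 1 + a / n + O (n⁻²)`. -/
def HasOneJet (f : ℕ → ℝ) (a : ℝ) : Prop :=
  (fun n : ℕ => f n - 1 - a * (1 / (n : ℝ))) =O[atTop] fun n : ℕ => (1 / (n : ℝ)) ^ 2

theorem one_div_sq_isBigO : (fun n : ℕ => (1 / (n : ℝ)) ^ 2) =O[atTop] fun n : ℕ => 1 / (n : ℝ) := by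
  refine Asymptotics.IsBigO.of_bound 1 ?_
  filter_upwards [eventually_ge_atTop 1] with n hn
  have hn' : (1 : ℝ) ≤ n := by exact_mod_cast hn
  rw [Real.norm_of_nonneg (by positivity), Real.norm_of_nonneg (by positivity), one_mul, pow_two]
  refine mul_le_of_le_one_left (by positivity) ?_
  rw [div_le_one (by linarith)]
  exact hn'

namespace HasOneJet

variable {f g : ℕ → ℝ} {a b : ℝ}

theorem sub_one (hf : HasOneJet f a) : (fun n => f n - 1) =O[atTop] fun n : ℕ => 1 / (n : ℝ) := by
  have h := (hf.trans one_div_sq_isBigO).add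
    ((Asymptotics.isBigO_refl (fun n : ℕ => 1 / (n : ℝ)) atTop).const_mul_left a)
  exact h.congr_left fun n => by ring

theorem congr (hf : HasOneJet f a) (h : ∀ᶠ n in atTop, f n = g n) (hab : a = b) :
    HasOneJet g b := by
  subst hab
  exact Asymptotics.IsBigO.congr' hf (h.mono fun n hn => by simp only [hn]) EventuallyEq.rfl

theorem mul (hf : HasOneJet f a) (hg : HasOneJet g b) :
    HasOneJet (fun n => f n * g n) (a + b) := by
  have h1 : (fun n => (f n - 1) * (g n - 1)) =O[atTop] fun n : ℕ => (1 / (n : ℝ)) ^ 2 :=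
    (hf.sub_one.mul hg.sub_one).congr_right fun n => by ring
  exact ((h1.add hf).add hg).congr_left fun n => by ring

theorem tendsto_sub_one (hf : HasOneJet f a) : Tendsto (fun n => f n - 1) atTop (𝓝 0) :=
  hf.sub_one.trans_tendsto tendsto_one_div_atTop_nhds_zero_nat

theorem rpow (hf : HasOneJet f a) (s : ℝ) : HasOneJet (fun n => f n ^ s) (s * a) := by
  have hsmall : ∀ᶠ n in atTop, |f n - 1| ≤ 1 / 2 := by
    have := hf.tendsto_sub_one.abs
    rw [abs_zero] at this
    exact this.eventually_le_const (by norm_num)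
  have h1 : (fun n => f n ^ s - 1 - s * (f n - 1)) =O[atTop] fun n : ℕ => (1 / (n : ℝ)) ^ 2 := by
    refine Asymptotics.IsBigO.trans (Asymptotics.IsBigO.of_bound
      (|s| * (|s - 1| * 2 ^ |s - 1 - 1|)) ?_) (hf.sub_one.pow 2)
    filter_upwards [hsmall] with n hn
    have := abs_one_add_rpow_sub_le s hn
    rw [add_sub_cancel] at this
    rwa [Real.norm_eq_abs, Real.norm_of_nonneg (sq_nonneg _)]
  exact (h1.add (Asymptotics.IsBigO.const_mul_left hf s)).congr_left fun n => by ring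

end HasOneJet

/-- The exponential rate `-log (1 - 1 / n)`. -/
noncomputable def geomRate (n : ℕ) : ℝ := -Real.log (1 - 1 / (n : ℝ))

theorem one_div_le_geomRate {n : ℕ} (hn : 2 ≤ n) : 1 / (n : ℝ) ≤ geomRate n := by
  have hn' : (2 : ℝ) ≤ n := by exact_mod_cast hn
  have h : 0 < 1 - 1 / (n : ℝ) := by
    rw [sub_pos, div_lt_one (by linarith)]
    linarith
  have := Real.log_le_sub_one_of_pos h
  rw [geomRate]
  linarith

theorem exp_neg_geomRate {n : ℕ} (hn : 2 ≤ n) : Real.exp (-geomRate n) = 1 - 1 / (n : ℝ) := by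
  have hn' : (2 : ℝ) ≤ n := by exact_mod_cast hn
  have h : 0 < 1 - 1 / (n : ℝ) := by
    rw [sub_pos, div_lt_one (by linarith)]
    linarith
  rw [geomRate, neg_neg, Real.exp_log h]

theorem hasOneJet_mul_geomRate : HasOneJet (fun n => (n : ℝ) * geomRate n) (1 / 2) := by
  refine Asymptotics.IsBigO.of_bound 2 ?_
  filter_upwards [eventually_ge_atTop 2] with n hn
  have hn' : (2 : ℝ) ≤ n := by exact_mod_cast hn
  have hn0 : (0 : ℝ) < n := by linarith
  set u := 1 / (n : ℝ) with hu
  have hu0 : 0 < u := by positivity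
  have hu2 : u ≤ 1 / 2 := one_div_le_one_div_of_le (by norm_num) hn'
  have h := abs_log_one_add_sub_le (x := -u) (by rw [abs_neg, abs_of_pos hu0]; exact hu2)
  rw [abs_neg, abs_of_pos hu0, ← sub_eq_add_neg] at h
  rw [Real.norm_eq_abs, Real.norm_of_nonneg (by positivity), geomRate]
  have e : (n : ℝ) * -Real.log (1 - u) - 1 - 1 / 2 * u
      = -((n : ℝ) * (Real.log (1 - u) - (-u - (-u) ^ 2 / 2))) := by
    have : (n : ℝ) * u = 1 := by rw [hu]; field_simp
    linear_combination (1 + u / 2) * this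
  rw [e, abs_neg, abs_mul, abs_of_pos hn0]
  calc (n : ℝ) * |Real.log (1 - u) - (-u - (-u) ^ 2 / 2)| ≤ n * (2 * u ^ 3) :=
        mul_le_mul_of_nonneg_left h hn0.le
    _ = 2 * u ^ 2 * (n * u) := by ring
    _ = 2 * u ^ 2 := by rw [show (n : ℝ) * u = 1 by rw [hu]; field_simp]; ring

theorem hasOneJet_one_add (a : ℝ) : HasOneJet (fun n : ℕ => 1 + a * (1 / (n : ℝ))) a :=
  (Asymptotics.isBigO_zero _ _).congr_left fun n => by ring

theorem negBinomialScale_pos {r : ℝ} (hr : 0 < r) {n : ℕ} (hn : 1 ≤ n) :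
    0 < negBinomialScale r n := by
  have : (1 : ℝ) ≤ n := by exact_mod_cast hn
  unfold negBinomialScale
  have : 0 ≤ r * ((n : ℝ) - 1) := mul_nonneg hr.le (by linarith)
  linarith

theorem min_mul_le_negBinomialScale {r : ℝ} {n : ℕ} (hn : 1 ≤ n) :
    min r 1 * n ≤ negBinomialScale r n := by
  have h : (1 : ℝ) ≤ n := by exact_mod_cast hn
  unfold negBinomialScale
  have h1 := min_le_left r 1
  have h2 := min_le_right r 1
  nlinarith

theorem hasOneJet_scale {r : ℝ} (hr : 0 < r) :
    HasOneJet (fun n => negBinomialScale r n / (r * n)) ((1 - r) / r) := by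
  refine (hasOneJet_one_add _).congr ?_ rfl
  filter_upwards [eventually_ge_atTop 1] with n hn
  have hn0 : (0 : ℝ) < n := by exact_mod_cast hn
  unfold negBinomialScale
  field_simp
  ring

theorem hasOneJet_one_add_geomRate (a : ℝ) : HasOneJet (fun n => 1 + a * geomRate n) a := by
  have h := ((hasOneJet_mul_geomRate.sub_one).mul
    (Asymptotics.isBigO_refl (fun n : ℕ => 1 / (n : ℝ)) atTop)).const_mul_left a
  refine (h.congr_right fun n => by ring).congr' ?_ EventuallyEq.rfl
  filter_upwards [eventually_ge_atTop 1] with n hn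
  have hn0 : (0 : ℝ) < n := by exact_mod_cast hn
  field_simp
  ring

/-- The normalizing factor of the shifted negative binomial mass function. -/
noncomputable def massFactor (r : ℝ) (n : ℕ) : ℝ :=
  (n : ℝ) ^ (-r) / ((1 - 1 / (n : ℝ)) * Real.Gamma r)

theorem massFactor_pos {r : ℝ} (hr : 0 < r) {n : ℕ} (hn : 2 ≤ n) : 0 < massFactor r n := by
  have hn' : (2 : ℝ) ≤ n := by exact_mod_cast hn
  have h : 0 < 1 - 1 / (n : ℝ) := by
    rw [sub_pos, div_lt_one (by linarith)]
    linarith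
  have := Real.Gamma_pos_of_pos hr
  unfold massFactor
  positivity

theorem massFactor_le {r : ℝ} (hr : 0 < r) {n : ℕ} (hn : 2 ≤ n) :
    massFactor r n ≤ 2 / Real.Gamma r * (n : ℝ) ^ (-r) := by
  have hn' : (2 : ℝ) ≤ n := by exact_mod_cast hn
  have h : (1 : ℝ) / 2 ≤ 1 - 1 / (n : ℝ) := by
    have : 1 / (n : ℝ) ≤ 1 / 2 := one_div_le_one_div_of_le (by norm_num) hn'
    linarith
  have hG := Real.Gamma_pos_of_pos hr
  have hp : 0 < (n : ℝ) ^ (-r) := by positivity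
  unfold massFactor
  rw [div_mul_eq_mul_div, div_le_div_iff₀ (mul_pos (by linarith) hG) hG]
  have : Real.Gamma r * (n : ℝ) ^ (-r) * (1 / 2) ≤ Real.Gamma r * (n : ℝ) ^ (-r) * (1 - 1 / n) :=
    mul_le_mul_of_nonneg_left h (by positivity)
  linarith

theorem shiftedNegBinomialMass_eq {r : ℝ} (hr : 0 < r) {n : ℕ} (hn : 2 ≤ n) (k : ℕ) :
    shiftedNegBinomialMass r n (k + 1) = massFactor r n
      * (Real.Gamma ((k : ℝ) + 1 + (r - 1)) / Real.Gamma ((k : ℝ) + 1))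
      * Real.exp (-(geomRate n * ((k : ℝ) + 1))) := by
  have hn' : (2 : ℝ) ≤ n := by exact_mod_cast hn
  have h : 0 < 1 - 1 / (n : ℝ) := by
    rw [sub_pos, div_lt_one (by linarith)]
    linarith
  have e : Real.exp (-(geomRate n * ((k : ℝ) + 1))) = (1 - 1 / (n : ℝ)) ^ (k + 1) := by
    rw [← exp_neg_geomRate hn, ← Real.exp_nat_mul]
    congr 1
    push_cast
    ring
  have hG := Real.Gamma_pos_of_pos hr
  have hG1 : 0 < Real.Gamma ((k : ℝ) + 1) := Real.Gamma_pos_of_pos (by positivity)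
  rw [e, shiftedNegBinomialMass, massFactor, one_div, Real.inv_rpow (by linarith),
    ← Real.rpow_neg (by linarith), Nat.add_sub_cancel, pow_succ]
  rw [one_div] at h
  push_cast
  rw [show (k : ℝ) + 1 + r - 1 = k + 1 + (r - 1) by ring]
  generalize 1 - (n : ℝ)⁻¹ = q at h
  field_simp

/-- `√(r / (β g))`, close to `1`. -/
noncomputable def scaleRatio (r : ℝ) (n : ℕ) : ℝ :=
  Real.sqrt (r / (geomRate n * negBinomialScale r n))

theorem hasOneJet_rate_ratio {r : ℝ} (hr : 0 < r) :
    HasOneJet (fun n => geomRate n / (r / negBinomialScale r n)) ((2 - r) / (2 * r)) := by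
  refine (hasOneJet_mul_geomRate.mul (hasOneJet_scale hr)).congr ?_ ?_
  · filter_upwards [eventually_ge_atTop 1] with n hn
    have hn0 : (0 : ℝ) < n := by exact_mod_cast hn
    have := negBinomialScale_pos hr hn
    field_simp
  · field_simp
    ring

theorem hasOneJet_scaleRatio {r : ℝ} (hr : 0 < r) :
    HasOneJet (scaleRatio r) (-(2 - r) / (4 * r)) := by
  refine ((hasOneJet_rate_ratio hr).rpow (-(1 / 2))).congr ?_ ?_
  · filter_upwards [eventually_ge_atTop 2] with n hn
    have hn0 : (0 : ℝ) < n := by exact_mod_cast (by omega : 0 < n)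
    have h1 := negBinomialScale_pos hr (by omega : 1 ≤ n)
    have h2 : 0 < geomRate n := lt_of_lt_of_le (by positivity) (one_div_le_geomRate hn)
    rw [scaleRatio, Real.sqrt_eq_rpow, Real.rpow_neg (by positivity), ← Real.inv_rpow (by positivity)]
    congr 1
    field_simp
  · field_simp
    ring

theorem hasOneJet_one_sub : HasOneJet (fun n : ℕ => 1 - 1 / (n : ℝ)) (-1) :=
  (hasOneJet_one_add (-1)).congr (Eventually.of_forall fun n => by ring) rfl

theorem hasOneJet_massFactor_gamma {r : ℝ} (hr : 0 < r) :
    HasOneJet (fun n => massFactor r n * (Real.Gamma r * geomRate n ^ (-r))) (1 - r / 2) := by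
  refine ((hasOneJet_mul_geomRate.rpow (-r)).mul (hasOneJet_one_sub.rpow (-1))).congr ?_ (by ring)
  filter_upwards [eventually_ge_atTop 2] with n hn
  have hn0 : (0 : ℝ) < n := by exact_mod_cast (by omega : 0 < n)
  have h2 : 0 < geomRate n := lt_of_lt_of_le (by positivity) (one_div_le_geomRate hn)
  have hG := Real.Gamma_pos_of_pos hr
  rw [Real.mul_rpow hn0.le h2.le, Real.rpow_neg_one, massFactor]
  field_simp

theorem hasOneJet_massFactor_scale {r : ℝ} (hr : 0 < r) :
    HasOneJet (fun n => massFactor r n * (Real.Gamma r * (r / negBinomialScale r n) ^ (-r)))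
      (2 - r) := by
  refine (((hasOneJet_scale hr).rpow r).mul (hasOneJet_one_sub.rpow (-1))).congr ?_ ?_
  · filter_upwards [eventually_ge_atTop 2] with n hn
    have hn0 : (0 : ℝ) < n := by exact_mod_cast (by omega : 0 < n)
    have h1 := negBinomialScale_pos hr (by omega : 1 ≤ n)
    have hG := Real.Gamma_pos_of_pos hr
    have e : (r / negBinomialScale r n) ^ (-r) = (negBinomialScale r n / r) ^ r := by
      rw [Real.rpow_neg (by positivity), ← Real.inv_rpow (by positivity), inv_div]
    rw [e, Real.div_rpow h1.le (by positivity), Real.mul_rpow hr.le hn0.le, Real.rpow_neg_one,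
      massFactor, Real.rpow_neg hn0.le, Real.div_rpow h1.le hr.le]
    field_simp
  · field_simp
    ring

/-- The correction is expressed through `1/g` instead of `1/n`, the variable of the final expansion;
`g/(rn) = 1 + O(1/n)` makes the exchange free. -/
theorem isBigO_scaleRatio_sub {r : ℝ} (hr : 0 < r) :
    (fun n => scaleRatio r n - 1 + (2 - r) / (4 * negBinomialScale r n))
      =O[atTop] fun n : ℕ => (1 / (n : ℝ)) ^ 2 := by
  have h1 := (((hasOneJet_scale hr).rpow (-1)).sub_one.mul
    (Asymptotics.isBigO_refl (fun n : ℕ => 1 / (n : ℝ)) atTop)).const_mul_left ((2 - r) / (4 * r))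
  have h2 := h1.congr_right (g₂ := fun n : ℕ => (1 / (n : ℝ)) ^ 2) fun n => by ring
  refine (Asymptotics.IsBigO.add (hasOneJet_scaleRatio hr) h2).congr' ?_ EventuallyEq.rfl
  filter_upwards [eventually_ge_atTop 2] with n hn
  have hn0 : (0 : ℝ) < n := by exact_mod_cast (by omega : 0 < n)
  have h1 := negBinomialScale_pos hr (by omega : 1 ≤ n)
  rw [Real.rpow_neg_one]
  field_simp
  ring

theorem exists_eventually_abs_le {f g : ℕ → ℝ} (h : f =O[atTop] g) (hg : ∀ n, 0 ≤ g n) :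
    ∃ C : ℝ, 0 < C ∧ ∀ᶠ n in atTop, |f n| ≤ C * g n := by
  obtain ⟨C, hC, hb⟩ := h.exists_pos
  refine ⟨C, hC, hb.bound.mono fun n hn => ?_⟩
  rwa [Real.norm_eq_abs, Real.norm_of_nonneg (hg n)] at hn

/-- The quantitative asymptotics of the parameters of the negative binomial law. -/
theorem exists_parameter_estimates {r : ℝ} (hr : 0 < r) :
    ∃ C : ℝ, 0 < C ∧ ∃ n₀ : ℕ, 2 ≤ n₀ ∧ ∀ n : ℕ, n₀ ≤ n →
      |geomRate n / (r / negBinomialScale r n) - 1| ≤ C * (1 / (n : ℝ)) ∧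
      |geomRate n / (r / negBinomialScale r n) - 1| ≤ 1 / 2 ∧
      |massFactor r n * (Real.Gamma r * (r / negBinomialScale r n) ^ (-r)) - 1|
        ≤ C * (1 / (n : ℝ)) ∧
      |massFactor r n * (Real.Gamma r * geomRate n ^ (-r)) - 1| ≤ C * (1 / (n : ℝ)) ∧
      |massFactor r n * (Real.Gamma r * geomRate n ^ (-r)) * (1 + (r - 2) / 2 * geomRate n) - 1|
        ≤ C * (1 / (n : ℝ)) ^ 2 ∧
      |scaleRatio r n - 1 + (2 - r) / (4 * negBinomialScale r n)| ≤ C * (1 / (n : ℝ)) ^ 2 ∧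
      |scaleRatio r n - 1| ≤ C * (1 / (n : ℝ)) ∧ |scaleRatio r n - 1| ≤ 1 / 2 := by
  have hu : ∀ n : ℕ, 0 ≤ 1 / (n : ℝ) := fun n => by positivity
  have hu2 : ∀ n : ℕ, 0 ≤ (1 / (n : ℝ)) ^ 2 := fun n => by positivity
  have hhalf : ∀ {f : ℕ → ℝ} {a : ℝ}, HasOneJet f a → ∀ᶠ n in atTop, |f n - 1| ≤ 1 / 2 := by
    intro f a hf
    have := hf.tendsto_sub_one.abs
    rw [abs_zero] at this
    exact this.eventually_le_const (by norm_num)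
  -- The jets `1 - r/2` and `(r-2)/2` cancel. The factor `1 + (r-2)β/2` is what the main integral
  -- and the integrated-by-parts secondary integral produce together, so the total mass is correct
  -- up to `O(n⁻²)`.
  have h5 : (fun n => massFactor r n * (Real.Gamma r * geomRate n ^ (-r))
      * (1 + (r - 2) / 2 * geomRate n) - 1) =O[atTop] fun n : ℕ => (1 / (n : ℝ)) ^ 2 := by
    have h := (hasOneJet_massFactor_gamma hr).mul (hasOneJet_one_add_geomRate ((r - 2) / 2))
    exact Asymptotics.IsBigO.congr_left h fun n => by ring
  obtain ⟨C₁, hC₁, e₁⟩ := exists_eventually_abs_le (hasOneJet_rate_ratio hr).sub_one hu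
  obtain ⟨C₃, hC₃, e₃⟩ := exists_eventually_abs_le (hasOneJet_massFactor_scale hr).sub_one hu
  obtain ⟨C₄, hC₄, e₄⟩ := exists_eventually_abs_le (hasOneJet_massFactor_gamma hr).sub_one hu
  obtain ⟨C₅, hC₅, e₅⟩ := exists_eventually_abs_le h5 hu2
  obtain ⟨C₆, hC₆, e₆⟩ := exists_eventually_abs_le (isBigO_scaleRatio_sub hr) hu2
  obtain ⟨C₇, hC₇, e₇⟩ := exists_eventually_abs_le (hasOneJet_scaleRatio hr).sub_one hu
  have hall := (e₁.and (e₃.and (e₄.and (e₅.and (e₆.and e₇))))).and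
    ((hhalf (hasOneJet_rate_ratio hr)).and (hhalf (hasOneJet_scaleRatio hr)))
  obtain ⟨n₀, hn₀⟩ := eventually_atTop.mp hall
  refine ⟨C₁ + C₃ + C₄ + C₅ + C₆ + C₇, by positivity, max n₀ 2, le_max_right _ _, fun n hn => ?_⟩
  obtain ⟨⟨a1, a3, a4, a5, a6, a7⟩, b1, b2⟩ := hn₀ n ((le_max_left _ _).trans hn)
  have hun := hu n
  have hun2 := hu2 n
  have hle : ∀ c : ℝ, c ≤ C₁ + C₃ + C₄ + C₅ + C₆ + C₇ → ∀ z : ℝ, 0 ≤ z →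
      c * z ≤ (C₁ + C₃ + C₄ + C₅ + C₆ + C₇) * z := fun c hc z hz =>
    mul_le_mul_of_nonneg_right hc hz
  exact ⟨a1.trans (hle _ (by linarith) _ hun), b1, a3.trans (hle _ (by linarith) _ hun),
    a4.trans (hle _ (by linarith) _ hun), a5.trans (hle _ (by linarith) _ hun2),
    a6.trans (hle _ (by linarith) _ hun2), a7.trans (hle _ (by linarith) _ hun), b2⟩

/-! ### Termwise expansion of the mixture -/

theorem expPowerSum_nonneg (a b : ℝ) : 0 ≤ expPowerSum a b := tsum_nonneg fun k => by positivity

theorem expPowerSum_mono {a a' b b' : ℝ} (ha : a ≤ a') (hb' : 0 < b') (hb : b' ≤ b) :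
    expPowerSum a b ≤ expPowerSum a' b' := by
  refine Summable.tsum_le_tsum (fun k => ?_) (summable_expPowerSum a (hb'.trans_le hb))
    (summable_expPowerSum a' hb')
  have hk : (0 : ℝ) ≤ k := k.cast_nonneg
  refine mul_le_mul (Real.rpow_le_rpow_of_exponent_le (by linarith) ha)
    (Real.exp_le_exp.mpr ?_) (Real.exp_pos _).le (by positivity)
  have := mul_le_mul_of_nonneg_right hb (by positivity : 0 ≤ (k : ℝ) + 1)
  linarith

/-- The first term alone is `e^(-b) ≥ 1/2`. This allows additive constants to be absorbed into the
error sum. -/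
theorem one_le_two_mul_expPowerSum (a : ℝ) {b : ℝ} (hb0 : 0 < b) (hb : b ≤ 1 / 2) :
    1 ≤ 2 * expPowerSum a b := by
  have h := (summable_expPowerSum a hb0).le_tsum 0 fun k _ => by positivity
  have h1 := Real.add_one_le_exp (-b)
  simp only [Nat.cast_zero, zero_add, Real.one_rpow, one_mul, mul_one] at h
  unfold expPowerSum
  linarith

theorem exists_abs_pow_mul_exp_le (k : ℕ) {c : ℝ} (hc : 0 < c) :
    ∃ C : ℝ, 0 < C ∧ ∀ y : ℝ, |y| ^ k * Real.exp (-(c * y ^ 2)) ≤ C := by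
  refine ⟨1 + (k.factorial : ℝ) / c ^ k, by positivity, fun y => ?_⟩
  have h1 : |y| ^ k ≤ 1 + (y ^ 2) ^ k := by
    rw [← sq_abs, ← pow_mul]
    rcases le_total |y| 1 with h | h
    · have := pow_le_one₀ (n := k) (abs_nonneg y) h
      have : 0 ≤ |y| ^ (2 * k) := by positivity
      linarith
    · have := pow_le_pow_right₀ h (by omega : k ≤ 2 * k)
      linarith
  have h2 : (y ^ 2) ^ k ≤ (k.factorial : ℝ) / c ^ k * Real.exp (c * y ^ 2) := by
    have := Real.pow_div_factorial_le_exp (c * y ^ 2) (by positivity) k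
    rw [mul_pow, div_le_iff₀ (by positivity)] at this
    rw [div_mul_eq_mul_div, le_div_iff₀ (by positivity)]
    linarith
  have h3 : Real.exp (-(c * y ^ 2)) * Real.exp (c * y ^ 2) = 1 := by rw [← Real.exp_add]; simp
  have h4 : Real.exp (-(c * y ^ 2)) ≤ 1 := by
    rw [Real.exp_le_one_iff]
    have : 0 ≤ c * y ^ 2 := by positivity
    linarith
  calc |y| ^ k * Real.exp (-(c * y ^ 2))
      ≤ (1 + (k.factorial : ℝ) / c ^ k * Real.exp (c * y ^ 2)) * Real.exp (-(c * y ^ 2)) :=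
        mul_le_mul_of_nonneg_right (by linarith) (Real.exp_pos _).le
    _ = Real.exp (-(c * y ^ 2))
        + (k.factorial : ℝ) / c ^ k * (Real.exp (-(c * y ^ 2)) * Real.exp (c * y ^ 2)) := by ring
    _ ≤ _ := by rw [h3]; linarith

theorem gaussDensity_le_exp (y : ℝ) : gaussDensity y ≤ Real.exp (-(1 / 2 * y ^ 2)) := by
  have := gaussDensity_le_one 0
  unfold gaussDensity at this ⊢
  norm_num at this
  rw [show -y ^ 2 / 2 = -(1 / 2 * y ^ 2) by ring]
  refine mul_le_of_le_one_left (Real.exp_pos _).le ?_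
  simpa using this

theorem exists_abs_pow_mul_gaussDensity_le (k : ℕ) :
    ∃ C : ℝ, 0 < C ∧ ∀ y : ℝ, |y| ^ k * gaussDensity y ≤ C := by
  obtain ⟨C, hC, h⟩ := exists_abs_pow_mul_exp_le k (c := 1 / 2) (by norm_num)
  exact ⟨C, hC, fun y => (mul_le_mul_of_nonneg_left (gaussDensity_le_exp y) (by positivity)).trans
    (h y)⟩

/-- The second order expansion of the distribution function of the sample median. -/
noncomputable def medianExpansion (κ₁ κ₂ κ₃ m y : ℝ) : ℝ :=
  gaussCDF y + gaussDensity y * (κ₁ * (y * |y|) * m ^ (-(1 / 2) : ℝ)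
    + (3 * y + κ₂ * y ^ 3 - κ₃ * y ^ 5) / 4 * m⁻¹)

theorem exists_abs_correction_le (κ₁ κ₂ κ₃ : ℝ) :
    ∃ B : ℝ, 0 < B ∧ ∀ y : ℝ, |gaussDensity y * (κ₁ * (y * |y|))| ≤ B ∧
      |gaussDensity y * ((3 * y + κ₂ * y ^ 3 - κ₃ * y ^ 5) / 4)| ≤ B := by
  obtain ⟨C₁, hC₁, h₁⟩ := exists_abs_pow_mul_gaussDensity_le 1
  obtain ⟨C₂, hC₂, h₂⟩ := exists_abs_pow_mul_gaussDensity_le 2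
  obtain ⟨C₃, hC₃, h₃⟩ := exists_abs_pow_mul_gaussDensity_le 3
  obtain ⟨C₅, hC₅, h₅⟩ := exists_abs_pow_mul_gaussDensity_le 5
  refine ⟨|κ₁| * C₂ + (3 * C₁ + |κ₂| * C₃ + |κ₃| * C₅), by positivity, fun y => ?_⟩
  have g0 := gaussDensity_pos y
  constructor
  · rw [abs_mul, abs_mul, abs_mul, abs_abs, abs_of_pos g0]
    have := mul_le_mul_of_nonneg_left (h₂ y) (abs_nonneg κ₁)
    have : 0 ≤ 3 * C₁ + |κ₂| * C₃ + |κ₃| * C₅ := by positivity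
    nlinarith
  · rw [abs_mul, abs_of_pos g0, abs_div]
    have e : |3 * y + κ₂ * y ^ 3 - κ₃ * y ^ 5|
        ≤ 3 * |y| ^ 1 + |κ₂| * |y| ^ 3 + |κ₃| * |y| ^ 5 := by
      refine (abs_sub _ _).trans ?_
      refine (add_le_add (abs_add_le _ _) le_rfl).trans (le_of_eq ?_)
      simp only [abs_mul, abs_pow, pow_one]
      norm_num
    have a1 := h₁ y
    have a3 := mul_le_mul_of_nonneg_left (h₃ y) (abs_nonneg κ₂)
    have a5 := mul_le_mul_of_nonneg_left (h₅ y) (abs_nonneg κ₃)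
    have e' := mul_le_mul_of_nonneg_left e g0.le
    have h4 : |(4 : ℝ)| = 4 := by norm_num
    have : 0 ≤ |κ₁| * C₂ := by positivity
    have e0 : 0 ≤ gaussDensity y * |3 * y + κ₂ * y ^ 3 - κ₃ * y ^ 5| := by positivity
    rw [h4, mul_div_assoc']
    refine (div_le_self e0 (by norm_num)).trans ?_
    nlinarith

/-- The sum of `|y_j| ^ (2 κ) * exp (-y_j² / 2)` over the geometric-type weights `j ^ a e^{-b j}`,
where `y_j² = v j`. -/
noncomputable def momentSum (κ a b v : ℝ) : ℝ :=
  ∑' k : ℕ, v ^ κ * (((k : ℝ) + 1) ^ (a + κ) * Real.exp (-((b + v / 2) * ((k : ℝ) + 1))))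

/-- The gamma integral approximating `momentSum`; zero when it diverges uniformly. -/
noncomputable def momentIntegral (κ a b v : ℝ) : ℝ :=
  if -1 < a then v ^ κ * (Real.Gamma (a + κ + 1) * (b + v / 2) ^ (-(a + κ + 1))) else 0

theorem summable_momentSum (κ a : ℝ) {b v : ℝ} (hb : 0 < b) (hv : 0 ≤ v) :
    Summable fun k : ℕ =>
      v ^ κ * (((k : ℝ) + 1) ^ (a + κ) * Real.exp (-((b + v / 2) * ((k : ℝ) + 1)))) :=
  (summable_expPowerSum _ (by positivity)).mul_left _

/-- For `a ≤ -1` the terms are dominated by those of exponent `κ - 1` and rate `v/2`, whose sum is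
of order `v^(-κ)` for small `v` and so cancels `v^κ`. For large `v` the exponential beats `v^κ`. -/
theorem exists_momentSum_le {κ a : ℝ} (hκ : 0 < κ) (ha : a ≤ -1) :
    ∃ C : ℝ, 0 < C ∧ ∀ b v : ℝ, 0 < b → 0 ≤ v → momentSum κ a b v ≤ C := by
  obtain ⟨K, hK, hKb⟩ := exists_rpow_mul_exp_neg_le hκ.le
  obtain ⟨C, hC, hCb⟩ := exists_expPowerSum_le_rpow (a := κ - 1) (by linarith)
  refine ⟨C * 4 ^ κ + K * expPowerSum (κ - 1) (1 / 2) + 1, by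
    have := expPowerSum_nonneg (κ - 1) (1 / 2)
    positivity, fun b v hb hv => ?_⟩
  have hE := expPowerSum_nonneg (κ - 1) (1 / 2)
  rcases hv.eq_or_lt with rfl | hv0
  · unfold momentSum
    simp only [Real.zero_rpow hκ.ne', zero_mul, tsum_zero]
    positivity
  have hle : ∀ k : ℕ, v ^ κ * (((k : ℝ) + 1) ^ (a + κ) * Real.exp (-((b + v / 2) * ((k : ℝ) + 1))))
      ≤ v ^ κ * (((k : ℝ) + 1) ^ (κ - 1) * Real.exp (-((v / 2) * ((k : ℝ) + 1)))) := by
    intro k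
    have hk : (0 : ℝ) ≤ k := k.cast_nonneg
    refine mul_le_mul_of_nonneg_left ?_ (by positivity)
    refine mul_le_mul (Real.rpow_le_rpow_of_exponent_le (by linarith) (by linarith))
      (Real.exp_le_exp.mpr ?_) (Real.exp_pos _).le (by positivity)
    nlinarith [mul_nonneg hb.le (by positivity : 0 ≤ (k : ℝ) + 1)]
  rcases le_total v 2 with h2 | h2
  · have h1 : momentSum κ a b v ≤ v ^ κ * expPowerSum (κ - 1) (v / 2) := by
      rw [expPowerSum, ← tsum_mul_left]
      exact Summable.tsum_le_tsum hle (summable_momentSum κ a hb hv)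
        ((summable_expPowerSum _ (by positivity)).mul_left _)
    have h3 := hCb (v / 2) (by positivity) (by linarith)
    have h4 : v ^ κ * (v / 2) ^ (-(κ - 1 + 1)) = 2 ^ κ := by
      rw [show -(κ - 1 + 1) = -κ by ring, Real.rpow_neg (by positivity),
        Real.div_rpow hv (by norm_num)]
      have : v ^ κ ≠ 0 := (Real.rpow_pos_of_pos hv0 _).ne'
      field_simp
    have h5 : (2 : ℝ) ^ κ ≤ 4 ^ κ := Real.rpow_le_rpow (by norm_num) (by norm_num) hκ.le
    have h6 : v ^ κ * expPowerSum (κ - 1) (v / 2) ≤ C * 2 ^ κ := by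
      rw [← h4]
      have := mul_le_mul_of_nonneg_left h3 (by positivity : 0 ≤ v ^ κ)
      linarith
    have := mul_le_mul_of_nonneg_left h5 hC.le
    have := mul_nonneg hK.le hE
    linarith
  · have h1 : momentSum κ a b v ≤ K * expPowerSum (κ - 1) (1 / 2) := by
      rw [expPowerSum, ← tsum_mul_left]
      refine Summable.tsum_le_tsum (fun k => (hle k).trans ?_) (summable_momentSum κ a hb hv)
        ((summable_expPowerSum _ (by norm_num)).mul_left _)
      have hk : (0 : ℝ) ≤ k := k.cast_nonneg
      have e : Real.exp (-((v / 2) * ((k : ℝ) + 1)))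
          ≤ Real.exp (-(v / 4)) * Real.exp (-(1 / 2 * ((k : ℝ) + 1))) := by
        rw [← Real.exp_add]
        apply Real.exp_le_exp.mpr
        nlinarith
      calc _ ≤ v ^ κ * (((k : ℝ) + 1) ^ (κ - 1)
            * (Real.exp (-(v / 4)) * Real.exp (-(1 / 2 * ((k : ℝ) + 1))))) := by gcongr
        _ = (v ^ κ * Real.exp (-(v / 4))) * (((k : ℝ) + 1) ^ (κ - 1)
            * Real.exp (-(1 / 2 * ((k : ℝ) + 1)))) := by ring
        _ ≤ _ := mul_le_mul_of_nonneg_right (hKb v hv) (by positivity)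
    have : 0 ≤ C * 4 ^ κ := by positivity
    linarith

/-- When `a ≤ -1` the whole sum is bounded uniformly and counts as error, which is why the
approximating integral is declared zero there. -/
theorem exists_abs_momentSum_sub_le {κ : ℝ} (hκ : 0 < κ) (a : ℝ) :
    ∃ C : ℝ, 0 < C ∧ ∀ b v : ℝ, 0 < b → 0 ≤ v →
      |momentSum κ a b v - momentIntegral κ a b v| ≤ C * (expPowerSum (a - 1) (b / 4) + 1) := by
  by_cases ha : -1 < a
  · obtain ⟨C, hC, h⟩ := exists_abs_tsum_rpow_mul_exp_sub_le (κ := κ) (α := a + κ) hκ.le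
      (by linarith)
    refine ⟨C, hC, fun b v hb hv => ?_⟩
    have := (h b v hb hv).2
    rw [show a + κ - 1 - κ = a - 1 by ring] at this
    rw [momentIntegral, if_pos ha]
    exact this
  · obtain ⟨C, hC, h⟩ := exists_momentSum_le hκ (not_lt.mp ha)
    refine ⟨C, hC, fun b v hb hv => ?_⟩
    have h0 : 0 ≤ momentSum κ a b v := tsum_nonneg fun k => by positivity
    rw [momentIntegral, if_neg ha, sub_zero, abs_of_nonneg h0]
    have := expPowerSum_nonneg (a - 1) (b / 4)
    nlinarith [h b v hb hv, mul_nonneg hC.le this]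

/-- The sign of `x`, with value `1` at `0`. -/
noncomputable def signOf (x : ℝ) : ℝ := if 0 ≤ x then 1 else -1

theorem signOf_mul_abs (x : ℝ) : signOf x * |x| = x := by
  unfold signOf
  split_ifs with h
  · rw [abs_of_nonneg h, one_mul]
  · rw [abs_of_neg (not_le.mp h)]; ring

theorem signOf_sq (x : ℝ) : signOf x ^ 2 = 1 := by
  unfold signOf
  split_ifs <;> norm_num

theorem abs_signOf (x : ℝ) : |signOf x| = 1 := by
  unfold signOf
  split_ifs <;> norm_num

/-- The odd functions of `y = √(t/g) x` occurring in the expansion split into the sign of `x` and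
`(vt)^κ` with `v = x²/g ≥ 0`. All corrections thereby become moment sums with `κ = 1/2, 1, 3/2,
5/2`. -/
theorem odd_powers_sqrt_mul {g t : ℝ} (hg : 0 < g) (ht : 0 < t) (x : ℝ) :
    Real.sqrt (t / g) * x = signOf x * ((x ^ 2 / g) ^ (1 / 2 : ℝ) * t ^ (1 / 2 : ℝ)) ∧
    Real.sqrt (t / g) * x * |Real.sqrt (t / g) * x|
      = signOf x * ((x ^ 2 / g) ^ (1 : ℝ) * t ^ (1 : ℝ)) ∧
    (Real.sqrt (t / g) * x) ^ 3
      = signOf x * ((x ^ 2 / g) ^ (3 / 2 : ℝ) * t ^ (3 / 2 : ℝ)) ∧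
    (Real.sqrt (t / g) * x) ^ 5
      = signOf x * ((x ^ 2 / g) ^ (5 / 2 : ℝ) * t ^ (5 / 2 : ℝ)) := by
  set z : ℝ := Real.sqrt (t / g) * |x| with hz
  have hz0 : 0 ≤ z := by positivity
  have hzz : z ^ 2 = x ^ 2 / g * t := by
    rw [hz, mul_pow, Real.sq_sqrt (by positivity), sq_abs]
    field_simp
  have hy : Real.sqrt (t / g) * x = signOf x * z := by
    rw [hz]
    nth_rw 1 [← signOf_mul_abs x]
    ring
  have hp : ∀ k : ℕ, (x ^ 2 / g) ^ ((k : ℝ) / 2) * t ^ ((k : ℝ) / 2) = z ^ k := by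
    intro k
    rw [← Real.mul_rpow (by positivity) ht.le, ← hzz, ← Real.rpow_natCast z 2,
      ← Real.rpow_mul hz0]
    rw [show ((2 : ℕ) : ℝ) * ((k : ℝ) / 2) = k by push_cast; ring, Real.rpow_natCast]
  have s2 := signOf_sq x
  have p1 := hp 1
  have p2 := hp 2
  have p3 := hp 3
  have p5 := hp 5
  norm_num at p1 p2 p3 p5
  rw [hy, abs_mul, abs_signOf, abs_of_nonneg hz0]
  refine ⟨?_, ?_, ?_, ?_⟩
  · rw [p1]
  · rw [Real.rpow_one, Real.rpow_one, p2]; ring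
  · rw [p3]
    linear_combination (signOf x * z ^ 3) * s2
  · rw [p5]
    linear_combination (signOf x * z ^ 5) * (signOf x ^ 2 + 1) * s2

/-- Product of two expansions in powers of `τ = j ^ (-1/2)`. -/
theorem abs_mul_expansion_sub_le {c C K B τ ε η Φ a₁ a₂ : ℝ} (hC : 0 ≤ C)
    (hτ0 : 0 ≤ τ) (hτ1 : τ ≤ 1) (hε : |ε| ≤ C * τ ^ 4) (hη : |η| ≤ K * τ ^ 3)
    (hΦ : |Φ| ≤ 1) (h₁ : |a₁| ≤ B) (h₂ : |a₂| ≤ B) :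
    |(1 + c * τ ^ 2 + ε) * (Φ + a₁ * τ + a₂ * τ ^ 2 + η)
      - (Φ + c * τ ^ 2 * Φ + a₁ * τ + a₂ * τ ^ 2)|
      ≤ ((1 + |c| + C) * K + C * (1 + 2 * B) + 2 * |c| * B) * τ ^ 3 := by
  have hτ2 : τ ^ 2 ≤ 1 := pow_le_one₀ hτ0 hτ1
  have hτ4 : τ ^ 4 ≤ τ ^ 3 := pow_le_pow_of_le_one hτ0 hτ1 (by norm_num)
  have hτ4' : τ ^ 4 ≤ 1 := pow_le_one₀ hτ0 hτ1
  have hτ3 : 0 ≤ τ ^ 3 := by positivity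
  have e : (1 + c * τ ^ 2 + ε) * (Φ + a₁ * τ + a₂ * τ ^ 2 + η)
      - (Φ + c * τ ^ 2 * Φ + a₁ * τ + a₂ * τ ^ 2)
      = (1 + c * τ ^ 2 + ε) * η + ε * (Φ + a₁ * τ + a₂ * τ ^ 2)
        + c * τ ^ 3 * (a₁ + a₂ * τ) := by ring
  rw [e]
  have b1 : |(1 + c * τ ^ 2 + ε) * η| ≤ (1 + |c| + C) * (K * τ ^ 3) := by
    rw [abs_mul]
    refine mul_le_mul ?_ hη (abs_nonneg _) (by positivity)
    refine (abs_add_le _ _).trans (add_le_add ((abs_add_le _ _).trans ?_) (hε.trans ?_))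
    · rw [abs_one, abs_mul, abs_of_nonneg (by positivity : 0 ≤ τ ^ 2)]
      have := mul_le_mul_of_nonneg_left hτ2 (abs_nonneg c)
      linarith
    · exact mul_le_of_le_one_right hC hτ4'
  have h₁τ : |a₁ * τ| ≤ B := by
    rw [abs_mul, abs_of_nonneg hτ0]
    exact (mul_le_of_le_one_right (abs_nonneg _) hτ1).trans h₁
  have h₂τ : |a₂ * τ ^ 2| ≤ B := by
    rw [abs_mul, abs_of_nonneg (by positivity : 0 ≤ τ ^ 2)]
    exact (mul_le_of_le_one_right (abs_nonneg _) hτ2).trans h₂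
  have h₂τ' : |a₂ * τ| ≤ B := by
    rw [abs_mul, abs_of_nonneg hτ0]
    exact (mul_le_of_le_one_right (abs_nonneg _) hτ1).trans h₂
  have b2 : |ε * (Φ + a₁ * τ + a₂ * τ ^ 2)| ≤ (C * τ ^ 3) * (1 + 2 * B) := by
    rw [abs_mul]
    refine mul_le_mul (hε.trans (mul_le_mul_of_nonneg_left hτ4 hC)) ?_ (abs_nonneg _) (by positivity)
    refine (abs_add_le _ _).trans ((add_le_add (abs_add_le _ _) le_rfl).trans ?_)
    linarith
  have b3 : |c * τ ^ 3 * (a₁ + a₂ * τ)| ≤ |c| * τ ^ 3 * (2 * B) := by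
    rw [abs_mul, abs_mul, abs_of_nonneg hτ3]
    refine mul_le_mul_of_nonneg_left ?_ (by positivity)
    refine (abs_add_le _ _).trans ?_
    linarith
  refine (abs_add_le _ _).trans ((add_le_add (abs_add_le _ _) le_rfl).trans ?_)
  linarith

/-- The secondary integral coming from the two-term asymptotics of the Gamma ratio. -/
noncomputable def secondaryIntegral (r b g x : ℝ) : ℝ :=
  if 1 < r then (r - 1) * (r - 1 - 1) / 2
    * ∫ t in Set.Ioi 0, t ^ (r - 2) * Real.exp (-(b * t)) * gaussCDF (Real.sqrt (t / g) * x)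
  else 0

/-- For `r < 1` the sum is bounded and counts as error, for `r = 1` its coefficient vanishes, and
for `r > 1` the weight `t^(r-2)` is integrable at `0` and the sum is compared with its integral. -/
theorem exists_abs_secondary_sub_le {r : ℝ} (hr : 0 < r) :
    ∃ C : ℝ, 0 < C ∧ ∀ b g x : ℝ, 0 < b → 0 < g →
      (Summable fun k : ℕ => ((k : ℝ) + 1) ^ (r - 2) * Real.exp (-(b * ((k : ℝ) + 1)))
        * gaussCDF (Real.sqrt (((k : ℝ) + 1) / g) * x)) ∧
      |(r - 1) * (r - 1 - 1) / 2 * ∑' k : ℕ, ((k : ℝ) + 1) ^ (r - 2)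
          * Real.exp (-(b * ((k : ℝ) + 1))) * gaussCDF (Real.sqrt (((k : ℝ) + 1) / g) * x)
        - secondaryIntegral r b g x| ≤ C * (expPowerSum (r - 3) (b / 4) + 1) := by
  have hsummable : ∀ b g x : ℝ, 0 < b → 0 < g →
      Summable fun k : ℕ => ((k : ℝ) + 1) ^ (r - 2) * Real.exp (-(b * ((k : ℝ) + 1)))
        * gaussCDF (Real.sqrt (((k : ℝ) + 1) / g) * x) := by
    intro b g x hb hg
    refine Summable.of_nonneg_of_le (fun k => ?_) (fun k => ?_) (summable_expPowerSum (r - 2) hb)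
    · have := gaussCDF_nonneg (Real.sqrt (((k : ℝ) + 1) / g) * x)
      positivity
    · exact mul_le_of_le_one_right (by positivity) (gaussCDF_le_one _)
  rcases lt_trichotomy r 1 with h | h | h
  · obtain ⟨C, hC, hb⟩ := exists_expPowerSum_le_const (a := r - 2) (by linarith)
    refine ⟨|(r - 1) * (r - 1 - 1) / 2| * C + 1, by positivity, fun b g x hb0 hg => 
      ⟨hsummable b g x hb0 hg, ?_⟩⟩
    rw [secondaryIntegral, if_neg (by linarith), sub_zero, abs_mul]
    have h1 : |∑' k : ℕ, ((k : ℝ) + 1) ^ (r - 2) * Real.exp (-(b * ((k : ℝ) + 1)))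
        * gaussCDF (Real.sqrt (((k : ℝ) + 1) / g) * x)| ≤ C := by
      rw [abs_of_nonneg (tsum_nonneg fun k => by
        have := gaussCDF_nonneg (Real.sqrt (((k : ℝ) + 1) / g) * x)
        positivity)]
      refine le_trans (Summable.tsum_le_tsum (fun k => ?_) (hsummable b g x hb0 hg)
        (summable_expPowerSum (r - 2) hb0)) (hb b hb0)
      exact mul_le_of_le_one_right (by positivity) (gaussCDF_le_one _)
    have h2 := mul_le_mul_of_nonneg_left h1 (abs_nonneg ((r - 1) * (r - 1 - 1) / 2))
    have h3 := expPowerSum_nonneg (r - 3) (b / 4)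
    have h4 : 0 ≤ |(r - 1) * (r - 1 - 1) / 2| * C := by positivity
    nlinarith
  · subst h
    refine ⟨1, one_pos, fun b g x hb0 hg => ⟨hsummable b g x hb0 hg, ?_⟩⟩
    rw [secondaryIntegral, if_neg (by linarith)]
    norm_num
    have h3 := expPowerSum_nonneg (-2) (b / 4)
    linarith
  · obtain ⟨C, hC, hb⟩ := exists_abs_tsum_gaussCDF_sub_le (α := r - 2) (by linarith)
    refine ⟨|(r - 1) * (r - 1 - 1) / 2| * C + 1, by positivity, fun b g x hb0 hg => 
      ⟨hsummable b g x hb0 hg, ?_⟩⟩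
    have h1 := (hb b g x hb0 hg).2.2.1
    rw [show r - 2 - 1 = r - 3 by ring] at h1
    rw [secondaryIntegral, if_pos h, ← mul_sub, abs_mul]
    have h2 := mul_le_mul_of_nonneg_left h1 (abs_nonneg ((r - 1) * (r - 1 - 1) / 2))
    have h3 := expPowerSum_nonneg (r - 3) (b / 4)
    linarith

/-- Two sources of error: the term at `j` is expanded up to relative order `j^(-3/2)`, and each
resulting sum is replaced by an integral with an error of exponent at most `r - 5/2`. Both are
controlled by the same sum at rate `1/(4n)`, since `β ≥ 1/n`. -/
theorem exists_abs_tsum_mass_mul_sub_le {r : ℝ} (hr : 0 < r) (κ₁ κ₂ κ₃ : ℝ) {K : ℝ} (hK : 0 ≤ K) :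
    ∃ C : ℝ, 0 < C ∧ ∀ n : ℕ, 2 ≤ n → ∀ F : ℕ → ℝ → ℝ,
      (∀ k : ℕ, ∀ y, |F k y - medianExpansion κ₁ κ₂ κ₃ ((k : ℝ) + 1) y|
        ≤ K * ((k : ℝ) + 1) ^ (-(3 / 2) : ℝ)) → ∀ x g b v : ℝ, 0 < g → b = geomRate n →
      v = x ^ 2 / g →
      |∑' k : ℕ, shiftedNegBinomialMass r n (k + 1) * F k (Real.sqrt (((k : ℝ) + 1) / g) * x)
        - massFactor r n *
          ((∫ t in Set.Ioi 0, t ^ (r - 1) * Real.exp (-(b * t)) * gaussCDF (Real.sqrt (t / g) * x))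
            + secondaryIntegral r b g x
            + (Real.sqrt (2 * Real.pi))⁻¹ * signOf x * (κ₁ * momentIntegral 1 (r - 3 / 2) b v
              + (3 * momentIntegral (1 / 2) (r - 2) b v + κ₂ * momentIntegral (3 / 2) (r - 2) b v
                - κ₃ * momentIntegral (5 / 2) (r - 2) b v) / 4))|
        ≤ C * ((n : ℝ) ^ (-r) * expPowerSum (r - 5 / 2) (1 / 4 / n)) := by
  obtain ⟨Cρ, hCρ, hρ⟩ := exists_abs_Gamma_ratio_sub_le (s := r - 1) (by linarith)
  obtain ⟨B, hB, hBb⟩ := exists_abs_correction_le κ₁ κ₂ κ₃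
  obtain ⟨C₀, hC₀, h₀⟩ := exists_abs_tsum_gaussCDF_sub_le (α := r - 1) (by linarith)
  obtain ⟨Cₛ, hCₛ, hₛ⟩ := exists_abs_secondary_sub_le hr
  obtain ⟨M₁, hM₁, m₁⟩ := exists_abs_momentSum_sub_le (κ := 1) one_pos (r - 3 / 2)
  obtain ⟨M₂, hM₂, m₂⟩ := exists_abs_momentSum_sub_le (κ := 1 / 2) (by norm_num) (r - 2)
  obtain ⟨M₃, hM₃, m₃⟩ := exists_abs_momentSum_sub_le (κ := 3 / 2) (by norm_num) (r - 2)
  obtain ⟨M₅, hM₅, m₅⟩ := exists_abs_momentSum_sub_le (κ := 5 / 2) (by norm_num) (r - 2)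
  set c : ℝ := (r - 1) * (r - 1 - 1) / 2 with hc
  set φ₀ : ℝ := (Real.sqrt (2 * Real.pi))⁻¹ with hφ₀
  have hφ₀0 : 0 < φ₀ := by positivity
  set Q := (1 + |c| + Cρ) * K + Cρ * (1 + 2 * B) + 2 * |c| * B with hQ
  have hQ0 : 0 ≤ Q := by positivity
  set R := C₀ + Cₛ + φ₀ * (|κ₁| * M₁ + (3 * M₂ + |κ₂| * M₃ + |κ₃| * M₅)) with hR
  have hR0 : 0 < R := by positivity
  have hG := Real.Gamma_pos_of_pos hr
  refine ⟨2 / Real.Gamma r * (Q + R * 3), by positivity, ?_⟩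
  intro n hn F hF x g b v hg hbn hv
  have hn' : (2 : ℝ) ≤ n := by exact_mod_cast hn
  have hb : 0 < b := by
    rw [hbn]
    exact lt_of_lt_of_le (by positivity) (one_div_le_geomRate hn)
  have hb1 : 1 / (n : ℝ) ≤ b := hbn ▸ one_div_le_geomRate hn
  have hv0 : 0 ≤ v := by rw [hv]; positivity
  set D := massFactor r n with hD
  have hD0 : 0 < D := massFactor_pos hr hn
  set E := expPowerSum (r - 5 / 2) (1 / 4 / n) with hE
  have hE0 : 0 ≤ E := expPowerSum_nonneg _ _
  have hE1 : 1 ≤ 2 * E := by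
    refine one_le_two_mul_expPowerSum _ (by positivity) ?_
    rw [div_le_iff₀ (by linarith)]
    linarith
  have hEb : ∀ a, a ≤ r - 5 / 2 → expPowerSum a (b / 4) + 1 ≤ 3 * E := by
    intro a ha
    have := expPowerSum_mono (b := b / 4) ha (by positivity : 0 < 1 / 4 / (n : ℝ)) (by
      rw [div_div, ← one_div_mul_one_div]
      linarith)
    linarith
  have hEb' : expPowerSum (r - 5 / 2) b ≤ E := by
    refine expPowerSum_mono le_rfl (by positivity) ?_
    rw [div_div, ← one_div_mul_one_div]
    have : 0 < 1 / (n : ℝ) := by positivity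
    linarith
  set y : ℕ → ℝ := fun k => Real.sqrt (((k : ℝ) + 1) / g) * x with hy
  set mS : ℝ → ℝ → ℕ → ℝ := fun κ a k =>
    v ^ κ * (((k : ℝ) + 1) ^ (a + κ) * Real.exp (-((b + v / 2) * ((k : ℝ) + 1)))) with hmS
  set s₀ : ℕ → ℝ := fun k =>
    ((k : ℝ) + 1) ^ (r - 1) * Real.exp (-(b * ((k : ℝ) + 1))) * gaussCDF (y k) with hs₀
  set sₛ : ℕ → ℝ := fun k =>
    ((k : ℝ) + 1) ^ (r - 2) * Real.exp (-(b * ((k : ℝ) + 1))) * gaussCDF (y k) with hsₛ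
  -- The product of the two expansions kept through order `1/j`: the normal term, the `c/j` term of
  -- the Gamma ratio, and the two corrections of the median.
  set G : ℕ → ℝ := fun k => s₀ k + c * sₛ k + φ₀ * signOf x * (κ₁ * mS 1 (r - 3 / 2) k
      + (3 * mS (1 / 2) (r - 2) k + κ₂ * mS (3 / 2) (r - 2) k - κ₃ * mS (5 / 2) (r - 2) k) / 4)
    with hGdef
  obtain ⟨-, hsum₀, -, h₀'⟩ := h₀ b g x hb hg
  obtain ⟨hsumₛ, hₛ'⟩ := hₛ b g x hb hg
  have hsm : ∀ κ a, Summable (mS κ a) := fun κ a => summable_momentSum κ a hb hv0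
  have hsG : Summable G := by
    refine (hsum₀.add (hsumₛ.mul_left c)).add (Summable.mul_left _ ?_)
    exact ((hsm _ _).mul_left κ₁).add (((((hsm _ _).mul_left 3).add
      ((hsm _ _).mul_left κ₂)).sub ((hsm _ _).mul_left κ₃)).div_const 4)
  have htG : ∑' k, G k = ∑' k, s₀ k + c * ∑' k, sₛ k
      + φ₀ * signOf x * (κ₁ * momentSum 1 (r - 3 / 2) b v
      + (3 * momentSum (1 / 2) (r - 2) b v + κ₂ * momentSum (3 / 2) (r - 2) b v
        - κ₃ * momentSum (5 / 2) (r - 2) b v) / 4) := by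
    have h1 := (hsum₀.hasSum.add (hsumₛ.hasSum.mul_left c)).add
      ((((hsm 1 (r - 3 / 2)).hasSum.mul_left κ₁).add
        ((((((hsm (1 / 2) (r - 2)).hasSum.mul_left 3).add
        ((hsm (3 / 2) (r - 2)).hasSum.mul_left κ₂)).sub
        ((hsm (5 / 2) (r - 2)).hasSum.mul_left κ₃)).div_const 4))).mul_left (φ₀ * signOf x))
    exact h1.tsum_eq
  have hpoint : ∀ k : ℕ, |shiftedNegBinomialMass r n (k + 1) * F k (y k) - D * G k|
      ≤ D * Q * (((k : ℝ) + 1) ^ (r - 5 / 2) * Real.exp (-(b * ((k : ℝ) + 1)))) := by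
    intro k
    have hk : (0 : ℝ) ≤ k := k.cast_nonneg
    set t : ℝ := (k : ℝ) + 1 with ht
    have ht0 : 0 < t := by positivity
    have ht1 : 1 ≤ t := by linarith
    -- In powers of `τ = j^(-1/2)` the Gamma ratio has remainder `τ⁴` and the median expansion has
    -- remainder `τ³`.
    set τ : ℝ := t ^ (-(1 / 2) : ℝ) with hτ
    have hτ0 : 0 < τ := by positivity
    have hτ1 : τ ≤ 1 := Real.rpow_le_one_of_one_le_of_nonpos ht1 (by norm_num)
    have hτp : ∀ m : ℕ, τ ^ m = t ^ (-(m : ℝ) / 2) := by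
      intro m
      rw [hτ, ← Real.rpow_natCast, ← Real.rpow_mul ht0.le]
      congr 1
      ring
    have hτ2 : τ ^ 2 = t⁻¹ := by
      rw [hτp, ← Real.rpow_neg_one]; norm_num
    have hτ3 : τ ^ 3 = t ^ (-(3 / 2) : ℝ) := by rw [hτp]; norm_num
    have hpow : ∀ a : ℝ, ∀ m : ℕ, a = r - 1 - m / 2 → t ^ a = t ^ (r - 1) * τ ^ m := by
      intro a m ha
      rw [hτp, ← Real.rpow_add ht0, ha]
      congr 1
      ring
    set e := Real.exp (-(b * t)) with he
    have he0 : 0 < e := Real.exp_pos _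
    set ρ := Real.Gamma (t + (r - 1)) / Real.Gamma t with hρdef
    set ε := ρ / t ^ (r - 1) - (1 + c * τ ^ 2) with hε
    have hεb : |ε| ≤ Cρ * τ ^ 4 := by
      have := hρ (k + 1) (by omega)
      push_cast at this
      rw [hε, hτ2, hρdef, div_div]
      rw [show τ ^ 4 = (1 / t) ^ 2 by rw [one_div, ← hτ2]; ring]
      rwa [← div_eq_mul_inv]
    have hρe : ρ = t ^ (r - 1) * (1 + c * τ ^ 2 + ε) := by
      rw [hε]
      have : t ^ (r - 1) ≠ 0 := (Real.rpow_pos_of_pos ht0 _).ne'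
      field_simp
      ring
    obtain ⟨a1b, a2b⟩ := hBb (y k)
    set a₁ := gaussDensity (y k) * (κ₁ * (y k * |y k|)) with ha₁
    set a₂ := gaussDensity (y k) * ((3 * y k + κ₂ * y k ^ 3 - κ₃ * y k ^ 5) / 4) with ha₂
    set η := F k (y k) - (gaussCDF (y k) + a₁ * τ + a₂ * τ ^ 2) with hη
    have hηb : |η| ≤ K * τ ^ 3 := by
      have := hF k (y k)
      rw [hτ3]
      convert this using 2
      rw [hη, medianExpansion, ha₁, ha₂, hτ2, hτ]
      ring
    have hFe : F k (y k) = gaussCDF (y k) + a₁ * τ + a₂ * τ ^ 2 + η := by rw [hη]; ring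
    have hGe : G k = t ^ (r - 1) * e
        * (gaussCDF (y k) + c * τ ^ 2 * gaussCDF (y k) + a₁ * τ + a₂ * τ ^ 2) := by
      obtain ⟨o1, o2, o3, o5⟩ := odd_powers_sqrt_mul hg ht0 x
      have hm : ∀ κ a, mS κ a k = e * Real.exp (-(v / 2 * t)) * (t ^ a * (v ^ κ * t ^ κ)) := by
        intro κ a
        simp only [hmS]
        rw [Real.rpow_add ht0, he, ← Real.exp_add,
          show -((b + v / 2) * t) = -(b * t) + -(v / 2 * t) by ring]
        ring
      have hφ : gaussDensity (y k) = φ₀ * Real.exp (-(v / 2 * t)) := by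
        simp only [hy]
        rw [gaussDensity_mul_sqrt x ht0.le hg, hv]
        congr 3
        field_simp
      rw [← hv] at o1 o2 o3 o5
      have e1 : y k = signOf x * (v ^ (1 / 2 : ℝ) * t ^ (1 / 2 : ℝ)) := o1
      have e2 : y k * |y k| = signOf x * (v ^ (1 : ℝ) * t ^ (1 : ℝ)) := o2
      have e3 : y k ^ 3 = signOf x * (v ^ (3 / 2 : ℝ) * t ^ (3 / 2 : ℝ)) := o3
      have e5 : y k ^ 5 = signOf x * (v ^ (5 / 2 : ℝ) * t ^ (5 / 2 : ℝ)) := o5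
      have p2 := hpow (r - 2) 2 (by push_cast; ring)
      have p1 := hpow (r - 3 / 2) 1 (by push_cast; ring)
      simp only [hGdef, hs₀, hsₛ]
      have q₁ : a₁ = φ₀ * Real.exp (-(v / 2 * t))
          * (κ₁ * (signOf x * (v ^ (1 : ℝ) * t ^ (1 : ℝ)))) := by rw [ha₁, hφ, e2]
      have q₂ : a₂ = φ₀ * Real.exp (-(v / 2 * t))
          * ((3 * (signOf x * (v ^ (1 / 2 : ℝ) * t ^ (1 / 2 : ℝ)))
            + κ₂ * (signOf x * (v ^ (3 / 2 : ℝ) * t ^ (3 / 2 : ℝ)))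
            - κ₃ * (signOf x * (v ^ (5 / 2 : ℝ) * t ^ (5 / 2 : ℝ)))) / 4) := by
        rw [ha₂, hφ, e3, e5, ← e1]
      rw [hm, hm, hm, hm, q₁, q₂, p2, p1]
      ring
    have hmass : shiftedNegBinomialMass r n (k + 1) = D * (t ^ (r - 1) * (1 + c * τ ^ 2 + ε)) * e := by
      rw [shiftedNegBinomialMass_eq hr hn, ← hρe, hbn.symm]
    rw [hmass, hFe, hGe, hpow (r - 5 / 2) 3 (by push_cast; ring)]
    have hfin := abs_mul_expansion_sub_le (c := c) hCρ.le hτ0.le hτ1 hεb hηb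
      (by rw [abs_of_nonneg (gaussCDF_nonneg _)]; exact gaussCDF_le_one (y k)) a1b a2b
    have ht' : 0 < t ^ (r - 1) := by positivity
    calc _ = D * t ^ (r - 1) * e * |(1 + c * τ ^ 2 + ε) * (gaussCDF (y k) + a₁ * τ + a₂ * τ ^ 2 + η)
          - (gaussCDF (y k) + c * τ ^ 2 * gaussCDF (y k) + a₁ * τ + a₂ * τ ^ 2)| := by
          have hP : 0 < D * t ^ (r - 1) * e := by positivity
          conv_rhs => rw [← abs_of_pos hP, ← abs_mul]
          congr 1
          ring
      _ ≤ D * t ^ (r - 1) * e * (Q * τ ^ 3) := mul_le_mul_of_nonneg_left hfin (by positivity)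
      _ = _ := by ring
  have hsE := summable_expPowerSum (r - 5 / 2) hb
  have hsdiff : Summable fun k => shiftedNegBinomialMass r n (k + 1) * F k (y k) - D * G k :=
    Summable.of_norm_bounded (hsE.mul_left (D * Q)) hpoint
  have hsF : Summable fun k => shiftedNegBinomialMass r n (k + 1) * F k (y k) := by
    have := hsdiff.add (hsG.mul_left D)
    exact this.congr fun k => by ring
  have h1 : |∑' k, shiftedNegBinomialMass r n (k + 1) * F k (y k) - D * ∑' k, G k|
      ≤ D * Q * E := by
    rw [← tsum_mul_left, ← hsF.tsum_sub (hsG.mul_left D)]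
    have := tsum_of_norm_bounded
      (f := fun k => shiftedNegBinomialMass r n (k + 1) * F k (y k) - D * G k)
      (hsE.mul_left (D * Q)).hasSum hpoint
    rw [Real.norm_eq_abs] at this
    refine this.trans ?_
    rw [tsum_mul_left]
    exact mul_le_mul_of_nonneg_left hEb' (by positivity)
  have h2 : |∑' k, G k - ((∫ t in Set.Ioi 0, t ^ (r - 1) * Real.exp (-(b * t))
            * gaussCDF (Real.sqrt (t / g) * x))
            + secondaryIntegral r b g x
            + φ₀ * signOf x * (κ₁ * momentIntegral 1 (r - 3 / 2) b v
              + (3 * momentIntegral (1 / 2) (r - 2) b v + κ₂ * momentIntegral (3 / 2) (r - 2) b v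
                - κ₃ * momentIntegral (5 / 2) (r - 2) b v) / 4))| ≤ R * (3 * E) := by
    have d0 : |∑' k, s₀ k - ∫ t in Set.Ioi 0, t ^ (r - 1) * Real.exp (-(b * t))
            * gaussCDF (Real.sqrt (t / g) * x)| ≤ C₀ * (3 * E) :=
      h₀'.trans (mul_le_mul_of_nonneg_left (hEb _ (by linarith)) hC₀.le)
    have d1 : |c * ∑' k, sₛ k - secondaryIntegral r b g x| ≤ Cₛ * (3 * E) :=
      hₛ'.trans (mul_le_mul_of_nonneg_left (hEb _ (by linarith)) hCₛ.le)
    have d2 := (m₁ b v hb hv0).trans (mul_le_mul_of_nonneg_left (hEb _ (by linarith)) hM₁.le)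
    have d3 := (m₂ b v hb hv0).trans (mul_le_mul_of_nonneg_left (hEb _ (by linarith)) hM₂.le)
    have d4 := (m₃ b v hb hv0).trans (mul_le_mul_of_nonneg_left (hEb _ (by linarith)) hM₃.le)
    have d5 := (m₅ b v hb hv0).trans (mul_le_mul_of_nonneg_left (hEb _ (by linarith)) hM₅.le)
    rw [htG]
    set δ₁ := momentSum 1 (r - 3 / 2) b v - momentIntegral 1 (r - 3 / 2) b v
    set δ₂ := momentSum (1 / 2) (r - 2) b v - momentIntegral (1 / 2) (r - 2) b v
    set δ₃ := momentSum (3 / 2) (r - 2) b v - momentIntegral (3 / 2) (r - 2) b v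
    set δ₅ := momentSum (5 / 2) (r - 2) b v - momentIntegral (5 / 2) (r - 2) b v
    have hδ : |φ₀ * signOf x * (κ₁ * δ₁ + (3 * δ₂ + κ₂ * δ₃ - κ₃ * δ₅) / 4)|
        ≤ φ₀ * (|κ₁| * M₁ + (3 * M₂ + |κ₂| * M₃ + |κ₃| * M₅)) * (3 * E) := by
      rw [abs_mul, abs_mul, abs_signOf, abs_of_pos hφ₀0, mul_one, mul_assoc φ₀]
      refine mul_le_mul_of_nonneg_left ?_ hφ₀0.le
      have t1 : |κ₁ * δ₁| ≤ |κ₁| * (M₁ * (3 * E)) := by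
        rw [abs_mul]; exact mul_le_mul_of_nonneg_left d2 (abs_nonneg _)
      have t3 : |κ₂ * δ₃| ≤ |κ₂| * (M₃ * (3 * E)) := by
        rw [abs_mul]; exact mul_le_mul_of_nonneg_left d4 (abs_nonneg _)
      have t5 : |κ₃ * δ₅| ≤ |κ₃| * (M₅ * (3 * E)) := by
        rw [abs_mul]; exact mul_le_mul_of_nonneg_left d5 (abs_nonneg _)
      have t6 : |(3 * δ₂ + κ₂ * δ₃ - κ₃ * δ₅) / 4|
          ≤ 3 * (M₂ * (3 * E)) + |κ₂| * (M₃ * (3 * E)) + |κ₃| * (M₅ * (3 * E)) := by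
        rw [abs_div, show |(4 : ℝ)| = 4 by norm_num]
        refine (div_le_self (abs_nonneg _) (by norm_num)).trans ?_
        refine (abs_sub _ _).trans (add_le_add ((abs_add_le _ _).trans (add_le_add ?_ t3)) t5)
        rw [abs_mul, show |(3 : ℝ)| = 3 by norm_num]
        linarith
      refine (abs_add_le _ _).trans ?_
      linarith
    calc _ = |(∑' k, s₀ k - ∫ t in Set.Ioi 0, t ^ (r - 1) * Real.exp (-(b * t))
            * gaussCDF (Real.sqrt (t / g) * x)) + (c * ∑' k, sₛ k - secondaryIntegral r b g x)
            + φ₀ * signOf x * (κ₁ * δ₁ + (3 * δ₂ + κ₂ * δ₃ - κ₃ * δ₅) / 4)| := by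
          congr 1
          ring
      _ ≤ C₀ * (3 * E) + Cₛ * (3 * E)
          + φ₀ * (|κ₁| * M₁ + (3 * M₂ + |κ₂| * M₃ + |κ₃| * M₅)) * (3 * E) :=
          (abs_add_le _ _).trans (add_le_add ((abs_add_le _ _).trans (add_le_add d0 d1)) hδ)
      _ = _ := by rw [hR]; ring
  have h3 := mul_le_mul_of_nonneg_left h2 hD0.le
  rw [← abs_of_pos hD0, ← abs_mul, abs_of_pos hD0, mul_sub] at h3
  have h4 := (abs_sub_le _ _ _).trans (add_le_add h1 h3)
  refine h4.trans ?_
  have h5 : D * (Q * E + R * (3 * E))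
      ≤ 2 / Real.Gamma r * (n : ℝ) ^ (-r) * (Q * E + R * (3 * E)) :=
    mul_le_mul_of_nonneg_right (massFactor_le hr hn) (by positivity)
  calc _ = D * (Q * E + R * (3 * E)) := by ring
    _ ≤ _ := h5
    _ = _ := by ring

/-! ### Evaluation of the gamma integrals -/

theorem integral_rpow_mul_exp_mul_gaussDensity {r b g x v : ℝ} (hr : 1 < r) (hb : 0 < b)
    (hg : 0 < g) (hv : v = x ^ 2 / g) :
    IntegrableOn (fun t => t ^ (r - 1) * Real.exp (-(b * t))
      * (gaussDensity (Real.sqrt (t / g) * x) * (Real.sqrt (t / g) * x / (2 * t)))) (Set.Ioi 0) ∧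
    ∫ t in Set.Ioi 0, t ^ (r - 1) * Real.exp (-(b * t))
      * (gaussDensity (Real.sqrt (t / g) * x) * (Real.sqrt (t / g) * x / (2 * t)))
      = (Real.sqrt (2 * Real.pi))⁻¹ * signOf x / 2 * momentIntegral (1 / 2) (r - 2) b v := by
  have hv0 : 0 ≤ v := by rw [hv]; positivity
  have hγ : 0 < b + v / 2 := by positivity
  have h : Set.EqOn (fun t => t ^ (r - 1) * Real.exp (-(b * t))
      * (gaussDensity (Real.sqrt (t / g) * x) * (Real.sqrt (t / g) * x / (2 * t))))
      (fun t => (Real.sqrt (2 * Real.pi))⁻¹ * signOf x / 2 * v ^ (1 / 2 : ℝ)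
        * (t ^ ((r - 1 / 2) - 1) * Real.exp (-((b + v / 2) * t)))) (Set.Ioi 0) := by
    intro t ht
    have ht0 : (0 : ℝ) < t := ht
    have o1 := (odd_powers_sqrt_mul hg ht0 x).1
    simp only
    rw [gaussDensity_mul_sqrt x ht0.le hg, o1, ← hv,
      show x ^ 2 / (2 * g) = v / 2 by rw [hv]; field_simp,
      show -((b + v / 2) * t) = -(b * t) + -(v / 2 * t) by ring, Real.exp_add,
      show r - 1 / 2 - 1 = (r - 1) + 1 / 2 + -1 by ring, Real.rpow_add ht0, Real.rpow_add ht0,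
      Real.rpow_neg_one]
    field_simp
  constructor
  · rw [integrableOn_congr_fun h measurableSet_Ioi]
    exact (integrableOn_rpow_mul_exp (by linarith) hγ).const_mul _
  · rw [setIntegral_congr_fun measurableSet_Ioi h, integral_const_mul,
      Real.integral_rpow_mul_exp_neg_mul_Ioi (by linarith) hγ, momentIntegral, if_pos (by linarith),
      one_div (b + v / 2), Real.inv_rpow hγ.le, ← Real.rpow_neg hγ.le,
      show r - 2 + 1 / 2 + 1 = r - 1 / 2 by ring]
    ring

/-- Integration by parts for the secondary integral. -/
theorem secondaryIntegral_eq {r b g x v : ℝ} (hr : 1 < r) (hb : 0 < b) (hg : 0 < g)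
    (hv : v = x ^ 2 / g) :
    secondaryIntegral r b g x = (r - 2) / 2 * (b * (∫ t in Set.Ioi 0, t ^ (r - 1)
        * Real.exp (-(b * t)) * gaussCDF (Real.sqrt (t / g) * x))
      - (Real.sqrt (2 * Real.pi))⁻¹ * signOf x / 2 * momentIntegral (1 / 2) (r - 2) b v) := by
  obtain ⟨C₁, -, h₁⟩ := exists_abs_tsum_gaussCDF_sub_le (α := r - 1) (by linarith)
  obtain ⟨C₂, -, h₂⟩ := exists_abs_tsum_gaussCDF_sub_le (α := r - 2) (by linarith)
  have i₁ := (h₁ b g x hb hg).1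
  have i₂ := (h₂ b g x hb hg).1
  obtain ⟨i₃, v₃⟩ := integral_rpow_mul_exp_mul_gaussDensity (x := x) hr hb hg hv
  set f : ℝ → ℝ := fun t => t ^ (r - 1) * Real.exp (-(b * t)) * gaussCDF (Real.sqrt (t / g) * x)
    with hf
  set f₂ : ℝ → ℝ := fun t => t ^ (r - 2) * Real.exp (-(b * t)) * gaussCDF (Real.sqrt (t / g) * x)
    with hf₂
  set f₃ : ℝ → ℝ := fun t => t ^ (r - 1) * Real.exp (-(b * t))
      * (gaussDensity (Real.sqrt (t / g) * x) * (Real.sqrt (t / g) * x / (2 * t))) with hf₃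
  have hder : ∀ t ∈ Set.Ioi (0 : ℝ), HasDerivAt f ((r - 1) * f₂ t - b * f t + f₃ t) t := by
    intro t ht
    have ht0 : (0 : ℝ) < t := ht
    refine ((hasDerivAt_rpow_mul_exp (r - 1) b ht0).mul
      (hasDerivAt_gaussCDF_sqrt hg ht0 x)).congr_deriv ?_
    simp only [hf, hf₂, hf₃]
    have e : t ^ (r - 2) = t ^ (r - 1) / t := by
      rw [show r - 2 = r - 1 - 1 by ring, Real.rpow_sub_one ht0.ne']
    rw [e]
    generalize t ^ (r - 1) = z
    ring
  have hcont : Continuous f := by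
    have := continuous_gaussCDF
    have h1 : Continuous fun t : ℝ => t ^ (r - 1) := Real.continuous_rpow_const (by linarith)
    fun_prop
  have hlim : Tendsto f atTop (𝓝 0) := by
    have h1 := tendsto_rpow_mul_exp_neg_mul_atTop_nhds_zero (r - 1) b hb
    refine squeeze_zero' ?_ ?_ h1
    · filter_upwards [eventually_gt_atTop 0] with t ht
      have := gaussCDF_nonneg (Real.sqrt (t / g) * x)
      simp only [hf]
      positivity
    · filter_upwards [eventually_gt_atTop 0] with t ht
      simp only [hf, neg_mul]
      exact mul_le_of_le_one_right (by positivity) (gaussCDF_le_one _)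
  have i₁₂ : IntegrableOn (fun t => (r - 1) * f₂ t - b * f t) (Set.Ioi 0) :=
    (i₂.const_mul _).sub (i₁.const_mul _)
  have hint : IntegrableOn (fun t => (r - 1) * f₂ t - b * f t + f₃ t) (Set.Ioi 0) := i₁₂.add i₃
  -- No boundary terms: the exponent `r - 1` is positive, so the product vanishes at `0`, and the
  -- exponential kills it at infinity.
  have key := integral_Ioi_of_hasDerivAt_of_tendsto hcont.continuousWithinAt hder hint hlim
  have hf0 : f 0 = 0 := by
    simp only [hf]
    rw [Real.zero_rpow (by linarith)]
    ring
  rw [integral_add i₁₂ i₃,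
    integral_sub (i₂.const_mul _) (i₁.const_mul _), integral_const_mul, integral_const_mul, v₃,
    hf0] at key
  rw [secondaryIntegral, if_pos hr]
  linear_combination ((r - 2) / 2) * key

/-- The leading approximation of `massFactor * momentIntegral`. -/
noncomputable def leadingMoment (r κ a g x : ℝ) : ℝ :=
  Real.Gamma (a + κ + 1) / Real.Gamma r * r ^ (r - a - κ - 1) * g ^ (a + 1 - r)
    * (x ^ 2) ^ κ * (1 + x ^ 2 / (2 * r)) ^ (-(a + κ + 1))

theorem leadingMoment_nonneg {r κ a g : ℝ} (hr : 0 < r) (hg : 0 < g) (h : 0 < a + κ + 1) (x : ℝ) :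
    0 ≤ leadingMoment r κ a g x := by
  have := Real.Gamma_pos_of_pos hr
  have := Real.Gamma_pos_of_pos h
  unfold leadingMoment
  positivity

/-- Uniformity in `x`: with `W = 1 + x²/(2r)` one has `x² ≤ 2rW`, and the power `W^(-(a+1))` left
over is at most `1` because `a > -1`. -/
theorem leadingMoment_le {r κ a g : ℝ} (hr : 0 < r) (hg : 0 < g) (hκ : 0 ≤ κ) (ha : -1 < a)
    (x : ℝ) :
    leadingMoment r κ a g x ≤ Real.Gamma (a + κ + 1) / Real.Gamma r * r ^ (r - a - κ - 1)
      * (2 * r) ^ κ * g ^ (a + 1 - r) := by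
  have h1 := Real.Gamma_pos_of_pos hr
  have h2 := Real.Gamma_pos_of_pos (show 0 < a + κ + 1 by linarith)
  set W := 1 + x ^ 2 / (2 * r) with hW
  have hW1 : 1 ≤ W := by
    have : 0 ≤ x ^ 2 / (2 * r) := by positivity
    linarith
  have hx : x ^ 2 ≤ 2 * r * W := by
    rw [hW]
    have : 2 * r * (1 + x ^ 2 / (2 * r)) = 2 * r + x ^ 2 := by field_simp
    linarith
  have e1 : (x ^ 2) ^ κ * W ^ (-(a + κ + 1)) ≤ (2 * r) ^ κ := by
    calc (x ^ 2) ^ κ * W ^ (-(a + κ + 1)) ≤ (2 * r * W) ^ κ * W ^ (-(a + κ + 1)) :=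
          mul_le_mul_of_nonneg_right (Real.rpow_le_rpow (by positivity) hx hκ) (by positivity)
      _ = (2 * r) ^ κ * W ^ (-(a + 1)) := by
          rw [Real.mul_rpow (by positivity) (by positivity), mul_assoc,
            ← Real.rpow_add (by positivity)]
          congr 2
          ring
      _ ≤ (2 * r) ^ κ := mul_le_of_le_one_right (by positivity)
          (Real.rpow_le_one_of_one_le_of_nonpos hW1 (by linarith))
  unfold leadingMoment
  rw [← hW]
  calc _ = Real.Gamma (a + κ + 1) / Real.Gamma r * r ^ (r - a - κ - 1) * g ^ (a + 1 - r)
        * ((x ^ 2) ^ κ * W ^ (-(a + κ + 1))) := by ring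
    _ ≤ Real.Gamma (a + κ + 1) / Real.Gamma r * r ^ (r - a - κ - 1) * g ^ (a + 1 - r)
        * (2 * r) ^ κ := mul_le_mul_of_nonneg_left e1 (by positivity)
    _ = _ := by ring

/-- The rate `b` is replaced by `r/g` and the prefactor by its limit, each with relative error
`O(u)`; the parameter `u` is later `1/n`. -/
theorem exists_abs_massFactor_momentIntegral_sub_le {r : ℝ} (hr : 0 < r) {κ a : ℝ} (ha : -1 < a)
    (hκ : 0 ≤ κ) (C₀ : ℝ) (hC₀ : 0 < C₀) :
    ∃ C : ℝ, 0 < C ∧ ∀ (D b g x v u : ℝ), 0 < b → 0 < g → v = x ^ 2 / g →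
      0 ≤ u → u ≤ 1 → |b / (r / g) - 1| ≤ C₀ * u → |b / (r / g) - 1| ≤ 1 / 2 →
      |D * (Real.Gamma r * (r / g) ^ (-r)) - 1| ≤ C₀ * u →
      |D * momentIntegral κ a b v - leadingMoment r κ a g x| ≤ C * u * g ^ (a + 1 - r) := by
  set p := -(a + κ + 1) with hp
  set A := |p| * 2 ^ |p - 1| with hA
  have h1 := Real.Gamma_pos_of_pos hr
  have h2 := Real.Gamma_pos_of_pos (show 0 < a + κ + 1 by linarith)
  set B := Real.Gamma (a + κ + 1) / Real.Gamma r * r ^ (r - a - κ - 1) * (2 * r) ^ κ with hB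
  have hB0 : 0 < B := by positivity
  refine ⟨(A * C₀ + C₀ * (1 + A * C₀)) * B, by positivity, ?_⟩
  intro D b g x v u hb hg hv hu0 hu1 hb1 hb2 hD
  have hv0 : 0 ≤ v := by rw [hv]; positivity
  set γ₀ := r / g + v / 2 with hγ₀
  have hrg : 0 < r / g := by positivity
  have hγ₀0 : 0 < γ₀ := by positivity
  have hγ : 0 < b + v / 2 := by positivity
  set h := (b + v / 2) / γ₀ - 1 with hh
  -- Adding the same `v/2 ≥ 0` to both rates can only reduce their relative difference, so the
  -- estimate does not depend on `x`.
  have hhb : |h| ≤ |b / (r / g) - 1| := by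
    have e1 : h = (b - r / g) / γ₀ := by
      rw [hh, div_sub_one hγ₀0.ne', hγ₀]
      congr 1
      ring
    rw [e1, div_sub_one hrg.ne', abs_div, abs_div, abs_of_pos hγ₀0, abs_of_pos hrg]
    refine div_le_div_of_nonneg_left (abs_nonneg _) hrg ?_
    rw [hγ₀]
    linarith
  have hpow := abs_one_add_rpow_sub_one_le p (hhb.trans hb2)
  set q := (1 + h) ^ p - 1 with hq
  have hqb : |q| ≤ A * C₀ * u := by
    refine hpow.trans ?_
    rw [mul_assoc A]
    exact mul_le_mul_of_nonneg_left (hhb.trans hb1) (by positivity)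
  set d := D * (Real.Gamma r * (r / g) ^ (-r)) - 1 with hd
  have hgam : (b + v / 2) ^ p = γ₀ ^ p * (1 + q) := by
    rw [hq, hh, add_sub_cancel, add_sub_cancel, ← Real.mul_rpow hγ₀0.le (by positivity)]
    congr 1
    field_simp
  have hDe : D = (r / g) ^ r / Real.Gamma r * (1 + d) := by
    rw [hd, Real.rpow_neg hrg.le]
    have : (r / g) ^ r ≠ 0 := (Real.rpow_pos_of_pos hrg _).ne'
    field_simp
    ring
  have hlead : leadingMoment r κ a g x
      = (r / g) ^ r / Real.Gamma r * (v ^ κ * (Real.Gamma (a + κ + 1) * γ₀ ^ p)) := by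
    have e2 : γ₀ = r / g * (1 + x ^ 2 / (2 * r)) := by
      rw [hγ₀, hv]
      field_simp
    have e3 : (r / g) ^ r * (r / g) ^ p = r ^ (r - a - κ - 1) * g ^ (a + 1 - r) * g ^ κ := by
      rw [← Real.rpow_add hrg, Real.div_rpow hr.le hg.le, mul_assoc, ← Real.rpow_add hg,
        div_eq_mul_inv, ← Real.rpow_neg hg.le]
      congr 2 <;> rw [hp] <;> ring
    rw [e2, Real.mul_rpow hrg.le (by positivity), hv, Real.div_rpow (x := x ^ 2) (by positivity) hg.le,
      leadingMoment]
    have : g ^ κ ≠ 0 := (Real.rpow_pos_of_pos hg _).ne'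
    rw [← hp]
    calc _ = Real.Gamma (a + κ + 1) / Real.Gamma r * (r ^ (r - a - κ - 1) * g ^ (a + 1 - r) * g ^ κ)
          / g ^ κ * (x ^ 2) ^ κ * (1 + x ^ 2 / (2 * r)) ^ p := by field_simp
      _ = _ := by
          rw [← e3]
          generalize (r / g) ^ r = z₁
          generalize (r / g) ^ p = z₂
          ring
  have hdiff : D * momentIntegral κ a b v - leadingMoment r κ a g x
      = leadingMoment r κ a g x * (q + d * (1 + q)) := by
    rw [momentIntegral, if_pos ha, ← hp, hgam, hlead, hDe]
    ring
  have hL0 := leadingMoment_nonneg hr hg (show 0 < a + κ + 1 by linarith) x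
  have hL1 := leadingMoment_le hr hg hκ ha x
  rw [hdiff, abs_mul, abs_of_nonneg hL0]
  have hqd : |q + d * (1 + q)| ≤ (A * C₀ + C₀ * (1 + A * C₀)) * u := by
    have h5 : |1 + q| ≤ 1 + A * C₀ := by
      refine (abs_add_le _ _).trans ?_
      rw [abs_one]
      have : A * C₀ * u ≤ A * C₀ := mul_le_of_le_one_right (by positivity) hu1
      linarith
    have h6 : |d * (1 + q)| ≤ C₀ * u * (1 + A * C₀) := by
      rw [abs_mul]
      exact mul_le_mul hD h5 (abs_nonneg _) (by positivity)
    refine (abs_add_le _ _).trans ?_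
    linarith
  calc _ ≤ (B * g ^ (a + 1 - r)) * ((A * C₀ + C₀ * (1 + A * C₀)) * u) :=
        mul_le_mul hL1 hqd (abs_nonneg _) (by positivity)
    _ = _ := by ring

theorem studentDensity_two_mul {r : ℝ} (hr : 0 < r) (x : ℝ) :
    studentDensity (2 * r) x = (Real.sqrt (2 * Real.pi))⁻¹ * (Real.Gamma (r + 1 / 2) / Real.Gamma r
      * r ^ (-(1 / 2) : ℝ)) * (1 + x ^ 2 / (2 * r)) ^ (-(r + 1 / 2)) := by
  unfold studentDensity
  rw [show 2 * r / 2 = r by ring, show (2 * r + 1) / 2 = r + 1 / 2 by ring,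
    show -(2 * r + 1) / 2 = -(r + 1 / 2) by ring, show 2 * r * Real.pi = r * (2 * Real.pi) by ring,
    Real.sqrt_mul hr.le, Real.rpow_neg hr.le, ← Real.sqrt_eq_rpow]
  field_simp

theorem sq_rpow_half (x : ℝ) (k : ℕ) : (x ^ 2) ^ ((k : ℝ) / 2) = |x| ^ k := by
  rw [← sq_abs, ← Real.rpow_natCast |x| 2, ← Real.rpow_mul (abs_nonneg x)]
  rw [show ((2 : ℕ) : ℝ) * ((k : ℝ) / 2) = k by push_cast; ring, Real.rpow_natCast]

/-- The shape `a + κ + 1` is `r + 1/2` up to an integer shift, so the functional equation of Gamma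
reduces each moment to the Student density. A shift by `-1` leaves the factor `(2r+x²)/(2r-1)`, a
shift by `+1` leaves `(2r+1)/(2r+x²)`. -/
theorem leadingMoment_values {r g : ℝ} (hr : 0 < r) (hg : 0 < g) (x : ℝ) :
    (Real.sqrt (2 * Real.pi))⁻¹ * signOf x * leadingMoment r 1 (r - 3 / 2) g x
      = x * |x| * studentDensity (2 * r) x * g ^ (-(1 / 2) : ℝ) ∧
    (1 < r → (Real.sqrt (2 * Real.pi))⁻¹ * signOf x * leadingMoment r (1 / 2) (r - 2) g x
      = x * studentDensity (2 * r) x * ((2 * r + x ^ 2) / (2 * r - 1)) * g⁻¹) ∧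
    (Real.sqrt (2 * Real.pi))⁻¹ * signOf x * leadingMoment r (3 / 2) (r - 2) g x
      = x ^ 3 * studentDensity (2 * r) x * g⁻¹ ∧
    (Real.sqrt (2 * Real.pi))⁻¹ * signOf x * leadingMoment r (5 / 2) (r - 2) g x
      = x ^ 5 * studentDensity (2 * r) x * ((2 * r + 1) / (2 * r + x ^ 2)) * g⁻¹ := by
  have hG := Real.Gamma_pos_of_pos hr
  have hW : 0 < 1 + x ^ 2 / (2 * r) := by positivity
  have s1 := signOf_mul_abs x
  have s2 := signOf_sq x
  have p1 := sq_rpow_half x 1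
  have p3 := sq_rpow_half x 3
  have p5 := sq_rpow_half x 5
  norm_num at p1 p3 p5
  have hxs : ∀ m : ℕ, x ^ m = signOf x ^ m * |x| ^ m := fun m => by rw [← mul_pow, s1]
  rw [studentDensity_two_mul hr]
  set φ₀ := (Real.sqrt (2 * Real.pi))⁻¹
  set W := 1 + x ^ 2 / (2 * r) with hWd
  unfold leadingMoment
  rw [← hWd]
  refine ⟨?_, fun hr1 => ?_, ?_, ?_⟩
  · rw [show r - 3 / 2 + 1 + 1 = r + 1 / 2 by ring, show r - (r - 3 / 2) - 1 - 1 = -(1 / 2) by ring,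
      show r - 3 / 2 + 1 - r = -(1 / 2) by ring, Real.rpow_one, ← sq_abs x]
    linear_combination (φ₀ * (Real.Gamma (r + 1 / 2) / Real.Gamma r) * r ^ (-(1 / 2) : ℝ)
      * g ^ (-(1 / 2) : ℝ) * |x| * W ^ (-(r + 1 / 2))) * s1
  · rw [show r - 2 + 1 / 2 + 1 = r - 1 / 2 by ring, show r - (r - 2) - 1 / 2 - 1 = -(1 / 2) + 1 by ring,
      show r - 2 + 1 - r = -1 by ring, Real.rpow_neg_one, p1,
      show r + 1 / 2 = (r - 1 / 2) + 1 by ring, Real.Gamma_add_one (by linarith),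
      show -(r - 1 / 2) = -(r - 1 / 2 + 1) + 1 by ring, Real.rpow_add hW, Real.rpow_add hr,
      Real.rpow_one, Real.rpow_one]
    have e : 2 * r + x ^ 2 = 2 * r * W := by rw [hWd]; field_simp
    rw [e]
    have : r - 1 / 2 ≠ 0 := by linarith
    have : r * 2 - 1 ≠ 0 := by linarith
    rw [show 2 * r * W / (2 * r - 1) = r * W / (r - 1 / 2) by
      rw [show 2 * r - 1 = 2 * (r - 1 / 2) by ring]; field_simp]
    have h3 : W ^ (-(r - 1 / 2 + 1)) ≠ 0 := (Real.rpow_pos_of_pos hW _).ne'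
    clear_value W
    generalize |x| = X at s1 ⊢
    generalize signOf x = σ at s1 ⊢
    rw [← s1]
    field_simp
  · rw [show r - 2 + 3 / 2 + 1 = r + 1 / 2 by ring, show r - (r - 2) - 3 / 2 - 1 = -(1 / 2) by ring,
      show r - 2 + 1 - r = -1 by ring, Real.rpow_neg_one, p3, hxs 3]
    linear_combination (-(φ₀ * signOf x * (Real.Gamma (r + 1 / 2) / Real.Gamma r
      * r ^ (-(1 / 2) : ℝ) * g⁻¹ * |x| ^ 3 * W ^ (-(r + 1 / 2))))) * s2
  · rw [show r - 2 + 5 / 2 + 1 = r + 1 / 2 + 1 by ring,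
      show r - (r - 2) - 5 / 2 - 1 = -(1 / 2) - 1 by ring,
      show r - 2 + 1 - r = -1 by ring, Real.rpow_neg_one, p5, hxs 5, Real.Gamma_add_one (by linarith),
      show -(r + 1 / 2 + 1) = -(r + 1 / 2) - 1 by ring, Real.rpow_sub_one hW.ne',
      Real.rpow_sub_one hr.ne']
    have e : 2 * r + x ^ 2 = 2 * r * W := by rw [hWd]; field_simp
    rw [e]
    have s5 : signOf x ^ 5 = signOf x := by
      linear_combination (signOf x ^ 3 + signOf x) * s2
    rw [s5]
    field_simp

/-! ### Assembly of the Student expansion -/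

theorem exists_abs_mul_studentDensity_le {r : ℝ} (hr : 0 < r) :
    ∃ C : ℝ, 0 < C ∧ ∀ x : ℝ, |x * studentDensity (2 * r) x| ≤ C := by
  have hG := Real.Gamma_pos_of_pos hr
  have hG' := Real.Gamma_pos_of_pos (show 0 < r + 1 / 2 by linarith)
  set K := (Real.sqrt (2 * Real.pi))⁻¹ * (Real.Gamma (r + 1 / 2) / Real.Gamma r
      * r ^ (-(1 / 2) : ℝ)) with hK
  have hK0 : 0 < K := by positivity
  refine ⟨K * (2 * r) ^ (1 / 2 : ℝ), by positivity, fun x => ?_⟩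
  have hW : 1 ≤ 1 + x ^ 2 / (2 * r) := by
    have : 0 ≤ x ^ 2 / (2 * r) := by positivity
    linarith
  rw [abs_mul, abs_of_nonneg (studentDensity_nonneg (by linarith) x), studentDensity_two_mul hr, ← hK]
  set W := 1 + x ^ 2 / (2 * r) with hWd
  have e : 2 * r + x ^ 2 = 2 * r * W := by rw [hWd]; field_simp
  have p1 := sq_rpow_half x 1
  norm_num at p1
  have h1 : |x| ≤ (2 * r) ^ (1 / 2 : ℝ) * W ^ (1 / 2 : ℝ) := by
    rw [← p1, ← Real.mul_rpow (by positivity) (by positivity), ← e]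
    exact Real.rpow_le_rpow (by positivity) (by linarith) (by norm_num)
  calc |x| * (K * W ^ (-(r + 1 / 2)))
      ≤ ((2 * r) ^ (1 / 2 : ℝ) * W ^ (1 / 2 : ℝ)) * (K * W ^ (-(r + 1 / 2))) :=
        mul_le_mul_of_nonneg_right h1 (by positivity)
    _ = K * (2 * r) ^ (1 / 2 : ℝ) * W ^ (-r) := by
        rw [show W ^ (-r) = W ^ (1 / 2 : ℝ) * W ^ (-(r + 1 / 2)) by
          rw [← Real.rpow_add (by positivity)]; congr 1; ring]
        ring
    _ ≤ _ := mul_le_of_le_one_right (by positivity)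
        (Real.rpow_le_one_of_one_le_of_nonpos hW (by linarith))

theorem hasDerivAt_studentDensity {r : ℝ} (hr : 0 < r) (x : ℝ) :
    HasDerivAt (studentDensity (2 * r)) (-((2 * r + 1) * x / (2 * r + x ^ 2))
      * studentDensity (2 * r) x) x := by
  unfold studentDensity
  have hW : 0 < 1 + x ^ 2 / (2 * r) := by positivity
  have h1 : HasDerivAt (fun x : ℝ => 1 + x ^ 2 / (2 * r)) (2 * x / (2 * r)) x := by
    have := ((hasDerivAt_pow 2 x).div_const (2 * r)).const_add 1
    exact this.congr_deriv (by simp)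
  refine ((h1.rpow_const (p := -(2 * r + 1) / 2) (Or.inl hW.ne')).const_mul _).congr_deriv ?_
  rw [Real.rpow_sub_one hW.ne']
  have e : 2 * r + x ^ 2 = 2 * r * (1 + x ^ 2 / (2 * r)) := by field_simp
  rw [e]
  generalize (1 + x ^ 2 / (2 * r)) = W at hW
  field_simp

/-- A Taylor expansion in the scale `l` at `1`. With `u = sx` the second derivative is `-s⁻² (2r+1)
u²/(2r+u²)` times `u` times the Student density at `u`, bounded uniformly in `x`. -/
theorem exists_abs_studentCDF_scale_sub_le {r : ℝ} (hr : 0 < r) :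
    ∃ C : ℝ, 0 < C ∧ ∀ x l : ℝ, |l - 1| ≤ 1 / 2 →
      |studentCDF (2 * r) (l * x) - studentCDF (2 * r) x - x * studentDensity (2 * r) x * (l - 1)|
        ≤ C * (l - 1) ^ 2 := by
  obtain ⟨C, hC, hb⟩ := exists_abs_mul_studentDensity_le hr
  refine ⟨4 * (2 * r + 1) * C, by positivity, fun x l hl => ?_⟩
  have hmem : ∀ s ∈ Set.uIcc 1 l, |s - 1| ≤ |l - 1| := fun s hs => by
    have : s - 1 ∈ Set.uIcc 0 (l - 1) := by
      have := Set.mem_image_of_mem (fun z => z - 1) hs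
      rw [Set.image_sub_const_uIcc, sub_self] at this
      exact this
    exact abs_le_of_mem_uIcc_zero this
  have hder1 : ∀ s : ℝ, HasDerivAt (fun s => x * studentDensity (2 * r) (s * x))
      (x * (-((2 * r + 1) * (s * x) / (2 * r + (s * x) ^ 2)) * studentDensity (2 * r) (s * x)
        * x)) s := fun s => by
    have := (hasDerivAt_studentDensity hr (s * x)).comp s ((hasDerivAt_id s).mul_const x)
    exact (this.const_mul x).congr_deriv (by simp)
  have hbound1 : ∀ s : ℝ, 1 / 2 ≤ s → |x * (-((2 * r + 1) * (s * x) / (2 * r + (s * x) ^ 2))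
      * studentDensity (2 * r) (s * x) * x)| ≤ 4 * (2 * r + 1) * C := by
    intro s hs
    have hs0 : 0 < s := by linarith
    set u := s * x with hu
    have e : x * (-((2 * r + 1) * u / (2 * r + u ^ 2)) * studentDensity (2 * r) u * x)
        = -((1 / s ^ 2) * ((2 * r + 1) * (u ^ 2 / (2 * r + u ^ 2)))
          * (u * studentDensity (2 * r) u)) := by
      have : x = u / s := by rw [hu]; field_simp
      rw [this]
      field_simp
    rw [e, abs_neg, abs_mul]
    refine mul_le_mul ?_ (hb u) (abs_nonneg _) (by positivity)
    rw [abs_of_nonneg (by positivity)]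
    have h1 : u ^ 2 / (2 * r + u ^ 2) ≤ 1 := by
      rw [div_le_one (by positivity)]
      linarith
    have h2 : 1 / s ^ 2 ≤ 4 := by
      rw [div_le_iff₀ (by positivity)]
      nlinarith
    exact mul_le_mul h2 (mul_le_of_le_one_right (by positivity) h1) (by positivity) (by norm_num)
  have hlip : ∀ s ∈ Set.uIcc 1 l, |x * studentDensity (2 * r) (s * x)
      - x * studentDensity (2 * r) x| ≤ 4 * (2 * r + 1) * C * |l - 1| := by
    intro s hs
    have := Convex.norm_image_sub_le_of_norm_hasDerivWithin_le
      (f := fun s => x * studentDensity (2 * r) (s * x))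
      (s := Set.uIcc 1 l) (x := 1) (y := s) (fun z _ => (hder1 z).hasDerivWithinAt) (fun z hz => by
        rw [Real.norm_eq_abs]
        exact hbound1 z (by linarith [(abs_le.mp ((hmem z hz).trans hl)).1]))
      (convex_uIcc 1 l) Set.left_mem_uIcc hs
    simp only [Real.norm_eq_abs, one_mul] at this
    exact this.trans (mul_le_mul_of_nonneg_left (hmem s hs) (by positivity))
  have hder0 : ∀ s : ℝ, HasDerivAt
      (fun s => studentCDF (2 * r) (s * x) - x * studentDensity (2 * r) x * s)
      (x * studentDensity (2 * r) (s * x) - x * studentDensity (2 * r) x) s := fun s => by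
    have h1 := (hasDerivAt_studentCDF hr (s * x)).comp s ((hasDerivAt_id s).mul_const x)
    have h2 := (hasDerivAt_id s).const_mul (x * studentDensity (2 * r) x)
    exact (h1.sub h2).congr_deriv (by ring)
  have := Convex.norm_image_sub_le_of_norm_hasDerivWithin_le
    (f := fun s => studentCDF (2 * r) (s * x) - x * studentDensity (2 * r) x * s)
    (s := Set.uIcc 1 l) (x := 1) (y := l) (fun z _ => (hder0 z).hasDerivWithinAt)
    (fun z hz => by rw [Real.norm_eq_abs]; exact hlip z hz)
    (convex_uIcc 1 l) Set.left_mem_uIcc Set.right_mem_uIcc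
  simp only [Real.norm_eq_abs, one_mul, mul_one] at this
  calc _ = |studentCDF (2 * r) (l * x) - x * studentDensity (2 * r) x * l
        - (studentCDF (2 * r) x - x * studentDensity (2 * r) x)| := by congr 1; ring
    _ ≤ _ := this
    _ = _ := by rw [mul_assoc _ |l - 1|, abs_mul_abs_self, pow_two]

theorem rpow_neg_three_halves_le_rate (r : ℝ) {n : ℕ} (hn : 2 ≤ n) :
    (n : ℝ) ^ (-(3 / 2) : ℝ) ≤ 2 * approximationRate r n := by
  have hn1 : (1 : ℝ) ≤ n := by exact_mod_cast (by omega : 1 ≤ n)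
  have h0 : 0 ≤ (n : ℝ) ^ (-(3 / 2) : ℝ) := by positivity
  unfold approximationRate
  split_ifs with h
  · have : Real.log 2 ≤ Real.log n := Real.log_le_log (by norm_num) (by exact_mod_cast hn)
    nlinarith [Real.log_two_gt_d9]
  · have : (n : ℝ) ^ (-(3 / 2) : ℝ) ≤ (n : ℝ) ^ (-min r (3 / 2)) :=
      Real.rpow_le_rpow_of_exponent_le hn1 (neg_le_neg (min_le_right _ _))
    linarith [Real.rpow_nonneg (by linarith : (0 : ℝ) ≤ n) (-min r (3 / 2))]

/-- For `r ≤ 1` all effects of order `1/n` are below the rate, so no second-order term is needed. -/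
theorem one_div_le_rate {r : ℝ} (hr : r ≤ 1) {n : ℕ} (hn : 2 ≤ n) :
    1 / (n : ℝ) ≤ approximationRate r n := by
  have hn1 : (1 : ℝ) ≤ n := by exact_mod_cast (by omega : 1 ≤ n)
  unfold approximationRate
  rw [if_neg (by linarith), one_div, ← Real.rpow_neg_one]
  exact Real.rpow_le_rpow_of_exponent_le hn1 (neg_le_neg ((min_le_left _ _).trans hr))

/-- The moment has size `g^(a+1-r)` and relative error `1/n`, in total `n^(a-r)`; the condition `a +
3/2 ≤ r` is exactly what brings this below `n^(-3/2)`. -/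
theorem exists_abs_scaled_moment_sub_le {r : ℝ} (hr : 0 < r) {κ a : ℝ} (ha : -1 < a) (hκ : 0 ≤ κ)
    (har : a + 3 / 2 ≤ r) :
    ∃ C : ℝ, 0 < C ∧ ∃ n₀ : ℕ, 2 ≤ n₀ ∧ ∀ n : ℕ, n₀ ≤ n → ∀ x : ℝ,
      |massFactor r n * momentIntegral κ a (geomRate n) (x ^ 2 / negBinomialScale r n)
        - leadingMoment r κ a (negBinomialScale r n) x| ≤ C * (n : ℝ) ^ (-(3 / 2) : ℝ) := by
  obtain ⟨C₀, hC₀, n₀, hn₀, hp⟩ := exists_parameter_estimates hr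
  obtain ⟨C, hC, hm⟩ := exists_abs_massFactor_momentIntegral_sub_le hr ha hκ C₀ hC₀
  have hmin : 0 < min r 1 := lt_min hr one_pos
  refine ⟨C * min r 1 ^ (a + 1 - r), by positivity, n₀, hn₀, fun n hn x => ?_⟩
  obtain ⟨e1, e2, e3, -⟩ := hp n hn
  have hn2 : 2 ≤ n := hn₀.trans hn
  have hn1 : (1 : ℝ) ≤ n := by exact_mod_cast (by omega : 1 ≤ n)
  have hn0 : (0 : ℝ) < n := by linarith
  have hg := negBinomialScale_pos hr (show 1 ≤ n by omega)
  have hb : 0 < geomRate n := lt_of_lt_of_le (by positivity) (one_div_le_geomRate hn2)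
  refine (hm _ _ _ x _ (1 / (n : ℝ)) hb hg rfl (by positivity)
    (by rw [div_le_one hn0]; exact hn1) e1 e2 e3).trans ?_
  have hgle := min_mul_le_negBinomialScale (r := r) (show 1 ≤ n by omega)
  calc C * (1 / (n : ℝ)) * negBinomialScale r n ^ (a + 1 - r)
      ≤ C * (1 / (n : ℝ)) * (min r 1 * n) ^ (a + 1 - r) :=
        mul_le_mul_of_nonneg_left (Real.rpow_le_rpow_of_nonpos (by positivity) hgle (by linarith))
          (by positivity)
    _ = C * min r 1 ^ (a + 1 - r) * (n : ℝ) ^ (a - r) := by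
        rw [Real.mul_rpow hmin.le hn0.le, show a - r = -1 + (a + 1 - r) by ring,
          Real.rpow_add hn0, Real.rpow_neg_one]
        ring
    _ ≤ _ := mul_le_mul_of_nonneg_left
        (Real.rpow_le_rpow_of_exponent_le hn1 (by linarith)) (by positivity)

theorem abs_inv_sqrt_two_pi_mul_signOf_le (x : ℝ) : |(Real.sqrt (2 * Real.pi))⁻¹ * signOf x| ≤ 1 := by
  rw [abs_mul, abs_signOf, mul_one, abs_of_nonneg (by positivity)]
  apply inv_le_one_of_one_le₀
  rw [Real.one_le_sqrt]
  linarith [Real.pi_gt_three]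

theorem exists_abs_first_moment_sub_le {r : ℝ} (hr : 0 < r) (κ₁ : ℝ) :
    ∃ C : ℝ, 0 < C ∧ ∃ n₀ : ℕ, 2 ≤ n₀ ∧ ∀ n : ℕ, n₀ ≤ n → ∀ x : ℝ,
      |massFactor r n * ((Real.sqrt (2 * Real.pi))⁻¹ * signOf x * (κ₁ * momentIntegral 1 (r - 3 / 2)
          (geomRate n) (x ^ 2 / negBinomialScale r n)))
        - studentDensity (2 * r) x * ((if 1 / 2 < r then κ₁ * (x * |x|) else 0)
          * negBinomialScale r n ^ (-(1 / 2) : ℝ))| ≤ C * (n : ℝ) ^ (-(3 / 2) : ℝ) := by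
  by_cases h : 1 / 2 < r
  · obtain ⟨C, hC, n₀, hn₀, hm⟩ := exists_abs_scaled_moment_sub_le hr (κ := 1) (a := r - 3 / 2)
      (by linarith) (by norm_num) (by linarith)
    refine ⟨(|κ₁| + 1) * C, by positivity, n₀, hn₀, fun n hn x => ?_⟩
    have hg := negBinomialScale_pos hr (show 1 ≤ n by omega)
    have hv := (leadingMoment_values hr hg x).1
    have h1 := abs_inv_sqrt_two_pi_mul_signOf_le x
    have h2 := hm n hn x
    rw [if_pos h]
    generalize (Real.sqrt (2 * Real.pi))⁻¹ * signOf x = φ at *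
    calc _ = |φ * κ₁ * (massFactor r n * momentIntegral 1 (r - 3 / 2) (geomRate n)
          (x ^ 2 / negBinomialScale r n) - leadingMoment r 1 (r - 3 / 2) (negBinomialScale r n) x)| := by
            congr 1
            linear_combination κ₁ * hv
      _ = |φ| * |κ₁| * _ := by rw [abs_mul, abs_mul]
      _ ≤ 1 * (|κ₁| + 1) * (C * (n : ℝ) ^ (-(3 / 2) : ℝ)) := by
            gcongr
            linarith
      _ = _ := by ring
  · refine ⟨1, one_pos, 2, le_rfl, fun n hn x => ?_⟩
    rw [if_neg h, momentIntegral, if_neg (by linarith)]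
    simp only [mul_zero, zero_mul, sub_zero, abs_zero]
    positivity

/-- The coefficient `5 - r` is `3 + (2 - r)`: the `3` comes from the median expansion, the `2 - r`
from the boundary-density part of the secondary integral after integration by parts. -/
theorem exists_abs_second_moments_sub_le {r : ℝ} (hr : 1 < r) (κ₂ κ₃ : ℝ) :
    ∃ C : ℝ, 0 < C ∧ ∃ n₀ : ℕ, 2 ≤ n₀ ∧ ∀ n : ℕ, n₀ ≤ n → ∀ x g b v : ℝ,
      g = negBinomialScale r n → b = geomRate n → v = x ^ 2 / g →
      |massFactor r n * ((Real.sqrt (2 * Real.pi))⁻¹ * signOf x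
          * ((5 - r) * momentIntegral (1 / 2) (r - 2) b v
          + κ₂ * momentIntegral (3 / 2) (r - 2) b v - κ₃ * momentIntegral (5 / 2) (r - 2) b v))
        - x * studentDensity (2 * r) x * ((5 - r) * ((2 * r + x ^ 2) / (2 * r - 1)) + κ₂ * x ^ 2
          - κ₃ * (x ^ 4 * ((2 * r + 1) / (2 * r + x ^ 2)))) * g⁻¹|
        ≤ C * (n : ℝ) ^ (-(3 / 2) : ℝ) := by
  have hr0 : 0 < r := by linarith
  obtain ⟨C₁, hC₁, n₁, hn₁, hm₁⟩ := exists_abs_scaled_moment_sub_le hr0 (κ := 1 / 2) (a := r - 2)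
    (by linarith) (by norm_num) (by linarith)
  obtain ⟨C₂, hC₂, n₂, hn₂, hm₂⟩ := exists_abs_scaled_moment_sub_le hr0 (κ := 3 / 2) (a := r - 2)
    (by linarith) (by norm_num) (by linarith)
  obtain ⟨C₃, hC₃, n₃, hn₃, hm₃⟩ := exists_abs_scaled_moment_sub_le hr0 (κ := 5 / 2) (a := r - 2)
    (by linarith) (by norm_num) (by linarith)
  refine ⟨|5 - r| * C₁ + |κ₂| * C₂ + |κ₃| * C₃ + 1, by positivity, max n₁ (max n₂ n₃),
    hn₁.trans (le_max_left _ _), fun n hn x g b v hg' hb hv => ?_⟩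
  have e₁ := hm₁ n ((le_max_left _ _).trans hn) x
  have e₂ := hm₂ n (((le_max_left _ _).trans (le_max_right _ _)).trans hn) x
  have e₃ := hm₃ n (((le_max_right _ _).trans (le_max_right _ _)).trans hn) x
  have hg := negBinomialScale_pos hr0 (show 1 ≤ n by have := (le_max_left _ _).trans hn; omega)
  obtain ⟨-, hv₁, hv₂, hv₃⟩ := leadingMoment_values hr0 hg x
  specialize hv₁ hr
  rw [← hg'] at e₁ e₂ e₃ hv₁ hv₂ hv₃
  rw [← hb, ← hv] at e₁ e₂ e₃
  have h1 := abs_inv_sqrt_two_pi_mul_signOf_le x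
  have hw : 0 ≤ (n : ℝ) ^ (-(3 / 2) : ℝ) := by positivity
  generalize (Real.sqrt (2 * Real.pi))⁻¹ * signOf x = φ at *
  generalize massFactor r n = D at *
  generalize (n : ℝ) ^ (-(3 / 2) : ℝ) = w at *
  set d₁ := D * momentIntegral (1 / 2) (r - 2) b v - leadingMoment r (1 / 2) (r - 2) g x with hd₁
  set d₂ := D * momentIntegral (3 / 2) (r - 2) b v - leadingMoment r (3 / 2) (r - 2) g x with hd₂
  set d₃ := D * momentIntegral (5 / 2) (r - 2) b v - leadingMoment r (5 / 2) (r - 2) g x with hd₃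
  calc _ = |φ * ((5 - r) * d₁ + κ₂ * d₂ - κ₃ * d₃)| := by
        congr 1
        rw [hd₁, hd₂, hd₃]
        linear_combination (5 - r) * hv₁ + κ₂ * hv₂ - κ₃ * hv₃
    _ ≤ 1 * |(5 - r) * d₁ + κ₂ * d₂ - κ₃ * d₃| := by
        rw [abs_mul]; exact mul_le_mul_of_nonneg_right h1 (abs_nonneg _)
    _ ≤ |5 - r| * |d₁| + |κ₂| * |d₂| + |κ₃| * |d₃| := by
        rw [one_mul, ← abs_mul, ← abs_mul, ← abs_mul]
        exact (abs_sub _ _).trans (add_le_add (abs_add_le _ _) le_rfl)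
    _ ≤ |5 - r| * (C₁ * w) + |κ₂| * (C₂ * w) + |κ₃| * (C₃ * w) := by gcongr
    _ ≤ _ := by linarith

/-- For `r > 1` five errors are added: total mass, quadratic remainder in the scale, first-order
shift of the scale, first moment, second moments. For `r ≤ 1` the second moments and the secondary
integral are zero by definition. -/
theorem exists_abs_leading_sub_student_le {r : ℝ} (hr : 0 < r) (κ₁ κ₂ κ₃ : ℝ) :
    ∃ C : ℝ, 0 < C ∧ ∃ n₀ : ℕ, 2 ≤ n₀ ∧ ∀ n : ℕ, n₀ ≤ n → ∀ x g b v : ℝ,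
      g = negBinomialScale r n → b = geomRate n → v = x ^ 2 / g →
      |massFactor r n *
          ((∫ t in Set.Ioi 0, t ^ (r - 1) * Real.exp (-(b * t)) * gaussCDF (Real.sqrt (t / g) * x))
            + secondaryIntegral r b g x
            + (Real.sqrt (2 * Real.pi))⁻¹ * signOf x * (κ₁ * momentIntegral 1 (r - 3 / 2) b v
              + (3 * momentIntegral (1 / 2) (r - 2) b v + κ₂ * momentIntegral (3 / 2) (r - 2) b v
                - κ₃ * momentIntegral (5 / 2) (r - 2) b v) / 4))
        - (studentCDF (2 * r) x + studentDensity (2 * r) x *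
          ((if 1 / 2 < r then κ₁ * (x * |x|) else 0) * g ^ (-(1 / 2) : ℝ)
          + (if 1 < r then x / 4 * (((5 - r) * x ^ 2 + 5 * r + 2) / (2 * r - 1)
            + x ^ 2 * κ₂ - κ₃ * (x ^ 4 * ((2 * r + 1) / (2 * r + x ^ 2)))) else 0) * g⁻¹))|
        ≤ C * approximationRate r n := by
  obtain ⟨C₀, hC₀, n₀, hn₀, hp⟩ := exists_parameter_estimates hr
  obtain ⟨C₁, hC₁, n₁, hn₁, hm₁⟩ := exists_abs_first_moment_sub_le hr κ₁
  obtain ⟨C₂, hC₂, hS⟩ := exists_abs_studentCDF_scale_sub_le hr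
  obtain ⟨C₃, hC₃, hxs⟩ := exists_abs_mul_studentDensity_le hr
  by_cases hr1 : 1 < r
  · obtain ⟨C₄, hC₄, n₄, hn₄, hm₄⟩ := exists_abs_second_moments_sub_le hr1 κ₂ κ₃
    refine ⟨2 * (C₀ + C₂ * C₀ ^ 2 + C₃ * C₀ + C₁ + C₄), by positivity, max n₀ (max n₁ n₄),
      hn₀.trans (le_max_left _ _), fun n hn x g b v hg' hb hv => ?_⟩
    have hnn : n₀ ≤ n := (le_max_left _ _).trans hn
    have hn2 : 2 ≤ n := hn₀.trans hnn
    have hn1 : (1 : ℝ) ≤ n := by exact_mod_cast (by omega : 1 ≤ n)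
    obtain ⟨-, -, -, -, e5, e6, e7, e8⟩ := hp n hnn
    have hg := negBinomialScale_pos hr (show 1 ≤ n by omega)
    have m1 := hm₁ n (((le_max_left _ _).trans (le_max_right _ _)).trans hn) x
    have m4 := hm₄ n (((le_max_right _ _).trans (le_max_right _ _)).trans hn) x g b v hg' hb hv
    have hbp : 0 < geomRate n := lt_of_lt_of_le (by positivity) (one_div_le_geomRate hn2)
    have hrate := rpow_neg_three_halves_le_rate r hn2
    have hw2 : (1 / (n : ℝ)) ^ 2 ≤ (n : ℝ) ^ (-(3 / 2) : ℝ) := by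
      rw [one_div, ← Real.rpow_natCast, Real.inv_rpow (by linarith), ← Real.rpow_neg (by linarith)]
      exact Real.rpow_le_rpow_of_exponent_le hn1 (by norm_num)
    have hS' := hS x (scaleRatio r n) e8
    have hSl0 := studentCDF_nonneg hr (scaleRatio r n * x)
    have hSl1 := studentCDF_le_one hr (scaleRatio r n * x)
    rw [← hg'] at hg e6 m1
    rw [← hb] at hbp e5 m1
    rw [← hv] at m1
    have hlam : scaleRatio r n = Real.sqrt (r / (b * g)) := by rw [hb, hg']; rfl
    rw [secondaryIntegral_eq hr1 hbp hg hv, integral_gamma_gaussCDF hr hbp hg, ← hlam, if_pos hr1]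
    set l := scaleRatio r n
    set D := massFactor r n
    set w := (n : ℝ) ^ (-(3 / 2) : ℝ) with hwd
    have hw : 0 ≤ w := by positivity
    have hx := hxs x
    set P := D * (Real.Gamma r * b ^ (-r)) * (1 + (r - 2) / 2 * b) with hP
    set Sl := studentCDF (2 * r) (l * x)
    set S := studentCDF (2 * r) x
    set s := studentDensity (2 * r) x
    have hl2 : (l - 1) ^ 2 ≤ C₀ ^ 2 * w := by
      rw [← sq_abs]
      calc |l - 1| ^ 2 ≤ (C₀ * (1 / (n : ℝ))) ^ 2 := by gcongr
        _ = C₀ ^ 2 * (1 / (n : ℝ)) ^ 2 := by ring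
        _ ≤ _ := mul_le_mul_of_nonneg_left hw2 (by positivity)
    have b1 : |(P - 1) * Sl| ≤ C₀ * w := by
      rw [abs_mul, abs_of_nonneg hSl0]
      calc |P - 1| * Sl ≤ |P - 1| * 1 := by gcongr
        _ ≤ C₀ * (1 / (n : ℝ)) ^ 2 := by rw [mul_one]; exact e5
        _ ≤ _ := by gcongr
    have b2 : |Sl - S - x * s * (l - 1)| ≤ C₂ * C₀ ^ 2 * w := by
      refine hS'.trans ?_
      rw [mul_assoc]
      gcongr
    have b3 : |x * s * (l - 1 + (2 - r) / (4 * g))| ≤ C₃ * C₀ * w := by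
      rw [abs_mul, mul_assoc]
      exact mul_le_mul hx (e6.trans (by gcongr)) (abs_nonneg _) hC₃.le
    have key : ∀ a b c d e : ℝ, |a + b + c + d + e / 4| ≤ |a| + |b| + |c| + |d| + |e| := by
      intro a b c d e
      have h5 : |e / 4| ≤ |e| := by
        rw [abs_div, abs_of_pos (by norm_num : (0 : ℝ) < 4)]
        linarith [abs_nonneg e]
      linarith [abs_add_le (a + b + c + d) (e / 4), abs_add_le (a + b + c) d, abs_add_le (a + b) c,
        abs_add_le a b]
    refine (le_of_eq ?_).trans ((key _ _ _ _ _).trans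
      ((add_le_add (add_le_add (add_le_add (add_le_add b1 b2) b3) m1) m4).trans ?_))
    · congr 1
      rw [hP]
      have : 2 * r - 1 ≠ 0 := by linarith
      have hgne : g ≠ 0 := hg.ne'
      -- The `2 - r` subtracted here comes from the scale correction `-(2-r)/(4g)`; together with
      -- the moment of exponent `1/2` it gives the first fraction of `A₂`.
      have hid : (5 - r) * ((2 * r + x ^ 2) / (2 * r - 1)) - (2 - r)
          = ((5 - r) * x ^ 2 + 5 * r + 2) / (2 * r - 1) := by
        rw [eq_div_iff this]
        linear_combination (5 - r) * div_mul_cancel₀ (2 * r + x ^ 2) this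
      rw [← hid, show (2 - r) / (4 * g) = (2 - r) / 4 * g⁻¹ by field_simp]
      ring
    · linarith [mul_le_mul_of_nonneg_left hrate
        (show 0 ≤ C₀ + C₂ * C₀ ^ 2 + C₃ * C₀ + C₁ + C₄ by positivity)]
  · refine ⟨C₀ + C₂ * C₀ ^ 2 + C₃ * C₀ + 2 * C₁, by positivity, max n₀ n₁,
      hn₀.trans (le_max_left _ _), fun n hn x g b v hg' hb hv => ?_⟩
    have hnn : n₀ ≤ n := (le_max_left _ _).trans hn
    have hn2 : 2 ≤ n := hn₀.trans hnn
    have hn1 : (1 : ℝ) ≤ n := by exact_mod_cast (by omega : 1 ≤ n)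
    obtain ⟨-, -, -, e4, -, -, e7, e8⟩ := hp n hnn
    have hg := negBinomialScale_pos hr (show 1 ≤ n by omega)
    have m1 := hm₁ n ((le_max_right _ _).trans hn) x
    have hbp : 0 < geomRate n := lt_of_lt_of_le (by positivity) (one_div_le_geomRate hn2)
    have hrate := rpow_neg_three_halves_le_rate r hn2
    have hrate1 := one_div_le_rate (not_lt.mp hr1) hn2
    have hS' := hS x (scaleRatio r n) e8
    have hSl0 := studentCDF_nonneg hr (scaleRatio r n * x)
    have hSl1 := studentCDF_le_one hr (scaleRatio r n * x)
    rw [← hg'] at hg m1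
    rw [← hb] at hbp e4 m1
    rw [← hv] at m1
    have hlam : scaleRatio r n = Real.sqrt (r / (b * g)) := by rw [hb, hg']; rfl
    have hz : ∀ κ : ℝ, momentIntegral κ (r - 2) b v = 0 := fun κ => by
      rw [momentIntegral, if_neg (by linarith)]
    rw [secondaryIntegral, if_neg hr1, integral_gamma_gaussCDF hr hbp hg, ← hlam, if_neg hr1, hz, hz,
      hz]
    set l := scaleRatio r n
    set D := massFactor r n
    set w := (n : ℝ) ^ (-(3 / 2) : ℝ) with hwd
    have hw : 0 ≤ w := by positivity
    have hu0 : 0 ≤ 1 / (n : ℝ) := by positivity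
    have hu1 : 1 / (n : ℝ) ≤ 1 := by rw [div_le_one (by linarith)]; exact hn1
    set u := 1 / (n : ℝ)
    have hx := hxs x
    set P := D * (Real.Gamma r * b ^ (-r)) with hP
    set Sl := studentCDF (2 * r) (l * x)
    set S := studentCDF (2 * r) x
    set s := studentDensity (2 * r) x
    have hl2 : (l - 1) ^ 2 ≤ C₀ ^ 2 * u := by
      rw [← sq_abs]
      calc |l - 1| ^ 2 ≤ (C₀ * u) ^ 2 := by gcongr
        _ = C₀ ^ 2 * u * u := by ring
        _ ≤ _ := mul_le_of_le_one_right (by positivity) hu1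
    have b1 : |(P - 1) * Sl| ≤ C₀ * u := by
      rw [abs_mul, abs_of_nonneg hSl0]
      calc |P - 1| * Sl ≤ |P - 1| * 1 := by gcongr
        _ ≤ C₀ * u := by rw [mul_one]; exact e4
    have b2 : |Sl - S - x * s * (l - 1)| ≤ C₂ * C₀ ^ 2 * u := by
      refine hS'.trans ?_
      rw [mul_assoc]
      gcongr
    have b3 : |x * s * (l - 1)| ≤ C₃ * C₀ * u := by
      rw [abs_mul, mul_assoc]
      exact mul_le_mul hx e7 (abs_nonneg _) hC₃.le
    have key : ∀ a b c d : ℝ, |a + b + c + d| ≤ |a| + |b| + |c| + |d| := by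
      intro a b c d
      linarith [abs_add_le (a + b + c) d, abs_add_le (a + b) c, abs_add_le a b]
    refine (le_of_eq ?_).trans ((key _ _ _ _).trans
      ((add_le_add (add_le_add (add_le_add b1 b2) b3) m1).trans ?_))
    · congr 1
      rw [hP]
      ring
    · linarith [mul_le_mul_of_nonneg_left hrate hC₁.le, mul_le_mul_of_nonneg_left hrate1
        (show 0 ≤ C₀ + C₂ * C₀ ^ 2 + C₃ * C₀ by positivity)]

/-- The density decays like `|x|^(-(2r+1))`, hence the restriction on `k`. -/
theorem exists_pow_mul_studentDensity_le {r : ℝ} (hr : 0 < r) {k : ℕ} (hk : (k : ℝ) ≤ 2 * r + 1) :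
    ∃ C : ℝ, 0 < C ∧ ∀ x : ℝ, |x| ^ k * studentDensity (2 * r) x ≤ C := by
  have hG := Real.Gamma_pos_of_pos hr
  have hG' := Real.Gamma_pos_of_pos (show 0 < r + 1 / 2 by linarith)
  set K := (Real.sqrt (2 * Real.pi))⁻¹ * (Real.Gamma (r + 1 / 2) / Real.Gamma r
      * r ^ (-(1 / 2) : ℝ)) with hK
  have hK0 : 0 < K := by positivity
  refine ⟨K * (2 * r) ^ ((k : ℝ) / 2), by positivity, fun x => ?_⟩
  have hW : 1 ≤ 1 + x ^ 2 / (2 * r) := by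
    have : 0 ≤ x ^ 2 / (2 * r) := by positivity
    linarith
  rw [studentDensity_two_mul hr, ← hK]
  set W := 1 + x ^ 2 / (2 * r) with hWd
  have e : 2 * r + x ^ 2 = 2 * r * W := by rw [hWd]; field_simp
  have h1 : |x| ^ k ≤ (2 * r) ^ ((k : ℝ) / 2) * W ^ ((k : ℝ) / 2) := by
    rw [← sq_rpow_half x k, ← Real.mul_rpow (by positivity) (by positivity), ← e]
    exact Real.rpow_le_rpow (by positivity) (by linarith) (by positivity)
  calc |x| ^ k * (K * W ^ (-(r + 1 / 2)))
      ≤ ((2 * r) ^ ((k : ℝ) / 2) * W ^ ((k : ℝ) / 2)) * (K * W ^ (-(r + 1 / 2))) :=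
        mul_le_mul_of_nonneg_right h1 (by positivity)
    _ = K * (2 * r) ^ ((k : ℝ) / 2) * W ^ ((k : ℝ) / 2 - (r + 1 / 2)) := by
        rw [sub_eq_add_neg, Real.rpow_add (by positivity)]
        ring
    _ ≤ _ := mul_le_of_le_one_right (by positivity)
        (Real.rpow_le_one_of_one_le_of_nonpos hW (by linarith))

/-- Serves for the finitely many small `n`. The terms grow like `x²` times the density in `A₁` and
`x³` times the density in `A₂`; the indicator conditions `r > 1/2` and `r > 1` ensure that these
products are bounded. -/
theorem exists_abs_studentExpansion_le (p₀ p₁ p₂ : ℝ) {r : ℝ} (hr : 0 < r) :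
    ∃ B : ℝ, 0 < B ∧ ∀ n : ℕ, 1 ≤ n → ∀ x, |studentExpansion p₀ p₁ p₂ r n x| ≤ B := by
  have h1 : ∃ B : ℝ, 0 < B ∧ ∀ x, |studentDensity (2 * r) x * coeffA1 p₀ p₁ r x| ≤ B := by
    by_cases h : 1 / 2 < r
    · obtain ⟨C, hC, hb⟩ := exists_pow_mul_studentDensity_le hr (k := 2) (by push_cast; linarith)
      refine ⟨(|p₁ / (4 * p₀ ^ 2)| + 1) * C, by positivity, fun x => ?_⟩
      rw [coeffA1, if_pos h]
      have hs := studentDensity_nonneg (show 0 < 2 * r by linarith) x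
      calc _ = |p₁ / (4 * p₀ ^ 2)| * (|x| ^ 2 * studentDensity (2 * r) x) := by
            rw [show studentDensity (2 * r) x * (p₁ * x * |x| / (4 * p₀ ^ 2))
              = p₁ / (4 * p₀ ^ 2) * (x * |x|) * studentDensity (2 * r) x by ring, abs_mul, abs_mul,
              abs_mul x, abs_abs, abs_of_nonneg hs]
            ring
        _ ≤ _ := mul_le_mul (by linarith) (hb x) (by positivity) (by positivity)
    · refine ⟨1, one_pos, fun x => ?_⟩
      rw [coeffA1, if_neg h]
      simp
  have h2 : ∃ B : ℝ, 0 < B ∧ ∀ x, |studentDensity (2 * r) x * coeffA2 p₀ p₁ p₂ r x| ≤ B := by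
    by_cases h : 1 < r
    · obtain ⟨C₁, hC₁, hb₁⟩ := exists_pow_mul_studentDensity_le hr (k := 1) (by push_cast; linarith)
      obtain ⟨C₃, hC₃, hb₃⟩ := exists_pow_mul_studentDensity_le hr (k := 3) (by push_cast; linarith)
      set a := (5 * r + 2) / (4 * (2 * r - 1)) with ha
      set b := (5 - r) / (4 * (2 * r - 1)) + (1 + p₂ / (6 * p₀ ^ 3)) / 4 with hb
      set c := p₁ ^ 2 * (2 * r + 1) / (8 * p₀ ^ 4) / 4 with hc
      refine ⟨|a| * C₁ + |b| * C₃ + |c| * C₃ + 1, by positivity, fun x => ?_⟩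
      rw [coeffA2, if_pos h]
      have hs := studentDensity_nonneg (show 0 < 2 * r by linarith) x
      set s := studentDensity (2 * r) x
      have hq0 : 0 < 2 * r + x ^ 2 := by positivity
      have hq : |x ^ 2 / (2 * r + x ^ 2)| ≤ 1 := by
        rw [abs_of_nonneg (by positivity), div_le_one hq0]
        linarith
      have hne : 2 * r - 1 ≠ 0 := by linarith
      have h3 : |x ^ 3 * s| ≤ C₃ := by rw [abs_mul, abs_pow, abs_of_nonneg hs]; exact hb₃ x
      have h1 : |x * s| ≤ C₁ := by
        rw [abs_mul, abs_of_nonneg hs]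
        simpa using hb₁ x
      calc _ = |a * (x * s) + b * (x ^ 3 * s) - c * (x ^ 3 * s * (x ^ 2 / (2 * r + x ^ 2)))| := by
            congr 1
            rw [ha, hb, hc]
            field_simp
            ring
        _ ≤ |a * (x * s)| + |b * (x ^ 3 * s)| + |c * (x ^ 3 * s * (x ^ 2 / (2 * r + x ^ 2)))| :=
            (abs_sub _ _).trans (add_le_add (abs_add_le _ _) le_rfl)
        _ ≤ |a| * C₁ + |b| * C₃ + |c| * (C₃ * 1) := by
            rw [abs_mul a, abs_mul b, abs_mul c, abs_mul (x ^ 3 * s)]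
            gcongr
        _ ≤ _ := by linarith
    · refine ⟨1, one_pos, fun x => ?_⟩
      rw [coeffA2, if_neg h]
      simp
  obtain ⟨B₁, hB₁, h1⟩ := h1
  obtain ⟨B₂, hB₂, h2⟩ := h2
  have hmin : 0 < min r 1 := lt_min hr one_pos
  refine ⟨1 + (B₁ * min r 1 ^ (-(1 / 2) : ℝ) + B₂ * (min r 1)⁻¹), by positivity, fun n hn x => ?_⟩
  have hg := negBinomialScale_pos hr hn
  have hgle : min r 1 ≤ negBinomialScale r n := by
    refine le_trans ?_ (min_mul_le_negBinomialScale (r := r) hn)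
    exact le_mul_of_one_le_right hmin.le (by exact_mod_cast hn)
  unfold studentExpansion
  set g := negBinomialScale r n
  have e1 : g ^ (-(1 / 2) : ℝ) ≤ min r 1 ^ (-(1 / 2) : ℝ) :=
    Real.rpow_le_rpow_of_nonpos hmin hgle (by norm_num)
  have e2 : g⁻¹ ≤ (min r 1)⁻¹ := inv_anti₀ hmin hgle
  have e0 : |studentCDF (2 * r) x| ≤ 1 := by
    rw [abs_of_nonneg (studentCDF_nonneg hr x)]
    exact studentCDF_le_one hr x
  rw [mul_add, ← mul_assoc, ← mul_assoc]
  refine (abs_add_le _ _).trans (add_le_add e0 ((abs_add_le _ _).trans ?_))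
  rw [abs_mul, abs_mul (_ * _), abs_of_nonneg (show 0 ≤ g ^ (-(1 / 2) : ℝ) by positivity),
    abs_of_nonneg (show 0 ≤ g⁻¹ by positivity)]
  exact add_le_add (mul_le_mul (h1 x) e1 (by positivity) hB₁.le)
    (mul_le_mul (h2 x) e2 (by positivity) hB₂.le)

/-- The second hypothesis excludes `r = 3/2`, `n = 1`, where `log n` makes the rate vanish. -/
theorem approximationRate_pos {r : ℝ} {n : ℕ} (hn : 1 ≤ n) (h : r = 3 / 2 → 2 ≤ n) :
    0 < approximationRate r n := by
  have hn0 : (0 : ℝ) < n := by exact_mod_cast hn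
  unfold approximationRate
  split_ifs with hr
  · exact mul_pos (Real.log_pos (by exact_mod_cast h hr)) (by positivity)
  · positivity

/-- Approximation of negative binomial mixtures of normal expansions. -/
theorem exists_abs_tsum_mass_sub_studentExpansion_le (p₀ p₁ p₂ : ℝ) {r : ℝ} (hr : 0 < r) {K : ℝ}
    (hK : 0 ≤ K) :
    ∃ C : ℝ, 0 < C ∧ ∃ n₀ : ℕ, 2 ≤ n₀ ∧ ∀ n : ℕ, n₀ ≤ n → ∀ F : ℕ → ℝ → ℝ,
      (∀ k : ℕ, ∀ y, |F k y - medianExpansion (p₁ / (4 * p₀ ^ 2)) (1 + p₂ / (6 * p₀ ^ 3))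
        (p₁ ^ 2 / (8 * p₀ ^ 4)) ((k : ℝ) + 1) y| ≤ K * ((k : ℝ) + 1) ^ (-(3 / 2) : ℝ)) →
      ∀ x : ℝ, |∑' k : ℕ, shiftedNegBinomialMass r n (k + 1)
          * F k (Real.sqrt (((k : ℝ) + 1) / negBinomialScale r n) * x)
        - studentExpansion p₀ p₁ p₂ r n x| ≤ C * approximationRate r n := by
  set κ₁ := p₁ / (4 * p₀ ^ 2) with h₁
  set κ₂ := 1 + p₂ / (6 * p₀ ^ 3) with h₂
  set κ₃ := p₁ ^ 2 / (8 * p₀ ^ 4) with h₃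
  obtain ⟨C₁, hC₁, hm⟩ := exists_abs_tsum_mass_mul_sub_le hr κ₁ κ₂ κ₃ hK
  obtain ⟨C₂, hC₂, hr2⟩ := exists_expPowerSum_le_rate (r := r) (κ := 1 / 4) (by norm_num)
    (by norm_num)
  obtain ⟨C₃, hC₃, n₀, hn₀, hl⟩ := exists_abs_leading_sub_student_le hr κ₁ κ₂ κ₃
  refine ⟨C₁ * C₂ + C₃, by positivity, n₀, hn₀, fun n hn F hF x => ?_⟩
  have hn2 : 2 ≤ n := hn₀.trans hn
  have hg := negBinomialScale_pos hr (show 1 ≤ n by omega)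
  have a1 := hm n hn2 F hF x _ _ _ hg rfl rfl
  have a2 := hr2 n (by omega) fun _ => hn2
  have a3 := hl n hn x _ _ _ rfl rfl rfl
  have e : studentExpansion p₀ p₁ p₂ r n x = studentCDF (2 * r) x + studentDensity (2 * r) x *
      ((if 1 / 2 < r then κ₁ * (x * |x|) else 0) * negBinomialScale r n ^ (-(1 / 2) : ℝ)
      + (if 1 < r then x / 4 * (((5 - r) * x ^ 2 + 5 * r + 2) / (2 * r - 1)
        + x ^ 2 * κ₂ - κ₃ * (x ^ 4 * ((2 * r + 1) / (2 * r + x ^ 2)))) else 0)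
          * (negBinomialScale r n)⁻¹) := by
    unfold studentExpansion coeffA1 coeffA2
    congr 4
    · congr 1
      rw [h₁]; ring
    · congr 2
      rw [h₃, h₂]
      simp only [div_eq_mul_inv, mul_inv]
      ring
  rw [e]
  refine (abs_sub_le _ _ _).trans ((add_le_add (a1.trans
    (mul_le_mul_of_nonneg_left a2 hC₁.le)) a3).trans (le_of_eq (by ring)))

/-! ### Order statistics through counting -/

/-- The number of `v₀, …, v_{m-1}` that are at most `y`. -/
noncomputable def countLE {m : ℕ} (v : Fin m → ℝ) (y : ℝ) : ℕ :=
  (Finset.univ.filter fun i => v i ≤ y).card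

/-- Reduces order statistics to counts: measurability, translation, reflection and the law of the
median are all read off from `countLE`. -/
theorem orderStat_le_iff {m k : ℕ} (hk : 1 ≤ k) (hkm : k ≤ m) (v : Fin m → ℝ) (y : ℝ) :
    orderStat v k ≤ y ↔ k ≤ countLE v y := by
  have hlt : k - 1 < m := by omega
  have h := Tuple.lt_card_le_iff_apply_le_of_monotone (f := v ∘ Tuple.sort v) (a := y)
    (j := ⟨k - 1, hlt⟩) (Tuple.monotone_sort v)
  have hc : (Finset.univ.filter fun i => (v ∘ Tuple.sort v) i ≤ y).card = countLE v y := by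
    rw [countLE, ← Fintype.card_subtype, ← Fintype.card_subtype]
    exact Fintype.card_congr ((Tuple.sort v).subtypeEquiv fun a => Iff.rfl)
  rw [hc] at h
  rw [orderStat, dif_pos hlt]
  simp only [Function.comp] at h
  rw [← h]
  omega

theorem measurableSet_le_countLE (m k : ℕ) (y : ℝ) :
    MeasurableSet {v : Fin m → ℝ | k ≤ countLE v y} := by
  have hm : Measurable fun v : Fin m → ℝ => countLE v y := by
    have : (fun v : Fin m → ℝ => countLE v y)
        = fun v => ∑ i : Fin m, (Set.Iic y).indicator (fun _ => (1 : ℕ)) (v i) := by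
      funext v
      rw [countLE, Finset.card_filter]
      rfl
    rw [this]
    exact Finset.measurable_sum _ fun i _ =>
      (measurable_const.indicator measurableSet_Iic).comp (measurable_pi_apply i)
  exact hm measurableSet_Ici

theorem measurable_orderStat (m k : ℕ) : Measurable fun v : Fin m → ℝ => orderStat v k := by
  by_cases h : k - 1 < m
  -- With truncated subtraction the index `k = 0` behaves like `k = 1`; writing `k - 1 + 1` meets
  -- the lower bound on the index in both cases.
  · have e : (fun v : Fin m → ℝ => orderStat v k) = fun v => orderStat v (k - 1 + 1) := by
      funext v
      simp [orderStat]
    rw [e]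
    refine measurable_of_Iic fun y => ?_
    have : (fun v : Fin m → ℝ => orderStat v (k - 1 + 1)) ⁻¹' Set.Iic y
        = {v | k - 1 + 1 ≤ countLE v y} := by
      ext v
      exact orderStat_le_iff (by omega) (by omega) v y
    rw [this]
    exact measurableSet_le_countLE _ _ _
  · simp only [orderStat, dif_neg h]
    exact measurable_const

theorem measurable_sampleMedian (m : ℕ) : Measurable fun v : Fin m → ℝ => sampleMedian v := by
  unfold sampleMedian
  split_ifs
  · exact measurable_orderStat _ _
  · exact ((measurable_orderStat _ _).add (measurable_orderStat _ _)).div_const 2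

theorem countLE_sub_const {m : ℕ} (v : Fin m → ℝ) (θ y : ℝ) :
    countLE (fun i => v i - θ) y = countLE v (y + θ) := by
  simp only [countLE, sub_le_iff_le_add]

theorem orderStat_sub_const {m k : ℕ} (hk : 1 ≤ k) (hkm : k ≤ m) (v : Fin m → ℝ) (θ : ℝ) :
    orderStat (fun i => v i - θ) k = orderStat v k - θ := by
  refine eq_of_forall_ge_iff fun y => ?_
  rw [orderStat_le_iff hk hkm, countLE_sub_const, ← orderStat_le_iff hk hkm, sub_le_iff_le_add]

theorem sampleMedian_sub_const {m : ℕ} (hm : 1 ≤ m) (v : Fin m → ℝ) (θ : ℝ) :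
    sampleMedian (fun i => v i - θ) = sampleMedian v - θ := by
  unfold sampleMedian
  split_ifs with h
  · exact orderStat_sub_const (by omega) (by omega) v θ
  · have := Nat.not_odd_iff_even.mp h
    obtain ⟨j, hj⟩ := this
    rw [orderStat_sub_const (by omega) (by omega), orderStat_sub_const (by omega) (by omega)]
    ring

theorem orderStat_neg {m k : ℕ} (hk : 1 ≤ k) (hkm : k ≤ m) (v : Fin m → ℝ) :
    orderStat (fun i => -v i) k = -orderStat v (m + 1 - k) := by
  -- At least `k` of the `-vᵢ` are at most `y` exactly when at most `m - k` of the `vᵢ` lie strictly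
  -- below `-y`. The strict count is attained at the largest value below `-y`, so it is described by
  -- counts at levels `z < -y`.
  have hlt (y : ℝ) : k ≤ countLE (fun i => -v i) y ↔ ∀ z, z < -y → ¬ (m + 1 - k ≤ countLE v z) := by
    have h1 : (Finset.univ.filter fun i : Fin m => v i < -y).card + countLE (fun i => -v i) y = m := by
      have := Finset.card_filter_add_card_filter_not (s := (Finset.univ : Finset (Fin m)))
        (fun i => v i < -y)
      rw [Finset.card_univ, Fintype.card_fin] at this
      refine Eq.trans ?_ this
      rw [countLE]
      congr 3
      ext i
      rw [not_lt, neg_le]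
    constructor
    · intro h z hz hc
      have : countLE v z ≤ (Finset.univ.filter fun i : Fin m => v i < -y).card :=
        Finset.card_le_card fun i hi => by
          simp only [Finset.mem_filter, Finset.mem_univ, true_and] at hi ⊢
          linarith
      omega
    · intro h
      by_contra hc
      have hne : (Finset.univ.filter fun i : Fin m => v i < -y).Nonempty := by
        rw [← Finset.card_pos]; omega
      obtain ⟨i, hi, hmax⟩ := Finset.exists_max_image _ v hne
      simp only [Finset.mem_filter, Finset.mem_univ, true_and] at hi hmax
      refine h (v i) hi ?_
      have : (Finset.univ.filter fun i : Fin m => v i < -y).card ≤ countLE v (v i) :=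
        Finset.card_le_card fun j hj => by
          simp only [Finset.mem_filter, Finset.mem_univ, true_and] at hj ⊢
          exact hmax j hj
      omega
  refine eq_of_forall_ge_iff fun y => ?_
  rw [orderStat_le_iff hk hkm, hlt, neg_le]
  constructor
  · intro h
    by_contra hc
    rw [not_le] at hc
    obtain ⟨z, hz1, hz2⟩ := exists_between hc
    exact h z hz2 ((orderStat_le_iff (by omega) (by omega) v z).mp hz1.le)
  · intro h z hz hc
    have := (orderStat_le_iff (by omega) (by omega) v z).mpr hc
    linarith

theorem sampleMedian_neg {m : ℕ} (hm : 1 ≤ m) (v : Fin m → ℝ) :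
    sampleMedian (fun i => -v i) = -sampleMedian v := by
  unfold sampleMedian
  split_ifs with h
  · obtain ⟨j, hj⟩ := h
    rw [orderStat_neg (by omega) (by omega)]
    congr 2
    omega
  · obtain ⟨j, hj⟩ := Nat.not_odd_iff_even.mp h
    rw [orderStat_neg (by omega) (by omega), orderStat_neg (by omega) (by omega),
      show m + 1 - m / 2 = m / 2 + 1 by omega, show m + 1 - (m / 2 + 1) = m / 2 by omega]
    ring

theorem sampleMedian_odd_le_iff (k : ℕ) (v : Fin (2 * k + 1) → ℝ) (y : ℝ) :
    sampleMedian v ≤ y ↔ k + 1 ≤ countLE v y := by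
  have ho : Odd (2 * k + 1) := odd_two_mul_add_one k
  rw [sampleMedian, if_pos ho, show (2 * k + 1 + 1) / 2 = k + 1 by omega,
    orderStat_le_iff (by omega) (by omega)]

/-- If the median of an even sample is at most `y`, then either more than half of the sample is, or
the two middle order statistics lie on both sides of `y`, the lower one being farther from `y`. -/
theorem sampleMedian_even_le_imp (l : ℕ) (v : Fin (2 * l + 1 + 1) → ℝ) (y : ℝ)
    (h : sampleMedian v ≤ y) :
    l + 2 ≤ countLE v y ∨ ∃ i : Fin (2 * l + 1 + 1), ∃ T ∈ Finset.powersetCard (l + 1)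
      (Finset.univ : Finset (Fin (2 * l + 1))), y < v i ∧
      (∀ j, if j ∈ T then v (i.succAbove j) ≤ 2 * y - v i else v i ≤ v (i.succAbove j)) := by
  have ho : ¬ Odd (2 * l + 1 + 1) := by
    rw [Nat.not_odd_iff_even]
    exact ⟨l + 1, by ring⟩
  rw [sampleMedian, if_neg ho, show (2 * l + 1 + 1) / 2 = l + 1 by omega] at h
  rw [← orderStat_le_iff (by omega) (by omega)]
  by_cases hc : orderStat v (l + 2) ≤ y
  · exact Or.inl hc
  right
  rw [not_le] at hc
  set σ := Tuple.sort v with hσ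
  have hmono : ∀ a b, a ≤ b → v (σ a) ≤ v (σ b) := fun a b hab => Tuple.monotone_sort v hab
  have hl1 : l < 2 * l + 1 + 1 := by omega
  have hl2 : l + 1 < 2 * l + 1 + 1 := by omega
  have e1 : orderStat v (l + 1) = v (σ ⟨l, hl1⟩) := by simp [orderStat, hl1, hσ]
  have e2 : orderStat v (l + 1 + 1) = v (σ ⟨l + 1, hl2⟩) := by simp [orderStat, hl2, hσ]
  rw [e1, e2] at h
  rw [show l + 2 = l + 1 + 1 by ring, e2] at hc
  set i := σ ⟨l + 1, hl2⟩ with hi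
  -- The index `i` carries the upper middle observation and `T` collects the `l + 1` observations
  -- sorted before it. The average of the two middle values being at most `y` bounds the lower one
  -- by `2y - vᵢ`.
  refine ⟨i, Finset.univ.filter fun j => (σ.symm (i.succAbove j) : ℕ) < l + 1, ?_, hc, ?_⟩
  · rw [Finset.mem_powersetCard]
    refine ⟨Finset.subset_univ _, ?_⟩
    have h1 : ((Finset.univ.filter fun j => (σ.symm (i.succAbove j) : ℕ) < l + 1).map
        (Fin.succAboveEmb i)).map σ.symm.toEmbedding
        = Finset.Iio (⟨l + 1, hl2⟩ : Fin (2 * l + 1 + 1)) := by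
      ext a
      simp only [Finset.mem_map, Finset.mem_filter, Finset.mem_univ, true_and, Finset.mem_Iio]
      constructor
      · rintro ⟨b, ⟨j, hj, rfl⟩, rfl⟩
        exact hj
      · intro ha
        have hne : σ a ≠ i := fun h => by
          have := σ.injective h
          rw [this] at ha
          exact lt_irrefl _ ha
        obtain ⟨j, hj⟩ := Fin.exists_succAbove_eq hne
        refine ⟨σ a, ⟨j, ?_, hj⟩, by simp⟩
        rw [hj, Equiv.symm_apply_apply]
        exact ha
    have h2 := congrArg Finset.card h1
    rw [Finset.card_map, Finset.card_map, Fin.card_Iio] at h2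
    exact h2
  · intro j
    have hj : v (i.succAbove j) = v (σ (σ.symm (i.succAbove j))) := by rw [Equiv.apply_symm_apply]
    simp only [Finset.mem_filter, Finset.mem_univ, true_and]
    split_ifs with hlt
    · have : v (i.succAbove j) ≤ v (σ ⟨l, hl1⟩) := by
        rw [hj]
        exact hmono _ _ (by rw [Fin.le_def]; simp only; omega)
      linarith
    · rw [hj]
      exact hmono _ _ (by rw [Fin.le_def]; simp only; omega)

/-! ### Binomial tails and the uniform median -/

/-- The probability that a binomial variable with parameters `m` and `u` is at least `a`. -/
noncomputable def binomialTail (m a : ℕ) (u : ℝ) : ℝ :=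
  ∑ j ∈ Finset.Ico a (m + 1), (m.choose j : ℝ) * u ^ j * (1 - u) ^ (m - j)

theorem binomialTail_eq_eval (m a : ℕ) (u : ℝ) :
    binomialTail m a u = (∑ j ∈ Finset.Ico a (m + 1), bernsteinPolynomial ℝ m j).eval u := by
  rw [binomialTail, Polynomial.eval_finsetSum]
  refine Finset.sum_congr rfl fun j _ => ?_
  simp [bernsteinPolynomial]

/-- Derivatives of Bernstein polynomials are differences of neighbouring ones, so the derivative of
the tail telescopes to a single term. -/
theorem hasDerivAt_binomialTail {m a : ℕ} (ha : a ≤ m) (u : ℝ) :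
    HasDerivAt (binomialTail (m + 1) (a + 1))
      ((m + 1 : ℝ) * ((m.choose a : ℝ) * u ^ a * (1 - u) ^ (m - a))) u := by
  have e : binomialTail (m + 1) (a + 1)
      = fun u => (∑ j ∈ Finset.Ico (a + 1) (m + 1 + 1), bernsteinPolynomial ℝ (m + 1) j).eval u :=
    funext fun u => binomialTail_eq_eval _ _ u
  rw [e]
  refine (Polynomial.hasDerivAt _ u).congr_deriv ?_
  have h : Polynomial.derivative (∑ j ∈ Finset.Ico (a + 1) (m + 1 + 1), bernsteinPolynomial ℝ (m + 1) j)
      = (m + 1) * bernsteinPolynomial ℝ m a := by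
    rw [Polynomial.derivative_sum, ← Finset.sum_Ico_add' _ a (m + 1) 1]
    simp only [bernsteinPolynomial.derivative_succ_aux]
    rw [← Finset.mul_sum, Finset.sum_Ico_eq_sum_range]
    have := Finset.sum_range_sub' (fun i => bernsteinPolynomial ℝ m (a + i)) (m + 1 - a)
    simp only [← add_assoc] at this
    rw [this, show a + (m + 1 - a) = m + 1 by omega,
      bernsteinPolynomial.eq_zero_of_lt ℝ (Nat.lt_succ_self m), add_zero, sub_zero]
  rw [h]
  simp [bernsteinPolynomial]

theorem binomialTail_zero (m a : ℕ) : binomialTail m (a + 1) 0 = 0 := by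
  refine Finset.sum_eq_zero fun j hj => ?_
  rw [Finset.mem_Ico] at hj
  rw [zero_pow (by omega)]
  ring

theorem binomialTail_one {m a : ℕ} (ha : a ≤ m) : binomialTail m a 1 = 1 := by
  rw [binomialTail, Finset.sum_eq_single m]
  · simp
  · intro j hj hne
    rw [Finset.mem_Ico] at hj
    rw [sub_self, zero_pow (by omega), mul_zero]
  · intro h
    exact absurd (Finset.mem_Ico.mpr ⟨ha, by omega⟩) h

/-- The distribution function of the median of `2 k + 1` uniform variables. -/
noncomputable def medianPoly (k : ℕ) (u : ℝ) : ℝ := binomialTail (2 * k + 1) (k + 1) u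

theorem hasDerivAt_medianPoly (k : ℕ) (u : ℝ) :
    HasDerivAt (medianPoly k) ((2 * k + 1 : ℝ) * (k.centralBinom * (u * (1 - u)) ^ k)) u := by
  refine (hasDerivAt_binomialTail (m := 2 * k) (a := k) (by omega) u).congr_deriv ?_
  rw [show 2 * k - k = k by omega, mul_pow, Nat.centralBinom_eq_two_mul_choose]
  push_cast
  ring

/-- The value `1/2` at the centre follows from the endpoint values `0` and `1` and the evenness of
`(1/4 - s²)^k`; no beta integral has to be evaluated. -/
theorem medianPoly_eq (k : ℕ) (u : ℝ) :
    medianPoly k u = 1 / 2 + (2 * k + 1 : ℝ) * k.centralBinom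
      * ∫ s in (0 : ℝ)..(u - 1 / 2), (1 / 4 - s ^ 2) ^ k := by
  have hd : ∀ s : ℝ, HasDerivAt (fun s => medianPoly k (s + 1 / 2))
      ((2 * k + 1 : ℝ) * k.centralBinom * (1 / 4 - s ^ 2) ^ k) s := fun s => by
    refine ((hasDerivAt_medianPoly k (s + 1 / 2)).comp_add_const s (1 / 2)).congr_deriv ?_
    rw [show (s + 1 / 2) * (1 - (s + 1 / 2)) = 1 / 4 - s ^ 2 by ring]
    ring
  have hcont : Continuous fun s : ℝ => (2 * k + 1 : ℝ) * k.centralBinom * (1 / 4 - s ^ 2) ^ k := by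
    fun_prop
  have hint : ∀ a b : ℝ, medianPoly k (b + 1 / 2) - medianPoly k (a + 1 / 2)
      = (2 * k + 1 : ℝ) * k.centralBinom * ∫ s in a..b, (1 / 4 - s ^ 2) ^ k := fun a b => by
    rw [← intervalIntegral.integral_const_mul]
    exact (intervalIntegral.integral_eq_sub_of_hasDerivAt (fun s _ => hd s)
      (hcont.intervalIntegrable _ _)).symm
  have h1 := hint 0 (1 / 2)
  have h2 := hint (-(1 / 2)) 0
  have h3 : ∫ s in (-(1 / 2) : ℝ)..0, (1 / 4 - s ^ 2) ^ k
      = ∫ s in (0 : ℝ)..(1 / 2), (1 / 4 - s ^ 2) ^ k := by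
    have := intervalIntegral.integral_comp_neg (a := (0 : ℝ)) (b := 1 / 2)
      (fun s : ℝ => (1 / 4 - s ^ 2) ^ k)
    simp only [neg_sq, neg_zero] at this
    exact this.symm
  have h4 : medianPoly k (1 / 2 + 1 / 2) = 1 := by
    rw [show (1 / 2 + 1 / 2 : ℝ) = 1 by norm_num]
    exact binomialTail_one (by omega)
  have h5 : medianPoly k (-(1 / 2) + 1 / 2) = 0 := by
    rw [show (-(1 / 2) + 1 / 2 : ℝ) = 0 by norm_num]
    exact binomialTail_zero _ _
  have h6 := hint 0 (u - 1 / 2)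
  rw [show u - 1 / 2 + 1 / 2 = u by ring] at h6
  rw [h3] at h2
  linarith

theorem medianPoly_one_sub (k : ℕ) (u : ℝ) : medianPoly k (1 - u) = 1 - medianPoly k u := by
  rw [medianPoly_eq, medianPoly_eq]
  have := intervalIntegral.integral_comp_neg (a := (0 : ℝ)) (b := u - 1 / 2)
    (fun s : ℝ => (1 / 4 - s ^ 2) ^ k)
  simp only [neg_sq, neg_zero] at this
  rw [show 1 - u - 1 / 2 = -(u - 1 / 2) by ring, intervalIntegral.integral_symm, this.symm]
  ring

/-- Adding one observation to a sample of even size. -/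
theorem binomialTail_even_add (l : ℕ) (u : ℝ) :
    binomialTail (2 * l + 1 + 1) (l + 2) u + u * ((l + 1).centralBinom * (u * (1 - u)) ^ (l + 1))
      = medianPoly (l + 1) u := by
  have hcb : ((2 * l + 1).choose (l + 1) : ℝ) * 2 = (l + 1).centralBinom := by
    have h1 := Nat.choose_symm_half l
    have h2 : (2 * (l + 1)).choose (l + 1) = (2 * l + 1).choose l + (2 * l + 1).choose (l + 1) := by
      rw [show 2 * (l + 1) = 2 * l + 1 + 1 by ring, Nat.choose_succ_succ]
    rw [Nat.centralBinom_eq_two_mul_choose, h2, ← h1]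
    push_cast
    ring
  -- Both sides have the same derivative and vanish at `0`. In probabilistic terms, the additional
  -- observation matters only when exactly half of the even sample lies below.
  have hd : ∀ v : ℝ, HasDerivAt (fun u => binomialTail (2 * l + 1 + 1) (l + 2) u
      + u * ((l + 1).centralBinom * (u * (1 - u)) ^ (l + 1)) - medianPoly (l + 1) u) 0 v := fun v => by
    have h1 := hasDerivAt_binomialTail (m := 2 * l + 1) (a := l + 1) (by omega) v
    have h2 : HasDerivAt (fun u : ℝ => u * (1 - u)) (1 - 2 * v) v :=
      ((hasDerivAt_id v).mul ((hasDerivAt_id v).const_sub 1)).congr_deriv (by simp; ring)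
    have h3 := (hasDerivAt_id v).mul ((h2.pow (l + 1)).const_mul ((l + 1).centralBinom : ℝ))
    refine ((h1.add h3).sub (hasDerivAt_medianPoly (l + 1) v)).congr_deriv ?_
    rw [← hcb, show 2 * l + 1 - (l + 1) = l by omega, show l + 1 - 1 = l by omega]
    simp only [id, Pi.pow_apply, mul_pow]
    push_cast
    ring
  have hconst := is_const_of_deriv_eq_zero (fun v => (hd v).differentiableAt) (fun v => (hd v).deriv)
    u 0
  have h0 : binomialTail (2 * l + 1 + 1) (l + 2) 0 = 0 := binomialTail_zero _ _
  have h0' : medianPoly (l + 1) 0 = 0 := binomialTail_zero _ _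
  simp only [h0, h0', zero_mul, add_zero, sub_zero] at hconst
  linarith

/-! ### The law of the sample median -/

section SampleLaw

variable (μ : Measure ℝ) [IsProbabilityMeasure μ]

theorem measureReal_Ioi_eq (y : ℝ) : μ.real (Set.Ioi y) = 1 - μ.real (Set.Iic y) := by
  rw [← Set.compl_Iic, probReal_compl_eq_one_sub measurableSet_Iic]

theorem measureReal_pi_ite {m : ℕ} (S : Finset (Fin m)) (A B : Set ℝ) :
    (Measure.pi fun _ : Fin m => μ).real (Set.univ.pi fun i => if i ∈ S then A else B)
      = μ.real A ^ S.card * μ.real B ^ (m - S.card) := by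
  rw [measureReal_def, Measure.pi_pi, ENNReal.toReal_prod]
  have : ∀ i, (μ (if i ∈ S then A else B)).toReal = if i ∈ S then μ.real A else μ.real B := fun i => by
    split_ifs <;> rfl
  simp only [this]
  rw [Finset.prod_ite, Finset.prod_const, Finset.prod_const, Finset.filter_mem_eq_inter,
    Finset.univ_inter]
  congr 2
  rw [Finset.filter_not, Finset.filter_mem_eq_inter, Finset.univ_inter,
    Finset.card_sdiff_of_subset (Finset.subset_univ _), Finset.card_univ, Fintype.card_fin]

theorem measureReal_countLE_eq (m j : ℕ) (y : ℝ) :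
    (Measure.pi fun _ : Fin m => μ).real {v | countLE v y = j}
      = (m.choose j : ℝ) * μ.real (Set.Iic y) ^ j * (1 - μ.real (Set.Iic y)) ^ (m - j) := by
  have hset : {v : Fin m → ℝ | countLE v y = j} = ⋃ S ∈ Finset.powersetCard j
      (Finset.univ : Finset (Fin m)), Set.univ.pi fun i => if i ∈ S then Set.Iic y else Set.Ioi y := by
    ext v
    simp only [Set.mem_ofPred_eq, Set.mem_iUnion, Finset.mem_powersetCard, Set.mem_univ_pi, exists_prop]
    constructor
    · intro h
      refine ⟨Finset.univ.filter fun i => v i ≤ y, ⟨Finset.subset_univ _, h⟩, fun i => ?_⟩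
      simp only [Finset.mem_filter, Finset.mem_univ, true_and]
      split_ifs with hi
      · exact hi
      · exact not_le.mp hi
    · rintro ⟨S, ⟨-, hS⟩, h⟩
      rw [← hS, countLE]
      congr 1
      ext i
      simp only [Finset.mem_filter, Finset.mem_univ, true_and]
      have := h i
      split_ifs at this with hi
      · exact ⟨fun _ => hi, fun _ => this⟩
      · exact ⟨fun h' => absurd h' (not_le.mpr this), fun h' => absurd h' hi⟩
  have hbox : ∀ S : Finset (Fin m), MeasurableSet
      (Set.univ.pi fun i => if i ∈ S then Set.Iic y else Set.Ioi y) := fun S =>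
    MeasurableSet.univ_pi fun i => by
      split_ifs
      · exact measurableSet_Iic
      · exact measurableSet_Ioi
  rw [hset, measureReal_biUnion_finset _ fun S _ => hbox S]
  · have : ∀ S ∈ Finset.powersetCard j (Finset.univ : Finset (Fin m)),
        (Measure.pi fun _ : Fin m => μ).real
          (Set.univ.pi fun i => if i ∈ S then Set.Iic y else Set.Ioi y)
        = μ.real (Set.Iic y) ^ j * (1 - μ.real (Set.Iic y)) ^ (m - j) := fun S hS => by
      rw [measureReal_pi_ite, (Finset.mem_powersetCard.mp hS).2, measureReal_Ioi_eq]
    rw [Finset.sum_congr rfl this, Finset.sum_const, Finset.card_powersetCard, Finset.card_univ,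
      Fintype.card_fin, nsmul_eq_mul, mul_assoc]
  · intro S _ T _ hST
    rw [Function.onFun, Set.disjoint_left]
    intro v hv hv'
    apply hST
    ext i
    have h1 := hv i (Set.mem_univ i)
    have h2 := hv' i (Set.mem_univ i)
    simp only at h1 h2
    split_ifs at h1 h2 with h3 h4 h4
    · exact ⟨fun _ => h4, fun _ => h3⟩
    · exact absurd h1 (not_le.mpr (Set.mem_Ioi.mp h2))
    · exact absurd h2 (not_le.mpr (Set.mem_Ioi.mp h1))
    · exact ⟨fun h => absurd h h3, fun h => absurd h h4⟩

theorem measureReal_le_countLE (m a : ℕ) (y : ℝ) :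
    (Measure.pi fun _ : Fin m => μ).real {v | a ≤ countLE v y}
      = binomialTail m a (μ.real (Set.Iic y)) := by
  have hset : {v : Fin m → ℝ | a ≤ countLE v y}
      = ⋃ j ∈ Finset.Ico a (m + 1), {v | countLE v y = j} := by
    ext v
    simp only [Set.mem_ofPred_eq, Set.mem_iUnion, Finset.mem_Ico, exists_prop, exists_eq_right']
    have : countLE v y ≤ m := (Finset.card_le_univ _).trans (by rw [Fintype.card_fin])
    constructor <;> intro h <;> omega
  have hmeas : ∀ j, MeasurableSet {v : Fin m → ℝ | countLE v y = j} := fun j => by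
    have : {v : Fin m → ℝ | countLE v y = j}
        = {v | j ≤ countLE v y} \ {v | j + 1 ≤ countLE v y} := by
      ext v
      simp only [Set.mem_ofPred_eq, Set.mem_sdiff]
      omega
    rw [this]
    exact (measurableSet_le_countLE _ _ _).diff (measurableSet_le_countLE _ _ _)
  rw [hset, measureReal_biUnion_finset _ fun j _ => hmeas j]
  · exact Finset.sum_congr rfl fun j _ => measureReal_countLE_eq μ m j y
  · intro i _ j _ hij
    rw [Function.onFun, Set.disjoint_left]
    rintro v rfl h
    exact hij h

theorem measureReal_sampleMedian_odd (k : ℕ) (y : ℝ) :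
    (Measure.pi fun _ : Fin (2 * k + 1) => μ).real {v | sampleMedian v ≤ y}
      = medianPoly k (μ.real (Set.Iic y)) := by
  simp only [sampleMedian_odd_le_iff]
  exact measureReal_le_countLE μ _ _ y

/-- Disintegration along the coordinate `i`: given its value `w`, the other coordinates are
independent and the event is a box. -/
theorem measureReal_gap_event (n : ℕ) (i : Fin (n + 1)) (T : Finset (Fin n)) (y : ℝ) :
    (Measure.pi fun _ : Fin (n + 1) => μ).real {v | y < v i ∧
      ∀ j, if j ∈ T then v (i.succAbove j) ≤ 2 * y - v i else v i ≤ v (i.succAbove j)}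
    = ∫ w in Set.Ioi y, μ.real (Set.Iic (2 * y - w)) ^ T.card
        * μ.real (Set.Ici w) ^ (n - T.card) ∂μ := by
  set E : Set (ℝ × (Fin n → ℝ)) := {q | y < q.1 ∧
    ∀ j, if j ∈ T then q.2 j ≤ 2 * y - q.1 else q.1 ≤ q.2 j} with hE
  have hEm : MeasurableSet E := by
    have : E = {q | y < q.1} ∩ ⋂ j, {q | if j ∈ T then q.2 j ≤ 2 * y - q.1 else q.1 ≤ q.2 j} := by
      ext q
      simp [hE]
    rw [this]
    refine (measurableSet_lt measurable_const measurable_fst).inter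
      (MeasurableSet.iInter fun j => ?_)
    split_ifs
    · exact measurableSet_le (by fun_prop) (by fun_prop)
    · exact measurableSet_le (by fun_prop) (by fun_prop)
  have hmp := measurePreserving_piFinSuccAbove (fun _ : Fin (n + 1) => μ) i
  have hpre : {v : Fin (n + 1) → ℝ | y < v i ∧
      ∀ j, if j ∈ T then v (i.succAbove j) ≤ 2 * y - v i else v i ≤ v (i.succAbove j)}
      = (MeasurableEquiv.piFinSuccAbove (fun _ => ℝ) i) ⁻¹' E := by
    ext v
    rfl
  rw [hpre, measureReal_def, hmp.measure_preimage hEm.nullMeasurableSet, Measure.prod_apply hEm,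
    ← integral_toReal (measurable_measure_prodMk_left hEm).aemeasurable
      (Eventually.of_forall fun _ => measure_lt_top _ _), ← integral_indicator measurableSet_Ioi]
  simp only [← measureReal_def]
  congr 1
  funext w
  by_cases hw : y < w
  · rw [Set.indicator_of_mem (show w ∈ Set.Ioi y from hw), ← measureReal_pi_ite]
    congr 1
    ext x
    simp only [hE, Set.mem_preimage, Set.mem_ofPred_eq, hw, true_and, Set.mem_univ_pi]
    refine forall_congr' fun j => ?_
    split_ifs <;> rfl
  · rw [Set.indicator_of_notMem (show w ∉ Set.Ioi y from hw)]
    have : Prod.mk w ⁻¹' E = ∅ := by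
      ext x
      simp [hE, hw]
    rw [this, measureReal_empty]

/-- A union bound over the choices of `i` and `T`, all of equal probability; their number is `(2l+2)
C(2l+1, l+1) = (l+1) C(2l+2, l+1)`. Only an upper bound is needed, because the lower one will come
from symmetry. -/
theorem measureReal_sampleMedian_even_le (l : ℕ) (y : ℝ) :
    (Measure.pi fun _ : Fin (2 * l + 1 + 1) => μ).real {v | sampleMedian v ≤ y}
      ≤ binomialTail (2 * l + 1 + 1) (l + 2) (μ.real (Set.Iic y))
        + (l + 1) * (l + 1).centralBinom * ∫ w in Set.Ioi y, μ.real (Set.Iic (2 * y - w)) ^ (l + 1)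
          * μ.real (Set.Ici w) ^ l ∂μ := by
  have hsub : {v : Fin (2 * l + 1 + 1) → ℝ | sampleMedian v ≤ y} ⊆ {v | l + 2 ≤ countLE v y} ∪
      ⋃ i ∈ (Finset.univ : Finset (Fin (2 * l + 1 + 1))),
        ⋃ T ∈ Finset.powersetCard (l + 1) (Finset.univ : Finset (Fin (2 * l + 1))),
        {v | y < v i ∧ ∀ j, if j ∈ T then v (i.succAbove j) ≤ 2 * y - v i
          else v i ≤ v (i.succAbove j)} := by
    intro v hv
    rcases sampleMedian_even_le_imp l v y hv with h | ⟨i, T, hT, h⟩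
    · exact Or.inl h
    · refine Or.inr ?_
      simp only [Set.mem_iUnion]
      exact ⟨i, Finset.mem_univ i, T, hT, h⟩
  have hcb : ((2 * l + 1).choose (l + 1) : ℝ) * 2 = (l + 1).centralBinom := by
    have h1 := Nat.choose_symm_half l
    have h2 : (2 * (l + 1)).choose (l + 1) = (2 * l + 1).choose l + (2 * l + 1).choose (l + 1) := by
      rw [show 2 * (l + 1) = 2 * l + 1 + 1 by ring, Nat.choose_succ_succ]
    rw [Nat.centralBinom_eq_two_mul_choose, h2, ← h1]
    push_cast
    ring
  refine (measureReal_mono hsub).trans ((measureReal_union_le _ _).trans (add_le_add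
    (measureReal_le_countLE μ _ _ y).le ?_))
  refine (measureReal_biUnion_finset_le _ _).trans ((Finset.sum_le_sum fun i _ =>
    measureReal_biUnion_finset_le _ _).trans (le_of_eq ?_))
  have : ∀ i : Fin (2 * l + 1 + 1), ∀ T ∈ Finset.powersetCard (l + 1)
      (Finset.univ : Finset (Fin (2 * l + 1))), (Measure.pi fun _ : Fin (2 * l + 1 + 1) => μ).real
        {v | y < v i ∧ ∀ j, if j ∈ T then v (i.succAbove j) ≤ 2 * y - v i
          else v i ≤ v (i.succAbove j)}
      = ∫ w in Set.Ioi y, μ.real (Set.Iic (2 * y - w)) ^ (l + 1) * μ.real (Set.Ici w) ^ l ∂μ := by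
    intro i T hT
    rw [measureReal_gap_event, (Finset.mem_powersetCard.mp hT).2,
      show 2 * l + 1 - (l + 1) = l by omega]
  rw [Finset.sum_congr rfl fun i _ => Finset.sum_congr rfl (this i)]
  rw [Finset.sum_const, Finset.sum_const, Finset.card_powersetCard, Finset.card_univ,
    Finset.card_univ, Fintype.card_fin, Fintype.card_fin, nsmul_eq_mul, nsmul_eq_mul, ← hcb]
  push_cast
  ring

end SampleLaw

/-! ### The density and its distribution function near zero -/

/-- The probability measure on the line with density `p`. -/
noncomputable def densityMeasure (p : ℝ → ℝ) : Measure ℝ :=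
  volume.withDensity fun y => ENNReal.ofReal (p y)

/-- The distribution function of the probability measure with density `p`. -/
noncomputable def densityCDF (p : ℝ → ℝ) (s : ℝ) : ℝ := (densityMeasure p).real (Set.Iic s)

/-- A one-sided Taylor step: the bound is integrated from `ε` to `s` and `ε → 0+`, so only the right
limit at `0` enters and no derivative at `0` is required. -/
theorem abs_le_mul_pow_succ_of_abs_deriv_le {f f' : ℝ → ℝ} {x₀ K : ℝ} {j : ℕ} (hK : 0 ≤ K)
    (hd : ∀ s ∈ Set.Ioo 0 x₀, HasDerivAt f (f' s) s) (hb : ∀ s ∈ Set.Ioo 0 x₀, |f' s| ≤ K * s ^ j)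
    (hlim : Tendsto f (𝓝[>] 0) (𝓝 0)) : ∀ s ∈ Set.Ioo 0 x₀, |f s| ≤ K * s ^ (j + 1) := by
  intro s hs
  have h1 : ∀ ε ∈ Set.Ioo 0 s, |f s - f ε| ≤ K * s ^ j * (s - ε) := by
    intro ε hε
    have := Convex.norm_image_sub_le_of_norm_hasDerivWithin_le (f := f) (f' := f') (C := K * s ^ j)
      (s := Set.Icc ε s) (x := ε) (y := s)
      (fun z hz => (hd z ⟨hε.1.trans_le hz.1, hz.2.trans_lt hs.2⟩).hasDerivWithinAt)
      (fun z hz => (hb z ⟨hε.1.trans_le hz.1, hz.2.trans_lt hs.2⟩).trans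
        (mul_le_mul_of_nonneg_left (pow_le_pow_left₀ (hε.1.le.trans hz.1) hz.2 j) hK))
      (convex_Icc ε s) (Set.left_mem_Icc.mpr hε.2.le) (Set.right_mem_Icc.mpr hε.2.le)
    rwa [Real.norm_eq_abs, Real.norm_eq_abs, abs_of_pos (sub_pos.mpr hε.2)] at this
  have h2 : Tendsto (fun ε => |f s - f ε|) (𝓝[>] 0) (𝓝 |f s - 0|) :=
    (tendsto_const_nhds.sub hlim).abs
  have h3 : Tendsto (fun ε => K * s ^ j * (s - ε)) (𝓝[>] 0) (𝓝 (K * s ^ j * (s - 0))) :=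
    (tendsto_const_nhds.mul (tendsto_const_nhds.sub
      (tendsto_id.mono_left nhdsWithin_le_nhds)))
  have h4 := le_of_tendsto_of_tendsto h2 h3 (by
    filter_upwards [Ioo_mem_nhdsGT hs.1] with ε hε using h1 ε hε)
  rw [sub_zero, sub_zero] at h4
  exact h4.trans_eq (by ring)

theorem densityCDF_nonneg (p : ℝ → ℝ) (s : ℝ) : 0 ≤ densityCDF p s := measureReal_nonneg

namespace RegularSymmetricDensity

theorem isProbabilityMeasure {p : ℝ → ℝ} (hp : RegularSymmetricDensity p) : IsProbabilityMeasure (densityMeasure p) := by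
  refine ⟨?_⟩
  rw [densityMeasure, withDensity_apply _ MeasurableSet.univ, setLIntegral_univ]
  exact hp.lintegral_eq_one

theorem integrable {p : ℝ → ℝ} (hp : RegularSymmetricDensity p) : Integrable p := by
  refine ⟨hp.measurable.aestronglyMeasurable, ?_⟩
  rw [hasFiniteIntegral_iff_ofReal (Eventually.of_forall hp.nonneg), hp.lintegral_eq_one]
  exact ENNReal.one_lt_top

theorem cdf_eq_integral {p : ℝ → ℝ} (hp : RegularSymmetricDensity p) (s : ℝ) : densityCDF p s = ∫ t in Set.Iic s, p t := by
  rw [densityCDF, measureReal_def, densityMeasure, withDensity_apply _ measurableSet_Iic,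
    integral_eq_lintegral_of_nonneg_ae (Eventually.of_forall hp.nonneg)
      hp.measurable.aestronglyMeasurable]

theorem cdf_sub_cdf {p : ℝ → ℝ} (hp : RegularSymmetricDensity p) (a b : ℝ) : densityCDF p b - densityCDF p a = ∫ t in a..b, p t := by
  rw [hp.cdf_eq_integral, hp.cdf_eq_integral]
  exact intervalIntegral.integral_Iic_sub_Iic hp.integrable.integrableOn hp.integrable.integrableOn

theorem cdf_mono {p : ℝ → ℝ} (hp : RegularSymmetricDensity p) {a b : ℝ} (h : a ≤ b) : densityCDF p a ≤ densityCDF p b := by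
  have := hp.isProbabilityMeasure
  exact measureReal_mono (Set.Iic_subset_Iic.mpr h)

theorem cdf_le_one {p : ℝ → ℝ} (hp : RegularSymmetricDensity p) (s : ℝ) : densityCDF p s ≤ 1 := by
  have := hp.isProbabilityMeasure
  exact measureReal_le_one

theorem measureReal_Ici {p : ℝ → ℝ} (hp : RegularSymmetricDensity p) (s : ℝ) : (densityMeasure p).real (Set.Ici s) = 1 - densityCDF p s := by
  have := hp.isProbabilityMeasure
  rw [densityCDF, ← measureReal_Ioi_eq]
  refine measureReal_congr ?_
  exact (withDensity_absolutelyContinuous _ _).ae_eq Ioi_ae_eq_Ici.symm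

theorem measurePreserving_neg {p : ℝ → ℝ} (hp : RegularSymmetricDensity p) :
    MeasurePreserving (fun x : ℝ => -x) (densityMeasure p) (densityMeasure p) := by
  refine ⟨measurable_neg, ?_⟩
  ext s hs
  rw [Measure.map_apply measurable_neg hs, densityMeasure, withDensity_apply _ (measurable_neg hs),
    withDensity_apply _ hs]
  have := (Measure.measurePreserving_neg (volume : Measure ℝ)).setLIntegral_comp_preimage hs
    (f := fun y => ENNReal.ofReal (p y)) (by have := hp.measurable; fun_prop)
  rw [← this]
  refine lintegral_congr fun x => ?_
  rw [hp.symm]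

theorem cdf_neg {p : ℝ → ℝ} (hp : RegularSymmetricDensity p) (s : ℝ) : densityCDF p (-s) = 1 - densityCDF p s := by
  have := hp.isProbabilityMeasure
  rw [← hp.measureReal_Ici, densityCDF, measureReal_def, measureReal_def,
    ← hp.measurePreserving_neg.measure_preimage measurableSet_Iic.nullMeasurableSet]
  congr 2
  ext x
  simp

theorem cdf_zero {p : ℝ → ℝ} (hp : RegularSymmetricDensity p) : densityCDF p 0 = 1 / 2 := by
  have := hp.cdf_neg 0
  rw [neg_zero] at this
  linarith

theorem hasDerivAt_cdf {p : ℝ → ℝ} (hp : RegularSymmetricDensity p) {s : ℝ} (hs : ContinuousAt p s) : HasDerivAt (densityCDF p) (p s) s := by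
  have e : densityCDF p = fun z => densityCDF p 0 + ∫ t in (0 : ℝ)..z, p t := by
    funext z
    rw [← hp.cdf_sub_cdf]
    ring
  rw [e]
  exact (intervalIntegral.integral_hasDerivAt_right hp.integrable.intervalIntegrable
    (hp.measurable.stronglyMeasurable.stronglyMeasurableAtFilter) hs).const_add _

/-- Local behaviour of a regular symmetric density and of its distribution function. -/
theorem exists_local_expansion {p : ℝ → ℝ} (hp : RegularSymmetricDensity p)
    {p₁ p₂ : ℝ} (hp₁ : Tendsto (deriv p) (𝓝[>] 0) (𝓝 p₁))
    (hp₂ : Tendsto (iteratedDeriv 2 p) (𝓝[>] 0) (𝓝 p₂)) :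
    ∃ δ : ℝ, 0 < δ ∧ ∃ K : ℝ, 0 < K ∧ (∀ s, |s| < δ → p 0 / 2 ≤ p s ∧ p s ≤ 2 * p 0) ∧
      (∀ s t, |s| < δ → |t| < δ → |p s - p t| ≤ K * |s - t|) ∧
      ∀ s, |s| < δ → |densityCDF p s - 1 / 2 - (p 0 * s + p₁ / 2 * (s * |s|) + p₂ / 6 * s ^ 3)|
        ≤ K * s ^ 4 := by
  obtain ⟨x₀, hx₀, hsm, K₀, hK₀⟩ := hp.smooth
  have hder : ∀ k : ℕ, k < 3 → ∀ s ∈ Set.Ioo 0 x₀,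
      HasDerivAt (iteratedDeriv k p) (iteratedDeriv (k + 1) p s) s := by
    intro k hk s hs
    rw [iteratedDeriv_succ]
    refine DifferentiableAt.hasDerivAt ?_
    have h1 := ((hsm.differentiableOn_iteratedDerivWithin (m := k) (by exact_mod_cast hk)
      isOpen_Ioo.uniqueDiffOn) s hs).differentiableAt (isOpen_Ioo.mem_nhds hs)
    refine h1.congr_of_eventuallyEq ?_
    filter_upwards [isOpen_Ioo.mem_nhds hs] with z hz
    exact (iteratedDerivWithin_of_isOpen isOpen_Ioo hz).symm
  have hd0 : ∀ s ∈ Set.Ioo 0 x₀, HasDerivAt p (deriv p s) s := fun s hs => by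
    have := hder 0 (by norm_num) s hs
    rwa [iteratedDeriv_zero, zero_add, iteratedDeriv_one] at this
  have hd1 : ∀ s ∈ Set.Ioo 0 x₀, HasDerivAt (deriv p) (iteratedDeriv 2 p s) s := fun s hs => by
    have := hder 1 (by norm_num) s hs
    rwa [iteratedDeriv_one] at this
  have hd2 := hder 2 (by norm_num)
  set K := max K₀ 1 with hK
  have hKpos : 0 < K := lt_of_lt_of_le one_pos (le_max_right _ _)
  have hpow : ∀ j : ℕ, Tendsto (fun s : ℝ => s ^ (j + 1)) (𝓝[>] 0) (𝓝 0) := fun j => by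
    have : Tendsto (fun s : ℝ => s ^ (j + 1)) (𝓝 0) (𝓝 (0 ^ (j + 1))) :=
      (continuous_pow (j + 1)).tendsto 0
    rw [zero_pow (by omega)] at this
    exact this.mono_left nhdsWithin_le_nhds
  have hp0 : Tendsto p (𝓝[>] 0) (𝓝 (p 0)) := hp.continuousAt_zero.tendsto.mono_left
    nhdsWithin_le_nhds
  -- Starting from the bounded third derivative, three such steps give the quadratic expansion of
  -- `p` on the right of `0`.
  have b1 := abs_le_mul_pow_succ_of_abs_deriv_le (f := fun s => iteratedDeriv 2 p s - p₂)
    (f' := iteratedDeriv 3 p) (j := 0) (x₀ := x₀) hKpos.le (fun s hs => (hd2 s hs).sub_const p₂)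
    (fun s hs => by
      rw [pow_zero, mul_one]
      exact (hK₀ 3 (by norm_num) (by norm_num) s hs).trans (le_max_left _ _))
    (by simpa using hp₂.sub_const p₂)
  have b2 := abs_le_mul_pow_succ_of_abs_deriv_le (f := fun s => deriv p s - p₁ - p₂ * s)
    (f' := fun s => iteratedDeriv 2 p s - p₂) (j := 0 + 1) (x₀ := x₀) hKpos.le (fun s hs => by
      have := ((hd1 s hs).sub_const p₁).sub ((hasDerivAt_id s).const_mul p₂)
      exact this.congr_deriv (by simp)) b1 (by
      have := (hp₁.sub_const p₁).sub ((hpow 0).const_mul p₂)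
      simpa using this)
  have b3 := abs_le_mul_pow_succ_of_abs_deriv_le (f := fun s => p s - p 0 - p₁ * s - p₂ / 2 * s ^ 2)
    (f' := fun s => deriv p s - p₁ - p₂ * s) (j := 0 + 1 + 1) (x₀ := x₀) hKpos.le (fun s hs => by
      have := (((hd0 s hs).sub_const (p 0)).sub ((hasDerivAt_id s).const_mul p₁)).sub
        ((hasDerivAt_pow 2 s).const_mul (p₂ / 2))
      exact this.congr_deriv (by simp; ring)) b2 (by
      have := ((hp0.sub_const (p 0)).sub ((hpow 0).const_mul p₁)).sub ((hpow 1).const_mul (p₂ / 2))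
      simpa using this)
  have b0 := abs_le_mul_pow_succ_of_abs_deriv_le (f := fun s => p s - p 0)
    (f' := deriv p) (j := 0) (x₀ := x₀) hKpos.le (fun s hs => (hd0 s hs).sub_const (p 0))
    (fun s hs => by
      have := hK₀ 1 le_rfl (by norm_num) s hs
      rw [iteratedDeriv_one] at this
      rw [pow_zero, mul_one]
      exact this.trans (le_max_left _ _))
    (by simpa using hp0.sub_const (p 0))
  simp only [zero_add, pow_one] at b0 b3
  have habs : ∀ s, p |s| = p s := fun s => by
    rcases abs_choice s with h | h <;> rw [h]
    exact hp.symm s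
  have lip0 : ∀ s ∈ Set.Ioo 0 x₀, ∀ t ∈ Set.Ioo 0 x₀, |p s - p t| ≤ K * |s - t| := by
    intro s hs t ht
    have := Convex.norm_image_sub_le_of_norm_hasDerivWithin_le (f := p) (f' := deriv p) (C := K)
      (s := Set.Ioo 0 x₀) (x := t) (y := s) (fun z hz => (hd0 z hz).hasDerivWithinAt)
      (fun z hz => by
        have := hK₀ 1 le_rfl (by norm_num) z hz
        rw [iteratedDeriv_one] at this
        exact this.trans (le_max_left _ _)) (convex_Ioo 0 x₀) ht hs
    exact this
  -- By symmetry `p s = p |s|`, so the Lipschitz bound passes from the right half to both sides even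
  -- though `p` may have a corner at `0`.
  have lip : ∀ s t, |s| < x₀ → |t| < x₀ → |p s - p t| ≤ K * |s - t| := by
    intro s t hs ht
    refine le_trans ?_ (mul_le_mul_of_nonneg_left (abs_abs_sub_abs_le_abs_sub s t) hKpos.le)
    rw [← habs s, ← habs t]
    rcases (abs_nonneg s).eq_or_lt with h | h
    · rw [← h]
      rcases (abs_nonneg t).eq_or_lt with h' | h'
      · rw [← h']; simp
      · rw [abs_sub_comm, zero_sub, abs_neg, abs_abs]
        exact b0 _ ⟨h', ht⟩
    · rcases (abs_nonneg t).eq_or_lt with h' | h'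
      · rw [← h', sub_zero, abs_abs]
        exact b0 _ ⟨h, hs⟩
      · exact lip0 _ ⟨h, hs⟩ _ ⟨h', ht⟩
  have hF : ∀ s ∈ Set.Ico 0 x₀, |densityCDF p s - 1 / 2 - (p 0 * s + p₁ / 2 * s ^ 2
      + p₂ / 6 * s ^ 3)| ≤ K * s ^ 4 := by
    intro s hs
    have h1 := hp.cdf_sub_cdf 0 s
    rw [hp.cdf_zero] at h1
    have h2 : ∫ t in (0 : ℝ)..s, (p 0 + p₁ * t + p₂ / 2 * t ^ 2)
        = p 0 * s + p₁ / 2 * s ^ 2 + p₂ / 6 * s ^ 3 := by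
      have hi : ∀ f : ℝ → ℝ, Continuous f → IntervalIntegrable f volume 0 s :=
        fun f hf => hf.intervalIntegrable _ _
      rw [intervalIntegral.integral_add (hi _ (by fun_prop)) (hi _ (by fun_prop)),
        intervalIntegral.integral_add (hi _ (by fun_prop)) (hi _ (by fun_prop)),
        intervalIntegral.integral_const_mul, intervalIntegral.integral_const_mul, integral_id,
        integral_pow, intervalIntegral.integral_const]
      simp only [smul_eq_mul]
      push_cast
      ring
    have hint : IntervalIntegrable (fun t : ℝ => p 0 + p₁ * t + p₂ / 2 * t ^ 2) volume 0 s :=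
      Continuous.intervalIntegrable (by fun_prop) _ _
    rw [h1, ← h2, ← intervalIntegral.integral_sub hp.integrable.intervalIntegrable hint,
      ← Real.norm_eq_abs]
    refine (intervalIntegral.norm_integral_le_of_norm_le_const (C := K * s ^ 3) fun t ht => ?_).trans
      (le_of_eq ?_)
    · rw [Set.uIoc_of_le hs.1] at ht
      rw [Real.norm_eq_abs, show p t - (p 0 + p₁ * t + p₂ / 2 * t ^ 2)
        = p t - p 0 - p₁ * t - p₂ / 2 * t ^ 2 by ring]
      exact (b3 t ⟨ht.1, ht.2.trans_lt hs.2⟩).trans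
        (mul_le_mul_of_nonneg_left (pow_le_pow_left₀ ht.1.le ht.2 3) hKpos.le)
    · rw [sub_zero, abs_of_nonneg hs.1]
      ring
  have hδ : 0 < p 0 / (2 * K) := by have := hp.pos; positivity
  refine ⟨min x₀ (p 0 / (2 * K)), lt_min hx₀ hδ, K, hKpos, fun s hs => ?_, fun s t hs ht =>
    lip s t (hs.trans_le (min_le_left _ _)) (ht.trans_le (min_le_left _ _)), fun s hs => ?_⟩
  · have h1 := lip s 0 (hs.trans_le (min_le_left _ _)) (by rwa [abs_zero])
    rw [sub_zero] at h1
    have h2 : K * |s| ≤ p 0 / 2 := by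
      have := mul_le_mul_of_nonneg_left (hs.trans_le (min_le_right _ _)).le hKpos.le
      rwa [show K * (p 0 / (2 * K)) = p 0 / 2 by field_simp] at this
    have h3 := abs_le.mp (h1.trans h2)
    have := hp.pos
    constructor <;> linarith [h3.1, h3.2]
  · have hs' := hs.trans_le (min_le_left _ _)
    rcases le_total 0 s with h | h
    · rw [abs_of_nonneg h] at hs' ⊢
      rw [← pow_two]
      exact hF s ⟨h, hs'⟩
    · rw [abs_of_nonpos h] at hs' ⊢
      have h1 := hF (-s) ⟨by linarith, hs'⟩
      rw [hp.cdf_neg, ← abs_neg] at h1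
      convert h1 using 2 <;> ring

end RegularSymmetricDensity

/-! ### Central binomial coefficients -/

theorem centralBinom_div_four_pow (k : ℕ) :
    (k.centralBinom : ℝ) / 4 ^ k = Real.Gamma (k + 1 / 2) / (Real.sqrt Real.pi * Real.Gamma (k + 1)) := by
  induction k with
  | zero =>
    have : Real.sqrt Real.pi ≠ 0 := (Real.sqrt_pos.mpr Real.pi_pos).ne'
    simp only [Nat.centralBinom_zero, Nat.cast_zero, zero_add, Real.Gamma_one_half_eq, Real.Gamma_one]
    field_simp
    simp
  | succ k ih =>
    have h1 : ((k : ℝ) + 1) * (k + 1).centralBinom = 2 * (2 * k + 1) * k.centralBinom := by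
      exact_mod_cast Nat.succ_mul_centralBinom_succ k
    have hk : (0 : ℝ) < (k : ℝ) + 1 := by positivity
    push_cast
    rw [show (k : ℝ) + 1 + 1 / 2 = (k + 1 / 2) + 1 by ring, Real.Gamma_add_one (by positivity),
      Real.Gamma_add_one hk.ne', pow_succ]
    have h2 : ((k + 1).centralBinom : ℝ) / (4 ^ k * 4)
        = (k.centralBinom : ℝ) / 4 ^ k * ((k + 1 / 2) / (k + 1)) := by
      have : ((k + 1).centralBinom : ℝ) = 2 * (2 * k + 1) * k.centralBinom / (k + 1) := by
        rw [eq_div_iff hk.ne', ← h1]; ring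
      rw [this]
      field_simp
      ring
    have : Real.sqrt Real.pi ≠ 0 := (Real.sqrt_pos.mpr Real.pi_pos).ne'
    have : Real.Gamma (k + 1) ≠ 0 := (Real.Gamma_pos_of_pos hk).ne'
    rw [h2, ih]
    field_simp

/-- The case `s = 1/2` of the Gamma ratio, where `s(s-1)/2 = -1/8`. -/
theorem exists_abs_centralBinom_sub_le :
    ∃ C : ℝ, 0 < C ∧ ∀ k : ℕ, 1 ≤ k →
      |(k.centralBinom : ℝ) / 4 ^ k * (Real.sqrt Real.pi * Real.sqrt k) - (1 - 1 / 8 / k)|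
        ≤ C * (1 / (k : ℝ)) ^ 2 := by
  obtain ⟨C, hC, h⟩ := exists_abs_Gamma_ratio_sub_le (s := 1 / 2) (by norm_num)
  refine ⟨C, hC, fun k hk => ?_⟩
  have hk0 : (0 : ℝ) < k := by exact_mod_cast hk
  refine (le_of_eq ?_).trans (h k hk)
  congr 1
  have h1 : Real.sqrt Real.pi ≠ 0 := (Real.sqrt_pos.mpr Real.pi_pos).ne'
  have h2 : Real.sqrt k ≠ 0 := (Real.sqrt_pos.mpr hk0).ne'
  have h3 : Real.Gamma k ≠ 0 := (Real.Gamma_pos_of_pos hk0).ne'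
  rw [centralBinom_div_four_pow, Real.Gamma_add_one hk0.ne', ← Real.sqrt_eq_rpow]
  have h4 : (k : ℝ) = Real.sqrt k * Real.sqrt k := (Real.mul_self_sqrt hk0.le).symm
  congr 1
  · rw [div_mul_eq_mul_div, div_eq_div_iff (by positivity) (by positivity)]
    linear_combination Real.Gamma (k + 1 / 2) * Real.sqrt Real.pi * Real.Gamma k * (-h4)
  · ring

theorem exists_centralBinom_le :
    ∃ C : ℝ, 0 < C ∧ ∀ k : ℕ, 1 ≤ k →
      (k.centralBinom : ℝ) ≤ C * 4 ^ k * (k : ℝ) ^ (-(1 / 2) : ℝ) := by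
  obtain ⟨C, hC, h⟩ := exists_abs_centralBinom_sub_le
  refine ⟨1 + C, by positivity, fun k hk => ?_⟩
  have hk1 : (1 : ℝ) ≤ k := by exact_mod_cast hk
  have h0 : (0 : ℝ) < Real.sqrt k := Real.sqrt_pos.mpr (by linarith)
  have h1 := (abs_le.mp (h k hk)).2
  have h2 : (1 / (k : ℝ)) ^ 2 ≤ 1 := pow_le_one₀ (by positivity) (by rw [div_le_one (by linarith)]; exact hk1)
  have h3 : (k.centralBinom : ℝ) / 4 ^ k * (Real.sqrt Real.pi * Real.sqrt k) ≤ 1 + C := by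
    have : 0 ≤ 1 / 8 / (k : ℝ) := by positivity
    nlinarith
  have h4 : 1 ≤ Real.sqrt Real.pi := by rw [Real.one_le_sqrt]; linarith [Real.pi_gt_three]
  rw [Real.rpow_neg (by linarith), ← Real.sqrt_eq_rpow, ← div_eq_mul_inv, le_div_iff₀ h0]
  have h5 : (k.centralBinom : ℝ) / 4 ^ k * Real.sqrt k
      ≤ (k.centralBinom : ℝ) / 4 ^ k * (Real.sqrt Real.pi * Real.sqrt k) :=
    mul_le_mul_of_nonneg_left (le_mul_of_one_le_left h0.le h4) (by positivity)
  have h6 := h5.trans h3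
  rw [div_mul_eq_mul_div, div_le_iff₀ (by positivity)] at h6
  exact h6

/-- The normalizing constant in the distribution of the median of `2 k + 1` uniform variables. -/
noncomputable def medianConst (k : ℕ) : ℝ :=
  (2 * k + 1 : ℝ) * k.centralBinom / 4 ^ k / (2 * Real.sqrt (2 * k))

/-- From `(1 + 1/(2k))(1 - 1/(8k)) = 1 + 3/(8k) + O(k⁻²)`; the last fraction is written in the
variable `2k`. -/
theorem exists_abs_medianConst_sub_le :
    ∃ C : ℝ, 0 < C ∧ ∀ k : ℕ, 1 ≤ k →
      |medianConst k - (Real.sqrt (2 * Real.pi))⁻¹ * (1 + 3 / 4 / (2 * k))| ≤ C * (1 / (k : ℝ)) ^ 2 := by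
  obtain ⟨C, hC, h⟩ := exists_abs_centralBinom_sub_le
  refine ⟨2 * C + 1, by positivity, fun k hk => ?_⟩
  have hk1 : (1 : ℝ) ≤ k := by exact_mod_cast hk
  have hk0 : (0 : ℝ) < k := by linarith
  set e := (k.centralBinom : ℝ) / 4 ^ k * (Real.sqrt Real.pi * Real.sqrt k) - (1 - 1 / 8 / k) with he
  have h1 : Real.sqrt Real.pi ≠ 0 := (Real.sqrt_pos.mpr Real.pi_pos).ne'
  have h2 : Real.sqrt k ≠ 0 := (Real.sqrt_pos.mpr hk0).ne'
  have h5 : Real.sqrt 2 ≠ 0 := by positivity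
  have h4 : (k : ℝ) = Real.sqrt k * Real.sqrt k := (Real.mul_self_sqrt hk0.le).symm
  have hcb : (k.centralBinom : ℝ) / 4 ^ k = (1 - 1 / 8 / k + e) / (Real.sqrt Real.pi * Real.sqrt k) := by
    rw [eq_div_iff (by positivity), he]
    ring
  have hmc : medianConst k = (Real.sqrt (2 * Real.pi))⁻¹ * ((1 + 1 / (2 * k)) * (1 - 1 / 8 / k + e)) := by
    rw [medianConst, mul_div_assoc, hcb, Real.sqrt_mul (by norm_num), Real.sqrt_mul (by norm_num)]
    have : (2 * (k : ℝ) + 1) = 2 * (Real.sqrt k * Real.sqrt k) * (1 + 1 / (2 * k)) := by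
      rw [← h4]; field_simp
    rw [this]
    field_simp
  have h6 : |(Real.sqrt (2 * Real.pi))⁻¹| ≤ 1 := by
    rw [abs_of_nonneg (by positivity)]
    apply inv_le_one_of_one_le₀
    rw [Real.one_le_sqrt]
    linarith [Real.pi_gt_three]
  rw [hmc, ← mul_sub, abs_mul]
  refine (mul_le_mul_of_nonneg_right h6 (abs_nonneg _)).trans ?_
  rw [one_mul, show (1 + 1 / (2 * (k : ℝ))) * (1 - 1 / 8 / k + e) - (1 + 3 / 4 / (2 * k))
    = (1 + 1 / (2 * k)) * e - 1 / 16 * (1 / (k : ℝ)) ^ 2 by field_simp; ring]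
  have h7 : |1 + 1 / (2 * (k : ℝ))| ≤ 2 := by
    rw [abs_of_nonneg (by positivity)]
    have : 1 / (2 * (k : ℝ)) ≤ 1 := by rw [div_le_one (by positivity)]; linarith
    linarith
  refine (abs_sub _ _).trans ?_
  rw [abs_mul, abs_of_nonneg (show 0 ≤ 1 / 16 * (1 / (k : ℝ)) ^ 2 by positivity)]
  have h8 := mul_le_mul h7 (h k hk) (abs_nonneg _) (by norm_num)
  have : 0 ≤ (1 / (k : ℝ)) ^ 2 := by positivity
  linarith

/-! ### The gap integral for even samples -/

theorem exists_pow_mul_rpow_le {ρ : ℝ} (h0 : 0 ≤ ρ) (h1 : ρ < 1) :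
    ∃ C : ℝ, 0 < C ∧ ∀ l : ℕ, ((l : ℝ) + 1) * ρ ^ l ≤ C * ((l : ℝ) + 1) ^ (-(3 / 2) : ℝ) := by
  have ht := tendsto_pow_const_mul_const_pow_of_abs_lt_one 3 (show |ρ| < 1 by rwa [abs_of_nonneg h0])
  obtain ⟨C, hC⟩ := ht.bddAbove_range
  refine ⟨8 * |C| + 1, by positivity, fun l => ?_⟩
  have hl : (1 : ℝ) ≤ (l : ℝ) + 1 := by linarith [(Nat.cast_nonneg l : (0 : ℝ) ≤ l)]
  have hb : ((l : ℝ) + 1) ^ 3 * ρ ^ l ≤ 8 * |C| + 1 := by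
    rcases Nat.eq_zero_or_pos l with rfl | hl0
    · simp
    · have h2 : (l : ℝ) ^ 3 * ρ ^ l ≤ C := hC ⟨l, rfl⟩
      have h3 : (1 : ℝ) ≤ l := by exact_mod_cast hl0
      have h4 : ((l : ℝ) + 1) ^ 3 ≤ 8 * (l : ℝ) ^ 3 := by
        calc ((l : ℝ) + 1) ^ 3 ≤ (2 * (l : ℝ)) ^ 3 := pow_le_pow_left₀ (by linarith) (by linarith) 3
          _ = _ := by ring
      have h5 := mul_le_mul_of_nonneg_right h4 (pow_nonneg h0 l)
      linarith [le_abs_self C]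
  have h6 : ((l : ℝ) + 1) * ρ ^ l = ((l : ℝ) + 1) ^ 3 * ρ ^ l * ((l : ℝ) + 1) ^ (-2 : ℝ) := by
    rw [Real.rpow_neg (by linarith), show (2 : ℝ) = ((2 : ℕ) : ℝ) by norm_num, Real.rpow_natCast]
    field_simp
  rw [h6]
  exact mul_le_mul hb (Real.rpow_le_rpow_of_exponent_le hl (by norm_num)) (by positivity) (by positivity)

/-- The arithmetic-geometric mean inequality together with `1 - u ≤ e^(-u)`. -/
theorem mul_le_quarter_mul_exp {A B u : ℝ} (hA : 0 ≤ A) (hB : 0 ≤ B) (h : A + B ≤ 1 - u) :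
    A * B ≤ 1 / 4 * Real.exp (-(2 * u)) := by
  have s2 : A + B ≤ Real.exp (-u) := h.trans (by have := Real.add_one_le_exp (-u); linarith)
  have s4 : (A + B) ^ 2 ≤ Real.exp (-u) ^ 2 := pow_le_pow_left₀ (by linarith) s2 2
  rw [← Real.exp_nat_mul, show ((2 : ℕ) : ℝ) * -u = -(2 * u) by push_cast; ring] at s4
  have := four_mul_le_sq_add A B
  linarith

/-- Used with `a = p(w)`, `b = p(2y-w)`, `A = F(2y-w)`, `B = 1 - F(w)`, `φ = F(y)`, `t = w - y`. At
`t = 0` the two sides of the difference agree, and the final identity exhibits one nonpositive part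
and two parts of order `t`. -/
theorem gap_bracket_le {A B φ a b M L t : ℝ} (ha : 0 ≤ a) (hb : 0 ≤ b) (hbM : b ≤ M) (hM : 0 ≤ M)
    (hφ0 : 0 ≤ φ) (hφ1 : φ ≤ 1) (hA : A ≤ φ) (hB : 1 - φ - B ≤ M * t) (ht : 0 ≤ t) (hL : 0 ≤ L)
    (hl : a - b ≤ L * (2 * t)) :
    a * A - φ * (b * B + A * a) ≤ (2 * L + M ^ 2) * t := by
  have k1 : A * (a * (1 - φ)) ≤ φ * (a * (1 - φ)) :=
    mul_le_mul_of_nonneg_right hA (mul_nonneg ha (by linarith))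
  have k2 : φ * b * (1 - φ - B) ≤ M * (M * t) := by
    have k3 : φ * b ≤ 1 * M := mul_le_mul hφ1 hbM hb (by norm_num)
    rw [one_mul] at k3
    exact (mul_le_mul_of_nonneg_left hB (mul_nonneg hφ0 hb)).trans
      (mul_le_mul_of_nonneg_right k3 (by positivity))
  have k5 : φ * (1 - φ) * (a - b) ≤ 1 * (L * (2 * t)) := by
    have k6 : φ * (1 - φ) ≤ 1 := by nlinarith
    exact (mul_le_mul_of_nonneg_left hl (mul_nonneg hφ0 (by linarith))).trans
      (mul_le_mul_of_nonneg_right k6 (by positivity))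
  calc _ = A * (a * (1 - φ)) - φ * (a * (1 - φ)) + φ * b * (1 - φ - B) + φ * (1 - φ) * (a - b) := by
        ring
    _ ≤ 0 + M * (M * t) + 1 * (L * (2 * t)) := by linarith
    _ = _ := by ring

namespace RegularSymmetricDensity

theorem cdf_increment {p : ℝ → ℝ} (hp : RegularSymmetricDensity p) {δ : ℝ}
    (hpb : ∀ s, |s| < δ → p 0 / 2 ≤ p s ∧ p s ≤ 2 * p 0) {a b : ℝ} (ha : -δ < a) (hab : a ≤ b)
    (hb : b < δ) :
    p 0 / 2 * (b - a) ≤ densityCDF p b - densityCDF p a ∧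
      densityCDF p b - densityCDF p a ≤ 2 * p 0 * (b - a) := by
  rw [hp.cdf_sub_cdf]
  have hi : IntervalIntegrable p volume a b := hp.integrable.intervalIntegrable
  have hm : ∀ s ∈ Set.Icc a b, |s| < δ := fun s hs =>
    abs_lt.mpr ⟨ha.trans_le hs.1, hs.2.trans_lt hb⟩
  constructor
  · have := intervalIntegral.integral_mono_on hab (intervalIntegrable_const (c := p 0 / 2)) hi
      (fun s hs => (hpb s (hm s hs)).1)
    rw [intervalIntegral.integral_const, smul_eq_mul] at this
    linarith
  · have := intervalIntegral.integral_mono_on hab hi (intervalIntegrable_const (c := 2 * p 0))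
      (fun s hs => (hpb s (hm s hs)).2)
    rw [intervalIntegral.integral_const, smul_eq_mul] at this
    linarith

theorem setIntegral_densityMeasure {p : ℝ → ℝ} (hp : RegularSymmetricDensity p) (f : ℝ → ℝ)
    {s : Set ℝ} (hs : MeasurableSet s) :
    ∫ w in s, f w ∂(densityMeasure p) = ∫ w in s, p w * f w := by
  rw [densityMeasure, setIntegral_withDensity_eq_setIntegral_toReal_smul
    (by have := hp.measurable; fun_prop) (Eventually.of_forall fun _ => ENNReal.ofReal_lt_top) _ hs]
  refine integral_congr_ae (Eventually.of_forall fun w => ?_)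
  simp only [smul_eq_mul, ENNReal.toReal_ofReal (hp.nonneg w)]

/-- The near part of the gap integral. -/
theorem gap_integral_near_le {p : ℝ → ℝ} (hp : RegularSymmetricDensity p) {δ L : ℝ} (hL : 0 ≤ L)
    (hpb : ∀ s, |s| < δ → p 0 / 2 ≤ p s ∧ p s ≤ 2 * p 0)
    (hlip : ∀ s t, |s| < δ → |t| < δ → |p s - p t| ≤ L * |s - t|) {η y : ℝ} (hη : 0 < η)
    (h1 : y + η < δ) (h2 : -δ < y - η) (l : ℕ) :
    (l + 1 : ℝ) * ∫ w in y..(y + η), p w * (densityCDF p (2 * y - w) ^ (l + 1)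
        * (1 - densityCDF p w) ^ l)
      ≤ densityCDF p y * (densityCDF p y * (1 - densityCDF p y)) ^ (l + 1)
        + 4 * (2 * L + 4 * p 0 ^ 2) * Real.exp (2 * p 0 * η) / (4 * p 0 ^ 2)
          * (1 / 4) ^ (l + 1) / (l + 1) := by
  have hp0 := hp.pos
  set F := densityCDF p with hF
  set c := 2 * L + 4 * p 0 ^ 2 with hc
  have hc0 : 0 < c := by positivity
  -- For `t = w - y` the product `F(2y-w)(1-F(w))` is at most `e^(-2 p₀ t)/4`, so its `l`-th power
  -- decays at rate `2 p₀ l`. Rounding the rate up to `2 p₀ (l+1)` costs `e^(2 p₀ η)`, the factor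
  -- put into `Q`.
  set a : ℝ := 2 * p 0 * (l + 1) with ha
  have ha0 : 0 < a := by positivity
  set Q : ℝ := (l + 1) * c * (1 / 4) ^ l * Real.exp (2 * p 0 * η) with hQ
  have hQ0 : 0 < Q := by positivity
  have hcont : ∀ s, |s| < δ → ContinuousAt p s := by
    intro s hs
    rw [ContinuousAt, tendsto_iff_norm_sub_tendsto_zero]
    have h3 : Tendsto (fun t => L * |t - s|) (𝓝 s) (𝓝 0) := by
      have : Continuous fun t => L * |t - s| := by fun_prop
      simpa using this.tendsto s
    refine squeeze_zero' (Eventually.of_forall fun _ => norm_nonneg _) ?_ h3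
    filter_upwards [(isOpen_lt continuous_abs continuous_const).mem_nhds hs] with t ht
    exact hlip t s ht hs
  have hmem : ∀ w ∈ Set.Icc y (y + η), |w| < δ ∧ |2 * y - w| < δ := fun w hw =>
    ⟨abs_lt.mpr ⟨by linarith [hw.1], by linarith [hw.2]⟩,
      abs_lt.mpr ⟨by linarith [hw.2], by linarith [hw.1]⟩⟩
  have hdF : ∀ w ∈ Set.Icc y (y + η), HasDerivAt F (p w) w := fun w hw =>
    hp.hasDerivAt_cdf (hcont w (hmem w hw).1)
  have hdF' : ∀ w ∈ Set.Icc y (y + η), HasDerivAt (fun w => F (2 * y - w)) (-p (2 * y - w)) w :=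
    fun w hw => by
      have := (hp.hasDerivAt_cdf (hcont _ (hmem w hw).2)).comp w ((hasDerivAt_id w).const_sub (2 * y))
      exact this.congr_deriv (by simp)
  -- An explicit majorizing antiderivative. The first part yields the main term at `w = y`, being
  -- what results when `F(y)` replaces the exact ratio; the second integrates the error `Q t
  -- e^(-at)`.
  set G : ℝ → ℝ := fun w => -(F y * (F (2 * y - w) * (1 - F w)) ^ (l + 1))
    - Q * (((w - y) / a + 1 / a ^ 2) * Real.exp (-(a * (w - y)))) with hG
  set G' : ℝ → ℝ := fun w => F y * ((l + 1) * (F (2 * y - w) * (1 - F w)) ^ l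
    * (p (2 * y - w) * (1 - F w) + F (2 * y - w) * p w))
    + Q * ((w - y) * Real.exp (-(a * (w - y)))) with hG'
  have hdG : ∀ w ∈ Set.Icc y (y + η), HasDerivAt G (G' w) w := by
    intro w hw
    have e1 := ((hdF' w hw).mul ((hdF w hw).const_sub 1)).pow (l + 1)
    have e2 : HasDerivAt (fun w => (w - y) / a + 1 / a ^ 2) (1 / a) w :=
      (((hasDerivAt_id w).sub_const y).div_const a).add_const _
    have e3 : HasDerivAt (fun w => Real.exp (-(a * (w - y)))) (Real.exp (-(a * (w - y))) * (-a)) w := by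
      have := (((hasDerivAt_id w).sub_const y).const_mul a).neg.exp
      exact this.congr_deriv (by simp)
    have := ((e1.const_mul (F y)).neg).sub ((e2.mul e3).const_mul Q)
    refine this.congr_deriv ?_
    simp only [Pi.mul_apply, hG', Nat.add_sub_cancel]
    push_cast
    field_simp
    ring
  have hpt : ∀ w ∈ Set.Icc y (y + η), (l + 1 : ℝ) * (p w * (F (2 * y - w) ^ (l + 1)
      * (1 - F w) ^ l)) ≤ G' w := by
    intro w hw
    obtain ⟨m1, m2⟩ := hmem w hw
    set t := w - y with ht
    have ht0 : 0 ≤ t := by linarith [hw.1]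
    have htη : t ≤ η := by linarith [hw.2]
    obtain ⟨i1, i2⟩ := hp.cdf_increment hpb (a := y) (b := w) (by linarith) hw.1 (by linarith [hw.2])
    obtain ⟨i3, i4⟩ := hp.cdf_increment hpb (a := 2 * y - w) (b := y) (by linarith [hw.2])
      (by linarith [hw.1]) (by linarith)
    have hl := (abs_le.mp (hlip w (2 * y - w) m1 m2)).2
    rw [show w - (2 * y - w) = 2 * t by rw [ht]; ring, abs_of_nonneg (by linarith)] at hl
    rw [show y - (2 * y - w) = t by rw [ht]; ring] at i3 i4
    have n1 := hp.nonneg w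
    have n2 := hp.nonneg (2 * y - w)
    have u2 := (hpb _ m2).2
    have hA0 : 0 ≤ F (2 * y - w) := densityCDF_nonneg p _
    have hB0 : 0 ≤ 1 - F w := by linarith [hp.cdf_le_one w]
    have hy0 : 0 ≤ F y := densityCDF_nonneg p _
    have hy1 : F y ≤ 1 := hp.cdf_le_one y
    rw [← hF] at i1 i2 i3 i4
    set A := F (2 * y - w)
    set B := 1 - F w with hB
    set φ := F y
    have hAB : (A * B) ^ l ≤ (1 / 4) ^ l * (Real.exp (2 * p 0 * η) * Real.exp (-(a * t))) := by
      have s1 : A + B ≤ 1 - p 0 * t := by linarith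
      have s3 : A * B ≤ 1 / 4 * Real.exp (-(2 * p 0 * t)) := by
        rw [mul_assoc]
        exact mul_le_quarter_mul_exp hA0 hB0 s1
      calc (A * B) ^ l ≤ (1 / 4 * Real.exp (-(2 * p 0 * t))) ^ l :=
            pow_le_pow_left₀ (mul_nonneg hA0 hB0) s3 l
        _ = (1 / 4) ^ l * Real.exp (l * (-(2 * p 0 * t))) := by rw [mul_pow, ← Real.exp_nat_mul]
        _ ≤ (1 / 4) ^ l * Real.exp (2 * p 0 * η + -(a * t)) := by
            refine mul_le_mul_of_nonneg_left (Real.exp_le_exp.mpr ?_) (by positivity)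
            rw [ha]
            linarith [mul_le_mul_of_nonneg_left htη (show 0 ≤ 2 * p 0 by positivity)]
        _ = _ := by rw [Real.exp_add]
    have hkey : p w * A - φ * (p (2 * y - w) * B + A * p w) ≤ c * t := by
      have := gap_bracket_le (A := A) (B := B) n1 n2 u2 (by linarith) hy0 hy1
        (by linarith [mul_nonneg (show 0 ≤ p 0 / 2 by linarith) ht0]) (by linarith) ht0 hL hl
      rw [hc]
      linarith
    have hABl : 0 ≤ (A * B) ^ l := pow_nonneg (mul_nonneg hA0 hB0) l
    have hl1 : (0 : ℝ) < l + 1 := by positivity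
    calc (l + 1 : ℝ) * (p w * (A ^ (l + 1) * B ^ l))
        = (l + 1) * (A * B) ^ l * (φ * (p (2 * y - w) * B + A * p w))
          + (l + 1) * (A * B) ^ l * (p w * A - φ * (p (2 * y - w) * B + A * p w)) := by
          rw [mul_pow]; ring
      _ ≤ (l + 1) * (A * B) ^ l * (φ * (p (2 * y - w) * B + A * p w))
          + (l + 1) * (A * B) ^ l * (c * t) := by gcongr
      _ ≤ (l + 1) * (A * B) ^ l * (φ * (p (2 * y - w) * B + A * p w))
          + (l + 1) * ((1 / 4) ^ l * (Real.exp (2 * p 0 * η) * Real.exp (-(a * t)))) * (c * t) := by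
          gcongr
      _ = _ := by
          simp only [hG', hQ]
          ring
  have hG'G := intervalIntegral.integral_le_sub_of_hasDeriv_right_of_le (a := y) (b := y + η) (g := G)
    (g' := G') (φ := fun w => (l + 1 : ℝ) * (p w * (F (2 * y - w) ^ (l + 1) * (1 - F w) ^ l)))
    (by linarith) (fun w hw => (hdG w hw).continuousAt.continuousWithinAt)
    (fun w hw => (hdG w (Set.Ioo_subset_Icc_self hw)).hasDerivWithinAt)
    (by
      refine ContinuousOn.integrableOn_Icc ?_
      intro w hw
      have c1 := (hdF w hw).continuousAt
      have c2 := (hdF' w hw).continuousAt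
      have c3 := hcont w (hmem w hw).1
      exact (continuousAt_const.mul (c3.mul ((c2.pow _).mul
        ((continuousAt_const.sub c1).pow _)))).continuousWithinAt)
    (fun w hw => hpt w (Set.Ioo_subset_Icc_self hw))
  rw [intervalIntegral.integral_const_mul] at hG'G
  refine hG'G.trans ?_
  have g1 : G (y + η) ≤ 0 := by
    have b1 : 0 ≤ F y * (F (2 * y - (y + η)) * (1 - F (y + η))) ^ (l + 1) :=
      mul_nonneg (densityCDF_nonneg p _) (pow_nonneg (mul_nonneg (densityCDF_nonneg p _)
        (by linarith [hp.cdf_le_one (y + η)])) _)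
    have b2 : 0 ≤ Q * (((y + η - y) / a + 1 / a ^ 2) * Real.exp (-(a * (y + η - y)))) := by
      rw [add_sub_cancel_left]
      positivity
    simp only [hG]
    linarith
  have g2 : -G y = F y * (F y * (1 - F y)) ^ (l + 1) + Q / a ^ 2 := by
    simp only [hG]
    rw [show 2 * y - y = y by ring, sub_self, zero_div, mul_zero, neg_zero, Real.exp_zero]
    ring
  have g3 : Q / a ^ 2 = 4 * c * Real.exp (2 * p 0 * η) / (4 * p 0 ^ 2) * (1 / 4) ^ (l + 1) / (l + 1) := by
    rw [hQ, ha]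
    field_simp
    ring
  linarith

end RegularSymmetricDensity

namespace RegularSymmetricDensity

theorem measurable_cdf {p : ℝ → ℝ} (hp : RegularSymmetricDensity p) : Measurable (densityCDF p) :=
  Monotone.measurable fun _ _ h => hp.cdf_mono h

/-- Near `y` the error is `4^(-k)/k` with `k = l + 1`, and the central binomial coefficient of order
`4^k k^(-1/2)` makes it `k^(-3/2)`. Far from `y` the integrand is geometrically smaller than
`4^(-k)`. -/
theorem exists_gap_integral_le {p : ℝ → ℝ} (hp : RegularSymmetricDensity p) {δ L : ℝ} (hδ : 0 < δ)
    (hL : 0 ≤ L) (hpb : ∀ s, |s| < δ → p 0 / 2 ≤ p s ∧ p s ≤ 2 * p 0)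
    (hlip : ∀ s t, |s| < δ → |t| < δ → |p s - p t| ≤ L * |s - t|) :
    ∃ K : ℝ, 0 < K ∧ ∀ (l : ℕ) (y : ℝ), |y| ≤ δ / 4 →
      (l + 1 : ℝ) * (l + 1).centralBinom * ∫ w in Set.Ioi y, p w * (densityCDF p (2 * y - w) ^ (l + 1)
          * (1 - densityCDF p w) ^ l)
        ≤ densityCDF p y * ((l + 1).centralBinom * (densityCDF p y * (1 - densityCDF p y)) ^ (l + 1))
          + K * ((l : ℝ) + 1) ^ (-(3 / 2) : ℝ) := by
  have hp0 := hp.pos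
  obtain ⟨Cb, hCb, hcb⟩ := exists_centralBinom_le
  -- For `|y| ≤ δ/4` and `w > y + δ/2` one has `2y - w < -δ/4` and `w > δ/4`, so both factors of the
  -- integrand are at most `q < 1/2`.
  set q := densityCDF p (-(δ / 4)) with hq
  have hq0 : 0 ≤ q := densityCDF_nonneg p _
  have hq1 : q < 1 / 2 := by
    have := (hp.cdf_increment hpb (a := 0) (b := δ / 4) (by linarith) (by linarith) (by linarith)).1
    rw [hp.cdf_zero] at this
    rw [hq, hp.cdf_neg]
    nlinarith [mul_pos hp0 hδ]
  have hq' : densityCDF p (δ / 4) = 1 - q := by rw [hq, hp.cdf_neg]; ring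
  obtain ⟨C₂, hC₂, hpow⟩ := exists_pow_mul_rpow_le (ρ := 4 * q ^ 2) (by positivity) (by nlinarith)
  set C₁ := 4 * (2 * L + 4 * p 0 ^ 2) * Real.exp (2 * p 0 * (δ / 2)) / (4 * p 0 ^ 2) with hC₁
  have hC₁0 : 0 < C₁ := by positivity
  refine ⟨Cb * C₁ + 4 * Cb * C₂, by positivity, fun l y hy => ?_⟩
  obtain ⟨hy1, hy2⟩ := abs_le.mp hy
  have hnear := hp.gap_integral_near_le hL hpb hlip (η := δ / 2) (y := y) (by linarith) (by linarith)
    (by linarith) l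
  rw [← hC₁] at hnear
  set F := densityCDF p with hF
  have hF0 : ∀ s, 0 ≤ F s := densityCDF_nonneg p
  have hF1 : ∀ s, F s ≤ 1 := hp.cdf_le_one
  have hFm := hp.measurable_cdf
  set f : ℝ → ℝ := fun w => F (2 * y - w) ^ (l + 1) * (1 - F w) ^ l with hf
  have hf0 : ∀ w, 0 ≤ f w := fun w =>
    mul_nonneg (pow_nonneg (hF0 _) _) (pow_nonneg (by linarith [hF1 w]) _)
  have hf1 : ∀ w, f w ≤ 1 := fun w =>
    mul_le_one₀ (pow_le_one₀ (hF0 _) (hF1 _)) (pow_nonneg (by linarith [hF1 w]) _)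
      (pow_le_one₀ (by linarith [hF1 w]) (by linarith [hF0 w]))
  have hfm : Measurable f := by
    rw [← hF] at hFm
    have h1 : Measurable fun w => F (2 * y - w) := hFm.comp (by fun_prop)
    exact (h1.pow_const _).mul ((measurable_const.sub hFm).pow_const _)
  have hint : Integrable fun w => p w * f w := by
    refine hp.integrable.mono (hp.measurable.mul hfm).aestronglyMeasurable
      (Eventually.of_forall fun w => ?_)
    rw [Real.norm_eq_abs, Real.norm_eq_abs, abs_mul, abs_of_nonneg (hf0 w)]
    exact mul_le_of_le_one_right (abs_nonneg _) (hf1 w)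
  have hsplit : ∫ w in Set.Ioi y, p w * f w
      = (∫ w in y..(y + δ / 2), p w * f w) + ∫ w in Set.Ioi (y + δ / 2), p w * f w := by
    rw [intervalIntegral.integral_of_le (by linarith), ← setIntegral_union
      (Set.Ioc_disjoint_Ioi le_rfl) measurableSet_Ioi hint.integrableOn hint.integrableOn,
      Set.Ioc_union_Ioi_eq_Ioi (by linarith)]
  have hfar : ∫ w in Set.Ioi (y + δ / 2), p w * f w ≤ (q ^ 2) ^ l := by
    have h1 : ∫ w in Set.Ioi (y + δ / 2), p w * f w ≤ ∫ w in Set.Ioi (y + δ / 2), p w * (q ^ 2) ^ l := by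
      refine setIntegral_mono_on hint.integrableOn (hp.integrable.mul_const _).integrableOn
        measurableSet_Ioi fun w hw => mul_le_mul_of_nonneg_left ?_ (hp.nonneg w)
      have hw' : y + δ / 2 < w := hw
      have a1 : F (2 * y - w) ≤ q := hp.cdf_mono (by linarith)
      have a2 : 1 - F w ≤ q := by
        have : F (δ / 4) ≤ F w := hp.cdf_mono (by linarith)
        linarith
      calc f w = F (2 * y - w) * (F (2 * y - w) * (1 - F w)) ^ l := by rw [hf, mul_pow]; ring
        _ ≤ 1 * (q ^ 2) ^ l := by
            refine mul_le_mul (hF1 _) (pow_le_pow_left₀ (mul_nonneg (hF0 _) (by linarith [hF1 w])) ?_ l)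
              (pow_nonneg (mul_nonneg (hF0 _) (by linarith [hF1 w])) l) (by norm_num)
            rw [pow_two]
            exact mul_le_mul a1 a2 (by linarith [hF1 w]) hq0
        _ = _ := one_mul _
    refine h1.trans ?_
    rw [integral_mul_const]
    refine mul_le_of_le_one_left (by positivity) ?_
    have h2 := hp.cdf_sub_cdf (y + δ / 2) (y + δ / 2)
    have h3 : ∫ w in Set.Ioi (y + δ / 2), p w ≤ ∫ w, p w :=
      setIntegral_le_integral hp.integrable (Eventually.of_forall hp.nonneg)
    have h4 : ∫ w, p w = 1 := by
      rw [integral_eq_lintegral_of_nonneg_ae (Eventually.of_forall hp.nonneg)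
        hp.measurable.aestronglyMeasurable, hp.lintegral_eq_one, ENNReal.toReal_one]
    linarith
  set k : ℝ := (l : ℝ) + 1 with hk
  have hk1 : 1 ≤ k := by rw [hk]; linarith [(Nat.cast_nonneg l : (0 : ℝ) ≤ l)]
  set c : ℝ := ((l + 1).centralBinom : ℝ) with hc
  have hc0 : 0 ≤ c := Nat.cast_nonneg _
  have hcb' : c ≤ Cb * 4 ^ (l + 1) * k ^ (-(1 / 2) : ℝ) := by
    have := hcb (l + 1) (by omega)
    push_cast at this
    exact this
  have hcb2 : c ≤ Cb * 4 ^ (l + 1) := hcb'.trans (mul_le_of_le_one_right (by positivity)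
    (Real.rpow_le_one_of_one_le_of_nonpos hk1 (by norm_num)))
  have e1 : c * (C₁ * (1 / 4) ^ (l + 1) / k) ≤ Cb * C₁ * k ^ (-(3 / 2) : ℝ) := by
    have h44 : (4 : ℝ) ^ (l + 1) * (1 / 4) ^ (l + 1) = 1 := by rw [← mul_pow]; norm_num
    calc c * (C₁ * (1 / 4) ^ (l + 1) / k)
        ≤ (Cb * 4 ^ (l + 1) * k ^ (-(1 / 2) : ℝ)) * (C₁ * (1 / 4) ^ (l + 1) / k) :=
          mul_le_mul_of_nonneg_right hcb' (by positivity)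
      _ = Cb * C₁ * (4 ^ (l + 1) * (1 / 4) ^ (l + 1)) * (k ^ (-(1 / 2) : ℝ) / k) := by ring
      _ = _ := by
          rw [h44, mul_one, ← Real.rpow_sub_one (by positivity)]
          norm_num
  have e2 : k * c * (q ^ 2) ^ l ≤ 4 * Cb * C₂ * k ^ (-(3 / 2) : ℝ) := by
    calc k * c * (q ^ 2) ^ l ≤ k * (Cb * 4 ^ (l + 1)) * (q ^ 2) ^ l := by gcongr
      _ = 4 * Cb * (k * (4 * q ^ 2) ^ l) := by rw [mul_pow, pow_succ]; ring
      _ ≤ 4 * Cb * (C₂ * k ^ (-(3 / 2) : ℝ)) := mul_le_mul_of_nonneg_left (hpow l) (by positivity)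
      _ = _ := by ring
  have e3 := mul_le_mul_of_nonneg_left hnear hc0
  have e4 := mul_le_mul_of_nonneg_left hfar (show 0 ≤ k * c by positivity)
  rw [hsplit]
  calc k * c * ((∫ w in y..(y + δ / 2), p w * f w) + ∫ w in Set.Ioi (y + δ / 2), p w * f w)
      = c * (k * ∫ w in y..(y + δ / 2), p w * f w) + k * c * ∫ w in Set.Ioi (y + δ / 2), p w * f w := by
        ring
    _ ≤ c * (F y * (F y * (1 - F y)) ^ (l + 1) + C₁ * (1 / 4) ^ (l + 1) / k) + k * c * (q ^ 2) ^ l :=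
        add_le_add e3 e4
    _ ≤ _ := by linarith

/-- The law of `m` independent observations with density `p`. -/
noncomputable def _root_.sampleLaw (p : ℝ → ℝ) (m : ℕ) : Measure (Fin m → ℝ) :=
  Measure.pi fun _ => densityMeasure p

theorem isProbabilityMeasure_sampleLaw {p : ℝ → ℝ} (hp : RegularSymmetricDensity p) (m : ℕ) :
    IsProbabilityMeasure (sampleLaw p m) := by
  have := hp.isProbabilityMeasure
  unfold sampleLaw
  infer_instance

/-- The sample law is invariant under `v ↦ -v` and the median is odd, so the second probability is
that of a median at least `y`, and the two events cover everything. -/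
theorem measureReal_median_reflect {p : ℝ → ℝ} (hp : RegularSymmetricDensity p) {m : ℕ} (hm : 1 ≤ m)
    (y : ℝ) :
    1 ≤ (sampleLaw p m).real {v | sampleMedian v ≤ y}
      + (sampleLaw p m).real {v | sampleMedian v ≤ -y} := by
  have := hp.isProbabilityMeasure
  have := hp.isProbabilityMeasure_sampleLaw m
  have hmp : MeasurePreserving (fun (v : Fin m → ℝ) i => -v i) (sampleLaw p m) (sampleLaw p m) :=
    measurePreserving_pi (fun _ => densityMeasure p) (fun _ => densityMeasure p)
      fun _ => hp.measurePreserving_neg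
  have hms : MeasurableSet {v : Fin m → ℝ | sampleMedian v ≤ -y} :=
    measurableSet_le (measurable_sampleMedian m) measurable_const
  have h1 : (sampleLaw p m).real {v | sampleMedian v ≤ -y}
      = (sampleLaw p m).real {v | y ≤ sampleMedian v} := by
    rw [measureReal_def, measureReal_def, ← hmp.measure_preimage hms.nullMeasurableSet]
    congr 2
    ext v
    simp only [Set.mem_preimage, Set.mem_ofPred_eq, sampleMedian_neg hm, neg_le_neg_iff]
  rw [h1]
  have h2 : {v : Fin m → ℝ | sampleMedian v ≤ y} ∪ {v | y ≤ sampleMedian v} = Set.univ := by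
    ext v
    simp [le_total]
  calc 1 = (sampleLaw p m).real Set.univ := probReal_univ.symm
    _ ≤ _ := by rw [← h2]; exact measureReal_union_le _ _

/-- The gap integral supplies exactly the term by which the binomial tail falls short of
`medianPoly`; the upper bound at `-y`, reflected, is the lower bound at `y`. -/
theorem exists_even_median_sub_le {p : ℝ → ℝ} (hp : RegularSymmetricDensity p) {δ L : ℝ} (hδ : 0 < δ)
    (hL : 0 ≤ L) (hpb : ∀ s, |s| < δ → p 0 / 2 ≤ p s ∧ p s ≤ 2 * p 0)
    (hlip : ∀ s t, |s| < δ → |t| < δ → |p s - p t| ≤ L * |s - t|) :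
    ∃ K : ℝ, 0 < K ∧ ∀ (l : ℕ) (y : ℝ), |y| ≤ δ / 4 →
      |(sampleLaw p (2 * l + 1 + 1)).real {v | sampleMedian v ≤ y}
        - medianPoly (l + 1) (densityCDF p y)| ≤ K * ((l : ℝ) + 1) ^ (-(3 / 2) : ℝ) := by
  obtain ⟨K, hK, h⟩ := hp.exists_gap_integral_le hδ hL hpb hlip
  have := hp.isProbabilityMeasure
  have hup : ∀ (l : ℕ) (y : ℝ), |y| ≤ δ / 4 →
      (sampleLaw p (2 * l + 1 + 1)).real {v | sampleMedian v ≤ y}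
        ≤ medianPoly (l + 1) (densityCDF p y) + K * ((l : ℝ) + 1) ^ (-(3 / 2) : ℝ) := by
    intro l y hy
    refine (measureReal_sampleMedian_even_le (densityMeasure p) l y).trans ?_
    rw [← binomialTail_even_add, add_assoc (binomialTail _ _ _)]
    refine add_le_add le_rfl ?_
    rw [hp.setIntegral_densityMeasure _ measurableSet_Ioi]
    simp only [hp.measureReal_Ici]
    exact h l y hy
  refine ⟨K, hK, fun l y hy => abs_le.mpr ⟨?_, by linarith [hup l y hy]⟩⟩
  have h1 := hup l (-y) (by rwa [abs_neg])
  rw [hp.cdf_neg, medianPoly_one_sub] at h1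
  linarith [hp.measureReal_median_reflect (m := 2 * l + 1 + 1) (by omega) y]

end RegularSymmetricDensity

/-! ### Normal expansion for the uniform median -/

theorem pow_sub_one_add_mul_bounds {g : ℝ} (h0 : 0 ≤ g) (h1 : g ≤ 1) (k : ℕ) :
    0 ≤ g ^ k - 1 + k * (1 - g) ∧ g ^ k - 1 + k * (1 - g) ≤ (k : ℝ) ^ 2 * (1 - g) ^ 2 := by
  induction k with
  | zero => simp
  | succ k ih =>
    have e : g ^ (k + 1) - 1 + ((k + 1 : ℕ) : ℝ) * (1 - g)
        = g * (g ^ k - 1 + k * (1 - g)) + k * (1 - g) ^ 2 := by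
      push_cast
      ring
    rw [e]
    have hk : (0 : ℝ) ≤ k := Nat.cast_nonneg k
    refine ⟨add_nonneg (mul_nonneg h0 ih.1) (by positivity), ?_⟩
    have h3 : g * (g ^ k - 1 + k * (1 - g)) ≤ (k : ℝ) ^ 2 * (1 - g) ^ 2 :=
      (mul_le_of_le_one_left ih.1 h1).trans ih.2
    push_cast
    nlinarith [sq_nonneg (1 - g), mul_nonneg hk (sq_nonneg (1 - g))]

/-- Factor `(1-w)^k = e^(-kw) ((1-w) e^w)^k`. The base of the second power is `1 - w²/2 + O(w³)`,
and `pow_sub_one_add_mul_bounds` controls the passage to its `k`-th power. Keeping `e^(-kw)` in the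
error makes it integrable uniformly in `k`. -/
theorem abs_one_sub_pow_sub_le {w : ℝ} (h0 : 0 ≤ w) (h1 : w ≤ 1) (k : ℕ) :
    |(1 - w) ^ k - Real.exp (-(k * w)) * (1 - k * w ^ 2 / 2)|
      ≤ Real.exp (-(k * w)) * (4 * (k : ℝ) ^ 2 * w ^ 4 + k * w ^ 3) := by
  set g := (1 - w) * Real.exp w with hg
  have hg0 : 0 ≤ g := mul_nonneg (by linarith) (Real.exp_pos _).le
  have hg1 : g ≤ 1 := by
    have := Real.add_one_le_exp (-w)
    calc g ≤ Real.exp (-w) * Real.exp w :=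
          mul_le_mul_of_nonneg_right (by linarith) (Real.exp_pos _).le
      _ = 1 := by rw [← Real.exp_add, neg_add_cancel, Real.exp_zero]
  have hexp := Real.exp_bound (x := w) (n := 3) (by rwa [abs_of_nonneg h0]) (by norm_num)
  rw [abs_of_nonneg h0] at hexp
  simp only [Finset.sum_range_succ, Finset.sum_range_zero, Nat.factorial] at hexp
  norm_num at hexp
  have hgw : |g - 1 + w ^ 2 / 2| ≤ w ^ 3 := by
    have e : g - 1 + w ^ 2 / 2 = (1 - w) * (Real.exp w - (1 + w + w ^ 2 / 2)) - w ^ 3 / 2 := by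
      rw [hg]; ring
    rw [e]
    have h2 : |(1 - w) * (Real.exp w - (1 + w + w ^ 2 / 2))| ≤ 1 * (w ^ 3 * (2 / 9)) := by
      rw [abs_mul, abs_of_nonneg (by linarith : 0 ≤ 1 - w)]
      exact mul_le_mul (by linarith) hexp (abs_nonneg _) (by norm_num)
    refine (abs_sub _ _).trans ?_
    rw [abs_of_nonneg (show 0 ≤ w ^ 3 / 2 by positivity)]
    have : 0 ≤ w ^ 3 := by positivity
    linarith
  have hw3 : w ^ 3 ≤ w ^ 2 := pow_le_pow_of_le_one h0 h1 (by norm_num)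
  have h1g : 1 - g ≤ 2 * w ^ 2 := by
    have := (abs_le.mp hgw).1
    nlinarith [sq_nonneg w]
  obtain ⟨b1, b2⟩ := pow_sub_one_add_mul_bounds hg0 hg1 k
  have hk : (0 : ℝ) ≤ k := Nat.cast_nonneg k
  have hmain : |g ^ k - (1 - k * w ^ 2 / 2)| ≤ 4 * (k : ℝ) ^ 2 * w ^ 4 + k * w ^ 3 := by
    have e : g ^ k - (1 - k * w ^ 2 / 2) = (g ^ k - 1 + k * (1 - g)) + k * (g - 1 + w ^ 2 / 2) := by
      ring
    rw [e]
    refine (abs_add_le _ _).trans (add_le_add ?_ ?_)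
    · rw [abs_of_nonneg b1]
      refine b2.trans ?_
      have : (1 - g) ^ 2 ≤ (2 * w ^ 2) ^ 2 := pow_le_pow_left₀ (by linarith) h1g 2
      calc _ ≤ (k : ℝ) ^ 2 * (2 * w ^ 2) ^ 2 := by gcongr
        _ = _ := by ring
    · rw [abs_mul, abs_of_nonneg hk]
      exact mul_le_mul_of_nonneg_left hgw hk
  have hpow : (1 - w) ^ k = Real.exp (-(k * w)) * g ^ k := by
    rw [hg, mul_pow, ← Real.exp_nat_mul, mul_left_comm, ← Real.exp_add, neg_add_cancel,
      Real.exp_zero, mul_one]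
  rw [hpow, ← mul_sub, abs_mul, abs_of_pos (Real.exp_pos _)]
  exact mul_le_mul_of_nonneg_left hmain (Real.exp_pos _).le

theorem integrable_pow_mul_exp_neg_half_sq (j : ℕ) :
    Integrable fun t : ℝ => |t| ^ j * Real.exp (-(t ^ 2 / 2)) := by
  obtain ⟨C, hC, h⟩ := exists_abs_pow_mul_exp_le j (c := 1 / 4) (by norm_num)
  refine ((integrable_exp_neg_mul_sq (b := 1 / 4) (by norm_num)).const_mul C).mono
    (by fun_prop) (Eventually.of_forall fun t => ?_)
  have e : Real.exp (-(t ^ 2 / 2)) = Real.exp (-(1 / 4 * t ^ 2)) * Real.exp (-(1 / 4) * t ^ 2) := by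
    rw [← Real.exp_add]; congr 1; ring
  rw [Real.norm_of_nonneg (by positivity), Real.norm_of_nonneg (by positivity), e, ← mul_assoc]
  exact mul_le_mul_of_nonneg_right (h t) (Real.exp_pos _).le

theorem abs_intervalIntegral_le_integral {f g : ℝ → ℝ} {a b : ℝ} (hg : Integrable g)
    (hg0 : ∀ t, 0 ≤ g t) (h : ∀ t ∈ Set.uIoc a b, |f t| ≤ g t) : |∫ t in a..b, f t| ≤ ∫ t, g t := by
  rw [← Real.norm_eq_abs, intervalIntegral.norm_intervalIntegral_eq]
  refine (norm_integral_le_of_norm_le hg.integrableOn ?_).trans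
    (setIntegral_le_integral hg (Eventually.of_forall hg0))
  exact (ae_restrict_iff' measurableSet_uIoc).mpr (Eventually.of_forall h)

theorem medianPoly_eq_medianConst {k : ℕ} (hk : 1 ≤ k) (u : ℝ) :
    medianPoly k u = 1 / 2 + medianConst k
      * ∫ t in (0 : ℝ)..(2 * Real.sqrt (2 * k) * (u - 1 / 2)), (1 - t ^ 2 / (2 * k)) ^ k := by
  have hk0 : (0 : ℝ) < k := by exact_mod_cast hk
  have hs : 0 < Real.sqrt (2 * k) := Real.sqrt_pos.mpr (by positivity)
  have hs2 : Real.sqrt (2 * k) ^ 2 = 2 * k := Real.sq_sqrt (by positivity)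
  have h := intervalIntegral.smul_integral_comp_mul_left (a := 0) (b := u - 1 / 2)
    (fun t : ℝ => (1 - t ^ 2 / (2 * k)) ^ k) (2 * Real.sqrt (2 * k))
  rw [mul_zero] at h
  have h2 : ∀ s : ℝ, (1 - (2 * Real.sqrt (2 * k) * s) ^ 2 / (2 * k)) ^ k
      = 4 ^ k * (1 / 4 - s ^ 2) ^ k := fun s => by
    rw [← mul_pow, mul_pow (2 * Real.sqrt (2 * k)), mul_pow 2, hs2]
    congr 1
    field_simp
    ring
  simp only [h2, intervalIntegral.integral_const_mul, smul_eq_mul] at h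
  rw [medianPoly_eq, ← h, medianConst]
  field_simp

/-- The combination `3 - t⁴` occurs because `φ(t)(t³+3t)` has derivative `(3 - t⁴) φ(t)`. -/
theorem gauss_moment_integrals (z : ℝ) :
    (Real.sqrt (2 * Real.pi))⁻¹ * (∫ t in (0 : ℝ)..z, Real.exp (-(t ^ 2 / 2))) = gaussCDF z - 1 / 2 ∧
    (Real.sqrt (2 * Real.pi))⁻¹ * (3 * (∫ t in (0 : ℝ)..z, Real.exp (-(t ^ 2 / 2)))
      - ∫ t in (0 : ℝ)..z, t ^ 4 * Real.exp (-(t ^ 2 / 2))) = gaussDensity z * (z ^ 3 + 3 * z) := by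
  have hφ : ∀ t, gaussDensity t = (Real.sqrt (2 * Real.pi))⁻¹ * Real.exp (-(t ^ 2 / 2)) := fun t => by
    rw [gaussDensity]; congr 2; ring
  constructor
  · rw [← intervalIntegral.integral_const_mul]
    simp only [← hφ]
    rw [intervalIntegral.integral_eq_sub_of_hasDerivAt (fun t _ => hasDerivAt_gaussCDF t)
      (continuous_gaussDensity.intervalIntegrable _ _), gaussCDF_zero]
  · rw [← intervalIntegral.integral_const_mul, ← intervalIntegral.integral_sub
      (Continuous.intervalIntegrable (by fun_prop) _ _) (Continuous.intervalIntegrable (by fun_prop) _ _),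
      ← intervalIntegral.integral_const_mul]
    have hd : ∀ t : ℝ, HasDerivAt (fun t => gaussDensity t * (t ^ 3 + 3 * t))
        ((Real.sqrt (2 * Real.pi))⁻¹ * (3 * Real.exp (-(t ^ 2 / 2)) - t ^ 4 * Real.exp (-(t ^ 2 / 2)))) t := by
      intro t
      have h1 : HasDerivAt (fun t : ℝ => t ^ 3 + 3 * t) (3 * t ^ 2 + 3) t := by
        have := (hasDerivAt_pow 3 t).add ((hasDerivAt_id t).const_mul 3)
        exact this.congr_deriv (by simp)
      refine ((hasDerivAt_gaussDensity t).mul h1).congr_deriv ?_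
      rw [hφ]
      ring
    rw [intervalIntegral.integral_eq_sub_of_hasDerivAt (fun t _ => hd t)
      (Continuous.intervalIntegrable (by fun_prop) _ _)]
    simp

/-- Normal expansion of the distribution of the median of an odd number of uniform variables. -/
theorem exists_abs_medianPoly_sub_le :
    ∃ C : ℝ, 0 < C ∧ ∀ k : ℕ, 1 ≤ k → ∀ u z : ℝ, 0 ≤ u → u ≤ 1 →
      z = 2 * Real.sqrt (2 * k) * (u - 1 / 2) →
      |medianPoly k u - (gaussCDF z + gaussDensity z * (z ^ 3 + 3 * z) / (4 * (2 * k)))|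
        ≤ C * (1 / (k : ℝ)) ^ 2 := by
  obtain ⟨C₁, hC₁, hmc⟩ := exists_abs_medianConst_sub_le
  set B : ℕ → ℝ := fun j => ∫ t : ℝ, |t| ^ j * Real.exp (-(t ^ 2 / 2)) with hB
  have hB0 : ∀ j, 0 ≤ B j := fun j => integral_nonneg fun t => by positivity
  refine ⟨B 4 + C₁ * (B 0 + B 4) + (2 + C₁) * (B 8 + B 6) + 1, by
    have := hB0 0; have := hB0 4; have := hB0 6; have := hB0 8; positivity, fun k hk u z hu0 hu1 hz => ?_⟩
  have hk1 : (1 : ℝ) ≤ k := by exact_mod_cast hk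
  have hk0 : (0 : ℝ) < k := by linarith
  set M : ℝ := 2 * k with hM
  have hM0 : 0 < M := by positivity
  -- Because `0 ≤ u ≤ 1`, the integration stays where `t²/M ≤ 1`, as the pointwise estimate
  -- requires.
  have hz2 : z ^ 2 ≤ M := by
    have h1 : (u - 1 / 2) ^ 2 ≤ 1 / 4 := by nlinarith
    rw [hz, mul_pow, mul_pow, Real.sq_sqrt hM0.le]
    nlinarith
  obtain ⟨m1, m2⟩ := gauss_moment_integrals z
  set φ₀ := (Real.sqrt (2 * Real.pi))⁻¹ with hφ₀
  have hφ0 : 0 ≤ φ₀ := by positivity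
  have hφ1 : φ₀ ≤ 1 := by
    apply inv_le_one_of_one_le₀
    rw [Real.one_le_sqrt]
    linarith [Real.pi_gt_three]
  set I₀ := ∫ t in (0 : ℝ)..z, Real.exp (-(t ^ 2 / 2)) with hI₀
  set I₄ := ∫ t in (0 : ℝ)..z, t ^ 4 * Real.exp (-(t ^ 2 / 2)) with hI₄
  have b0 : |I₀| ≤ B 0 := abs_intervalIntegral_le_integral (integrable_pow_mul_exp_neg_half_sq 0)
    (fun t => by positivity) fun t _ => by rw [pow_zero, one_mul, abs_of_pos (Real.exp_pos _)]
  have b4 : |I₄| ≤ B 4 := abs_intervalIntegral_le_integral (integrable_pow_mul_exp_neg_half_sq 4)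
    (fun t => by positivity) fun t _ => by rw [abs_mul, abs_pow, abs_of_pos (Real.exp_pos _)]
  set J := ∫ t in (0 : ℝ)..z, (1 - t ^ 2 / M) ^ k with hJ
  have hε : |J - (I₀ - I₄ / (4 * M))| ≤ (B 8 + B 6) * (1 / (k : ℝ)) ^ 2 := by
    have e1 : J - (I₀ - I₄ / (4 * M)) = ∫ t in (0 : ℝ)..z, ((1 - t ^ 2 / M) ^ k
        - Real.exp (-(t ^ 2 / 2)) * (1 - t ^ 4 / (4 * M))) := by
      rw [intervalIntegral.integral_sub (Continuous.intervalIntegrable (by fun_prop) _ _)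
        (Continuous.intervalIntegrable (by fun_prop) _ _), hJ, hI₀, hI₄,
        ← intervalIntegral.integral_div, ← intervalIntegral.integral_sub
        (Continuous.intervalIntegrable (by fun_prop) _ _)
        (Continuous.intervalIntegrable (by fun_prop) _ _)]
      congr 2
      funext t
      ring
    have e2 : (B 8 + B 6) * (1 / (k : ℝ)) ^ 2 = ∫ t : ℝ, (|t| ^ 8 * Real.exp (-(t ^ 2 / 2))
        + |t| ^ 6 * Real.exp (-(t ^ 2 / 2))) * (1 / (k : ℝ)) ^ 2 := by
      rw [integral_mul_const, integral_add (integrable_pow_mul_exp_neg_half_sq 8)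
        (integrable_pow_mul_exp_neg_half_sq 6)]
    rw [e1, e2]
    refine abs_intervalIntegral_le_integral (((integrable_pow_mul_exp_neg_half_sq 8).add
      (integrable_pow_mul_exp_neg_half_sq 6)).mul_const _) (fun t => by positivity) fun t ht => ?_
    have ht2 : t ^ 2 ≤ M := by
      refine le_trans ?_ hz2
      rw [← sq_abs t, ← sq_abs z]
      exact pow_le_pow_left₀ (abs_nonneg _) (abs_le_of_mem_uIcc_zero (Set.uIoc_subset_uIcc ht)) 2
    have h := abs_one_sub_pow_sub_le (w := t ^ 2 / M) (by positivity)
      (by rw [div_le_one hM0]; exact ht2) k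
    rw [show (k : ℝ) * (t ^ 2 / M) = t ^ 2 / 2 by rw [hM]; field_simp,
      show (k : ℝ) * (t ^ 2 / M) ^ 2 / 2 = t ^ 4 / (4 * M) by rw [hM]; field_simp; ring] at h
    refine h.trans ?_
    rw [show |t| ^ 8 = t ^ 8 by rw [← abs_pow, abs_of_nonneg (by positivity)],
      show |t| ^ 6 = t ^ 6 by rw [← abs_pow, abs_of_nonneg (by positivity)], ← add_mul]
    refine (le_of_eq (mul_comm _ _)).trans ((mul_le_mul_of_nonneg_right ?_ (Real.exp_pos _).le).trans
      (le_of_eq (mul_right_comm _ _ _)))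
    have : 4 * (k : ℝ) ^ 2 * (t ^ 2 / M) ^ 4 + k * (t ^ 2 / M) ^ 3
        = (1 / 4 * t ^ 8 + 1 / 8 * t ^ 6) * (1 / (k : ℝ)) ^ 2 := by
      rw [hM]; field_simp; ring
    rw [this]
    refine mul_le_mul_of_nonneg_right ?_ (by positivity)
    have : 0 ≤ t ^ 8 := by positivity
    have : 0 ≤ t ^ 6 := by positivity
    linarith
  have hd := hmc k hk
  rw [← hM] at hd
  set d := medianConst k
  set e := d - φ₀ * (1 + 3 / 4 / M) with he
  set ε := J - (I₀ - I₄ / (4 * M)) with hεd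
  have hku : (1 / (k : ℝ)) ^ 2 ≤ 1 := pow_le_one₀ (by positivity) (by rw [div_le_one hk0]; exact hk1)
  have hM1 : 1 / M ≤ 1 / k := by rw [hM]; gcongr; linarith
  have hM2 : 1 / M ≤ 1 := hM1.trans (by rw [div_le_one hk0]; exact hk1)
  have hdb : |d| ≤ 2 + C₁ := by
    have h3 : d = φ₀ * (1 + 3 / 4 / M) + e := by rw [he]; ring
    have h4 : φ₀ * (1 + 3 / 4 / M) ≤ 1 * 2 := by
      refine mul_le_mul hφ1 ?_ (by positivity) (by norm_num)
      rw [show 3 / 4 / M = 3 / 4 * (1 / M) by ring]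
      linarith
    have h5 : |e| ≤ C₁ * 1 := hd.trans (mul_le_mul_of_nonneg_left hku hC₁.le)
    rw [h3]
    refine (abs_add_le _ _).trans ?_
    rw [abs_of_nonneg (by positivity)]
    linarith
  have hJb : |I₀ - I₄ / (4 * M)| ≤ B 0 + B 4 := by
    refine (abs_sub _ _).trans (add_le_add b0 ?_)
    rw [abs_div, abs_of_pos (by positivity : 0 < 4 * M)]
    refine (div_le_self (abs_nonneg _) ?_).trans b4
    rw [hM]; linarith
  -- The product `φ₀ (1 + 3/(4M)) (I₀ - I₄/(4M))` equals `φ₀ I₀ + φ₀ (3 I₀ - I₄)/(4M)` minus a term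
  -- of order `M⁻²`; the middle expression is the stated correction.
  have key : medianPoly k u - (gaussCDF z + gaussDensity z * (z ^ 3 + 3 * z) / (4 * M))
      = -(φ₀ * 3 / 16 * (1 / M) ^ 2 * I₄) + e * (I₀ - I₄ / (4 * M)) + d * ε := by
    have h6 := medianPoly_eq_medianConst hk u
    rw [← hM, ← hz, ← hJ] at h6
    rw [h6, ← m2, hεd, he, show gaussCDF z = 1 / 2 + φ₀ * I₀ by linarith]
    field_simp
    ring
  rw [key]
  set κ := (1 / (k : ℝ)) ^ 2 with hκ
  have hκ0 : 0 ≤ κ := by positivity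
  have t1 : |-(φ₀ * 3 / 16 * (1 / M) ^ 2 * I₄)| ≤ B 4 * κ := by
    rw [abs_neg, abs_mul, abs_of_nonneg (by positivity)]
    have h7 : φ₀ * 3 / 16 * (1 / M) ^ 2 ≤ 1 * κ := by
      refine mul_le_mul (by linarith) ?_ (by positivity) (by norm_num)
      exact pow_le_pow_left₀ (by positivity) hM1 2
    rw [one_mul] at h7
    calc _ ≤ κ * B 4 := mul_le_mul h7 b4 (abs_nonneg _) hκ0
      _ = _ := mul_comm _ _
  have t2 : |e * (I₀ - I₄ / (4 * M))| ≤ C₁ * κ * (B 0 + B 4) := by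
    rw [abs_mul]
    exact mul_le_mul hd hJb (abs_nonneg _) (by positivity)
  have t3 : |d * ε| ≤ (2 + C₁) * ((B 8 + B 6) * κ) := by
    rw [abs_mul]
    exact mul_le_mul hdb hε (abs_nonneg _) (by positivity)
  refine (abs_add_le _ _).trans ((add_le_add ((abs_add_le _ _).trans (add_le_add t1 t2)) t3).trans ?_)
  linarith

/-! ### Taylor expansion of the normal distribution under perturbation -/

theorem abs_le_of_abs_deriv_le_on_unit {f f' : ℝ → ℝ} {C : ℝ} (hC : 0 ≤ C)
    (hd : ∀ s, HasDerivAt f (f' s) s) (h0 : f 0 = 0) (hb : ∀ s ∈ Set.Icc (0 : ℝ) 1, |f' s| ≤ C) :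
    ∀ s ∈ Set.Icc (0 : ℝ) 1, |f s| ≤ C := by
  intro s hs
  have := Convex.norm_image_sub_le_of_norm_hasDerivWithin_le (f := f) (f' := f') (C := C)
    (s := Set.Icc (0 : ℝ) 1) (x := 0) (y := s) (fun z _ => (hd z).hasDerivWithinAt) hb
    (convex_Icc 0 1) (Set.left_mem_Icc.mpr zero_le_one) hs
  rw [h0, sub_zero, sub_zero, Real.norm_eq_abs, Real.norm_eq_abs, abs_of_nonneg hs.1] at this
  exact this.trans (mul_le_of_le_one_right hC hs.2)

/-- Second order Taylor expansion of the normal distribution function. -/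
theorem abs_gaussCDF_add_sub_le {y h S : ℝ} (hS0 : 0 ≤ S)
    (hS : ∀ s ∈ Set.Icc (0 : ℝ) 1, ((y + s * h) ^ 2 + 1) * gaussDensity (y + s * h) ≤ S) :
    |gaussCDF (y + h) - (gaussCDF y + gaussDensity y * h - y * gaussDensity y * h ^ 2 / 2)|
      ≤ |h| ^ 3 * S := by
  have hC : 0 ≤ |h| ^ 3 * S := by positivity
  have hlin : ∀ s : ℝ, HasDerivAt (fun s : ℝ => y + s * h) h s := fun s => by
    have := ((hasDerivAt_id s).mul_const h).const_add y
    exact this.congr_deriv (by simp)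
  have hφ : ∀ s : ℝ, HasDerivAt (fun s => gaussDensity (y + s * h))
      (-(y + s * h) * gaussDensity (y + s * h) * h) s := fun s =>
    HasDerivAt.comp (h₂ := gaussDensity) (h := fun s => y + s * h) s
      (hasDerivAt_gaussDensity (y + s * h)) (hlin s)
  have hΦ : ∀ s : ℝ, HasDerivAt (fun s => gaussCDF (y + s * h)) (gaussDensity (y + s * h) * h) s :=
    fun s => HasDerivAt.comp (h₂ := gaussCDF) (h := fun s => y + s * h) s
      (hasDerivAt_gaussCDF (y + s * h)) (hlin s)
  have s2 := abs_le_of_abs_deriv_le_on_unit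
    (f := fun s => -(y + s * h) * gaussDensity (y + s * h) * h ^ 2 + y * gaussDensity y * h ^ 2)
    (f' := fun s => ((y + s * h) ^ 2 - 1) * gaussDensity (y + s * h) * h ^ 3) hC
    (fun s => by
      have := ((((hlin s).neg).mul (hφ s)).mul_const (h ^ 2)).add_const (y * gaussDensity y * h ^ 2)
      refine this.congr_deriv ?_
      simp only [Pi.neg_apply]
      ring)
    (by simp)
    (fun s hs => by
      rw [abs_mul, abs_pow, mul_comm, abs_mul, abs_of_pos (gaussDensity_pos _)]
      refine mul_le_mul_of_nonneg_left (le_trans ?_ (hS s hs)) (by positivity)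
      refine mul_le_mul_of_nonneg_right ?_ (gaussDensity_pos _).le
      rw [abs_le]
      constructor <;> nlinarith [sq_nonneg (y + s * h)])
  have s1 := abs_le_of_abs_deriv_le_on_unit
    (f := fun s => gaussDensity (y + s * h) * h - gaussDensity y * h + s * (y * gaussDensity y * h ^ 2))
    (f' := fun s => -(y + s * h) * gaussDensity (y + s * h) * h ^ 2 + y * gaussDensity y * h ^ 2) hC
    (fun s => by
      have := (((hφ s).mul_const h).sub_const (gaussDensity y * h)).add
        ((hasDerivAt_id s).mul_const (y * gaussDensity y * h ^ 2))
      exact this.congr_deriv (by simp; ring))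
    (by simp) s2
  have s0 := abs_le_of_abs_deriv_le_on_unit
    (f := fun s => gaussCDF (y + s * h) - gaussCDF y - s * (gaussDensity y * h)
      + s ^ 2 * (y * gaussDensity y * h ^ 2 / 2))
    (f' := fun s => gaussDensity (y + s * h) * h - gaussDensity y * h
      + s * (y * gaussDensity y * h ^ 2)) hC
    (fun s => by
      have := (((hΦ s).sub_const (gaussCDF y)).sub ((hasDerivAt_id s).mul_const
        (gaussDensity y * h))).add ((hasDerivAt_pow 2 s).mul_const (y * gaussDensity y * h ^ 2 / 2))
      exact this.congr_deriv (by simp; ring))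
    (by simp) s1 1 (Set.right_mem_Icc.mpr zero_le_one)
  refine (le_of_eq ?_).trans s0
  congr 1
  simp only [one_mul, one_pow]
  ring

/-- Since `ξ² ≥ y²/4`, half of the Gaussian exponent at `ξ` absorbs the polynomial and the other
half is at most `e^(-y²/16)`. The bounds along the segment from `y` to `z` thus decay in `y`. -/
theorem exists_poly_mul_gaussDensity_le :
    ∃ C : ℝ, 0 < C ∧ ∀ y ξ : ℝ, |y| / 2 ≤ |ξ| →
      (ξ ^ 2 + 1) * gaussDensity ξ ≤ C * Real.exp (-(1 / 16 * y ^ 2)) ∧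
      (3 + ξ ^ 4) * gaussDensity ξ ≤ C * Real.exp (-(1 / 16 * y ^ 2)) := by
  obtain ⟨C₂, hC₂, h₂⟩ := exists_abs_pow_mul_exp_le 2 (c := 1 / 4) (by norm_num)
  obtain ⟨C₄, hC₄, h₄⟩ := exists_abs_pow_mul_exp_le 4 (c := 1 / 4) (by norm_num)
  refine ⟨C₂ + C₄ + 3, by positivity, fun y ξ h => ?_⟩
  have hy : y ^ 2 / 4 ≤ ξ ^ 2 := by
    rw [← sq_abs y, ← sq_abs ξ]
    nlinarith [abs_nonneg y]
  have h1 : Real.exp (-(1 / 4 * ξ ^ 2)) ≤ Real.exp (-(1 / 16 * y ^ 2)) :=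
    Real.exp_le_exp.mpr (by linarith)
  have hφ : gaussDensity ξ ≤ Real.exp (-(1 / 4 * ξ ^ 2)) * Real.exp (-(1 / 16 * y ^ 2)) := by
    refine (gaussDensity_le_exp ξ).trans ?_
    rw [show -(1 / 2 * ξ ^ 2) = -(1 / 4 * ξ ^ 2) + -(1 / 4 * ξ ^ 2) by ring, Real.exp_add]
    exact mul_le_mul_of_nonneg_left h1 (Real.exp_pos _).le
  have k2 := h₂ ξ
  have k4 := h₄ ξ
  rw [sq_abs] at k2
  rw [show |ξ| ^ 4 = ξ ^ 4 by rw [← abs_pow, abs_of_nonneg (by positivity)]] at k4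
  have k0 : Real.exp (-(1 / 4 * ξ ^ 2)) ≤ 1 := Real.exp_le_one_iff.mpr (by nlinarith [sq_nonneg ξ])
  constructor
  · calc _ ≤ (ξ ^ 2 + 1) * (Real.exp (-(1 / 4 * ξ ^ 2)) * Real.exp (-(1 / 16 * y ^ 2))) :=
          mul_le_mul_of_nonneg_left hφ (by positivity)
      _ = (ξ ^ 2 * Real.exp (-(1 / 4 * ξ ^ 2)) + Real.exp (-(1 / 4 * ξ ^ 2)))
          * Real.exp (-(1 / 16 * y ^ 2)) := by ring
      _ ≤ _ := mul_le_mul_of_nonneg_right (by linarith) (Real.exp_pos _).le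
  · calc _ ≤ (3 + ξ ^ 4) * (Real.exp (-(1 / 4 * ξ ^ 2)) * Real.exp (-(1 / 16 * y ^ 2))) :=
          mul_le_mul_of_nonneg_left hφ (by positivity)
      _ = (3 * Real.exp (-(1 / 4 * ξ ^ 2)) + ξ ^ 4 * Real.exp (-(1 / 4 * ξ ^ 2)))
          * Real.exp (-(1 / 16 * y ^ 2)) := by ring
      _ ≤ _ := mul_le_mul_of_nonneg_right (by linarith) (Real.exp_pos _).le

theorem abs_gaussDensity_mul_cubic_sub_le {y h S : ℝ} (hS0 : 0 ≤ S)
    (hS : ∀ s ∈ Set.Icc (0 : ℝ) 1, (3 + (y + s * h) ^ 4) * gaussDensity (y + s * h) ≤ S) :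
    |gaussDensity (y + h) * ((y + h) ^ 3 + 3 * (y + h)) - gaussDensity y * (y ^ 3 + 3 * y)|
      ≤ |h| * S := by
  have hlin : ∀ s : ℝ, HasDerivAt (fun s : ℝ => y + s * h) h s := fun s => by
    have := ((hasDerivAt_id s).mul_const h).const_add y
    exact this.congr_deriv (by simp)
  have := abs_le_of_abs_deriv_le_on_unit
    (f := fun s => gaussDensity (y + s * h) * ((y + s * h) ^ 3 + 3 * (y + s * h))
      - gaussDensity y * (y ^ 3 + 3 * y))
    (f' := fun s => (3 - (y + s * h) ^ 4) * gaussDensity (y + s * h) * h)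
    (show 0 ≤ |h| * S by positivity)
    (fun s => by
      have hφ := (hasDerivAt_gaussDensity (y + s * h)).comp s (hlin s)
      have h3 := ((hlin s).pow 3).add ((hlin s).const_mul 3)
      refine ((hφ.mul h3).sub_const _).congr_deriv ?_
      simp only [Function.comp, Pi.add_apply, Pi.pow_apply]
      push_cast
      ring)
    (by simp)
    (fun s hs => by
      rw [abs_mul, mul_comm, abs_mul, abs_of_pos (gaussDensity_pos _)]
      refine mul_le_mul_of_nonneg_left (le_trans ?_ (hS s hs)) (abs_nonneg _)
      refine mul_le_mul_of_nonneg_right ?_ (gaussDensity_pos _).le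
      have : 0 ≤ (y + s * h) ^ 4 := by positivity
      rw [abs_le]
      constructor <;> linarith) 1 (Set.right_mem_Icc.mpr zero_le_one)
  simpa using this

/-- Expansion of `Φ(z) + φ(z) (z³ + 3 z) / (4 M)` for `z = y + κ₁ y |y| M^(-1/2) + b y³ M⁻¹ + ⋯`. -/
theorem exists_abs_gauss_perturbation_sub_le (κ₁ b : ℝ) {K : ℝ} (hK : 0 < K) :
    ∃ η : ℝ, 0 < η ∧ η ≤ 1 ∧ ∃ C : ℝ, 0 < C ∧ ∀ M y z : ℝ, 0 < M → |y| * M ^ (-(1 / 2) : ℝ) ≤ η →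
      |z - y - (κ₁ * (y * |y|) * M ^ (-(1 / 2) : ℝ) + b * y ^ 3 * M⁻¹)|
        ≤ K * y ^ 4 * (M ^ (-(1 / 2) : ℝ)) ^ 3 →
      |gaussCDF z + gaussDensity z * (z ^ 3 + 3 * z) / (4 * M)
        - medianExpansion κ₁ (1 + 4 * b) (2 * κ₁ ^ 2) M y| ≤ C * (M ^ (-(1 / 2) : ℝ)) ^ 3 := by
  obtain ⟨C₁, hC₁, hpoly⟩ := exists_poly_mul_gaussDensity_le
  obtain ⟨D₂, hD₂, hd₂⟩ := exists_abs_pow_mul_exp_le 2 (c := 1 / 16) (by norm_num)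
  obtain ⟨D₆, hD₆, hd₆⟩ := exists_abs_pow_mul_exp_le 6 (c := 1 / 16) (by norm_num)
  obtain ⟨E₄, hE₄, he₄⟩ := exists_abs_pow_mul_gaussDensity_le 4
  obtain ⟨E₆, hE₆, he₆⟩ := exists_abs_pow_mul_gaussDensity_le 6
  set A := |κ₁| + |b| + K with hA
  have hA0 : 0 < A := by positivity
  -- The bound `1/(2A)` ensures `|z - y| ≤ |y|/2`, so the whole segment from `y` to `z` keeps
  -- distance `|y|/2` from `0`.
  refine ⟨min 1 (1 / (2 * A)), by positivity, min_le_left _ _,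
    A ^ 3 * C₁ * D₆ + K * E₄ + A ^ 2 * E₆ + A * C₁ * D₂, by positivity, fun M y z hM hyM hz => ?_⟩
  set μ := M ^ (-(1 / 2) : ℝ) with hμ
  have hμ0 : 0 < μ := Real.rpow_pos_of_pos hM _
  have hμ2 : M⁻¹ = μ ^ 2 := by
    rw [hμ, ← Real.rpow_natCast, ← Real.rpow_mul hM.le, ← Real.rpow_neg_one]
    norm_num
  have hyμ1 : |y| * μ ≤ 1 := hyM.trans (min_le_left _ _)
  have hyμA : A * (|y| * μ) ≤ 1 / 2 := by
    have := mul_le_mul_of_nonneg_left (hyM.trans (min_le_right _ _)) hA0.le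
    rwa [show A * (1 / (2 * A)) = 1 / 2 by field_simp] at this
  rw [hμ2] at hz
  set α := κ₁ * (y * |y|) * μ with hα
  set β := b * y ^ 3 * μ ^ 2 with hβ
  set h := z - y with hh
  set ρ := h - (α + β) with hρ
  have hy0 := abs_nonneg y
  have hy4 : y ^ 4 = |y| ^ 4 := by rw [← abs_pow, abs_of_nonneg (by positivity)]
  have hα1 : |α| = |κ₁| * (|y| ^ 2 * μ) := by
    rw [hα, abs_mul, abs_mul, abs_mul, abs_abs, abs_of_pos hμ0]; ring
  have hβ1 : |β| = |b| * (|y| ^ 3 * μ ^ 2) := by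
    rw [hβ, abs_mul, abs_mul, abs_pow, abs_of_pos (by positivity : 0 < μ ^ 2)]; ring
  have q1 : |y| ^ 3 * μ ^ 2 ≤ |y| ^ 2 * μ := by
    calc |y| ^ 3 * μ ^ 2 = |y| ^ 2 * μ * (|y| * μ) := by ring
      _ ≤ _ := mul_le_of_le_one_right (by positivity) hyμ1
  have q2 : |y| ^ 4 * μ ^ 3 ≤ |y| ^ 3 * μ ^ 2 := by
    calc |y| ^ 4 * μ ^ 3 = |y| ^ 3 * μ ^ 2 * (|y| * μ) := by ring
      _ ≤ _ := mul_le_of_le_one_right (by positivity) hyμ1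
  have hρ1 : |ρ| ≤ K * (|y| ^ 4 * μ ^ 3) := by
    refine hz.trans (le_of_eq ?_)
    rw [hy4]; ring
  have hβρ : |β + ρ| ≤ A * (|y| ^ 3 * μ ^ 2) := by
    refine (abs_add_le _ _).trans ?_
    have h1 := hρ1.trans (mul_le_mul_of_nonneg_left q2 hK.le)
    have h2 : 0 ≤ |κ₁| * (|y| ^ 3 * μ ^ 2) := by positivity
    rw [hβ1, hA]
    linarith
  have hh1 : |h| ≤ A * (|y| ^ 2 * μ) := by
    have h1 : h = α + (β + ρ) := by rw [hρ]; ring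
    have h2 : |β + ρ| ≤ (|b| + K) * (|y| ^ 2 * μ) := by
      refine (abs_add_le _ _).trans ?_
      have h3 := hρ1.trans (mul_le_mul_of_nonneg_left (q2.trans q1) hK.le)
      have h4 := mul_le_mul_of_nonneg_left q1 (abs_nonneg b)
      rw [hβ1]
      linarith
    rw [h1]
    refine (abs_add_le _ _).trans ?_
    rw [hα1, hA]
    linarith
  have hh2 : |h| ≤ |y| / 2 := by
    refine hh1.trans ?_
    calc A * (|y| ^ 2 * μ) = |y| * (A * (|y| * μ)) := by ring
      _ ≤ |y| * (1 / 2) := mul_le_mul_of_nonneg_left hyμA hy0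
      _ = _ := by ring
  have hξ : ∀ s ∈ Set.Icc (0 : ℝ) 1, |y| / 2 ≤ |y + s * h| := by
    intro s hs
    have h1 : |s * h| ≤ |y| / 2 := by
      rw [abs_mul, abs_of_nonneg hs.1]
      exact (mul_le_of_le_one_left (abs_nonneg _) hs.2).trans hh2
    have h2 := abs_sub_abs_le_abs_sub y (-(s * h))
    rw [abs_neg, sub_neg_eq_add] at h2
    linarith
  set ω := Real.exp (-(1 / 16 * y ^ 2)) with hω
  have hω0 : 0 < ω := Real.exp_pos _
  have t1 := abs_gaussCDF_add_sub_le (y := y) (h := h) (S := C₁ * ω) (by positivity)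
    fun s hs => (hpoly y _ (hξ s hs)).1
  have t4 := abs_gaussDensity_mul_cubic_sub_le (y := y) (h := h) (S := C₁ * ω) (by positivity)
    fun s hs => (hpoly y _ (hξ s hs)).2
  have hyh : y + h = z := by rw [hh]; ring
  rw [hyh] at t1 t4
  have u1 : |h| ^ 3 * (C₁ * ω) ≤ A ^ 3 * C₁ * D₆ * μ ^ 3 := by
    calc |h| ^ 3 * (C₁ * ω) ≤ (A * (|y| ^ 2 * μ)) ^ 3 * (C₁ * ω) :=
          mul_le_mul_of_nonneg_right (pow_le_pow_left₀ (abs_nonneg _) hh1 3) (by positivity)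
      _ = A ^ 3 * C₁ * μ ^ 3 * (|y| ^ 6 * ω) := by ring
      _ ≤ A ^ 3 * C₁ * μ ^ 3 * D₆ := mul_le_mul_of_nonneg_left (hd₆ y) (by positivity)
      _ = _ := by ring
  have hφ0 := gaussDensity_pos y
  have he₄' : |y| ^ 4 * gaussDensity y ≤ E₄ := he₄ y
  have he₆' : |y| ^ 6 * gaussDensity y ≤ E₆ := he₆ y
  have u2 : |gaussDensity y * ρ| ≤ K * E₄ * μ ^ 3 := by
    rw [abs_mul, abs_of_pos hφ0]
    calc _ ≤ gaussDensity y * (K * (|y| ^ 4 * μ ^ 3)) := mul_le_mul_of_nonneg_left hρ1 hφ0.le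
      _ = K * μ ^ 3 * (|y| ^ 4 * gaussDensity y) := by ring
      _ ≤ K * μ ^ 3 * E₄ := mul_le_mul_of_nonneg_left he₄' (by positivity)
      _ = _ := by ring
  have u3 : |y * gaussDensity y / 2 * (h ^ 2 - α ^ 2)| ≤ A ^ 2 * E₆ * μ ^ 3 := by
    have h1 : h ^ 2 - α ^ 2 = (β + ρ) * (h + α) := by rw [hρ]; ring
    have h2 : |h + α| ≤ 2 * (A * (|y| ^ 2 * μ)) := by
      refine (abs_add_le _ _).trans ?_
      have h3 : |α| ≤ A * (|y| ^ 2 * μ) := by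
        rw [hα1]
        refine mul_le_mul_of_nonneg_right ?_ (by positivity)
        rw [hA]
        linarith [abs_nonneg b]
      linarith
    rw [h1, abs_mul, abs_mul, abs_div, abs_mul, abs_of_pos hφ0, abs_of_pos (by norm_num : (0 : ℝ) < 2)]
    calc _ ≤ |y| * gaussDensity y / 2 * ((A * (|y| ^ 3 * μ ^ 2)) * (2 * (A * (|y| ^ 2 * μ)))) :=
          mul_le_mul_of_nonneg_left (mul_le_mul hβρ h2 (abs_nonneg _) (by positivity)) (by positivity)
      _ = A ^ 2 * μ ^ 3 * (|y| ^ 6 * gaussDensity y) := by ring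
      _ ≤ A ^ 2 * μ ^ 3 * E₆ := mul_le_mul_of_nonneg_left he₆' (by positivity)
      _ = _ := by ring
  have u4 : |(gaussDensity z * (z ^ 3 + 3 * z) - gaussDensity y * (y ^ 3 + 3 * y)) * (μ ^ 2 / 4)|
      ≤ A * C₁ * D₂ * μ ^ 3 := by
    rw [abs_mul, abs_of_pos (by positivity : 0 < μ ^ 2 / 4)]
    calc _ ≤ (A * (|y| ^ 2 * μ)) * (C₁ * ω) * (μ ^ 2 / 4) :=
          mul_le_mul_of_nonneg_right (t4.trans (mul_le_mul_of_nonneg_right hh1 (by positivity)))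
            (by positivity)
      _ = A * C₁ * μ ^ 3 * (|y| ^ 2 * ω) / 4 := by ring
      _ ≤ A * C₁ * μ ^ 3 * (|y| ^ 2 * ω) := div_le_self (by positivity) (by norm_num)
      _ ≤ A * C₁ * μ ^ 3 * D₂ := mul_le_mul_of_nonneg_left (hd₂ y) (by positivity)
      _ = _ := by ring
  have hα2 : α ^ 2 = κ₁ ^ 2 * y ^ 4 * μ ^ 2 := by
    rw [hα, mul_pow, mul_pow, mul_pow, sq_abs]; ring
  -- At order `M⁻¹` the cubic terms `y³/4` and `b y³` give `1 + 4b`, and the quadratic Taylor term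
  -- `-y α²/2 = -κ₁² y⁵/(2M)` gives `2 κ₁²`.
  have key : gaussCDF z + gaussDensity z * (z ^ 3 + 3 * z) / (4 * M)
        - medianExpansion κ₁ (1 + 4 * b) (2 * κ₁ ^ 2) M y
      = (gaussCDF z - (gaussCDF y + gaussDensity y * h - y * gaussDensity y * h ^ 2 / 2))
        + gaussDensity y * ρ + -(y * gaussDensity y / 2 * (h ^ 2 - α ^ 2))
        + (gaussDensity z * (z ^ 3 + 3 * z) - gaussDensity y * (y ^ 3 + 3 * y)) * (μ ^ 2 / 4) := by
    rw [medianExpansion, ← hμ, hμ2, hα2, hρ, hα, hβ,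
      show gaussDensity z * (z ^ 3 + 3 * z) / (4 * M)
        = gaussDensity z * (z ^ 3 + 3 * z) / 4 * M⁻¹ by field_simp, hμ2]
    ring
  rw [key]
  refine (abs_add_le _ _).trans ((add_le_add ((abs_add_le _ _).trans (add_le_add
    ((abs_add_le _ _).trans (add_le_add (t1.trans u1) u2)) ((abs_neg _).le.trans u3))) u4).trans ?_)
  linarith

/-! ### Tails and stability of the expansion -/

theorem medianExpansion_neg (κ₁ κ₂ κ₃ m y : ℝ) :
    medianExpansion κ₁ κ₂ κ₃ m (-y) = 1 - medianExpansion κ₁ κ₂ κ₃ m y := by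
  rw [medianExpansion, medianExpansion, gaussCDF_neg, gaussDensity_neg, abs_neg]
  ring

theorem exists_gaussCDF_neg_le : ∃ C : ℝ, 0 < C ∧ ∀ y : ℝ, 0 < y → gaussCDF (-y) ≤ C / y ^ 3 := by
  have hi : Integrable fun t : ℝ => |t| ^ 3 * Real.exp (-(t ^ 2 / 2)) :=
    integrable_pow_mul_exp_neg_half_sq 3
  refine ⟨(∫ t : ℝ, |t| ^ 3 * Real.exp (-(t ^ 2 / 2))) + 1, by
    have : 0 ≤ ∫ t : ℝ, |t| ^ 3 * Real.exp (-(t ^ 2 / 2)) := integral_nonneg fun t => by positivity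
    positivity, fun y hy => ?_⟩
  have h1 : gaussCDF (-y) ≤ ∫ t in Set.Iic (-y), |t| ^ 3 * Real.exp (-(t ^ 2 / 2)) / y ^ 3 := by
    refine setIntegral_mono_on integrable_gaussDensity.integrableOn (hi.div_const _).integrableOn
      measurableSet_Iic fun t ht => ?_
    have ht' : y ≤ |t| := by
      have : t ≤ -y := ht
      rw [abs_of_neg (by linarith)]
      linarith
    rw [le_div_iff₀ (by positivity), mul_comm]
    refine mul_le_mul (pow_le_pow_left₀ hy.le ht' 3) ?_ (gaussDensity_pos _).le (by positivity)
    refine (gaussDensity_le_exp t).trans (le_of_eq ?_)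
    congr 1
    ring
  have h2 := setIntegral_le_integral (s := Set.Iic (-y)) (hi.div_const (y ^ 3))
    (Eventually.of_forall fun t => by positivity)
  rw [integral_div] at h1
  rw [integral_div, integral_div] at h2
  refine (h1.trans h2).trans ?_
  gcongr
  linarith

/-- A decay `y⁻³` suffices: away from the centre the normalized argument is of order `√k`, which
gives `k^(-3/2)`. -/
theorem exists_abs_medianExpansion_neg_le (κ₁ κ₂ κ₃ : ℝ) :
    ∃ C : ℝ, 0 < C ∧ ∀ m y : ℝ, 1 ≤ m → 0 < y → |medianExpansion κ₁ κ₂ κ₃ m (-y)| ≤ C / y ^ 3 := by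
  obtain ⟨C, hC, hΦ⟩ := exists_gaussCDF_neg_le
  obtain ⟨E₄, hE₄, h₄⟩ := exists_abs_pow_mul_gaussDensity_le 4
  obtain ⟨E₅, hE₅, h₅⟩ := exists_abs_pow_mul_gaussDensity_le 5
  obtain ⟨E₆, hE₆, h₆⟩ := exists_abs_pow_mul_gaussDensity_le 6
  obtain ⟨E₈, hE₈, h₈⟩ := exists_abs_pow_mul_gaussDensity_le 8
  refine ⟨C + (|κ₁| * E₅ + (3 * E₄ + |κ₂| * E₆ + |κ₃| * E₈)), by positivity, fun m y hm hy => ?_⟩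
  have hφ := gaussDensity_pos y
  have a1 : m ^ (-(1 / 2) : ℝ) ≤ 1 := Real.rpow_le_one_of_one_le_of_nonpos hm (by norm_num)
  have a2 : m⁻¹ ≤ 1 := inv_le_one_of_one_le₀ hm
  have a3 : 0 ≤ m ^ (-(1 / 2) : ℝ) := by positivity
  have a4 : 0 ≤ m⁻¹ := by positivity
  rw [le_div_iff₀ (by positivity)]
  have g := (le_div_iff₀ (by positivity)).mp (hΦ y hy)
  have g4 := h₄ y
  have g5 := h₅ y
  have g6 := h₆ y
  have g8 := h₈ y
  rw [abs_of_pos hy] at g4 g5 g6 g8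
  rw [medianExpansion, gaussDensity_neg, abs_neg, abs_of_pos hy]
  set μ := m ^ (-(1 / 2) : ℝ)
  set ν := m⁻¹
  set φ := gaussDensity y
  have hb : |κ₁ * (-y * y) * μ + (3 * -y + κ₂ * (-y) ^ 3 - κ₃ * (-y) ^ 5) / 4 * ν|
      ≤ |κ₁| * y ^ 2 + (3 * y + |κ₂| * y ^ 3 + |κ₃| * y ^ 5) := by
    refine (abs_add_le _ _).trans (add_le_add ?_ ?_)
    · rw [abs_mul, abs_mul, abs_of_nonneg a3, abs_mul, abs_neg, abs_of_pos hy, ← pow_two]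
      exact mul_le_of_le_one_right (by positivity) a1
    · rw [abs_mul, abs_of_nonneg a4, show 3 * -y + κ₂ * (-y) ^ 3 - κ₃ * (-y) ^ 5
        = -(3 * y + κ₂ * y ^ 3 - κ₃ * y ^ 5) by ring, abs_div, abs_neg,
        abs_of_pos (by norm_num : (0 : ℝ) < 4)]
      have h1 : |3 * y + κ₂ * y ^ 3 - κ₃ * y ^ 5| ≤ 3 * y + |κ₂| * y ^ 3 + |κ₃| * y ^ 5 := by
        refine (abs_sub _ _).trans (add_le_add ((abs_add_le _ _).trans (add_le_add ?_ ?_)) ?_)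
        · rw [abs_of_pos (by positivity)]
        · rw [abs_mul, abs_of_pos (by positivity : 0 < y ^ 3)]
        · rw [abs_mul, abs_of_pos (by positivity : 0 < y ^ 5)]
      have h2 := abs_nonneg (3 * y + κ₂ * y ^ 3 - κ₃ * y ^ 5)
      calc _ ≤ |3 * y + κ₂ * y ^ 3 - κ₃ * y ^ 5| / 4 * 1 := by gcongr
        _ ≤ _ := by linarith
  calc _ ≤ (gaussCDF (-y) + φ * (|κ₁| * y ^ 2 + (3 * y + |κ₂| * y ^ 3 + |κ₃| * y ^ 5))) * y ^ 3 := by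
        refine mul_le_mul_of_nonneg_right ((abs_add_le _ _).trans (add_le_add ?_ ?_)) (by positivity)
        · rw [abs_of_nonneg (gaussCDF_nonneg _)]
        · rw [abs_mul, abs_of_pos hφ]
          exact mul_le_mul_of_nonneg_left hb hφ.le
    _ = gaussCDF (-y) * y ^ 3 + (|κ₁| * (y ^ 5 * φ) + (3 * (y ^ 4 * φ) + |κ₂| * (y ^ 6 * φ)
        + |κ₃| * (y ^ 8 * φ))) := by ring
    _ ≤ _ := by gcongr

/-- Allows the even part `2⌊m/2⌋`, natural in the median, to be replaced by `m` in the coefficients.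
-/
theorem exists_abs_medianExpansion_sub_le (κ₁ κ₂ κ₃ : ℝ) :
    ∃ C : ℝ, 0 < C ∧ ∀ M m y : ℝ, 1 ≤ M → M ≤ m → m ≤ M + 1 →
      |medianExpansion κ₁ κ₂ κ₃ M y - medianExpansion κ₁ κ₂ κ₃ m y| ≤ C * M ^ (-(3 / 2) : ℝ) := by
  obtain ⟨B, hB, h⟩ := exists_abs_correction_le κ₁ κ₂ κ₃
  refine ⟨2 * B, by positivity, fun M m y hM1 hMm hm => ?_⟩
  have hM0 : 0 < M := by linarith
  have hm0 : 0 < m := by linarith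
  obtain ⟨h1, h2⟩ := h y
  have e32 : M ^ (-(3 / 2) : ℝ) = (Real.sqrt M)⁻¹ * M⁻¹ := by
    rw [Real.sqrt_eq_rpow, ← Real.rpow_neg hM0.le, ← Real.rpow_neg_one, ← Real.rpow_add hM0]
    norm_num
  have hs1 : 1 ≤ Real.sqrt M := by rw [Real.one_le_sqrt]; exact hM1
  have hs0 : 0 < Real.sqrt M := by linarith
  have hsm : Real.sqrt M ≤ Real.sqrt m := Real.sqrt_le_sqrt hMm
  have hsq : Real.sqrt M * Real.sqrt M = M := Real.mul_self_sqrt hM0.le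
  have hsqm : Real.sqrt m * Real.sqrt m = m := Real.mul_self_sqrt hm0.le
  have d1 : |M ^ (-(1 / 2) : ℝ) - m ^ (-(1 / 2) : ℝ)| ≤ M ^ (-(3 / 2) : ℝ) := by
    rw [Real.rpow_neg hM0.le, Real.rpow_neg hm0.le, ← Real.sqrt_eq_rpow, ← Real.sqrt_eq_rpow,
      abs_of_nonneg (sub_nonneg.mpr (inv_anti₀ hs0 hsm)), e32]
    have h3 : Real.sqrt m - Real.sqrt M ≤ (Real.sqrt m)⁻¹ := by
      rw [← one_div, le_div_iff₀ (by linarith)]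
      nlinarith
    have h4 : (Real.sqrt m)⁻¹ ≤ (Real.sqrt M)⁻¹ := inv_anti₀ hs0 hsm
    calc (Real.sqrt M)⁻¹ - (Real.sqrt m)⁻¹
        = (Real.sqrt m - Real.sqrt M) * ((Real.sqrt M)⁻¹ * (Real.sqrt m)⁻¹) := by
          have : Real.sqrt m ≠ 0 := by linarith
          field_simp
      _ ≤ (Real.sqrt M)⁻¹ * ((Real.sqrt M)⁻¹ * (Real.sqrt M)⁻¹) :=
          mul_le_mul (h3.trans h4) (mul_le_mul_of_nonneg_left h4 (by positivity)) (by positivity)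
            (by positivity)
      _ = _ := by rw [← mul_inv, hsq]
  have d2 : |M⁻¹ - m⁻¹| ≤ M ^ (-(3 / 2) : ℝ) := by
    have h3 : m⁻¹ ≤ M⁻¹ := inv_anti₀ hM0 hMm
    rw [abs_of_nonneg (sub_nonneg.mpr h3), e32]
    have h5 : M⁻¹ ≤ (Real.sqrt M)⁻¹ := inv_anti₀ hs0 (by nlinarith)
    calc M⁻¹ - m⁻¹ = (m - M) * (M⁻¹ * m⁻¹) := by field_simp
      _ ≤ 1 * (M⁻¹ * M⁻¹) := mul_le_mul (by linarith)
          (mul_le_mul_of_nonneg_left h3 (by positivity)) (by positivity) (by norm_num)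
      _ ≤ _ := by
          rw [one_mul]
          exact mul_le_mul_of_nonneg_right h5 (by positivity)
  have key : medianExpansion κ₁ κ₂ κ₃ M y - medianExpansion κ₁ κ₂ κ₃ m y
      = gaussDensity y * (κ₁ * (y * |y|)) * (M ^ (-(1 / 2) : ℝ) - m ^ (-(1 / 2) : ℝ))
        + gaussDensity y * ((3 * y + κ₂ * y ^ 3 - κ₃ * y ^ 5) / 4) * (M⁻¹ - m⁻¹) := by
    rw [medianExpansion, medianExpansion]
    ring
  rw [key]
  refine (abs_add_le _ _).trans ?_
  rw [abs_mul, abs_mul (_ * ((3 * y + κ₂ * y ^ 3 - κ₃ * y ^ 5) / 4))]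
  have f1 := mul_le_mul h1 d1 (abs_nonneg _) hB.le
  have f2 := mul_le_mul h2 d2 (abs_nonneg _) hB.le
  linarith

/-! ### Expansion of the sample median -/

/-- With `y = 2aqs` and `q² = M`, the Taylor remainder of the distribution function at `s` becomes
the remainder in the perturbation lemma, with `κ₁ = p₁/(4a²)` and `b = p₂/(24a³)`. -/
theorem median_scale_sub {a q : ℝ} (ha : 0 < a) (hq : 0 < q) (p₁ p₂ s F : ℝ) :
    2 * q * (F - 1 / 2) - 2 * a * q * s - (p₁ / (4 * a ^ 2) * (2 * a * q * s * |2 * a * q * s|) * q⁻¹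
        + p₂ / (24 * a ^ 3) * (2 * a * q * s) ^ 3 * (q * q)⁻¹)
      = 2 * q * (F - 1 / 2 - (a * s + p₁ / 2 * (s * |s|) + p₂ / 6 * s ^ 3)) := by
  rw [abs_mul, abs_of_pos (by positivity : 0 < 2 * a * q)]
  field_simp
  ring

theorem median_scale_remainder {a q : ℝ} (ha : 0 < a) (hq : 0 < q) (L s : ℝ) :
    L / (8 * a ^ 4) * (2 * a * q * s) ^ 4 * q⁻¹ ^ 3 = 2 * q * (L * s ^ 4) := by
  field_simp
  ring

namespace RegularSymmetricDensity

/-- A sample of size `2k` behaves to this order like one of size `2k + 1`, for which the identity is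
exact. -/
theorem exists_abs_median_sub_medianPoly_le {p : ℝ → ℝ} (hp : RegularSymmetricDensity p) {δ L : ℝ}
    (hδ : 0 < δ) (hL : 0 ≤ L) (hpb : ∀ s, |s| < δ → p 0 / 2 ≤ p s ∧ p s ≤ 2 * p 0)
    (hlip : ∀ s t, |s| < δ → |t| < δ → |p s - p t| ≤ L * |s - t|) :
    ∃ K : ℝ, 0 < K ∧ ∀ m : ℕ, 2 ≤ m → ∀ s : ℝ, |s| ≤ δ / 4 →
      |(sampleLaw p m).real {v | sampleMedian v ≤ s} - medianPoly (m / 2) (densityCDF p s)|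
        ≤ K * ((m / 2 : ℕ) : ℝ) ^ (-(3 / 2) : ℝ) := by
  obtain ⟨K, hK, h⟩ := hp.exists_even_median_sub_le hδ hL hpb hlip
  have := hp.isProbabilityMeasure
  refine ⟨K, hK, fun m hm s hs => ?_⟩
  rcases Nat.even_or_odd' m with ⟨k, rfl | rfl⟩
  · obtain ⟨l, rfl⟩ : ∃ l, k = l + 1 := ⟨k - 1, by omega⟩
    rw [show 2 * (l + 1) / 2 = l + 1 by omega]
    have := h l s hs
    push_cast
    exact this
  · rw [show (2 * k + 1) / 2 = k by omega, sampleLaw, measureReal_sampleMedian_odd, densityCDF, sub_self,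
      abs_zero]
    positivity

theorem exists_abs_median_sub_medianExpansion_near {p : ℝ → ℝ} (hp : RegularSymmetricDensity p)
    {p₁ p₂ : ℝ} (hp₁ : Tendsto (deriv p) (𝓝[>] 0) (𝓝 p₁))
    (hp₂ : Tendsto (iteratedDeriv 2 p) (𝓝[>] 0) (𝓝 p₂)) :
    ∃ δ : ℝ, 0 < δ ∧ ∃ C : ℝ, 0 < C ∧ ∀ m : ℕ, 2 ≤ m → ∀ s : ℝ, |s| ≤ δ →
      |(sampleLaw p m).real {v | sampleMedian v ≤ s}
        - medianExpansion (p₁ / (4 * p 0 ^ 2)) (1 + p₂ / (6 * p 0 ^ 3)) (p₁ ^ 2 / (8 * p 0 ^ 4))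
          (2 * (m / 2 : ℕ)) (2 * p 0 * Real.sqrt (2 * (m / 2 : ℕ)) * s)|
        ≤ C * ((m / 2 : ℕ) : ℝ) ^ (-(3 / 2) : ℝ) := by
  obtain ⟨δ, hδ, L, hL, hpb, hlip, hF⟩ := hp.exists_local_expansion hp₁ hp₂
  obtain ⟨K, hK, hmed⟩ := hp.exists_abs_median_sub_medianPoly_le hδ hL.le hpb hlip
  obtain ⟨C₂, hC₂, hpoly⟩ := exists_abs_medianPoly_sub_le
  have hp0 := hp.pos
  obtain ⟨η, hη, -, C₃, hC₃, hpert⟩ := exists_abs_gauss_perturbation_sub_le (p₁ / (4 * p 0 ^ 2))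
    (p₂ / (24 * p 0 ^ 3)) (K := L / (8 * p 0 ^ 4)) (by positivity)
  refine ⟨min (δ / 4) (η / (2 * p 0)), by positivity, K + C₂ + C₃, by positivity, fun m hm s hs => ?_⟩
  have hs1 : |s| ≤ δ / 4 := hs.trans (min_le_left _ _)
  have hs2 : 2 * p 0 * |s| ≤ η := by
    have := hs.trans (min_le_right _ _)
    rwa [le_div_iff₀ (by positivity), mul_comm] at this
  have hk : 1 ≤ m / 2 := by omega
  have a1 := hmed m hm s hs1
  set k := m / 2
  have hk1 : (1 : ℝ) ≤ k := by exact_mod_cast hk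
  have hk0 : (0 : ℝ) < k := by linarith
  set q := Real.sqrt (2 * k) with hq
  have hM0 : (0 : ℝ) < 2 * k := by positivity
  have hq0 : 0 < q := Real.sqrt_pos.mpr hM0
  have hq2 : q * q = 2 * k := Real.mul_self_sqrt hM0.le
  have hμ : (2 * k : ℝ) ^ (-(1 / 2) : ℝ) = q⁻¹ := by
    rw [Real.rpow_neg hM0.le, ← Real.sqrt_eq_rpow]
  have a2 := hpoly k hk (densityCDF p s) _ (densityCDF_nonneg p s) (hp.cdf_le_one s) rfl
  rw [← hq] at a2
  set z := 2 * q * (densityCDF p s - 1 / 2) with hz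
  have a3 := hpert (2 * k) (2 * p 0 * q * s) z hM0 (by
    rw [hμ, abs_mul, abs_of_pos (by positivity : 0 < 2 * p 0 * q)]
    calc 2 * p 0 * q * |s| * q⁻¹ = 2 * p 0 * |s| := by field_simp
      _ ≤ η := hs2) (by
    rw [hμ, ← hq2]
    have h1 := mul_le_mul_of_nonneg_left (hF s (by linarith)) (show 0 ≤ 2 * q by positivity)
    rw [median_scale_sub hp0 hq0, median_scale_remainder hp0 hq0, abs_mul,
      abs_of_pos (by positivity : 0 < 2 * q)]
    exact h1)
  have hr : q⁻¹ ^ 3 ≤ (k : ℝ) ^ (-(3 / 2) : ℝ) := by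
    rw [← hμ, ← Real.rpow_natCast, ← Real.rpow_mul hM0.le]
    refine le_trans (Real.rpow_le_rpow_of_nonpos hk0 (by linarith) (by norm_num)) (le_of_eq ?_)
    norm_num
  have hr2 : (1 / (k : ℝ)) ^ 2 ≤ (k : ℝ) ^ (-(3 / 2) : ℝ) := by
    rw [one_div, ← Real.rpow_natCast, Real.inv_rpow hk0.le, ← Real.rpow_neg hk0.le]
    exact Real.rpow_le_rpow_of_exponent_le hk1 (by norm_num)
  rw [hμ, show 1 + 4 * (p₂ / (24 * p 0 ^ 3)) = 1 + p₂ / (6 * p 0 ^ 3) by field_simp; ring,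
    show 2 * (p₁ / (4 * p 0 ^ 2)) ^ 2 = p₁ ^ 2 / (8 * p 0 ^ 4) by field_simp; ring] at a3
  refine (abs_sub_le _ _ _).trans ((add_le_add a1 ((abs_sub_le _ _ _).trans
    (add_le_add a2 a3))).trans ?_)
  have e2 := mul_le_mul_of_nonneg_left hr2 hC₂.le
  have e3 := mul_le_mul_of_nonneg_left hr hC₃.le
  linarith

/-- Second order expansion of the distribution of the sample median. -/
theorem exists_abs_median_sub_medianExpansion_le {p : ℝ → ℝ} (hp : RegularSymmetricDensity p)
    {p₁ p₂ : ℝ} (hp₁ : Tendsto (deriv p) (𝓝[>] 0) (𝓝 p₁))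
    (hp₂ : Tendsto (iteratedDeriv 2 p) (𝓝[>] 0) (𝓝 p₂)) :
    ∃ C : ℝ, 0 < C ∧ ∀ m : ℕ, 2 ≤ m → ∀ y : ℝ,
      |(sampleLaw p m).real {v | 2 * p 0 * Real.sqrt (evenPart m) * sampleMedian v ≤ y}
        - medianExpansion (p₁ / (4 * p 0 ^ 2)) (1 + p₂ / (6 * p 0 ^ 3)) (p₁ ^ 2 / (8 * p 0 ^ 4)) m y|
        ≤ C * (m : ℝ) ^ (-(3 / 2) : ℝ) := by
  obtain ⟨δ, hδ, C, hC, hnear⟩ := hp.exists_abs_median_sub_medianExpansion_near hp₁ hp₂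
  set κ₁ := p₁ / (4 * p 0 ^ 2)
  set κ₂ := 1 + p₂ / (6 * p 0 ^ 3)
  set κ₃ := p₁ ^ 2 / (8 * p 0 ^ 4)
  obtain ⟨T, hT, htail⟩ := exists_abs_medianExpansion_neg_le κ₁ κ₂ κ₃
  obtain ⟨D, hD, hshift⟩ := exists_abs_medianExpansion_sub_le κ₁ κ₂ κ₃
  have hp0 := hp.pos
  set E := T / (2 * p 0 * δ) ^ 3 with hE
  have hE0 : 0 < E := by positivity
  refine ⟨(C + 2 * E + D) * 6, by positivity, fun m hm y => ?_⟩
  have := hp.isProbabilityMeasure_sampleLaw m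
  have hk : 1 ≤ m / 2 := by omega
  have hn := hnear m hm
  have hkm : m ≤ 3 * (m / 2) := by omega
  have hkm2 : 2 * (m / 2) ≤ m := by omega
  have hkm3 : m ≤ 2 * (m / 2) + 1 := by omega
  set k := m / 2 with hkd
  have hk1 : (1 : ℝ) ≤ k := by exact_mod_cast hk
  have hk0 : (0 : ℝ) < k := by linarith
  have hM0 : (0 : ℝ) < 2 * k := by positivity
  have hm0 : (0 : ℝ) < m := by exact_mod_cast (by omega : 0 < m)
  set q := Real.sqrt (2 * k) with hq
  have hq0 : 0 < q := Real.sqrt_pos.mpr hM0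
  have hev : ((evenPart m : ℕ) : ℝ) = 2 * k := by rw [evenPart, ← hkd]; push_cast; ring
  rw [hev, ← hq]
  set w := (k : ℝ) ^ (-(3 / 2) : ℝ) with hw
  have hw0 : 0 < w := Real.rpow_pos_of_pos hk0 _
  have hM32 : (2 * k : ℝ) ^ (-(3 / 2) : ℝ) ≤ w :=
    Real.rpow_le_rpow_of_nonpos hk0 (by linarith) (by norm_num)
  have hwm : w ≤ 6 * (m : ℝ) ^ (-(3 / 2) : ℝ) := by
    have h1 : (m : ℝ) / 3 ≤ k := by
      rw [div_le_iff₀ (by norm_num)]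
      exact_mod_cast (by omega : m ≤ k * 3)
    refine (Real.rpow_le_rpow_of_nonpos (by positivity) h1 (by norm_num)).trans ?_
    rw [Real.div_rpow hm0.le (by norm_num), div_eq_mul_inv, mul_comm]
    refine mul_le_mul_of_nonneg_right ?_ (by positivity)
    rw [← Real.rpow_neg (by norm_num), neg_neg]
    calc (3 : ℝ) ^ (3 / 2 : ℝ) = 3 * Real.sqrt 3 := by
          rw [Real.sqrt_eq_rpow, ← Real.rpow_one_add' (by norm_num) (by norm_num)]; norm_num
      _ ≤ 3 * 2 := by
          refine mul_le_mul_of_nonneg_left ?_ (by norm_num)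
          rw [Real.sqrt_le_left (by norm_num)]
          norm_num
      _ = 6 := by norm_num
  have hq3 : T / (2 * p 0 * q * δ) ^ 3 ≤ E * w := by
    have h1 : q⁻¹ ^ 3 = (2 * k : ℝ) ^ (-(3 / 2) : ℝ) := by
      rw [hq, Real.sqrt_eq_rpow, ← Real.rpow_neg hM0.le, ← Real.rpow_natCast, ← Real.rpow_mul hM0.le]
      norm_num
    calc T / (2 * p 0 * q * δ) ^ 3 = E * q⁻¹ ^ 3 := by rw [hE]; field_simp
      _ ≤ _ := by rw [h1]; exact mul_le_mul_of_nonneg_left hM32 hE0.le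
  set s := y / (2 * p 0 * q) with hs
  have hys : 2 * p 0 * q * s = y := by rw [hs]; field_simp
  have hset : {v : Fin m → ℝ | 2 * p 0 * q * sampleMedian v ≤ y} = {v | sampleMedian v ≤ s} := by
    ext v
    simp only [Set.mem_ofPred_eq]
    rw [hs, le_div_iff₀ (by positivity), mul_comm]
  rw [hset]
  set P : ℝ → ℝ := fun s => (sampleLaw p m).real {v | sampleMedian v ≤ s} with hP
  have hPmono : ∀ a b, a ≤ b → P a ≤ P b := fun a b hab =>
    measureReal_mono fun v hv => le_trans hv hab
  have hP0 : ∀ a, 0 ≤ P a := fun a => measureReal_nonneg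
  have hP1 : ∀ a, P a ≤ 1 := fun a => measureReal_le_one
  have hneg : ∀ a, δ ≤ a → |medianExpansion κ₁ κ₂ κ₃ (2 * k) (-(2 * p 0 * q * a))| ≤ E * w := by
    intro a ha
    refine (htail (2 * k) _ (by linarith) (by have := hδ.trans_le ha; positivity)).trans
      (le_trans ?_ hq3)
    gcongr
  have hmain : |P s - medianExpansion κ₁ κ₂ κ₃ (2 * k) y| ≤ (C + 2 * E) * w := by
    rw [← hys]
    -- Outside `[-δ, δ]` the distribution function is squeezed, by monotonicity, between its value
    -- at `±δ` and `0` or `1`; the expansion is that close to `0` or `1` as well.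
    rcases le_or_gt |s| δ with h | h
    · refine (hn s h).trans ?_
      rw [add_mul]
      have : 0 ≤ 2 * E * w := by positivity
      linarith
    · rcases le_total 0 s with h0 | h0
      · rw [abs_of_nonneg h0] at h
        have b1 := (abs_le.mp (hn δ (abs_of_pos hδ).le)).1
        have b2 := hneg δ le_rfl
        rw [medianExpansion_neg] at b2
        have b3 := hneg s h.le
        rw [medianExpansion_neg] at b3
        have b2' := abs_le.mp b2
        have b3' := abs_le.mp b3
        have b4 := hPmono δ s h.le
        have b5 := hP1 s
        rw [abs_le, add_mul]
        simp only [hP] at b4 b5 ⊢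
        constructor <;> nlinarith
      · rw [abs_of_nonpos h0] at h
        have b1 := (abs_le.mp (hn (-δ) (by rw [abs_neg, abs_of_pos hδ]))).2
        have b2 := abs_le.mp (hneg δ le_rfl)
        have b3 := abs_le.mp (hneg (-s) h.le)
        rw [mul_neg, neg_neg] at b3
        rw [mul_neg] at b1
        have b4 := hPmono s (-δ) (by linarith)
        have b5 := hP0 s
        rw [abs_le, add_mul]
        simp only [hP] at b4 b5 ⊢
        constructor <;> nlinarith
  have hsh := (hshift (2 * k) m y (by linarith) (by exact_mod_cast hkm2) (by exact_mod_cast hkm3)).trans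
    (mul_le_mul_of_nonneg_left hM32 hD.le)
  refine (abs_sub_le _ _ _).trans ((add_le_add hmain hsh).trans ?_)
  calc (C + 2 * E) * w + D * w = (C + 2 * E + D) * w := by ring
    _ ≤ (C + 2 * E + D) * (6 * (m : ℝ) ^ (-(3 / 2) : ℝ)) :=
        mul_le_mul_of_nonneg_left hwm (by positivity)
    _ = _ := by ring

end RegularSymmetricDensity

/-! ### Random sample size and conclusion -/

theorem hasSum_shiftedNegBinomialMass {r : ℝ} (hr : 0 < r) {n : ℕ} (hn : 2 ≤ n) :
    HasSum (fun k : ℕ => shiftedNegBinomialMass r n (k + 1)) 1 := by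
  have hn2 : (2 : ℝ) ≤ n := by exact_mod_cast hn
  have h0 : (0 : ℝ) < 1 / n := by positivity
  have h1 : 1 / (n : ℝ) < 1 := by rw [div_lt_one (by linarith)]; linarith
  have h := (hasSum_Gamma_ratio_mul_pow (s := r - 1) (q := 1 - 1 / (n : ℝ)) (by linarith)
    (by linarith) (by linarith)).mul_left ((1 / (n : ℝ)) ^ r / Real.Gamma r)
  have hG : Real.Gamma r ≠ 0 := (Real.Gamma_pos_of_pos hr).ne'
  have e2 : (1 / (n : ℝ)) ^ r / Real.Gamma r *
      (Real.Gamma (r - 1 + 1) * (1 - (1 - 1 / (n : ℝ))) ^ (-(r - 1 + 1))) = 1 := by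
    rw [sub_sub_cancel, sub_add_cancel, Real.rpow_neg h0.le]
    have : (1 / (n : ℝ)) ^ r ≠ 0 := (Real.rpow_pos_of_pos h0 r).ne'
    field_simp
  rw [e2] at h
  refine (funext fun k => ?_ : (fun k : ℕ => shiftedNegBinomialMass r n (k + 1)) = _) ▸ h
  have e : ((k : ℝ) + 1) + r - 1 = k + 1 + (r - 1) := by ring
  simp only [shiftedNegBinomialMass, Nat.cast_add, Nat.cast_one, Nat.add_sub_cancel, e]
  field_simp

theorem map_sub_densityMeasure {p : ℝ → ℝ} (hp : Measurable p) (θ : ℝ) :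
    (volume.withDensity fun y => ENNReal.ofReal (p (y - θ))).map (fun y => y - θ)
      = densityMeasure p := by
  have hm : Measurable fun y : ℝ => y - θ := measurable_id.sub_const θ
  ext s hs
  rw [Measure.map_apply hm hs, withDensity_apply _ (hm hs), densityMeasure,
    withDensity_apply _ hs]
  exact (measurePreserving_sub_right volume θ).setLIntegral_comp_preimage hs hp.ennreal_ofReal

theorem map_sub_eq_sampleLaw {p : ℝ → ℝ} (hp : Measurable p) {θ : ℝ} {Ω : Type*}
    [MeasurableSpace Ω] {P : Measure Ω} [IsProbabilityMeasure P] {X : ℕ → Ω → ℝ}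
    (hX : ∀ i, Measurable (X i)) (hind : iIndepFun X P)
    (hlaw : ∀ i, P.map (X i) = volume.withDensity fun y => ENNReal.ofReal (p (y - θ))) (m : ℕ) :
    P.map (fun ω (i : Fin m) => X i ω - θ) = sampleLaw p m := by
  have hm : Measurable fun y : ℝ => y - θ := measurable_id.sub_const θ
  have h1 : iIndepFun (fun (i : Fin m) ω => X i ω - θ) P :=
    (hind.precomp (g := fun i : Fin m => (i : ℕ)) Fin.val_injective).comp
      (fun _ y => y - θ) fun _ => hm
  have h2 : ∀ i : Fin m, AEMeasurable (fun ω => X i ω - θ) P :=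
    fun i => ((hX i).sub_const θ).aemeasurable
  rw [(iIndepFun_iff_map_fun_eq_pi_map h2).mp h1]
  unfold sampleLaw
  congr 1
  funext i
  rw [← map_sub_densityMeasure hp θ, ← hlaw i, Measure.map_map hm (hX i)]
  rfl

/-- Multiplication by `√((k+1)/g)` moves the random factor `g/m` from the statistic to the
threshold. For a sample of size `1` the even part is `0` and both statistics are identically zero.
-/
theorem normalizedMedian_le_iff {p₀ g θ : ℝ} (hg : 0 < g) (x : ℕ → ℝ) (k : ℕ) (y : ℝ) :
    normalizedMedian p₀ g θ x (k + 1) ≤ y ↔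
      2 * p₀ * √(evenPart (k + 1)) * sampleMedian (fun i : Fin (k + 1) => x i - θ)
        ≤ √(((k : ℝ) + 1) / g) * y := by
  have hk : (0 : ℝ) < k + 1 := by positivity
  have hc : 0 < √(((k : ℝ) + 1) / g) := Real.sqrt_pos.mpr (by positivity)
  have e : √(g * (evenPart (k + 1) : ℝ) / ((k : ℝ) + 1)) * √(((k : ℝ) + 1) / g)
      = √(evenPart (k + 1)) := by
    rw [← Real.sqrt_mul (by positivity)]
    congr 1
    field_simp
  rw [sampleMedian_sub_const (by omega) (fun i : Fin (k + 1) => x i) θ, ← e, normalizedMedian]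
  push_cast
  rw [← mul_le_mul_iff_right₀ hc]
  constructor <;> intro h <;> linarith

theorem measurable_normalizedMedian (p₀ g θ : ℝ) (m : ℕ) :
    Measurable fun x : ℕ → ℝ => normalizedMedian p₀ g θ x m := by
  unfold normalizedMedian
  refine Measurable.const_mul (Measurable.sub_const ?_ _) _
  exact (measurable_sampleMedian m).comp (measurable_pi_lambda _ fun i => measurable_pi_apply _)

theorem measureReal_normalizedMedian_le {p : ℝ → ℝ} (hp : Measurable p) {g θ : ℝ} (hg : 0 < g)
    {Ω : Type*} [MeasurableSpace Ω] {P : Measure Ω} [IsProbabilityMeasure P] {X : ℕ → Ω → ℝ}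
    (hX : ∀ i, Measurable (X i)) (hind : iIndepFun X P)
    (hlaw : ∀ i, P.map (X i) = volume.withDensity fun y => ENNReal.ofReal (p (y - θ)))
    (k : ℕ) (x : ℝ) :
    P.real {ω | normalizedMedian (p 0) g θ (fun i => X i ω) (k + 1) ≤ x}
      = (sampleLaw p (k + 1)).real {v | 2 * p 0 * √(evenPart (k + 1)) * sampleMedian v
          ≤ √(((k : ℝ) + 1) / g) * x} := by
  have hmX : Measurable fun ω (i : Fin (k + 1)) => X i ω - θ :=
    measurable_pi_lambda _ fun i => (hX i).sub_const θ
  have hS : MeasurableSet {v : Fin (k + 1) → ℝ | 2 * p 0 * √(evenPart (k + 1)) * sampleMedian v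
      ≤ √(((k : ℝ) + 1) / g) * x} :=
    measurableSet_le ((measurable_sampleMedian _).const_mul _) measurable_const
  rw [← map_sub_eq_sampleLaw hp hX hind hlaw, map_measureReal_apply hmX hS]
  congr 1
  ext ω
  exact normalizedMedian_le_iff hg _ k x

theorem measureReal_randomIndex_eq_tsum {Ω E : Type*} [MeasurableSpace Ω] [MeasurableSpace E]
    {P : Measure Ω} [IsProbabilityMeasure P] {N : Ω → ℕ} {Y : Ω → E} (hN : Measurable N)
    (hY : Measurable Y) (hind : IndepFun N Y P) {w : ℕ → ℝ}
    (hw : ∀ k, P.real {ω | N ω = k + 1} = w k) (hw1 : HasSum w 1) {A : ℕ → Set E}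
    (hA : ∀ k, MeasurableSet (A k)) :
    P.real {ω | Y ω ∈ A (N ω)} = ∑' k, w k * P.real {ω | Y ω ∈ A (k + 1)} := by
  have hmN : ∀ j, MeasurableSet {ω | N ω = j} := fun j => hN (measurableSet_singleton j)
  have key : ∀ B : ℕ → Set Ω, (∀ j, MeasurableSet (B j)) →
      HasSum (fun j => P.real ({ω | N ω = j} ∩ B j)) (P.real {ω | ω ∈ B (N ω)}) := by
    intro B hB
    have e : {ω | ω ∈ B (N ω)} = ⋃ j, {ω | N ω = j} ∩ B j := by
      ext ω; simp
    have hd : Pairwise (Function.onFun Disjoint fun j => {ω | N ω = j} ∩ B j) := by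
      intro i j hij
      refine Set.disjoint_left.mpr fun ω h1 h2 => hij ?_
      exact h1.1.symm.trans h2.1
    have hs := measure_iUnion (μ := P) hd fun j => (hmN j).inter (hB j)
    rw [e, measureReal_def, hs, ENNReal.tsum_toReal_eq fun j => measure_ne_top _ _]
    exact (ENNReal.summable_toReal (hs ▸ measure_ne_top _ _)).hasSum
  -- The masses at `j ≥ 1` already sum to one.
  have h0 : P.real {ω | N ω = 0} = 0 := by
    have h := key (fun _ => Set.univ) fun _ => MeasurableSet.univ
    simp only [Set.inter_univ, Set.mem_univ, Set.ofPred_true, probReal_univ] at h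
    have h' := (hasSum_nat_add_iff' 1).mpr h
    simp only [hw, Finset.range_one, Finset.sum_singleton] at h'
    have := h'.unique hw1
    linarith
  have h := key (fun j => Y ⁻¹' A j) fun j => hY (hA j)
  have h' := (hasSum_nat_add_iff' 1).mpr h
  have hz : P.real ({ω | N ω = 0} ∩ Y ⁻¹' A 0) = 0 :=
    le_antisymm ((measureReal_mono Set.inter_subset_left).trans h0.le) measureReal_nonneg
  simp only [Finset.range_one, Finset.sum_singleton, hz, sub_zero] at h'
  refine h'.tsum_eq.symm.trans (tsum_congr fun k => ?_)
  rw [← hw k]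
  have := hind.measure_inter_preimage_eq_mul {k + 1} (A (k + 1))
    (measurableSet_singleton _) (hA _)
  rw [measureReal_def, measureReal_def, measureReal_def, ← ENNReal.toReal_mul]
  exact congrArg ENNReal.toReal this

/-- Adds the size `m = 1`, where a probability and a bounded expression differ by at most `1 + 2B`.
-/
theorem RegularSymmetricDensity.exists_abs_median_sub_medianExpansion_le_of_pos {p : ℝ → ℝ}
    (hp : RegularSymmetricDensity p) {p₁ p₂ : ℝ} (hp₁ : Tendsto (deriv p) (𝓝[>] 0) (𝓝 p₁))
    (hp₂ : Tendsto (iteratedDeriv 2 p) (𝓝[>] 0) (𝓝 p₂)) :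
    ∃ K : ℝ, 0 ≤ K ∧ ∀ (k : ℕ) (y : ℝ),
      |(sampleLaw p (k + 1)).real {v | 2 * p 0 * √(evenPart (k + 1)) * sampleMedian v ≤ y}
          - medianExpansion (p₁ / (4 * p 0 ^ 2)) (1 + p₂ / (6 * p 0 ^ 3)) (p₁ ^ 2 / (8 * p 0 ^ 4))
              ((k : ℝ) + 1) y| ≤ K * ((k : ℝ) + 1) ^ (-(3 / 2) : ℝ) := by
  obtain ⟨C, hC, h⟩ := hp.exists_abs_median_sub_medianExpansion_le hp₁ hp₂
  obtain ⟨B, hB, hb⟩ := exists_abs_correction_le (p₁ / (4 * p 0 ^ 2)) (1 + p₂ / (6 * p 0 ^ 3))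
    (p₁ ^ 2 / (8 * p 0 ^ 4))
  refine ⟨C + (1 + 2 * B), by positivity, fun k y => ?_⟩
  rcases Nat.eq_zero_or_pos k with rfl | hk
  · have hP := hp.isProbabilityMeasure_sampleLaw (0 + 1)
    have h0 := measureReal_nonneg (μ := sampleLaw p (0 + 1))
      (s := {v | 2 * p 0 * √(evenPart (0 + 1)) * sampleMedian v ≤ y})
    have h1 := measureReal_le_one (μ := sampleLaw p (0 + 1))
      (s := {v | 2 * p 0 * √(evenPart (0 + 1)) * sampleMedian v ≤ y})
    obtain ⟨b1, b2⟩ := hb y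
    have g0 := gaussCDF_nonneg y
    have g1 := gaussCDF_le_one y
    rw [abs_le] at b1 b2
    simp only [medianExpansion, Nat.cast_zero, zero_add, Real.one_rpow, inv_one, mul_one,
      mul_add] at *
    rw [abs_le]
    constructor <;> linarith
  · have h2 := h (k + 1) (by omega) y
    push_cast at h2
    refine h2.trans (mul_le_mul_of_nonneg_right ?_ (by positivity))
    linarith

theorem theorem4p3
    (p : ℝ → ℝ) (hp : RegularSymmetricDensity p)
    (p₁ p₂ : ℝ)
    (hp₁ : Tendsto (deriv p) (𝓝[>] 0) (𝓝 p₁))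
    (hp₂ : Tendsto (iteratedDeriv 2 p) (𝓝[>] 0) (𝓝 p₂))
    (r : ℝ) (hr : 0 < r) :
    ∃ C : ℝ, 0 < C ∧
      ∀ n : ℕ, 1 ≤ n → (r = 3 / 2 → 2 ≤ n) →
      ∀ (θ : ℝ) (Ω : Type*) [MeasurableSpace Ω] (P : Measure Ω) [IsProbabilityMeasure P]
        (X : ℕ → Ω → ℝ) (N : Ω → ℕ),
        (∀ i, Measurable (X i)) →
        Measurable N →
        -- the observations are independent with common density `p (· - θ)`
        iIndepFun X P →
        (∀ i, P.map (X i) = volume.withDensity (fun y => ENNReal.ofReal (p (y - θ)))) →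
        -- the sample size is independent of the whole sequence of observations
        IndepFun N (fun ω i => X i ω) P →
        (∀ j : ℕ, 1 ≤ j → P.real {ω | N ω = j} = shiftedNegBinomialMass r n j) →
        ∀ x : ℝ,
          |P.real {ω | normalizedMedian (p 0) (negBinomialScale r n) θ (fun i => X i ω) (N ω) ≤ x}
              - studentExpansion (p 0) p₁ p₂ r n x|
            ≤ C * approximationRate r n := by
  obtain ⟨K, hK, hF⟩ := hp.exists_abs_median_sub_medianExpansion_le_of_pos hp₁ hp₂
  obtain ⟨C, hC, n₀, -, hmain⟩ :=
    exists_abs_tsum_mass_sub_studentExpansion_le (p 0) p₁ p₂ hr hK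
  obtain ⟨B, hB, hb⟩ := exists_abs_studentExpansion_le (p 0) p₁ p₂ hr
  -- A constant for the remaining small `n`: the difference is at most `1 + B` and the rate is
  -- positive at every admissible `n`. Absolute values make the inadmissible indices of the sum
  -- harmless.
  set D := ∑ i ∈ Finset.range (n₀ + 2), |(1 + B) / approximationRate r i| with hD
  have hD0 : 0 ≤ D := Finset.sum_nonneg fun _ _ => abs_nonneg _
  refine ⟨C + D, by linarith, ?_⟩
  intro n hn hn' θ Ω _ P _ X N hX hN hind hlaw hNX hmass x
  have hrate := approximationRate_pos hn hn'
  have hg := negBinomialScale_pos hr hn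
  rcases lt_or_ge n (n₀ + 2) with hlt | hge
  · have h1 : (1 + B) / approximationRate r n ≤ D := (le_abs_self _).trans
      (Finset.single_le_sum (f := fun i => |(1 + B) / approximationRate r i|)
        (fun _ _ => abs_nonneg _) (Finset.mem_range.mpr hlt))
    rw [div_le_iff₀ hrate] at h1
    have h2 := abs_le.mp (hb n hn x)
    have h3 := measureReal_nonneg (μ := P) (s := {ω | normalizedMedian (p 0)
      (negBinomialScale r n) θ (fun i => X i ω) (N ω) ≤ x})
    have h4 := measureReal_le_one (μ := P) (s := {ω | normalizedMedian (p 0)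
      (negBinomialScale r n) θ (fun i => X i ω) (N ω) ≤ x})
    have h5 : 0 ≤ C * approximationRate r n := by positivity
    rw [abs_le]
    constructor <;> linarith
  · have hsum := measureReal_randomIndex_eq_tsum hN (measurable_pi_lambda _ hX) hNX
      (fun k => hmass (k + 1) (by omega)) (hasSum_shiftedNegBinomialMass hr (by omega))
      (A := fun j => {v | normalizedMedian (p 0) (negBinomialScale r n) θ v j ≤ x})
      fun j => measurableSet_le (measurable_normalizedMedian _ _ _ j) measurable_const
    have h := hmain n (by omega) _ hF x
    simp only [Set.mem_ofPred_eq] at hsum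
    rw [hsum]
    simp only [measureReal_normalizedMedian_le hp.measurable hg hX hind hlaw]
    refine h.trans (mul_le_mul_of_nonneg_right (by linarith) hrate.le)
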